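/- Let $H$ be a Lie group with Lie algebra $\mathfrak h$, let $\alpha$ be a derivation of $\mathfrak h$ that generates a smooth one-parameter group $(e^{t\alpha})_{t\in\mathbb R}$ of automorphisms of $H$, and let $G=H\rtimes_\alpha\mathbb R$ be the Lie group $H\times\mathbb R$ with the multiplication $(h,t)(h',t')=(h\,e^{t\alpha}(h'),t+t')$. Put $n=\dim G$. Equip $H$ and $G$ with left-invariant Riemannian metrics. For a Lie group $L$ with a left-invariant metric, a degree $k$ and a real $p>1$, let $H^{k,p}(L)$ be the $L^p$ cohomology of $L$: the space of $k$-forms in $L^p$ that are closed in the sense of distributions, modulo the $k$-forms in $L^p$ that are the distributional exterior derivative of a $(k-1)$-form in $L^p$. Let $\Omega^{k,p}(L)$ be the space of $k$-forms in $L^p$ whose distributional exterior derivative is in $L^p$. For each degree $k$ and exponent $p>1$, let $\alpha$ act on $\Lambda^k\mathfrak h^*$ as the induced derivation $(\alpha\theta)(v_1,\dots,v_k)=\sum_i\theta(v_1,\dots,\alpha v_i,\dots,v_k)$, and write $\Lambda^k\mathfrak h^*=\Lambda^k_{+(p)}\oplus\Lambda^k_{0(p)}\oplus\Lambda^k_{-(p)}$,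 where $\Lambda^k_{+(p)}$ (resp. $\Lambda^k_{0(p)}$, $\Lambda^k_{-(p)}$) is the sum of the characteristic (generalized eigen-) subspaces for the eigenvalues of real part greater than (resp. equal to, less than) $\operatorname{tr}(\alpha)/p$. Identifying forms on $H$, by left translation, with functions with values in $\Lambda^k\mathfrak h^*$, denote by $\theta_{+(p)},\theta_{0(p)},\theta_{-(p)}$ the components of a form $\theta$, and put $d_{\epsilon(p)}\theta=(d\theta)_{\epsilon(p)}$ for $\epsilon\in\{+,0,-\}$. The exponent $p$ is called critical in degree $k$ if $\Lambda^k_{0(p)}\neq0$, that is, if $\operatorname{tr}(\alpha)/p$ is the real part of an eigenvalue of $\alpha$ on $\Lambda^k\mathfrak h^*$. Let $1\le k\le n$, let $p>1$ be critical in degree $k-1$, and let $p'=p/(p-1)$. Suppose that there are a closed $(k-1)$-form $e$ in $L^p$ on $H$ and a sequence $e'_j\in\Omega^{n-k,p'}(H)$ such that 1. $e_{-(p)}=0$, and $(e'_j)_{-(p')}=0$ and $d_{-(p')}e'_j=0$ for all $j$; 2. $\int_H e\wedge e'_j$ does not tend to $0$ as $j\to\infty$; 3. $\|(e'_j)_{0(p')}\|_{L^{p'}}$,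 $\|(e'_j)_{+(p')}\|_{L^{p'}}$ and $\|d_{+(p')}e'_j\|_{L^{p'}}$ grow at most polynomially in $j$, that is, they are bounded by $C(j+1)^N$ for some constants $C$ and $N$; 4. $\|d_{0(p')}e'_j\|_{L^{p'}}$ tends to $0$ exponentially in $j$, that is, it is at most $Ce^{-cj}$ for some constants $C$ and $c>0$. Then $H^{k,p}(G)\neq0$. -/

import Mathlib

open scoped Manifold ContDiff ENNReal TensorProduct Topology
open MeasureTheory Set

noncomputable section

/-! ### Exterior calculus in the left trivialization of a Lie group

The tangent spaces of a Lie group `G` modelled on `E` are copies of `E`; the Lie algebra is the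
tangent space `E` at the identity. By left translation, a differential form of degree `k` on `G`
is a function from `G` to the alternating `k`-linear forms on the Lie algebra. The pointwise norm of
a form for a left-invariant metric is then the norm of its value in this fixed finite-dimensional
space. All norms there being equivalent, neither the class of `L^p` forms nor any of the
asymptotic conditions below depends on the left-invariant metric that is chosen. -/

/-- Alternating `k`-linear forms on the Lie algebra `E`. -/
abbrev AltForm (E : Type*) [NormedAddCommGroup E] [NormedSpace ℝ E] (k : ℕ) : Type _ :=
  E [⋀^Fin k]→L[ℝ] ℝ

/-- Wedge product, with the convention `(dx ∧ dy)(X, Y) = dx(X) dy(Y) - dx(Y) dy(X)`. -/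
def wedge {V : Type*} {m l : ℕ} (a : (Fin m → V) → ℝ) (b : (Fin l → V) → ℝ)
    (v : Fin (m + l) → V) : ℝ :=
  ((m.factorial : ℝ) * (l.factorial : ℝ))⁻¹ * ∑ σ : Equiv.Perm (Fin (m + l)),
    ((Equiv.Perm.sign σ : ℤ) : ℝ) *
      (a (fun i => v (σ (Fin.castAdd l i))) * b (fun i => v (σ (Fin.natAdd m i))))

section LieGroup

variable {E : Type*} [NormedAddCommGroup E] [NormedSpace ℝ E]
  {M : Type*} [TopologicalSpace M] (I : ModelWithCorners ℝ E M)
  {G : Type*} [TopologicalSpace G] [ChartedSpace M G] [Group G]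

/-- The derivative at `g` of a function `f`, along the left-invariant vector field whose value at
the identity is `x`. -/
def leftDeriv {F : Type*} [NormedAddCommGroup F] [NormedSpace ℝ F] (f : G → F) (x : E) (g : G) : F :=
  mfderiv I 𝓘(ℝ, F) f g (mulInvariantVectorField (I := I) (G := G) x g)

variable (G) in
/-- The Lie bracket of the Lie algebra of `G`. -/
def algBracket (x y : E) : E :=
  Bracket.bracket (L := GroupLieAlgebra I G) (M := GroupLieAlgebra I G) x y

/-- The exterior derivative of a smooth form, evaluated at `g` on left-invariant vector fields:
`dφ(X_0, …, X_l) = ∑_i (-1)^i X_i φ(…, X̂_i, …)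
  + ∑_{i<j} (-1)^(i+j) φ([X_i, X_j], …, X̂_i, …, X̂_j, …)`.
In the second sum the bracket has been moved to the `i`-th place, which absorbs the sign `(-1)^i`. -/
def extDer {l : ℕ} (φ : G → AltForm E l) (g : G) (v : Fin (l + 1) → E) : ℝ :=
  ∑ i : Fin (l + 1), (-1 : ℝ) ^ (i : ℕ) * leftDeriv I φ (v i) g (fun a => v (i.succAbove a)) +
  ∑ j : Fin (l + 1), ∑ i : Fin l, if i.castSucc < j then
    (-1 : ℝ) ^ (j : ℕ) *
      φ g (Function.update (fun a => v (j.succAbove a)) i (algBracket I G (v i.castSucc) (v j)))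
  else 0

variable [MeasurableSpace G]

/-- `η` is the exterior derivative of the `m`-form `θ` in the sense of distributions:
`∫ θ ∧ dφ = (-1)^(m+1) ∫ η ∧ φ` for all smooth compactly supported forms `φ` of the complementary
degree. A top-degree form is integrated by evaluating it on a basis `b` of the Lie algebra and
integrating the resulting function against Haar measure, since the form dual to `b` is a
left-invariant volume form. -/
def IsWeakExtDer (μ : Measure G) {m : ℕ} (θ : G → AltForm E m) (η : G → AltForm E (m + 1)) : Prop :=
  ∀ (l : ℕ) (b : Module.Basis (Fin (m + (l + 1))) ℝ E) (φ : G → AltForm E l),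
    ContMDiff I 𝓘(ℝ, AltForm E l) ∞ φ → HasCompactSupport φ →
    ∫ g, wedge (θ g) (extDer I φ g) b ∂μ =
      (-1) ^ (m + 1) * ∫ g, wedge (η g) (φ g) (fun i => b (Fin.cast (by omega) i)) ∂μ

end LieGroup

/-! ### Linearity of the weak exterior derivative -/

section Linearity

set_option linter.unusedSectionVars false

lemma wedge_add_left {V : Type*} {m l : ℕ} (a a' : (Fin m → V) → ℝ) (b : (Fin l → V) → ℝ)
    (v : Fin (m + l) → V) : wedge (a + a') b v = wedge a b v + wedge a' b v := by
  simp only [wedge, Pi.add_apply, add_mul, mul_add, Finset.sum_add_distrib]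

lemma wedge_smul_left {V : Type*} {m l : ℕ} (c : ℝ) (a : (Fin m → V) → ℝ) (b : (Fin l → V) → ℝ)
    (v : Fin (m + l) → V) : wedge (c • a) b v = c * wedge a b v := by
  simp only [wedge, Pi.smul_apply, smul_eq_mul, Finset.mul_sum]
  refine Finset.sum_congr rfl fun σ _ => by ring

lemma wedge_zero_left {V : Type*} {m l : ℕ} (b : (Fin l → V) → ℝ)
    (v : Fin (m + l) → V) : wedge (0 : (Fin m → V) → ℝ) b v = 0 := by
  simp [wedge]

variable {E : Type*} [NormedAddCommGroup E] [NormedSpace ℝ E]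
  {M : Type*} [TopologicalSpace M] (I : ModelWithCorners ℝ E M)
  {G : Type*} [TopologicalSpace G] [ChartedSpace M G] [Group G]

lemma continuous_leftDeriv [LieGroup I ∞ G] {F : Type*} [NormedAddCommGroup F] [NormedSpace ℝ F] {f : G → F}
    (hf : ContMDiff I 𝓘(ℝ, F) ∞ f) (x : E) : Continuous (leftDeriv I f x) := by
  have : LieGroup I (minSmoothness ℝ 3) G := by
    have : LieGroup I 3 G := inferInstance
    simpa using this
  have h1 : Continuous (tangentMap I 𝓘(ℝ, F) f) := hf.continuous_tangentMap (by simp)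
  have h2 : Continuous (fun g : G => (⟨g, mulInvariantVectorField (I := I) (G := G) x g⟩ :
      TangentBundle I G)) := (contMDiff_mulInvariantVectorField (I := I) (G := G) x).continuous
  have h3 := (contMDiff_snd_tangentBundle_modelSpace (n := ∞) F 𝓘(ℝ, F)).continuous
  exact h3.comp (h1.comp h2)

lemma leftDeriv_eq_zero {F : Type*} [NormedAddCommGroup F] [NormedSpace ℝ F] {f : G → F}
    (x : E) {g : G} (hg : g ∉ tsupport f) : leftDeriv I f x g = 0 := by
  have h : f =ᶠ[𝓝 g] fun _ => (0 : F) := notMem_tsupport_iff_eventuallyEq.1 hg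
  unfold leftDeriv
  rw [h.mfderiv_eq, mfderiv_const]
  rfl

lemma continuous_extDer [LieGroup I ∞ G] {l : ℕ} {φ : G → AltForm E l} (hφ : ContMDiff I 𝓘(ℝ, AltForm E l) ∞ φ)
    (v : Fin (l + 1) → E) : Continuous (fun g => extDer I φ g v) := by
  have hev : ∀ w : Fin l → E, Continuous (fun a : AltForm E l => a w) := fun w =>
    continuous_eval_const w
  unfold extDer
  refine Continuous.add ?_ ?_
  · exact continuous_finsetSum _ fun i _ =>
      continuous_const.mul ((hev _).comp (continuous_leftDeriv I hφ (v i)))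
  · refine continuous_finsetSum _ fun j _ => continuous_finsetSum _ fun i _ => ?_
    split_ifs
    · exact continuous_const.mul ((hev _).comp hφ.continuous)
    · exact continuous_const

lemma hasCompactSupport_extDer {l : ℕ} {φ : G → AltForm E l} (hs : HasCompactSupport φ)
    (v : Fin (l + 1) → E) : HasCompactSupport (fun g => extDer I φ g v) := by
  refine HasCompactSupport.intro' hs (isClosed_tsupport φ) fun g hg => ?_
  have h0 : φ g = 0 := image_eq_zero_of_notMem_tsupport hg
  simp [extDer, leftDeriv_eq_zero I _ hg, h0]

variable [MeasurableSpace G] (μ : Measure G)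

lemma integrable_wedge {G : Type*} [TopologicalSpace G] [MeasurableSpace G] (μ : Measure G) [T2Space G] [BorelSpace G] [IsLocallyFiniteMeasure μ] {p : ℝ≥0∞}
    (hp : 1 ≤ p) {m l : ℕ} {θ : G → AltForm E m} (hθ : MemLp θ p μ)
    {β : G → (Fin l → E) → ℝ} (hc : ∀ v, Continuous (fun g => β g v))
    (hs : ∀ v, HasCompactSupport (fun g => β g v)) (b : Fin (m + l) → E) :
    Integrable (fun g => wedge (θ g) (β g) b) μ := by
  unfold wedge
  refine Integrable.const_mul ?_ _
  refine integrable_finsetSum _ fun σ _ => Integrable.const_mul ?_ _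
  have hw : MemLp (fun g => θ g (fun i => b (σ (Fin.castAdd l i)))) p μ :=
    (ContinuousLinearMap.comp_memLp' (ContinuousAlternatingMap.apply ℝ E ℝ
      (fun i => b (σ (Fin.castAdd l i)))) hθ)
  exact (hw.locallyIntegrable hp).integrable_smul_right_of_hasCompactSupport (hc _) (hs _)

lemma IsWeakExtDer.congr {m : ℕ} {θ θ' : G → AltForm E m} {η η' : G → AltForm E (m + 1)}
    (h : IsWeakExtDer I μ θ η) (h1 : θ =ᵐ[μ] θ') (h2 : η =ᵐ[μ] η') : IsWeakExtDer I μ θ' η' := by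
  intro l b φ hφ hs
  have e1 : (fun g => wedge (θ' g) (extDer I φ g) b) =ᵐ[μ] fun g => wedge (θ g) (extDer I φ g) b :=
    h1.mono fun g hg => by simp only [hg]
  rw [integral_congr_ae e1, h l b φ hφ hs]
  congr 1
  exact integral_congr_ae (h2.mono fun g hg => by simp only [hg])

lemma IsWeakExtDer.zero {m : ℕ} :
    IsWeakExtDer I μ (fun _ => (0 : AltForm E m)) (fun _ => (0 : AltForm E (m + 1))) := by
  intro l b φ _ _
  have h1 (g : G) : wedge (0 : AltForm E m) (extDer I φ g) b = 0 := wedge_zero_left _ _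
  have h2 (g : G) : wedge (0 : AltForm E (m + 1)) (φ g) (fun i => b (Fin.cast (by omega) i)) = 0 :=
    wedge_zero_left _ _
  simp only [h1, h2, integral_zero, mul_zero]

lemma IsWeakExtDer.smul {m : ℕ} {θ : G → AltForm E m} {η : G → AltForm E (m + 1)} (c : ℝ)
    (h : IsWeakExtDer I μ θ η) :
    IsWeakExtDer I μ (fun g => c • θ g) (fun g => c • η g) := by
  intro l b φ hφ hs
  have h1 (g : G) : wedge (c • θ g) (extDer I φ g) b = c * wedge (θ g) (extDer I φ g) b :=
    wedge_smul_left c (θ g) _ _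
  have h2 (g : G) : wedge (c • η g) (φ g) (fun i => b (Fin.cast (by omega) i)) =
      c * wedge (η g) (φ g) (fun i => b (Fin.cast (by omega) i)) :=
    wedge_smul_left c (η g) _ _
  simp only [h1, h2, integral_const_mul, h l b φ hφ hs]
  ring

lemma IsWeakExtDer.add [FiniteDimensional ℝ E] [LieGroup I ∞ G] [BorelSpace G]
    [μ.IsHaarMeasure] {p : ℝ≥0∞} (hp : 1 ≤ p) {m : ℕ} {θ θ' : G → AltForm E m}
    {η η' : G → AltForm E (m + 1)} (h : IsWeakExtDer I μ θ η) (h' : IsWeakExtDer I μ θ' η')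
    (hθ : MemLp θ p μ) (hθ' : MemLp θ' p μ) (hη : MemLp η p μ) (hη' : MemLp η' p μ) :
    IsWeakExtDer I μ (fun g => θ g + θ' g) (fun g => η g + η' g) := by
  have : IsTopologicalGroup G := topologicalGroup_of_lieGroup I ∞
  have : T1Space G := I.t1Space G
  have : LocallyCompactSpace G := Manifold.locallyCompact_of_finiteDimensional I
  intro l b φ hφ hs
  have h1 (g : G) : wedge (θ g + θ' g) (extDer I φ g) b =
      wedge (θ g) (extDer I φ g) b + wedge (θ' g) (extDer I φ g) b :=
    wedge_add_left (θ g) (θ' g) _ _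
  have h2 (g : G) : wedge (η g + η' g) (φ g) (fun i => b (Fin.cast (by omega) i)) =
      wedge (η g) (φ g) (fun i => b (Fin.cast (by omega) i)) +
        wedge (η' g) (φ g) (fun i => b (Fin.cast (by omega) i)) :=
    wedge_add_left (η g) (η' g) _ _
  have c1 : ∀ v, Continuous fun g => extDer I φ g v := continuous_extDer I hφ
  have s1 : ∀ v, HasCompactSupport fun g => extDer I φ g v := hasCompactSupport_extDer I hs
  have c2 : ∀ v : Fin l → E, Continuous fun g => φ g v := fun v =>
    (continuous_eval_const v).comp hφ.continuous
  have s2 : ∀ v : Fin l → E, HasCompactSupport fun g => φ g v := fun v =>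
    hs.comp_left (g := fun a : AltForm E l => a v) rfl
  simp only [h1, h2]
  rw [integral_add (integrable_wedge μ hp hθ c1 s1 _) (integrable_wedge μ hp hθ' c1 s1 _),
    integral_add (integrable_wedge μ hp hη c2 s2 _) (integrable_wedge μ hp hη' c2 s2 _),
    h l b φ hφ hs, h' l b φ hφ hs]
  ring

end Linearity

/-! ### `L^p` cohomology -/

section Cohomology

set_option linter.unusedSectionVars false

variable {E : Type*} [NormedAddCommGroup E] [NormedSpace ℝ E] [FiniteDimensional ℝ E]
  {M : Type*} [TopologicalSpace M] (I : ModelWithCorners ℝ E M)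
  {G : Type*} [TopologicalSpace G] [ChartedSpace M G] [Group G] [LieGroup I ∞ G]
  [MeasurableSpace G] [BorelSpace G] (μ : Measure G) [μ.IsHaarMeasure]

/-- The `L^p` form `θ` is closed: its weak exterior derivative vanishes. -/
def IsClosedForm {k : ℕ} {p : ℝ≥0∞} (θ : Lp (AltForm E k) p μ) : Prop :=
  IsWeakExtDer I μ (θ : G → AltForm E k) (fun _ => (0 : AltForm E (k + 1)))

lemma IsClosedForm.add {k : ℕ} {p : ℝ≥0∞} (hp : 1 ≤ p) {θ θ' : Lp (AltForm E k) p μ}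
    (h : IsClosedForm I μ θ) (h' : IsClosedForm I μ θ') : IsClosedForm I μ (θ + θ') := by
  have hz : MemLp (fun _ : G => (0 : AltForm E (k + 1))) p μ :=
    (Lp.memLp (0 : Lp (AltForm E (k + 1)) p μ)).ae_eq (Lp.coeFn_zero (AltForm E (k + 1)) p μ)
  have h3 := IsWeakExtDer.add I μ hp h h' (Lp.memLp θ) (Lp.memLp θ') hz hz
  simp only [add_zero] at h3
  exact h3.congr I μ (Lp.coeFn_add θ θ').symm Filter.EventuallyEq.rfl

lemma IsClosedForm.smul {k : ℕ} {p : ℝ≥0∞} (c : ℝ) {θ : Lp (AltForm E k) p μ}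
    (h : IsClosedForm I μ θ) : IsClosedForm I μ (c • θ) := by
  have h3 := IsWeakExtDer.smul I μ c h
  simp only [smul_zero] at h3
  exact h3.congr I μ (Lp.coeFn_smul c θ).symm Filter.EventuallyEq.rfl

/-- The closed `L^p` forms of degree `k`. -/
def closedForms (k : ℕ) {p : ℝ≥0∞} (hp : 1 ≤ p) : Submodule ℝ (Lp (AltForm E k) p μ) where
  carrier := {θ | IsClosedForm I μ θ}
  zero_mem' := (IsWeakExtDer.zero I μ).congr I μ
    (Lp.coeFn_zero (AltForm E k) p μ).symm Filter.EventuallyEq.rfl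
  add_mem' h h' := IsClosedForm.add I μ hp h h'
  smul_mem' c _ h := IsClosedForm.smul I μ c h

/-- The `L^p` forms of degree `k` that are the weak exterior derivative of an `L^p` form. -/
def exactForms : (k : ℕ) → {p : ℝ≥0∞} → (hp : 1 ≤ p) → Submodule ℝ (Lp (AltForm E k) p μ)
  | 0, _, _ => ⊥
  | q + 1, p, hp =>
    { carrier := {θ | ∃ β : Lp (AltForm E q) p μ, IsWeakExtDer I μ β θ}
      zero_mem' := ⟨0, (IsWeakExtDer.zero I μ).congr I μ
        (Lp.coeFn_zero (AltForm E q) p μ).symm (Lp.coeFn_zero (AltForm E (q + 1)) p μ).symm⟩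
      add_mem' := by
        rintro θ θ' ⟨β, h⟩ ⟨β', h'⟩
        exact ⟨β + β', (IsWeakExtDer.add I μ hp h h' (Lp.memLp β) (Lp.memLp β') (Lp.memLp θ)
          (Lp.memLp θ')).congr I μ (Lp.coeFn_add β β').symm (Lp.coeFn_add θ θ').symm⟩
      smul_mem' := by
        rintro c θ ⟨β, h⟩
        exact ⟨c • β, (IsWeakExtDer.smul I μ c h).congr I μ (Lp.coeFn_smul c β).symm
          (Lp.coeFn_smul c θ).symm⟩ }

/-- The `L^p` cohomology of `G` in degree `k`, for a left-invariant metric: closed `L^p` forms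
modulo the exterior derivatives of `L^p` forms. -/
abbrev LpCohomology (k : ℕ) {p : ℝ≥0∞} (hp : 1 ≤ p) : Type _ :=
  closedForms I μ k hp ⧸ (exactForms I μ k hp).submoduleOf (closedForms I μ k hp)

end Cohomology

/-! ### Characteristic subspaces and the associated projectors -/

section Spectral

variable {V : Type*} [AddCommGroup V] [Module ℝ V]

/-- The sum, in the complexification, of the characteristic (generalized eigen-) subspaces of the
real endomorphism `D` for the complex eigenvalues that lie in `S`. -/
def charSubspace (D : Module.End ℝ V) (S : Set ℂ) : Submodule ℂ (ℂ ⊗[ℝ] V) :=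
  ⨆ z ∈ S, Module.End.maxGenEigenspace (D.baseChange ℂ) z

lemma isCompl_charSubspace [FiniteDimensional ℝ V] (D : Module.End ℝ V) (S : Set ℂ) :
    IsCompl (charSubspace D S) (charSubspace D Sᶜ) := by
  constructor
  · exact (Module.End.independent_maxGenEigenspace _).disjoint_biSup_biSup disjoint_compl_right
  · rw [codisjoint_iff, eq_top_iff,
      ← Module.End.iSup_maxGenEigenspace_eq_top (D.baseChange ℂ)]
    refine iSup_le fun z => ?_
    by_cases hz : z ∈ S
    · exact le_sup_of_le_left (le_iSup₂_of_le z hz le_rfl)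
    · exact le_sup_of_le_right (le_iSup₂_of_le z hz le_rfl)

/-- The real part `z ⊗ v ↦ Re(z) v`. -/
def tensorRe : ℂ ⊗[ℝ] V →ₗ[ℝ] V :=
  (TensorProduct.lid ℝ V).toLinearMap ∘ₗ LinearMap.rTensor V Complex.reLm

/-- The spectral projector of `D` for the eigenvalues in `S`, where `S` is invariant under complex
conjugation: the projector onto the sum of the characteristic subspaces for the eigenvalues in `S`,
along the sum of the other characteristic subspaces. It is computed in the complexification, where
it commutes with complex conjugation, so that taking real parts changes nothing. -/
def spectralProj [FiniteDimensional ℝ V] (D : Module.End ℝ V) (S : Set ℂ) : V →ₗ[ℝ] V :=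
  tensorRe ∘ₗ
    ((Submodule.projection _ _ (isCompl_charSubspace D S)).restrictScalars ℝ) ∘ₗ
    TensorProduct.mk ℝ ℂ V 1

end Spectral

section Weights

variable {E : Type*} [NormedAddCommGroup E] [NormedSpace ℝ E]

/-- The multilinear map `v ↦ ∑_i θ(v_1, …, α v_i, …, v_k)`. -/
def inducedDerAux (α : E →L[ℝ] E) {k : ℕ} (θ : AltForm E k) :
    ContinuousMultilinearMap ℝ (fun _ : Fin k => E) ℝ :=
  ∑ i : Fin k, θ.toContinuousMultilinearMap.compContinuousLinearMap
    (Function.update (fun _ => ContinuousLinearMap.id ℝ E) i α)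

lemma inducedDerAux_apply (α : E →L[ℝ] E) {k : ℕ} (θ : AltForm E k) (v : Fin k → E) :
    inducedDerAux α θ v = ∑ i : Fin k, θ (Function.update v i (α (v i))) := by
  have key : ∀ i : Fin k, (θ.toContinuousMultilinearMap.compContinuousLinearMap
      (Function.update (fun _ => ContinuousLinearMap.id ℝ E) i α)) v =
      θ (Function.update v i (α (v i))) := by
    intro i
    have e : (fun j => (Function.update (fun _ => ContinuousLinearMap.id ℝ E) i α :
        Fin k → E →L[ℝ] E) j (v j)) = Function.update v i (α (v i)) := by
      funext j
      by_cases hj : j = i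
      · subst hj; simp
      · simp [hj]
    rw [ContinuousMultilinearMap.compContinuousLinearMap_apply, e]
    rfl
  simp only [inducedDerAux, sum_apply, key]

/-- The derivation induced by `α` on the alternating `k`-forms:
`(Dθ)(v_1, …, v_k) = ∑_i θ(v_1, …, α v_i, …, v_k)`. Its eigenvalues are the sums of `k` eigenvalues
of `α`, with multiplicities. -/
def inducedDer (α : E →L[ℝ] E) (k : ℕ) : Module.End ℝ (AltForm E k) where
  toFun θ :=
    { toContinuousMultilinearMap := inducedDerAux α θ
      map_eq_zero_of_eq' := by
        intro v a b hv hab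
        change inducedDerAux α θ v = 0
        rw [inducedDerAux_apply, ← Finset.sum_subset (Finset.subset_univ {a, b}),
          Finset.sum_pair hab]
        · have h : θ (Function.update v b (α (v b)) ∘ Equiv.swap a b) =
              -θ (Function.update v b (α (v b))) :=
            θ.toAlternatingMap.map_swap (Function.update v b (α (v b))) hab
          have e : (Function.update v b (α (v b))) ∘ Equiv.swap a b =
              Function.update v a (α (v a)) := by
            funext j
            by_cases hja : j = a
            · subst hja; simp [hv]
            · by_cases hjb : j = b
              · subst hjb; simp [hja, hab, hv]
              · simp [Equiv.swap_apply_of_ne_of_ne hja hjb, hja, hjb]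
          rw [e] at h
          rw [h]; ring
        · intro i _ hi
          simp only [Finset.mem_insert, Finset.mem_singleton, not_or] at hi
          exact θ.map_eq_zero_of_eq _ (by simp [Ne.symm hi.1, Ne.symm hi.2, hv]) hab }
  map_add' θ θ' := by
    ext v
    change inducedDerAux α (θ + θ') v = inducedDerAux α θ v + inducedDerAux α θ' v
    simp only [inducedDerAux_apply, ← Finset.sum_add_distrib]
    rfl
  map_smul' c θ := by
    ext v
    change inducedDerAux α (c • θ) v = c • inducedDerAux α θ v
    simp only [inducedDerAux_apply, Finset.smul_sum]
    rfl

instance instFiniteDimensionalAltForm (k : ℕ) [FiniteDimensional ℝ E] :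
    FiniteDimensional ℝ (AltForm E k) := by
  let f : AltForm E k →ₗ[ℝ] MultilinearMap ℝ (fun _ : Fin k => E) ℝ :=
    { toFun := fun θ => θ.toMultilinearMap
      map_add' := fun _ _ => rfl
      map_smul' := fun _ _ => rfl }
  refine FiniteDimensional.of_injective f fun θ θ' h => ?_
  ext v
  exact congrArg (fun m : MultilinearMap ℝ (fun _ : Fin k => E) ℝ => m v) h

variable [FiniteDimensional ℝ E]

/-- The number `tr(α) / p`, with which the real parts of the eigenvalues on forms are compared. -/
def criticalWeight (α : E →L[ℝ] E) (p : ℝ) : ℝ := LinearMap.trace ℝ E (α : E →ₗ[ℝ] E) / p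

/-- The projector onto `Λ^k_+`, the sum of the characteristic subspaces of the derivation induced
by `α` for the eigenvalues of real part greater than `tr(α) / p`. -/
def projPlus (α : E →L[ℝ] E) (p : ℝ) (k : ℕ) : AltForm E k →ₗ[ℝ] AltForm E k :=
  spectralProj (inducedDer α k) {z | criticalWeight α p < z.re}

/-- The projector onto `Λ^k_0`, for the eigenvalues of real part equal to `tr(α) / p`. -/
def projZero (α : E →L[ℝ] E) (p : ℝ) (k : ℕ) : AltForm E k →ₗ[ℝ] AltForm E k :=
  spectralProj (inducedDer α k) {z | z.re = criticalWeight α p}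

/-- The projector onto `Λ^k_-`, for the eigenvalues of real part less than `tr(α) / p`. -/
def projMinus (α : E →L[ℝ] E) (p : ℝ) (k : ℕ) : AltForm E k →ₗ[ℝ] AltForm E k :=
  spectralProj (inducedDer α k) {z | z.re < criticalWeight α p}

/-- The exponent `p` is critical in degree `k` if `tr(α) / p` is the real part of an eigenvalue of
the derivation induced by `α` on the alternating `k`-forms. -/
def IsCritical (α : E →L[ℝ] E) (p : ℝ) (k : ℕ) : Prop :=
  ∃ z : ℂ, Module.End.HasEigenvalue ((inducedDer α k).baseChange ℂ) z ∧ z.re = criticalWeight α p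

end Weights

/-! ### Semi-direct products -/

section SemiDirect

variable {E : Type*} [NormedAddCommGroup E] [NormedSpace ℝ E]

/-- `α` is a derivation of the Lie algebra of `H`. -/
def IsDerivation (H : Type*) [TopologicalSpace H] [ChartedSpace E H] [Group H]
    (α : E →L[ℝ] E) : Prop :=
  ∀ x y : E, α (algBracket 𝓘(ℝ, E) H x y) =
    algBracket 𝓘(ℝ, E) H (α x) y + algBracket 𝓘(ℝ, E) H x (α y)

/-- A smooth one-parameter group of automorphisms of `H`, generated by `α`: the derivative at the
identity of the automorphism at time `t` is `exp(t α)`. -/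
structure AutFlow (H : Type*) [TopologicalSpace H] [ChartedSpace E H] [Group H]
    (α : E →L[ℝ] E) where
  hom : Multiplicative ℝ →* MulAut H
  smooth : ContMDiff (𝓘(ℝ, ℝ).prod 𝓘(ℝ, E)) 𝓘(ℝ, E) ∞
    (fun x : ℝ × H => hom (Multiplicative.ofAdd x.1) x.2)
  deriv_one : ∀ (t : ℝ) (x : E),
    mfderiv 𝓘(ℝ, E) 𝓘(ℝ, E) (fun h : H => hom (Multiplicative.ofAdd t) h) 1 x =
      (NormedSpace.exp (t • α) : E →L[ℝ] E) x

variable {H : Type*} [TopologicalSpace H] [ChartedSpace E H] [Group H] {α : E →L[ℝ] E}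

/-- The automorphism at time `t`. -/
def AutFlow.at (F : AutFlow H α) (t : ℝ) : MulAut H := F.hom (Multiplicative.ofAdd t)

/-- The semi-direct product `H ⋊ ℝ`: the manifold `H × ℝ` with the multiplication
`(h, t) (h', t') = (h * F_t(h'), t + t')`. -/
def SemiProd (_F : AutFlow H α) : Type _ := H × ℝ

namespace SemiProd

variable (F : AutFlow H α)

instance : TopologicalSpace (SemiProd F) := inferInstanceAs (TopologicalSpace (H × ℝ))

instance : ChartedSpace (ModelProd E ℝ) (SemiProd F) :=
  inferInstanceAs (ChartedSpace (ModelProd E ℝ) (H × ℝ))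

instance : MeasurableSpace (SemiProd F) := borel _

instance : BorelSpace (SemiProd F) := ⟨rfl⟩

instance : Group (SemiProd F) where
  mul x y := ((x.1 * F.at x.2 y.1, x.2 + y.2) : H × ℝ)
  one := ((1, 0) : H × ℝ)
  inv x := ((F.at (-x.2) x.1⁻¹, -x.2) : H × ℝ)
  mul_assoc x y z := by
    refine Prod.ext ?_ (add_assoc _ _ _)
    change x.1 * F.at x.2 y.1 * F.at (x.2 + y.2) z.1 = x.1 * F.at x.2 (y.1 * F.at y.2 z.1)
    simp [AutFlow.at, ofAdd_add, mul_assoc]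
  one_mul x := by
    refine Prod.ext ?_ (zero_add _)
    change 1 * F.at 0 x.1 = x.1
    simp [AutFlow.at]
  mul_one x := by
    refine Prod.ext ?_ (add_zero _)
    change x.1 * F.at x.2 1 = x.1
    simp
  inv_mul_cancel x := by
    refine Prod.ext ?_ (neg_add_cancel _)
    change F.at (-x.2) x.1⁻¹ * F.at (-x.2) x.1 = 1
    rw [← map_mul]
    simp

instance [LieGroup 𝓘(ℝ, E) ∞ H] : LieGroup (𝓘(ℝ, E).prod 𝓘(ℝ, ℝ)) ∞ (SemiProd F) where
  toIsManifold := inferInstanceAs (IsManifold (𝓘(ℝ, E).prod 𝓘(ℝ, ℝ)) ∞ (H × ℝ))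
  contMDiff_mul := by
    change ContMDiff ((𝓘(ℝ, E).prod 𝓘(ℝ, ℝ)).prod (𝓘(ℝ, E).prod 𝓘(ℝ, ℝ)))
      (𝓘(ℝ, E).prod 𝓘(ℝ, ℝ)) ∞ (fun x : (H × ℝ) × (H × ℝ) =>
        (x.1.1 * F.hom (Multiplicative.ofAdd x.1.2) x.2.1, x.1.2 + x.2.2))
    have h1 := F.smooth.comp ((contMDiff_snd.comp contMDiff_fst).prodMk
      (contMDiff_fst.comp contMDiff_snd) : ContMDiff
        ((𝓘(ℝ, E).prod 𝓘(ℝ, ℝ)).prod (𝓘(ℝ, E).prod 𝓘(ℝ, ℝ))) (𝓘(ℝ, ℝ).prod 𝓘(ℝ, E)) ∞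
        (fun x : (H × ℝ) × (H × ℝ) => (x.1.2, x.2.1)))
    exact ((contMDiff_fst.comp contMDiff_fst).mul h1).prodMk
      ((contMDiff_snd.comp contMDiff_fst).add (contMDiff_snd.comp contMDiff_snd))
  contMDiff_inv := by
    change ContMDiff (𝓘(ℝ, E).prod 𝓘(ℝ, ℝ)) (𝓘(ℝ, E).prod 𝓘(ℝ, ℝ)) ∞ (fun x : H × ℝ =>
        (F.hom (Multiplicative.ofAdd (-x.2)) x.1⁻¹, -x.2))
    have h1 := F.smooth.comp (contMDiff_snd.neg.prodMk contMDiff_fst.inv : ContMDiff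
        (𝓘(ℝ, E).prod 𝓘(ℝ, ℝ)) (𝓘(ℝ, ℝ).prod 𝓘(ℝ, E)) ∞
        (fun x : H × ℝ => (-x.2, x.1⁻¹)))
    exact h1.prodMk contMDiff_snd.neg

end SemiProd

end SemiDirect

/-- At most polynomial growth in `j`. -/
def PolyGrowth (u : ℕ → ℝ≥0∞) : Prop :=
  ∃ (C : ℝ) (N : ℕ), ∀ j : ℕ, u j ≤ ENNReal.ofReal (C * ((j : ℝ) + 1) ^ N)

/-- Exponential decay in `j`. -/
def ExpDecay (u : ℕ → ℝ≥0∞) : Prop :=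
  ∃ C c : ℝ, 0 < c ∧ ∀ j : ℕ, u j ≤ ENNReal.ofReal (C * Real.exp (-c * j))

end

noncomputable section

set_option linter.unusedSectionVars false

/-! ### Algebra of the wedge product -/

section WedgeAlgebra

/-! Suppose that the cohomology of G in degree k vanishes; then ∫ e ∧ e'_j tends to 0, against the
assumption. Write π : G → H for the projection (h, t) ↦ h and λ for tr α.

In left trivializations π^*θ at (h, t) is (e^{tα})^*θ(h), and Haar measure of G is a constant
multiple of e^{-λt} dt dμ (`exists_map_homeo_eq`). A component of θ of weight w therefore
contributes to the L^p norm of π^*θ near time t a factor of the size of e^{(Re w - λ/p)t}, up to a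
polynomial. As t → -∞ the components in Λ_+ decay exponentially, those in Λ_0 grow at most
polynomially, and those in Λ_- are absent by hypothesis (`exists_growth_bound`,
`exists_stripLift_bound`).

Let χ_j = f_j(t) dt ∧ π^*e, where f_j is the indicator of [a_j - 1, a_j + 1]. This form is closed,
its norm is polynomial in j when a_j is linear in j, and ∫_G χ_j ∧ π^*e'_j = 2c ∫_H e ∧ e'_j with a
constant c > 0, because the flow multiplies top-degree forms of H by e^{λt}, which cancels the
density of Haar measure (`wedge_flow`, `integral_dtLift_flowLift`).

By the open mapping theorem closed forms on G have primitives with a norm bound C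
(`exists_bounded_primitive`). Let β be a primitive of a closed form χ carried by a strip in t, and
κ(t) a cut-off equal to 1 on that strip. Then χ - d(κβ) = -κ' dt ∧ β; if κ has small slope, this new
closed form has at most half the norm of χ, and its strip is wider by a fixed D (`exists_cut`). By
Stokes the replacement changes the pairing with π^*e'_j by ±∫ κβ ∧ π^*de'_j. After j cuts the
pairing of χ_j is at most K‖χ_j‖(2^{-j}‖π^*e'_j‖ + 2C‖π^*de'_j‖), with norms over a strip of
half-width 1 + jD (`abs_integral_closed_le`). Place this strip in t ≤ -j. The first norm in the
bracket is then polynomial in j. In the second, the 0-part is exponentially small by hypothesis and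
the +-part gains e^{-δj}. Everything decays exponentially (`tendsto_integral_wedge`).

The analytic support is Stokes' formula for forms that are only in L^p and L^q with weak derivatives
(`integral_eq_of_isWeakExtDer`, `integral_wedge_flowLift`). One form is smoothed by convolution on
the left, which commutes with d because left translations preserve the left trivialization, and is
then cut off by functions with bounded left-invariant derivatives. The groups need not be
unimodular: integration by parts produces the linear form x ↦ tr(ad x), and this is the logarithmic
derivative of the modulus at the identity (`integral_leftDerivL`), so it cancels against the modulus
that inversion introduces in the convolution (`integral_extDerSymbol`). -/

lemma wedge_add_right {V : Type*} {m l : ℕ} (a : (Fin m → V) → ℝ) (b b' : (Fin l → V) → ℝ)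
    (v : Fin (m + l) → V) : wedge a (b + b') v = wedge a b v + wedge a b' v := by
  simp only [wedge, Pi.add_apply, mul_add, Finset.sum_add_distrib]

lemma wedge_smul_right {V : Type*} {m l : ℕ} (c : ℝ) (a : (Fin m → V) → ℝ) (b : (Fin l → V) → ℝ)
    (v : Fin (m + l) → V) : wedge a (c • b) v = c * wedge a b v := by
  simp only [wedge, Pi.smul_apply, smul_eq_mul, Finset.mul_sum]
  refine Finset.sum_congr rfl fun σ _ => by ring

/-- A permutation of the first `m` of `m + l` places. -/
def permCastAdd {m : ℕ} (l : ℕ) (p : Equiv.Perm (Fin m)) : Equiv.Perm (Fin (m + l)) :=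
  finSumFinEquiv.permCongr (Equiv.Perm.sumCongr p 1)

@[simp] lemma permCastAdd_castAdd {m : ℕ} (l : ℕ) (p : Equiv.Perm (Fin m)) (i : Fin m) :
    permCastAdd l p (Fin.castAdd l i) = Fin.castAdd l (p i) := by
  simp [permCastAdd, Equiv.permCongr_apply]

@[simp] lemma permCastAdd_natAdd {m : ℕ} (l : ℕ) (p : Equiv.Perm (Fin m)) (i : Fin l) :
    permCastAdd l p (Fin.natAdd m i) = Fin.natAdd m i := by
  simp [permCastAdd, Equiv.permCongr_apply]

@[simp] lemma sign_permCastAdd {m : ℕ} (l : ℕ) (p : Equiv.Perm (Fin m)) :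
    Equiv.Perm.sign (permCastAdd l p) = Equiv.Perm.sign p := by
  simp [permCastAdd, Equiv.Perm.sign_permCongr, Equiv.Perm.sign_sumCongr]

/-- A permutation of the last `l` of `m + l` places. -/
def permNatAdd (m : ℕ) {l : ℕ} (p : Equiv.Perm (Fin l)) : Equiv.Perm (Fin (m + l)) :=
  finSumFinEquiv.permCongr (Equiv.Perm.sumCongr 1 p)

@[simp] lemma permNatAdd_castAdd (m : ℕ) {l : ℕ} (p : Equiv.Perm (Fin l)) (i : Fin m) :
    permNatAdd m p (Fin.castAdd l i) = Fin.castAdd l i := by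
  simp [permNatAdd, Equiv.permCongr_apply]

@[simp] lemma permNatAdd_natAdd (m : ℕ) {l : ℕ} (p : Equiv.Perm (Fin l)) (i : Fin l) :
    permNatAdd m p (Fin.natAdd m i) = Fin.natAdd m (p i) := by
  simp [permNatAdd, Equiv.permCongr_apply]

@[simp] lemma sign_permNatAdd (m : ℕ) {l : ℕ} (p : Equiv.Perm (Fin l)) :
    Equiv.Perm.sign (permNatAdd m p) = Equiv.Perm.sign p := by
  simp [permNatAdd, Equiv.Perm.sign_permCongr, Equiv.Perm.sign_sumCongr]

/-- Antisymmetrization of a function of `n` variables. -/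
def altSum {V : Type*} {n : ℕ} (f : (Fin n → V) → ℝ) (v : Fin n → V) : ℝ :=
  ∑ σ : Equiv.Perm (Fin n), ((Equiv.Perm.sign σ : ℤ) : ℝ) * f (v ∘ σ)

/-- Substitution σ ↦ σρ⁻¹ in the sum. This is the device by which a linear factor standing at any
place is moved to the first one, at the price of a sign. -/
lemma altSum_comp_perm {V : Type*} {n : ℕ} (f : (Fin n → V) → ℝ) (ρ : Equiv.Perm (Fin n))
    (v : Fin n → V) :
    altSum (fun w => f (w ∘ ρ)) v = ((Equiv.Perm.sign ρ : ℤ) : ℝ) * altSum f v := by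
  unfold altSum
  rw [Finset.mul_sum, ← Equiv.sum_comp (Equiv.mulRight ρ⁻¹)]
  refine Finset.sum_congr rfl fun σ _ => ?_
  simp only [Equiv.coe_mulRight, Equiv.Perm.sign_mul, Equiv.Perm.sign_inv, Units.val_mul,
    Int.cast_mul]
  have h2 : (v ∘ ⇑(σ * ρ⁻¹)) ∘ ⇑ρ = v ∘ σ := by
    funext i; simp
  rw [h2]; ring

lemma wedge_eq_altSum {V : Type*} {m l : ℕ} (a : (Fin m → V) → ℝ) (b : (Fin l → V) → ℝ)
    (v : Fin (m + l) → V) : wedge a b v = ((m.factorial : ℝ) * (l.factorial : ℝ))⁻¹ *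
      altSum (fun w => a (fun i => w (Fin.castAdd l i)) * b (fun i => w (Fin.natAdd m i))) v := rfl

/-- The exterior product of a linear form with a function of several variables. -/
def extMul {V : Type*} {m : ℕ} (τ : V → ℝ) (a : (Fin m → V) → ℝ) (v : Fin (m + 1) → V) : ℝ :=
  ∑ i : Fin (m + 1), (-1 : ℝ) ^ (i : ℕ) * (τ (v i) * a (fun j => v (i.succAbove j)))

lemma altSum_sum {V ι : Type*} {n : ℕ} (s : Finset ι) (f : ι → (Fin n → V) → ℝ) (v : Fin n → V) :
    altSum (fun w => ∑ i ∈ s, f i w) v = ∑ i ∈ s, altSum (f i) v := by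
  unfold altSum
  rw [Finset.sum_comm]
  simp only [Finset.mul_sum]

lemma altSum_const_mul {V : Type*} {n : ℕ} (c : ℝ) (f : (Fin n → V) → ℝ) (v : Fin n → V) :
    altSum (fun w => c * f w) v = c * altSum f v := by
  unfold altSum
  rw [Finset.mul_sum]
  exact Finset.sum_congr rfl fun σ _ => by ring

lemma sign_cycleRange_symm {n : ℕ} (i : Fin (n + 1)) :
    ((Equiv.Perm.sign (Fin.cycleRange i).symm : ℤ) : ℝ) = (-1) ^ (i : ℕ) := by
  simp [Equiv.Perm.sign_symm]

lemma neg_one_pow_mul_self (n : ℕ) : (-1 : ℝ) ^ n * (-1) ^ n = 1 := by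
  rw [← mul_pow]; simp

/-- The m + 1 summands of the exterior product with τ all contribute the same: the cycle that brings
place i to the front has sign (-1)^i, which cancels the sign in the definition. The resulting factor
m + 1 turns (m + 1)! into m!. -/
lemma wedge_extMul_left {V : Type*} {m l : ℕ} (τ : V → ℝ) (a : (Fin m → V) → ℝ)
    (b : (Fin l → V) → ℝ) (v : Fin (m + 1 + l) → V) :
    wedge (extMul τ a) b v = ((m.factorial : ℝ) * (l.factorial : ℝ))⁻¹ *
      altSum (fun w => τ (w (Fin.castAdd l 0)) * a (fun i => w (Fin.castAdd l i.succ)) *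
        b (fun i => w (Fin.natAdd (m + 1) i))) v := by
  rw [wedge_eq_altSum]
  set S := altSum (fun w : Fin (m + 1 + l) → V => τ (w (Fin.castAdd l 0)) *
    a (fun i => w (Fin.castAdd l i.succ)) * b (fun i => w (Fin.natAdd (m + 1) i))) v with hS
  have key : ∀ i : Fin (m + 1), altSum (fun w : Fin (m + 1 + l) → V => (-1 : ℝ) ^ (i : ℕ) *
      (τ (w (Fin.castAdd l i)) * a (fun j => w (Fin.castAdd l (i.succAbove j))) *
        b (fun i => w (Fin.natAdd (m + 1) i)))) v = S := by
    intro i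
    have := altSum_comp_perm (fun w : Fin (m + 1 + l) → V => τ (w (Fin.castAdd l 0)) *
      a (fun i => w (Fin.castAdd l i.succ)) * b (fun i => w (Fin.natAdd (m + 1) i)))
      (permCastAdd l (Fin.cycleRange i).symm) v
    simp only [Function.comp_apply, permCastAdd_castAdd, permCastAdd_natAdd, sign_permCastAdd,
      sign_cycleRange_symm, Fin.cycleRange_symm_zero, Fin.cycleRange_symm_succ] at this
    rw [altSum_const_mul, this, ← mul_assoc, neg_one_pow_mul_self, one_mul]
  have e : (fun w : Fin (m + 1 + l) → V => extMul τ a (fun i => w (Fin.castAdd l i)) *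
      b (fun i => w (Fin.natAdd (m + 1) i))) = fun w => ∑ i : Fin (m + 1), (-1 : ℝ) ^ (i : ℕ) *
      (τ (w (Fin.castAdd l i)) * a (fun j => w (Fin.castAdd l (i.succAbove j))) *
        b (fun i => w (Fin.natAdd (m + 1) i))) := by
    funext w
    simp only [extMul, Finset.sum_mul]
    exact Finset.sum_congr rfl fun i _ => by ring
  rw [e, altSum_sum, Finset.sum_congr rfl fun i _ => key i]
  simp only [Finset.sum_const, Finset.card_univ, Fintype.card_fin, nsmul_eq_mul,
    Nat.factorial_succ, Nat.cast_mul]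
  have h1 : ((m + 1 : ℕ) : ℝ) ≠ 0 := by positivity
  field_simp

lemma wedge_extMul_right {V : Type*} {m l : ℕ} (τ : V → ℝ) (a : (Fin m → V) → ℝ)
    (b : (Fin l → V) → ℝ) (v : Fin (m + (l + 1)) → V) :
    wedge a (extMul τ b) v = ((m.factorial : ℝ) * (l.factorial : ℝ))⁻¹ *
      altSum (fun w => τ (w (Fin.natAdd m 0)) * a (fun i => w (Fin.castAdd (l + 1) i)) *
        b (fun i => w (Fin.natAdd m i.succ))) v := by
  rw [wedge_eq_altSum]
  set S := altSum (fun w : Fin (m + (l + 1)) → V => τ (w (Fin.natAdd m 0)) *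
    a (fun i => w (Fin.castAdd (l + 1) i)) * b (fun i => w (Fin.natAdd m i.succ))) v with hS
  have key : ∀ i : Fin (l + 1), altSum (fun w : Fin (m + (l + 1)) → V => (-1 : ℝ) ^ (i : ℕ) *
      (τ (w (Fin.natAdd m i)) * a (fun j => w (Fin.castAdd (l + 1) j)) *
        b (fun j => w (Fin.natAdd m (i.succAbove j))))) v = S := by
    intro i
    have := altSum_comp_perm (fun w : Fin (m + (l + 1)) → V => τ (w (Fin.natAdd m 0)) *
      a (fun i => w (Fin.castAdd (l + 1) i)) * b (fun i => w (Fin.natAdd m i.succ)))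
      (permNatAdd m (Fin.cycleRange i).symm) v
    simp only [Function.comp_apply, permNatAdd_castAdd, permNatAdd_natAdd, sign_permNatAdd,
      sign_cycleRange_symm, Fin.cycleRange_symm_zero, Fin.cycleRange_symm_succ] at this
    rw [altSum_const_mul, this, ← mul_assoc, neg_one_pow_mul_self, one_mul]
  have e : (fun w : Fin (m + (l + 1)) → V => a (fun i => w (Fin.castAdd (l + 1) i)) *
      extMul τ b (fun i => w (Fin.natAdd m i))) = fun w => ∑ i : Fin (l + 1), (-1 : ℝ) ^ (i : ℕ) *
      (τ (w (Fin.natAdd m i)) * a (fun j => w (Fin.castAdd (l + 1) j)) *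
        b (fun j => w (Fin.natAdd m (i.succAbove j)))) := by
    funext w
    simp only [extMul, Finset.mul_sum]
    exact Finset.sum_congr rfl fun i _ => by ring
  rw [e, altSum_sum, Finset.sum_congr rfl fun i _ => key i]
  simp only [Finset.sum_const, Finset.card_univ, Fintype.card_fin, nsmul_eq_mul,
    Nat.factorial_succ, Nat.cast_mul]
  have h1 : ((l + 1 : ℕ) : ℝ) ≠ 0 := by positivity
  field_simp

lemma altSum_cast {V : Type*} {n n' : ℕ} (h : n' = n) (f : (Fin n → V) → ℝ) (v : Fin n → V) :
    altSum (fun w : Fin n' → V => f (fun i => w (Fin.cast h.symm i))) (fun i => v (Fin.cast h i)) =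
      altSum f v := by
  subst h; rfl

/-- A linear form can be moved across the wedge product. -/
lemma wedge_extMul_comm {V : Type*} {m l : ℕ} (τ : V → ℝ) (a : (Fin m → V) → ℝ)
    (b : (Fin l → V) → ℝ) (v : Fin (m + (l + 1)) → V) :
    wedge a (extMul τ b) v =
      (-1) ^ m * wedge (extMul τ a) b (fun i : Fin (m + 1 + l) => v (Fin.cast (by omega) i)) := by
  have hN : m + 1 + l = m + (l + 1) := by omega
  rw [wedge_extMul_left, wedge_extMul_right, ← altSum_cast hN]
  -- On the two sides τ stands at place m and at place 0; the cycle through the first m + 1 places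
  -- relates them and has sign (-1)^m.
  have := altSum_comp_perm (fun w : Fin (m + 1 + l) → V => τ (w (Fin.castAdd l 0)) *
      a (fun i => w (Fin.castAdd l i.succ)) * b (fun i => w (Fin.natAdd (m + 1) i)))
      (permCastAdd l (Fin.cycleRange (Fin.last m)).symm) (fun i => v (Fin.cast hN i))
  simp only [Function.comp_apply, permCastAdd_castAdd, permCastAdd_natAdd, sign_permCastAdd,
      sign_cycleRange_symm, Fin.cycleRange_symm_zero, Fin.cycleRange_symm_succ,
      Fin.succAbove_last, Fin.val_last] at this
  rw [mul_left_comm, ← this]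
  congr 2
  funext w
  congr 1
  congr 1
  funext i
  exact congrArg w (Fin.ext (by simp; omega))

/-- Evaluation of `(τ ∧ a) ∧ b` on a family on which `τ` vanishes except for the first vector. -/
lemma wedge_extMul_cons {V : Type*} {m l : ℕ} (τ : V → ℝ) (a : (Fin m → V) → ℝ)
    (b : (Fin l → V) → ℝ) (x : V) (hx : τ x = 1) (v : Fin (m + l) → V) (hv : ∀ i, τ (v i) = 0) :
    wedge (extMul τ a) b (fun i : Fin (m + 1 + l) =>
      (Fin.cons x v : Fin (m + l + 1) → V) (Fin.cast (by omega) i)) = wedge a b v := by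
  have hN : m + 1 + l = m + l + 1 := by omega
  rw [wedge_extMul_left, wedge_eq_altSum]
  congr 1
  have := altSum_cast hN (fun w : Fin (m + l + 1) → V => τ (w 0) *
    a (fun i => w (Fin.castAdd l i).succ) * b (fun i => w (Fin.natAdd m i).succ))
    (Fin.cons x v)
  have e : (fun w : Fin (m + 1 + l) → V => τ (w (Fin.castAdd l 0)) *
      a (fun i => w (Fin.castAdd l i.succ)) * b (fun i => w (Fin.natAdd (m + 1) i))) =
    fun w => τ (w (Fin.cast hN.symm 0)) * a (fun i => w (Fin.cast hN.symm (Fin.castAdd l i).succ)) *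
      b (fun i => w (Fin.cast hN.symm (Fin.natAdd m i).succ)) := by
    funext w
    congr 1
    congr 1
    funext i
    congr 1
    ext
    simp
    omega
  rw [e, this]
  unfold altSum
  -- A permutation amounts to the image of 0 and a permutation of the other places. Since τ vanishes
  -- on all vectors but x, only the permutations that fix 0 contribute.
  rw [← Equiv.sum_comp Equiv.Perm.decomposeFin.symm, Fintype.sum_prod_type,
    Fintype.sum_eq_single 0]
  · refine Finset.sum_congr rfl fun σ _ => ?_
    simp [hx]
  · intro i hi
    refine Finset.sum_eq_zero fun σ _ => ?_
    obtain ⟨j, rfl⟩ := Fin.exists_succ_eq.2 hi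
    simp [hv]

end WedgeAlgebra

/-! ### Alternating forms: wedge pairing, induced derivations, bracket sums. -/

section AltFormAlgebra

variable {E : Type*} [NormedAddCommGroup E] [NormedSpace ℝ E]

/-- The wedge product as an alternating map. -/
def wedgeAlt {m l : ℕ} (a : AltForm E m) (b : AltForm E l) : E [⋀^Fin (m + l)]→ₗ[ℝ] ℝ :=
  ((m.factorial : ℝ) * (l.factorial : ℝ))⁻¹ • MultilinearMap.alternatization
    ((LinearMap.mul' ℝ ℝ).compMultilinearMap
      ((a.toMultilinearMap.domCoprod b.toMultilinearMap).domDomCongr finSumFinEquiv))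

lemma wedgeAlt_apply {m l : ℕ} (a : AltForm E m) (b : AltForm E l) (v : Fin (m + l) → E) :
    wedgeAlt a b v = wedge a b v := by
  simp only [wedgeAlt, AlternatingMap.smul_apply, MultilinearMap.alternatization_apply, wedge,
    smul_eq_mul]
  congr 1
  refine Finset.sum_congr rfl fun σ _ => ?_
  simp [Units.smul_def]

/-- The wedge product evaluated at `v`, as a bilinear form. -/
def wedgeBilin {m l : ℕ} (v : Fin (m + l) → E) : AltForm E m →ₗ[ℝ] AltForm E l →ₗ[ℝ] ℝ :=
  LinearMap.mk₂ ℝ (fun a b => wedge a b v) (fun _ _ _ => wedge_add_left _ _ _ _)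
    (fun c _ _ => wedge_smul_left c _ _ _) (fun _ _ _ => wedge_add_right _ _ _ _)
    (fun c _ _ => wedge_smul_right c _ _ _)

@[simp] lemma wedgeBilin_apply {m l : ℕ} (v : Fin (m + l) → E) (a : AltForm E m)
    (b : AltForm E l) : wedgeBilin v a b = wedge a b v := rfl

/-- Top-degree forms are multiples of the determinant of a basis, so an identity checked on one
basis holds on every family of vectors. -/
lemma wedge_eq_det_mul {m l n : ℕ} (a : AltForm E m) (b : AltForm E l)
    (e : Module.Basis (Fin n) ℝ E) (h : m + l = n) (v : Fin (m + l) → E) :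
    wedge a b v = e.det (fun i => v (Fin.cast h.symm i)) * wedge a b (fun i => e (Fin.cast h i)) := by
  subst h
  simp only [Fin.cast_refl, id_eq, ← wedgeAlt_apply]
  conv_lhs => rw [(wedgeAlt a b).eq_smul_basis_det e]
  simp [mul_comm]

lemma inducedDer_apply (A : E →L[ℝ] E) {k : ℕ} (θ : AltForm E k) (v : Fin k → E) :
    inducedDer A k θ v = ∑ i : Fin k, θ (Function.update v i (A (v i))) :=
  inducedDerAux_apply A θ v

lemma inducedDer_add (A B : E →L[ℝ] E) {k : ℕ} (θ : AltForm E k) :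
    inducedDer (A + B) k θ = inducedDer A k θ + inducedDer B k θ := by
  ext v
  simp [inducedDer_apply, Finset.sum_add_distrib]

lemma inducedDer_smul (c : ℝ) (A : E →L[ℝ] E) {k : ℕ} (θ : AltForm E k) :
    inducedDer (c • A) k θ = c • inducedDer A k θ := by
  ext v
  simp [inducedDer_apply, Finset.mul_sum]

/-- Leibniz rule: in each antisymmetrized summand the sum over all places splits into the places
belonging to a and those belonging to b. -/
lemma wedge_inducedDer_add {m l : ℕ} (A : E →L[ℝ] E) (a : AltForm E m) (b : AltForm E l)
    (v : Fin (m + l) → E) :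
    wedge (inducedDer A m a) b v + wedge a (inducedDer A l b) v =
      ∑ i, wedge a b (Function.update v i (A (v i))) := by
  simp only [wedge_eq_altSum, ← mul_add, ← Finset.mul_sum]
  congr 1
  unfold altSum
  rw [← Finset.sum_add_distrib, Finset.sum_comm]
  refine Finset.sum_congr rfl fun σ _ => ?_
  rw [← mul_add, ← Finset.mul_sum]
  congr 1
  rw [← Equiv.sum_comp σ, Fin.sum_univ_add]
  have hσ : ∀ k, (Function.update v (σ k) (A (v (σ k)))) ∘ σ =
      Function.update (v ∘ σ) k (A (v (σ k))) := by
    intro k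
    rw [Function.update_comp_eq_of_injective _ σ.injective]
  have hc : ∀ (w : Fin (m + l) → E) (j : Fin m) (y : E),
      (fun i => Function.update w (Fin.castAdd l j) y (Fin.castAdd l i)) =
        Function.update (fun i => w (Fin.castAdd l i)) j y := by
    intro w j y
    exact Function.update_comp_eq_of_injective w (Fin.castAdd_injective m l) j y
  have hn : ∀ (w : Fin (m + l) → E) (j : Fin l) (y : E),
      (fun i => Function.update w (Fin.natAdd m j) y (Fin.natAdd m i)) =
        Function.update (fun i => w (Fin.natAdd m i)) j y := by
    intro w j y
    exact Function.update_comp_eq_of_injective w (Fin.natAdd_injective l m) j y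
  have hc' : ∀ (w : Fin (m + l) → E) (j : Fin m) (y : E),
      (fun i => Function.update w (Fin.castAdd l j) y (Fin.natAdd m i)) =
        (fun i => w (Fin.natAdd m i)) := by
    intro w j y
    funext i
    exact Function.update_of_ne (by simp [Fin.ext_iff]; omega) _ _
  have hn' : ∀ (w : Fin (m + l) → E) (j : Fin l) (y : E),
      (fun i => Function.update w (Fin.natAdd m j) y (Fin.castAdd l i)) =
        (fun i => w (Fin.castAdd l i)) := by
    intro w j y
    funext i
    exact Function.update_of_ne (by simp [Fin.ext_iff]; omega) _ _
  beta_reduce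
  rw [inducedDer_apply, inducedDer_apply, Finset.sum_mul, Finset.mul_sum]
  refine congrArg₂ _ (Finset.sum_congr rfl fun j _ => ?_) (Finset.sum_congr rfl fun j _ => ?_)
  · simp only [hσ]
    rw [hc, hc']
    rfl
  · simp only [hσ]
    rw [hn, hn']
    rfl

variable [FiniteDimensional ℝ E]

/-- When A e_i is expanded in the basis only the diagonal coefficient survives, because Ω vanishes
on a family with a repeated vector. -/
lemma sum_update_eq_trace_mul {n : ℕ} (Ω : E [⋀^Fin n]→ₗ[ℝ] ℝ) (A : E →ₗ[ℝ] E)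
    (e : Module.Basis (Fin n) ℝ E) :
    ∑ i, Ω (Function.update e i (A (e i))) = LinearMap.trace ℝ E A * Ω e := by
  rw [LinearMap.trace_eq_matrix_trace ℝ e, Matrix.trace, Finset.sum_mul]
  refine Finset.sum_congr rfl fun i _ => ?_
  conv_lhs => rw [← e.sum_repr (A (e i))]
  rw [Ω.map_update_sum, Finset.sum_eq_single i]
  · rw [Ω.map_update_smul, Function.update_eq_self, Matrix.diag_apply, LinearMap.toMatrix_apply,
      smul_eq_mul]
  · intro j _ hj
    rw [Ω.map_update_smul, Ω.map_update_self e hj.symm, smul_zero]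
  · simp

lemma wedge_inducedDer_trace {m l : ℕ} (A : E →L[ℝ] E) (a : AltForm E m) (b : AltForm E l)
    (e : Module.Basis (Fin (m + l)) ℝ E) :
    wedge (inducedDer A m a) b e + wedge a (inducedDer A l b) e =
      LinearMap.trace ℝ E (A : E →ₗ[ℝ] E) * wedge a b e := by
  rw [wedge_inducedDer_add, ← wedgeAlt_apply, ← sum_update_eq_trace_mul]
  simp [wedgeAlt_apply]

lemma alternatizeUncurryFin_coe {k : ℕ} (Ψ : E →L[ℝ] AltForm E k) (v : Fin (k + 1) → E) :
    ContinuousAlternatingMap.alternatizeUncurryFin Ψ v =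
      ∑ i : Fin (k + 1), (-1 : ℝ) ^ (i : ℕ) * Ψ (v i) (fun j => v (i.succAbove j)) := by
  rw [ContinuousAlternatingMap.alternatizeUncurryFin_apply]
  refine Finset.sum_congr rfl fun i _ => ?_
  simp only [zsmul_eq_mul, Int.cast_pow, Int.cast_neg, Int.cast_one]
  rfl

/-- The exterior product of a linear form with an alternating form. -/
def lineWedge {k : ℕ} (τ : E →L[ℝ] ℝ) (a : AltForm E k) : AltForm E (k + 1) :=
  ContinuousAlternatingMap.alternatizeUncurryFin (τ.smulRight a)

lemma coe_lineWedge {k : ℕ} (τ : E →L[ℝ] ℝ) (a : AltForm E k) :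
    (lineWedge τ a : (Fin (k + 1) → E) → ℝ) = extMul τ a := by
  funext v
  rw [lineWedge, alternatizeUncurryFin_coe]
  rfl

/-- `lineWedge` as a bilinear map. -/
def lineWedgeₗ (k : ℕ) : (E →L[ℝ] ℝ) →ₗ[ℝ] AltForm E k →ₗ[ℝ] AltForm E (k + 1) :=
  LinearMap.mk₂ ℝ lineWedge
    (fun τ τ' a => by ext v; simp [coe_lineWedge, extMul, add_mul, mul_add, Finset.sum_add_distrib])
    (fun c τ a => by
      ext v; simp only [coe_lineWedge, extMul, ContinuousAlternatingMap.smul_apply, smul_eq_mul,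
        Finset.mul_sum]
      exact Finset.sum_congr rfl fun i _ => by simp; ring)
    (fun τ a a' => by ext v; simp [coe_lineWedge, extMul, mul_add, Finset.sum_add_distrib])
    (fun c τ a => by
      ext v; simp only [coe_lineWedge, extMul, ContinuousAlternatingMap.smul_apply, smul_eq_mul,
        Finset.mul_sum]
      exact Finset.sum_congr rfl fun i _ => by ring)

@[simp] lemma lineWedgeₗ_apply {k : ℕ} (τ : E →L[ℝ] ℝ) (a : AltForm E k) :
    lineWedgeₗ k τ a = lineWedge τ a := rfl

lemma wedge_lineWedge_comm {m l : ℕ} (τ : E →L[ℝ] ℝ) (a : AltForm E m) (b : AltForm E l)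
    (v : Fin (m + (l + 1)) → E) : wedge a (lineWedge τ b) v =
      (-1) ^ m * wedge (lineWedge τ a) b (fun i : Fin (m + 1 + l) => v (Fin.cast (by omega) i)) := by
  rw [coe_lineWedge, coe_lineWedge, wedge_extMul_comm]

/-- The coordinate forms of a basis. -/
def coordForm {n : ℕ} (e : Module.Basis (Fin n) ℝ E) (i : Fin n) : E →L[ℝ] ℝ :=
  LinearMap.toContinuousLinearMap (e.coord i)

/-- A differential in the form Σ e^i ∧ Ψ(e_i), where the linear factors can be moved across wedge
products one at a time. -/
lemma alternatizeUncurryFin_eq_sum {n k : ℕ} (e : Module.Basis (Fin n) ℝ E)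
    (Ψ : E →L[ℝ] AltForm E k) : ContinuousAlternatingMap.alternatizeUncurryFin Ψ =
      ∑ i, lineWedge (coordForm e i) (Ψ (e i)) := by
  have h : Ψ = ∑ i, (coordForm e i).smulRight (Ψ (e i)) := by
    ext1 x
    conv_lhs => rw [← e.sum_repr x, map_sum]
    simp [coordForm, map_smul]
  conv_lhs => rw [h]
  have := map_sum (ContinuousAlternatingMap.alternatizeUncurryFinCLM (n := k) ℝ E ℝ)
    (fun i => (coordForm e i).smulRight (Ψ (e i))) Finset.univ
  simp only [ContinuousAlternatingMap.alternatizeUncurryFinCLM_apply] at this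
  exact this

/-- Exchanging the removed place with a marked place. -/
lemma neg_one_pow_mul_update_succAbove {k : ℕ} (θ : AltForm E k) (v : Fin (k + 1) → E) (y : E)
    {i j : Fin (k + 1)} (hij : i ≠ j) :
    (-1 : ℝ) ^ (i : ℕ) * θ (fun a => Function.update v j y (i.succAbove a)) =
      -((-1) ^ (j : ℕ) * θ (fun a => Function.update v i y (j.succAbove a))) := by
  -- With y at both places i and j, removing one or the other leaves the same vectors in a different
  -- order.
  have := θ.neg_one_pow_smul_map_removeNth_add_eq_zero_of_eq
    (v := Function.update (Function.update v i y) j y) (i := i) (j := j)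
    (by simp [hij]) hij
  have h1 : i.removeNth (Function.update (Function.update v i y) j y) =
      fun a => Function.update v j y (i.succAbove a) := by
    funext a
    simp only [Fin.removeNth_apply]
    rw [Function.update_comm hij, Function.update_of_ne (Fin.succAbove_ne i a)]
  have h2 : j.removeNth (Function.update (Function.update v i y) j y) =
      fun a => Function.update v i y (j.succAbove a) := by
    funext a
    simp only [Fin.removeNth_apply]
    rw [Function.update_of_ne (Fin.succAbove_ne j a)]
  rw [h1, h2] at this
  simp only [zsmul_eq_mul, Int.cast_pow, Int.cast_neg, Int.cast_one] at this
  linarith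

lemma update_comp_succAbove {k : ℕ} (v : Fin (k + 1) → E) (j : Fin (k + 1)) (a : Fin k) (y : E) :
    Function.update (fun b => v (j.succAbove b)) a y =
      fun b => Function.update v (j.succAbove a) y (j.succAbove b) :=
  (Function.update_comp_eq_of_injective v Fin.succAbove_right_injective a y).symm

lemma sum_succAbove {k : ℕ} (f : Fin (k + 1) → Fin (k + 1) → ℝ) :
    ∑ j, ∑ a : Fin k, f j (j.succAbove a) = ∑ j, ∑ i, if i = j then 0 else f j i := by
  refine Finset.sum_congr rfl fun j _ => ?_
  rw [Fin.sum_univ_succAbove _ j]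
  simp [Fin.succAbove_ne]

lemma sum_castSucc_lt {k : ℕ} (f : Fin (k + 1) → Fin (k + 1) → ℝ) (j : Fin (k + 1)) :
    ∑ i : Fin k, (if i.castSucc < j then f j i.castSucc else 0) =
      ∑ i, if i < j then f j i else 0 := by
  rw [Fin.sum_univ_castSucc]
  simp [not_lt.2 (Fin.le_last j)]

/-- The derivation terms, antisymmetrized: exchanging the arguments of the bilinear map changes the
sign. -/
lemma alternatize_bilin_swap {k : ℕ} (θ : AltForm E k) (C : E → E → E) (v : Fin (k + 1) → E) :
    ∑ j : Fin (k + 1), (-1 : ℝ) ^ (j : ℕ) * ∑ a : Fin k,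
        θ (Function.update (fun b => v (j.succAbove b)) a (C (v j) (v (j.succAbove a)))) =
      -∑ j : Fin (k + 1), (-1 : ℝ) ^ (j : ℕ) * ∑ a : Fin k,
        θ (Function.update (fun b => v (j.succAbove b)) a (C (v (j.succAbove a)) (v j))) := by
  simp only [update_comp_succAbove, Finset.mul_sum]
  rw [sum_succAbove (fun j i => (-1 : ℝ) ^ (j : ℕ) *
      θ (fun b => Function.update v i (C (v j) (v i)) (j.succAbove b))),
    sum_succAbove (fun j i => (-1 : ℝ) ^ (j : ℕ) *
      θ (fun b => Function.update v i (C (v i) (v j)) (j.succAbove b))),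
    Finset.sum_comm, ← Finset.sum_neg_distrib]
  refine Finset.sum_congr rfl fun j _ => ?_
  rw [← Finset.sum_neg_distrib]
  refine Finset.sum_congr rfl fun i _ => ?_
  by_cases h : j = i
  · simp [h]
  · rw [if_neg h, if_neg (Ne.symm h), neg_one_pow_mul_update_succAbove θ v _ (Ne.symm h)]

/-- The bracket terms of the exterior derivative as half of a sum of derivation terms. -/
lemma bracket_sum_eq {k : ℕ} (θ : AltForm E k) (C : E → E → E) (hC : ∀ x y, C x y = -C y x)
    (v : Fin (k + 1) → E) :
    (∑ j : Fin (k + 1), ∑ i : Fin k, if i.castSucc < j then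
      (-1 : ℝ) ^ (j : ℕ) *
        θ (Function.update (fun a => v (j.succAbove a)) i (C (v i.castSucc) (v j))) else 0) =
    ∑ j : Fin (k + 1), (-1 : ℝ) ^ (j : ℕ) * (-(1 / 2) * ∑ a : Fin k,
        θ (Function.update (fun b => v (j.succAbove b)) a (C (v j) (v (j.succAbove a))))) := by
  have hneg : ∀ (j i : Fin (k + 1)) (y : E), i ≠ j →
      θ (fun b => Function.update v i (-y) (j.succAbove b)) =
        -θ (fun b => Function.update v i y (j.succAbove b)) := by
    intro j i y hij
    obtain ⟨a, rfl⟩ := Fin.exists_succAbove_eq hij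
    rw [← update_comp_succAbove, ← update_comp_succAbove, ← neg_one_smul ℝ y, θ.map_update_smul]; simp
  set f : Fin (k + 1) → Fin (k + 1) → ℝ := fun j i => (-1 : ℝ) ^ (j : ℕ) *
      θ (fun b => Function.update v i (C (v j) (v i)) (j.succAbove b)) with hf
  -- Skewness of C offsets the sign of the exchange of places, so f is symmetric off the diagonal,
  -- and the sum over i < j is half of the sum over i ≠ j. This is the source of the factor ½.
  have hsymm : ∀ i j, i ≠ j → f j i = f i j := by
    intro i j hij
    simp only [hf]
    rw [neg_one_pow_mul_update_succAbove θ v _ hij.symm, hC (v j), hneg i j _ hij.symm]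
    ring
  have hL : ∀ j : Fin (k + 1), ∀ i : Fin k, (if i.castSucc < j then
      (-1 : ℝ) ^ (j : ℕ) *
        θ (Function.update (fun a => v (j.succAbove a)) i (C (v i.castSucc) (v j))) else 0) =
      if i.castSucc < j then (fun j i => -f j i) j i.castSucc else 0 := by
    intro j i
    by_cases h : i.castSucc < j
    · rw [if_pos h, if_pos h]
      have e : j.succAbove i = i.castSucc := Fin.succAbove_of_castSucc_lt _ _ h
      rw [update_comp_succAbove, e, hC, hneg _ _ _ h.ne]
      simp [hf]
    · rw [if_neg h, if_neg h]
  have hL2 := fun j => sum_castSucc_lt (fun j i => -f j i) j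
  simp only [hL]
  simp only [hL2]
  have hR : ∀ j : Fin (k + 1), (-1 : ℝ) ^ (j : ℕ) * (-(1 / 2) * ∑ a : Fin k,
        θ (Function.update (fun b => v (j.succAbove b)) a (C (v j) (v (j.succAbove a))))) =
      -(1 / 2) * ∑ a : Fin k, f j (j.succAbove a) := by
    intro j
    simp only [update_comp_succAbove, hf, Finset.mul_sum]
    exact Finset.sum_congr rfl fun a _ => by ring
  simp only [hR]
  rw [← Finset.mul_sum, sum_succAbove]
  have hsplit : ∑ j, ∑ i, (if i = j then 0 else f j i) =
      ∑ j, ∑ i, (if i < j then f j i else 0) + ∑ j, ∑ i, (if j < i then f j i else 0) := by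
    simp only [← Finset.sum_add_distrib]
    refine Finset.sum_congr rfl fun j _ => Finset.sum_congr rfl fun i _ => ?_
    rcases lt_trichotomy i j with h | h | h
    · simp [h, h.ne, h.not_gt]
    · simp [h]
    · simp [h, h.ne', h.not_gt]
  have hsw : ∑ j, ∑ i, (if j < i then f j i else 0) = ∑ j, ∑ i, (if i < j then f j i else 0) := by
    rw [Finset.sum_comm]
    refine Finset.sum_congr rfl fun j _ => Finset.sum_congr rfl fun i _ => ?_
    by_cases h : i < j
    · rw [if_pos h, if_pos h, hsymm i j h.ne]
    · rw [if_neg h, if_neg h]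
  rw [hsplit, hsw]
  have : ∑ j, ∑ i, (if i < j then -f j i else 0) = -∑ j, ∑ i, (if i < j then f j i else 0) := by
    simp only [← Finset.sum_neg_distrib]
    exact Finset.sum_congr rfl fun j _ => Finset.sum_congr rfl fun i _ => by split_ifs <;> simp
  rw [this]
  ring

end AltFormAlgebra

/-! ### The Chevalley–Eilenberg differential and its Leibniz defect in top degree. -/

section ChevalleyEilenberg

variable {E : Type*} [NormedAddCommGroup E] [NormedSpace ℝ E] [FiniteDimensional ℝ E]

/-- The linear map `x ↦ -½ D_{ad x} c`, where `D_A` is the derivation induced by `A`. -/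
def halfDer (ad : E →L[ℝ] E →L[ℝ] E) {k : ℕ} (c : AltForm E k) : E →L[ℝ] AltForm E k :=
  LinearMap.toContinuousLinearMap
    { toFun := fun x => (-(1 / 2) : ℝ) • inducedDer (ad x) k c
      map_add' := fun x y => by rw [map_add, inducedDer_add, smul_add]
      map_smul' := fun r x => by rw [map_smul, inducedDer_smul, smul_comm]; rfl }

lemma halfDer_apply (ad : E →L[ℝ] E →L[ℝ] E) {k : ℕ} (c : AltForm E k) (x : E) :
    halfDer ad c x = (-(1 / 2) : ℝ) • inducedDer (ad x) k c := rfl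

/-- The Chevalley–Eilenberg differential of an alternating form. -/
def algDer (ad : E →L[ℝ] E →L[ℝ] E) {k : ℕ} (c : AltForm E k) : AltForm E (k + 1) :=
  ContinuousAlternatingMap.alternatizeUncurryFin (halfDer ad c)

/-- The linear form `x ↦ tr (ad x)`. -/
def traceForm (ad : E →L[ℝ] E →L[ℝ] E) : E →L[ℝ] ℝ :=
  LinearMap.toContinuousLinearMap
    { toFun := fun x => LinearMap.trace ℝ E (ad x : E →ₗ[ℝ] E)
      map_add' := fun x y => by simp
      map_smul' := fun r x => by simp }

lemma traceForm_apply (ad : E →L[ℝ] E →L[ℝ] E) (x : E) :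
    traceForm ad x = LinearMap.trace ℝ E (ad x : E →ₗ[ℝ] E) := rfl

lemma inducedDer_lineWedge (A : E →L[ℝ] E) {k : ℕ} (τ : E →L[ℝ] ℝ) (a : AltForm E k) :
    inducedDer A (k + 1) (lineWedge τ a) = lineWedge (τ ∘L A) a + lineWedge τ (inducedDer A k a) := by
  ext v
  simp only [inducedDer_apply, coe_lineWedge, extMul, ContinuousAlternatingMap.add_apply]
  rw [Finset.sum_comm, ← Finset.sum_add_distrib]
  refine Finset.sum_congr rfl fun i _ => ?_
  rw [Fin.sum_univ_succAbove _ i]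
  have h1 : (fun j => Function.update v i (A (v i)) (i.succAbove j)) =
      fun j => v (i.succAbove j) := by
    funext j
    exact Function.update_of_ne (Fin.succAbove_ne i j) _ _
  simp only [Function.update_self, h1, ContinuousLinearMap.comp_apply]
  congr 1
  rw [Finset.mul_sum, Finset.mul_sum]
  refine Finset.sum_congr rfl fun j _ => ?_
  rw [Function.update_of_ne (Fin.succAbove_ne i j).symm, ← update_comp_succAbove]

/-- In top degree, the failure of the Leibniz rule for the Chevalley–Eilenberg differential is
measured by the trace of the adjoint representation. -/
lemma wedge_algDer {m l : ℕ} (ad : E →L[ℝ] E →L[ℝ] E) (hsk : ∀ x y, ad x y = -ad y x)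
    (a : AltForm E m) (c : AltForm E l) (e : Module.Basis (Fin (m + (l + 1))) ℝ E)
    (h : m + 1 + l = m + (l + 1)) :
    wedge a (algDer ad c) e = (-1) ^ (m + 1) *
      (wedge (algDer ad a) c (fun i => e (Fin.cast h i)) +
        wedge (lineWedge (traceForm ad) a) c (fun i => e (Fin.cast h i))) := by
  set e' : Module.Basis (Fin (m + 1 + l)) ℝ E := e.reindex (finCongr h.symm) with he'
  have hcast : (fun i => e (Fin.cast h i)) = e' := by
    funext i; simp [he']
  rw [hcast]
  -- The differential of c is Σ e^i ∧ (-½ D c) with D the derivation induced by ad e_i; each e^i is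
  -- moved across a.
  have hL : wedge a (algDer ad c) e = ∑ i, (-1) ^ m * (-(1 / 2) *
      wedge (lineWedge (coordForm e' i) a) (inducedDer (ad (e' i)) l c) e') := by
    rw [algDer, alternatizeUncurryFin_eq_sum e', ← wedgeBilin_apply, map_sum]
    refine Finset.sum_congr rfl fun i _ => ?_
    rw [wedgeBilin_apply, wedge_lineWedge_comm, hcast, ← wedgeBilin_apply, halfDer_apply, map_smul]
    rfl
  have hR : wedge (algDer ad a) c e' = ∑ i, (-(1 / 2) *
      wedge (lineWedge (coordForm e' i) (inducedDer (ad (e' i)) m a)) c e') := by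
    rw [algDer, alternatizeUncurryFin_eq_sum e', ← wedgeBilin_apply, map_sum, LinearMap.sum_apply]
    refine Finset.sum_congr rfl fun i _ => ?_
    rw [halfDer_apply, ← lineWedgeₗ_apply, map_smul, map_smul]
    rfl
  -- A derivation acts on top-degree forms as multiplication by its trace, so it can be shifted from
  -- c to e^i ∧ a.
  have htop : ∀ i, wedge (lineWedge (coordForm e' i) a) (inducedDer (ad (e' i)) l c) e' =
      traceForm ad (e' i) * wedge (lineWedge (coordForm e' i) a) c e' -
      wedge (lineWedge (coordForm e' i ∘L ad (e' i)) a) c e' -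
      wedge (lineWedge (coordForm e' i) (inducedDer (ad (e' i)) m a)) c e' := by
    intro i
    have h1 := wedge_inducedDer_trace (ad (e' i)) (lineWedge (coordForm e' i) a) c e'
    rw [inducedDer_lineWedge] at h1
    have h2 := wedge_add_left (lineWedge (coordForm e' i ∘L ad (e' i)) a)
      (lineWedge (coordForm e' i) (inducedDer (ad (e' i)) m a)) c e'
    have h3 : wedge (lineWedge (coordForm e' i ∘L ad (e' i)) a +
      lineWedge (coordForm e' i) (inducedDer (ad (e' i)) m a)) c e' =
      wedge ((lineWedge (coordForm e' i ∘L ad (e' i)) a : (Fin (m + 1) → E) → ℝ) +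
      (lineWedge (coordForm e' i) (inducedDer (ad (e' i)) m a) : (Fin (m + 1) → E) → ℝ)) c e' := rfl
    rw [h3, h2, ← traceForm_apply] at h1
    linarith
  have hlin : ∀ f : Fin (m + 1 + l) → E →L[ℝ] ℝ, ∑ i, wedge (lineWedge (f i) a) c e' =
      wedge (lineWedge (∑ i, f i) a) c e' := by
    intro f
    rw [← lineWedgeₗ_apply, map_sum, LinearMap.sum_apply, ← wedgeBilin_apply, map_sum,
      LinearMap.sum_apply]
    rfl
  have hs1 : ∑ i, traceForm ad (e' i) * wedge (lineWedge (coordForm e' i) a) c e' =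
      wedge (lineWedge (traceForm ad) a) c e' := by
    have : ∀ i, traceForm ad (e' i) * wedge (lineWedge (coordForm e' i) a) c e' =
        wedge (lineWedge (traceForm ad (e' i) • coordForm e' i) a) c e' := by
      intro i
      rw [← lineWedgeₗ_apply, ← lineWedgeₗ_apply, map_smul, LinearMap.smul_apply,
        ← wedgeBilin_apply, ← wedgeBilin_apply, map_smul]
      rfl
    rw [Finset.sum_congr rfl fun i _ => this i, hlin]
    congr 3
    ext x
    conv_rhs => rw [← e'.sum_repr x, map_sum]
    simp [coordForm, mul_comm]
  -- By skewness Σ e^i([e_i, x]) = -tr(ad x). The trace therefore enters twice, once from each of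
  -- `hs1` and `hs2`, and the factor ½ makes it one.
  have hs2 : ∑ i, wedge (lineWedge (coordForm e' i ∘L ad (e' i)) a) c e' =
      -wedge (lineWedge (traceForm ad) a) c e' := by
    rw [hlin]
    have : ∑ i, coordForm e' i ∘L ad (e' i) = -traceForm ad := by
      ext x
      rw [neg_apply, traceForm_apply, LinearMap.trace_eq_matrix_trace ℝ e',
        Matrix.trace]
      simp only [sum_apply, ContinuousLinearMap.comp_apply, Matrix.diag_apply,
        LinearMap.toMatrix_apply, ← Finset.sum_neg_distrib]
      refine Finset.sum_congr rfl fun i _ => ?_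
      rw [hsk]
      simp [coordForm]
    rw [this, ← lineWedgeₗ_apply, ← lineWedgeₗ_apply, map_neg, LinearMap.neg_apply,
      ← wedgeBilin_apply, ← wedgeBilin_apply, map_neg]
    rfl
  rw [hL, hR]
  simp only [htop]
  rw [← Finset.mul_sum, ← Finset.mul_sum, ← Finset.mul_sum, Finset.sum_sub_distrib,
    Finset.sum_sub_distrib, hs1, hs2]
  ring

end ChevalleyEilenberg

/-! ### Non-degeneracy of the wedge pairing. -/

section Nondegenerate

variable {E : Type*} [NormedAddCommGroup E] [NormedSpace ℝ E] [FiniteDimensional ℝ E]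

lemma wedge_const_right {m : ℕ} (χ : AltForm E m) (v : Fin (m + 0) → E) :
    wedge χ (fun _ : Fin 0 → E => (1 : ℝ)) v = χ v := by
  rw [wedge_eq_altSum, altSum]
  have : ∀ σ : Equiv.Perm (Fin (m + 0)), ((Equiv.Perm.sign σ : ℤ) : ℝ) *
      (χ (fun i => (v ∘ σ) (Fin.castAdd 0 i)) * 1) = χ v := by
    intro σ
    have h := χ.toAlternatingMap.map_perm v σ
    have h' : χ (v ∘ σ) = ((Equiv.Perm.sign σ : ℤ) : ℝ) * χ v := by
      simpa [Units.smul_def] using h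
    change _ * (χ (v ∘ σ) * 1) = _
    rw [h', mul_one, ← mul_assoc, ← Int.cast_mul, ← Units.val_mul, Int.units_mul_self]
    simp
  rw [Finset.sum_congr rfl fun σ _ => this σ]
  have h2 : (m.factorial : ℝ) ≠ 0 := by positivity
  simp only [Finset.sum_const, Finset.card_univ, Fintype.card_perm, Fintype.card_fin,
    nsmul_eq_mul, Nat.factorial_zero, Nat.cast_one, mul_one, add_zero]
  field_simp

/-- Fewer vectors than the dimension lie in the kernel of some nonzero linear form f. Evaluating f ∧
χ on these vectors together with a u outside the kernel gives f(u) times the value of χ. -/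
lemma eq_zero_of_lineWedge_eq_zero {m : ℕ} (hm : m < Module.finrank ℝ E) (χ : AltForm E m)
    (h : ∀ τ : E →L[ℝ] ℝ, lineWedge τ χ = 0) : χ = 0 := by
  ext v
  have hlt : Submodule.span ℝ (Set.range v) < ⊤ := by
    refine lt_top_iff_ne_top.2 fun htop => ?_
    have := finrank_range_le_card (R := ℝ) v
    rw [Set.finrank, htop, finrank_top, Fintype.card_fin] at this
    omega
  obtain ⟨f, hf, hle⟩ := Submodule.exists_le_ker_of_lt_top _ hlt
  obtain ⟨u, hu⟩ : ∃ u, f u ≠ 0 := by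
    by_contra! hcon
    exact hf (LinearMap.ext hcon)
  have h1 : lineWedge (LinearMap.toContinuousLinearMap f) χ (Fin.cons u v) = 0 := by
    rw [h]; rfl
  simp only [coe_lineWedge, extMul, Fin.sum_univ_succ] at h1
  have hv : ∀ i, f (v i) = 0 := fun i => hle (Submodule.subset_span ⟨i, rfl⟩)
  simp [hv, hu] at h1
  simpa using h1

/-- The wedge pairing of complementary degrees is non-degenerate. -/
lemma eq_zero_of_wedge_eq_zero {m l : ℕ} (e : Module.Basis (Fin (m + l)) ℝ E) (χ : AltForm E m)
    (h : ∀ c : AltForm E l, wedge χ c e = 0) : χ = 0 := by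
  -- Induction on the complementary degree. It is enough to test on products τ ∧ c: moving τ across
  -- shows that every τ ∧ χ pairs to zero with all c, hence vanishes by induction.
  induction l generalizing m with
  | zero =>
    have h1 := h (ContinuousAlternatingMap.constOfIsEmpty ℝ E (Fin 0) 1)
    have h2 : wedge χ (fun _ : Fin 0 → E => (1 : ℝ)) e = 0 := h1
    rw [wedge_const_right] at h2
    have h3 := χ.toAlternatingMap.eq_smul_basis_det e
    have h4 : χ.toAlternatingMap e = 0 := h2
    rw [h4, zero_smul] at h3
    ext v
    exact congrArg (fun f : E [⋀^Fin m]→ₗ[ℝ] ℝ => f v) h3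
  | succ l ih =>
    have hN : m + 1 + l = m + (l + 1) := by omega
    refine eq_zero_of_lineWedge_eq_zero ?_ χ fun τ => ?_
    · rw [Module.finrank_eq_card_basis e, Fintype.card_fin]; omega
    · refine ih (e.reindex (finCongr hN.symm)) _ fun c => ?_
      have h1 := h (lineWedge τ c)
      rw [wedge_lineWedge_comm] at h1
      have h2 : (⇑(e.reindex (finCongr hN.symm)) : Fin (m + 1 + l) → E) =
          fun i => e (Fin.cast hN i) := by
        funext i; simp
      rw [h2]
      exact (mul_eq_zero.1 h1).resolve_left (by simp)

lemma altForm_eq_zero_of_finrank_lt {k : ℕ} (hk : Module.finrank ℝ E < k) (χ : AltForm E k) :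
    χ = 0 := by
  ext v
  refine χ.map_linearDependent v fun hli => ?_
  have := hli.fintype_card_le_finrank
  rw [Fintype.card_fin] at this
  omega

end Nondegenerate

/-! ### Smooth dependence of partial derivatives on parameters in a manifold. -/

section Parametric

variable {E : Type*} [NormedAddCommGroup E] [NormedSpace ℝ E]
  {M : Type*} [TopologicalSpace M] {I : ModelWithCorners ℝ E M} [I.Boundaryless]
  {G : Type*} [TopologicalSpace G] [ChartedSpace M G] [IsManifold I ∞ G]
  {F : Type*} [NormedAddCommGroup F] [NormedSpace ℝ F]
  {V : Type*} [NormedAddCommGroup V] [NormedSpace ℝ V]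

lemma contDiffAt_of_contMDiffAt_prod {W : Type*} [NormedAddCommGroup W] [NormedSpace ℝ W]
    {f : V × W → F} {x : V × W} (h : ContMDiffAt (𝓘(ℝ, V).prod 𝓘(ℝ, W)) 𝓘(ℝ, F) ∞ f x) :
    ContDiffAt ℝ ∞ f x := by
  rw [← contMDiffAt_iff_contDiffAt, modelWithCornersSelf_prod, ← chartedSpaceSelf_prod]
  exact h

lemma contMDiffAt_extChartAt_symm_of_boundaryless {g : G} {z : E}
    (hz : z ∈ (extChartAt I g).target) :
    ContMDiffAt 𝓘(ℝ, E) I ∞ (extChartAt I g).symm z :=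
  (contMDiffOn_extChartAt_symm (n := ∞) g).contMDiffAt (extChartAt_target_mem_nhds' hz)

/-- Partial derivatives of a smooth function depend smoothly on all the variables. -/
lemma ContMDiffAt.fderiv_fst {Φ : V × G → F} {v : V} {g : G}
    (h : ContMDiffAt (𝓘(ℝ, V).prod I) 𝓘(ℝ, F) ∞ Φ (v, g)) :
    ContMDiffAt (𝓘(ℝ, V).prod I) 𝓘(ℝ, V →L[ℝ] F) ∞
      (fun x : V × G => fderiv ℝ (fun w => Φ (w, x.2)) x.1) (v, g) := by
  -- In a chart around g the parameter ranges over a vector space, where partial derivatives of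
  -- smooth functions are known to be smooth.
  set c := extChartAt I g with hc
  have hsymm : c.symm (c g) = g := extChartAt_to_inv g
  have h1 : ContMDiffAt (𝓘(ℝ, V).prod 𝓘(ℝ, E)) 𝓘(ℝ, F) ∞
      (fun x : V × E => Φ (x.1, c.symm x.2)) (v, c g) := by
    have h2 : ContMDiffAt (𝓘(ℝ, V).prod 𝓘(ℝ, E)) (𝓘(ℝ, V).prod I) ∞
        (fun x : V × E => (x.1, c.symm x.2)) (v, c g) := by
      refine contMDiffAt_fst.prodMk ?_
      exact (contMDiffAt_extChartAt_symm_of_boundaryless (mem_extChartAt_target g)).comp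
        (v, c g) contMDiffAt_snd
    refine ContMDiffAt.comp (v, c g) ?_ h2
    simpa only [hsymm] using h
  have h3 : ContDiffAt ℝ ∞ (fun x : V × E => Φ (x.1, c.symm x.2)) (v, c g) :=
    contDiffAt_of_contMDiffAt_prod h1
  have h4 : ContDiffAt ℝ ∞ (fun x : V × E => fderiv ℝ (fun w => Φ (w, c.symm x.2)) x.1)
      (v, c g) := by
    refine ContDiffAt.fderiv (𝕜 := ℝ) (n := ∞) (f := fun (x : V × E) (w : V) => Φ (w, c.symm x.2))
      (g := fun x => x.1) ?_ contDiffAt_fst (by simp)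
    exact ContDiffAt.comp ((v, c g), v) (g := fun x : V × E => Φ (x.1, c.symm x.2))
      (f := fun x : (V × E) × V => (x.2, x.1.2)) h3
      (contDiffAt_snd.prodMk (contDiffAt_snd.comp _ contDiffAt_fst))
  have h5 : ContMDiffAt (𝓘(ℝ, V).prod 𝓘(ℝ, E)) 𝓘(ℝ, V →L[ℝ] F) ∞
      (fun x : V × E => fderiv ℝ (fun w => Φ (w, c.symm x.2)) x.1) (v, c g) := by
    rw [← contMDiffAt_iff_contDiffAt, modelWithCornersSelf_prod, ← chartedSpaceSelf_prod] at h4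
    exact h4
  have h6 : ContMDiffAt (𝓘(ℝ, V).prod I) (𝓘(ℝ, V).prod 𝓘(ℝ, E)) ∞
      (fun x : V × G => (x.1, c x.2)) (v, g) :=
    contMDiffAt_fst.prodMk ((contMDiffAt_extChartAt (n := ∞)).comp (v, g) contMDiffAt_snd)
  refine (h5.comp (v, g) h6).congr_of_eventuallyEq ?_
  have h7 : ∀ᶠ x : V × G in 𝓝 (v, g), x.2 ∈ c.source :=
    continuousAt_snd.eventually (extChartAt_source_mem_nhds g)
  filter_upwards [h7] with x hx
  simp only [Function.comp_apply, c.left_inv hx]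

end Parametric

/-! ### The left-invariant frame and the Lie bracket in the chart at the identity. -/

section LieChart

variable {E : Type*} [NormedAddCommGroup E] [NormedSpace ℝ E]
  {M : Type*} [TopologicalSpace M] (I : ModelWithCorners ℝ E M) [I.Boundaryless]
  (G : Type*) [TopologicalSpace G] [ChartedSpace M G] [Group G]
  {F : Type*} [NormedAddCommGroup F] [NormedSpace ℝ F]

/-- The coordinates of the identity. -/
def oneCoord : E := extChartAt I (1 : G) 1

/-- The inverse of the chart at the identity. -/
def oneParam : E → G := (extChartAt I (1 : G)).symm

/-- The multiplication in the chart at the identity. -/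
def chartMul (x : E × E) : E := extChartAt I (1 : G) (oneParam I G x.1 * oneParam I G x.2)

/-- The matrix of the left-invariant vector fields in the chart at the identity. -/
def leftFrame (z : E) : E →L[ℝ] E := fderiv ℝ (fun w => chartMul I G (z, w)) (oneCoord I G)

@[simp] lemma oneParam_oneCoord : oneParam I G (oneCoord I G) = 1 := extChartAt_to_inv (1 : G)

lemma oneCoord_mem_target : oneCoord I G ∈ (extChartAt I (1 : G)).target :=
  mem_extChartAt_target (1 : G)

lemma target_mem_nhds_oneCoord : (extChartAt I (1 : G)).target ∈ 𝓝 (oneCoord I G) :=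
  extChartAt_target_mem_nhds (1 : G)

variable {I G}

lemma mfderiv_one_eq {f : G → F} (hf : MDifferentiableAt I 𝓘(ℝ, F) f 1) (x : E) :
    mfderiv I 𝓘(ℝ, F) f 1 x = fderiv ℝ (fun z => f (oneParam I G z)) (oneCoord I G) x := by
  rw [hf.mfderiv]
  have : range I = univ := I.range_eq_univ
  rw [this, fderivWithin_univ]
  rfl

variable [LieGroup I ∞ G]

lemma contMDiffAt_oneParam {z : E} (hz : z ∈ (extChartAt I (1 : G)).target) :
    ContMDiffAt 𝓘(ℝ, E) I ∞ (oneParam I G) z :=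
  contMDiffAt_extChartAt_symm_of_boundaryless hz

lemma contMDiffAt_oneParam_oneCoord : ContMDiffAt 𝓘(ℝ, E) I ∞ (oneParam I G) (oneCoord I G) :=
  contMDiffAt_oneParam (oneCoord_mem_target I G)

lemma contMDiffAt_mul_left' (g h : G) : ContMDiffAt I I ∞ (fun a => g * a) h :=
  (contMDiff_mul_left (I := I) (n := ∞) (a := g)).contMDiffAt

lemma leftDeriv_eq_mfderiv {f : G → F} {g : G} (hf : MDifferentiableAt I 𝓘(ℝ, F) f g) (x : E) :
    leftDeriv I f x g = mfderiv I 𝓘(ℝ, F) (fun h => f (g * h)) 1 x := by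
  have h1 : MDifferentiableAt I I (fun a : G => g * a) 1 :=
    (contMDiffAt_mul_left' g 1).mdifferentiableAt (by simp)
  have h2 : MDifferentiableAt I 𝓘(ℝ, F) f (g * 1) := by rwa [mul_one]
  have := mfderiv_comp (1 : G) h2 h1
  change _ = mfderiv I 𝓘(ℝ, F) (f ∘ (fun a => g * a)) 1 x
  rw [this, mul_one]
  rfl

lemma leftDeriv_eq_fderiv {f : G → F} {g : G} (hf : MDifferentiableAt I 𝓘(ℝ, F) f g) (x : E) :
    leftDeriv I f x g =
      fderiv ℝ (fun z => f (g * oneParam I G z)) (oneCoord I G) x := by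
  rw [leftDeriv_eq_mfderiv hf, mfderiv_one_eq]
  have h1 : MDifferentiableAt I I (fun a : G => g * a) 1 :=
    (contMDiffAt_mul_left' g 1).mdifferentiableAt (by simp)
  have h2 : MDifferentiableAt I 𝓘(ℝ, F) f (g * 1) := by rwa [mul_one]
  exact h2.comp 1 h1

lemma differentiableAt_mul_oneParam {f : G → F} {g : G} (hf : MDifferentiableAt I 𝓘(ℝ, F) f g) :
    DifferentiableAt ℝ (fun z => f (g * oneParam I G z)) (oneCoord I G) := by
  rw [← mdifferentiableAt_iff_differentiableAt]
  have h1 : MDifferentiableAt I I (fun a : G => g * a) (oneParam I G (oneCoord I G)) :=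
    (contMDiffAt_mul_left' g _).mdifferentiableAt (by simp)
  have h2 : MDifferentiableAt I 𝓘(ℝ, F) f (g * oneParam I G (oneCoord I G)) := by
    rwa [oneParam_oneCoord, mul_one]
  exact (h2.comp _ h1).comp _ (contMDiffAt_oneParam_oneCoord.mdifferentiableAt (by simp))

lemma contDiffAt_chartMul {z w : E} (hz : z ∈ (extChartAt I (1 : G)).target)
    (hw : w ∈ (extChartAt I (1 : G)).target)
    (h : oneParam I G z * oneParam I G w ∈ (extChartAt I (1 : G)).source) :
    ContDiffAt ℝ ∞ (chartMul I G) (z, w) := by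
  apply contDiffAt_of_contMDiffAt_prod
  have h1 : ContMDiffAt (𝓘(ℝ, E).prod 𝓘(ℝ, E)) I ∞
      (fun x : E × E => oneParam I G x.1 * oneParam I G x.2) (z, w) :=
    ((contMDiffAt_oneParam hz).comp (z, w) contMDiffAt_fst).mul
      ((contMDiffAt_oneParam hw).comp (z, w) contMDiffAt_snd)
  exact ContMDiffAt.comp (z, w) (contMDiffAt_extChartAt' (by simpa using h)) h1

lemma contDiffAt_chartMul_oneCoord {z : E} (hz : z ∈ (extChartAt I (1 : G)).target) :
    ContDiffAt ℝ ∞ (chartMul I G) (z, oneCoord I G) := by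
  refine contDiffAt_chartMul hz (oneCoord_mem_target I G) ?_
  rw [oneParam_oneCoord, mul_one]
  exact (extChartAt I (1 : G)).map_target hz

lemma chartMul_oneCoord_left {z : E} (hz : z ∈ (extChartAt I (1 : G)).target) :
    chartMul I G (oneCoord I G, z) = z := by
  simp only [chartMul, oneParam_oneCoord, one_mul]
  exact (extChartAt I (1 : G)).right_inv hz

lemma contDiffAt_leftFrame {z : E} (hz : z ∈ (extChartAt I (1 : G)).target) :
    ContDiffAt ℝ ∞ (leftFrame I G) z := by
  refine ContDiffAt.fderiv (𝕜 := ℝ) (n := ∞) (f := fun (x : E) (w : E) => chartMul I G (x, w))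
      (g := fun _ => oneCoord I G) ?_ contDiffAt_const (by simp)
  exact contDiffAt_chartMul_oneCoord hz

lemma leftFrame_oneCoord : leftFrame I G (oneCoord I G) = ContinuousLinearMap.id ℝ E := by
  have h : (fun w => chartMul I G (oneCoord I G, w)) =ᶠ[𝓝 (oneCoord I G)] id := by
    filter_upwards [target_mem_nhds_oneCoord I G] with z hz using chartMul_oneCoord_left hz
  rw [leftFrame, h.fderiv_eq, fderiv_id]

open VectorField in
/-- The left-invariant vector fields in the chart at the identity. -/
lemma mpullbackWithin_mulInvariantVectorField (x : E) {z : E}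
    (hz : z ∈ (extChartAt I (1 : G)).target) :
    mpullbackWithin 𝓘(ℝ, E) I (extChartAt I (1 : G)).symm
      (mulInvariantVectorField (I := I) (G := G) x) (range I) z = leftFrame I G z x := by
  have : IsManifold I 1 G := IsManifold.of_le (n := ∞) (by simp)
  have hinv : (mfderivWithin 𝓘(ℝ, E) I (extChartAt I (1 : G)).symm (range I) z).inverse =
      mfderiv I 𝓘(ℝ, E) (extChartAt I (1 : G)) ((extChartAt I (1 : G)).symm z) := by
    refine ContinuousLinearMap.inverse_eq ?_ ?_
    · exact mfderivWithin_extChartAt_symm_comp_mfderiv_extChartAt hz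
    · exact mfderiv_extChartAt_comp_mfderivWithin_extChartAt_symm hz
  have hsrc : (extChartAt I (1 : G)).symm z ∈ (extChartAt I (1 : G)).source :=
    (extChartAt I (1 : G)).map_target hz
  have h1 : MDifferentiableAt I I (fun a : G => oneParam I G z * a) 1 :=
    (contMDiffAt_mul_left' _ 1).mdifferentiableAt (by simp)
  have h2 : MDifferentiableAt I 𝓘(ℝ, E) (extChartAt I (1 : G)) (oneParam I G z * 1) := by
    rw [mul_one]
    exact (contMDiffAt_extChartAt' (n := ∞)
      (by rw [extChartAt_source] at hsrc; exact hsrc)).mdifferentiableAt (by simp)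
  have h3 := mfderiv_comp (1 : G) h2 h1
  have h4 := mfderiv_one_eq (h2.comp (1 : G) h1) x
  rw [h3] at h4
  change (mfderivWithin 𝓘(ℝ, E) I (extChartAt I (1 : G)).symm (range I) z).inverse
    (mulInvariantVectorField (I := I) (G := G) x ((extChartAt I (1 : G)).symm z)) = _
  rw [hinv]
  rw [mul_one] at h4
  exact h4

-- The frame is the identity at the identity element, so in the chart the bracket of two
-- left-invariant fields is the antisymmetrized derivative of the frame.
open VectorField in
lemma algBracket_eq (x y : E) : algBracket I G x y =
    fderiv ℝ (leftFrame I G) (oneCoord I G) x y - fderiv ℝ (leftFrame I G) (oneCoord I G) y x := by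
  have : IsManifold I 1 G := IsManifold.of_le (n := ∞) (by simp)
  set L : E →L[ℝ] E := mfderiv I 𝓘(ℝ, E) (extChartAt I (1 : G)) 1 with hL
  have hφ : L = ContinuousLinearMap.id ℝ E := mfderiv_extChartAt_self
  set W : E → E → E := fun x => mpullbackWithin 𝓘(ℝ, E) I (extChartAt I (1 : G)).symm
      (mulInvariantVectorField (I := I) (G := G) x) (range I) with hW
  have hd : DifferentiableAt ℝ (leftFrame I G) (oneCoord I G) :=
    (contDiffAt_leftFrame (oneCoord_mem_target I G)).differentiableAt (by simp)
  have hV : ∀ x : E, W x =ᶠ[𝓝 (oneCoord I G)] fun z => leftFrame I G z x := by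
    intro x
    filter_upwards [target_mem_nhds_oneCoord I G] with z hz
      using mpullbackWithin_mulInvariantVectorField x hz
  have hder : ∀ x : E, fderiv ℝ (fun z => leftFrame I G z x) (oneCoord I G) =
      (fderiv ℝ (leftFrame I G) (oneCoord I G)).flip x := by
    intro x
    rw [fderiv_clm_apply hd (differentiableAt_const x)]
    ext y
    simp
  have key : lieBracket ℝ (W x) (W y) (oneCoord I G) =
    fderiv ℝ (leftFrame I G) (oneCoord I G) x y - fderiv ℝ (leftFrame I G) (oneCoord I G) y x := by
    rw [Filter.EventuallyEq.lieBracket_vectorField_eq (hV x) (hV y)]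
    simp only [lieBracket, hder, leftFrame_oneCoord]
    simp
  have hb : algBracket I G x y = L.inverse (lieBracketWithin ℝ (W x) (W y)
      ((extChartAt I (1 : G)).symm ⁻¹' univ ∩ range I) (oneCoord I G)) := rfl
  have hset : ((extChartAt I (1 : G)).symm ⁻¹' univ ∩ range I) = univ := by
    rw [I.range_eq_univ]; simp
  rw [hb, hφ, hset, lieBracketWithin_univ, key, ContinuousLinearMap.inverse_id]
  rfl

variable (I G) in
/-- The adjoint representation of the Lie algebra. -/
def adL : E →L[ℝ] E →L[ℝ] E :=
  fderiv ℝ (leftFrame I G) (oneCoord I G) - (fderiv ℝ (leftFrame I G) (oneCoord I G)).flip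

lemma adL_apply (x y : E) : adL I G x y = algBracket I G x y := by
  rw [algBracket_eq]; rfl

lemma adL_skew (x y : E) : adL I G x y = -adL I G y x := by
  simp [adL]

end LieChart

/-! ### Left-invariant derivatives and the adjoint action. -/

section LieCalculus

variable {E : Type*} [NormedAddCommGroup E] [NormedSpace ℝ E]
  {M : Type*} [TopologicalSpace M] {I : ModelWithCorners ℝ E M} [I.Boundaryless]
  {G : Type*} [TopologicalSpace G] [ChartedSpace M G] [Group G] [LieGroup I ∞ G]
  {F : Type*} [NormedAddCommGroup F] [NormedSpace ℝ F]

variable (I) in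
/-- The left-invariant derivatives of a function, as a linear map of the direction. -/
def leftDerivL (f : G → F) (g : G) : E →L[ℝ] F :=
  fderiv ℝ (fun z => f (g * oneParam I G z)) (oneCoord I G)

lemma leftDeriv_eq_leftDerivL {f : G → F} {g : G} (hf : MDifferentiableAt I 𝓘(ℝ, F) f g) (x : E) :
    leftDeriv I f x g = leftDerivL I f g x := leftDeriv_eq_fderiv hf x

lemma leftDerivL_smul {f : G → ℝ} {φ : G → F} {g : G} (hf : MDifferentiableAt I 𝓘(ℝ, ℝ) f g)
    (hφ : MDifferentiableAt I 𝓘(ℝ, F) φ g) :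
    leftDerivL I (fun h => f h • φ h) g =
      f g • leftDerivL I φ g + (leftDerivL I f g).smulRight (φ g) := by
  have := fderiv_fun_smul (differentiableAt_mul_oneParam hf) (differentiableAt_mul_oneParam hφ)
  simpa [leftDerivL] using this

lemma leftDerivL_clm_comp {F' : Type*} [NormedAddCommGroup F'] [NormedSpace ℝ F'] {f : G → F}
    {g : G} (hf : MDifferentiableAt I 𝓘(ℝ, F) f g) (A : F →L[ℝ] F') :
    leftDerivL I (fun h => A (f h)) g = A ∘L leftDerivL I f g :=
  (A.hasFDerivAt.comp _ (differentiableAt_mul_oneParam hf).hasFDerivAt).fderiv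

lemma contMDiffAt_mul_oneParam {f : G → F} (hf : ContMDiff I 𝓘(ℝ, F) ∞ f) {z : E}
    (hz : z ∈ (extChartAt I (1 : G)).target) (g : G) :
    ContMDiffAt (𝓘(ℝ, E).prod I) 𝓘(ℝ, F) ∞
      (fun x : E × G => f (x.2 * oneParam I G x.1)) (z, g) :=
  ContMDiffAt.comp (z, g) hf.contMDiffAt
    (contMDiffAt_snd.mul ((contMDiffAt_oneParam hz).comp (z, g) contMDiffAt_fst))

lemma contMDiffAt_oneParam_mul {f : G → F} (hf : ContMDiff I 𝓘(ℝ, F) ∞ f) {z : E}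
    (hz : z ∈ (extChartAt I (1 : G)).target) (g : G) :
    ContMDiffAt (𝓘(ℝ, E).prod I) 𝓘(ℝ, F) ∞
      (fun x : E × G => f (oneParam I G x.1 * x.2)) (z, g) :=
  ContMDiffAt.comp (z, g) hf.contMDiffAt
    (((contMDiffAt_oneParam hz).comp (z, g) contMDiffAt_fst).mul contMDiffAt_snd)

lemma contMDiff_leftDerivL {f : G → F} (hf : ContMDiff I 𝓘(ℝ, F) ∞ f) :
    ContMDiff I 𝓘(ℝ, E →L[ℝ] F) ∞ (leftDerivL I f) := by
  intro g
  have h := (contMDiffAt_mul_oneParam hf (oneCoord_mem_target I G) g).fderiv_fst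
  exact h.comp g (contMDiffAt_const.prodMk contMDiffAt_id)

variable (I) in
/-- The right-invariant vector fields in the left trivialization: the adjoint action of `h⁻¹`. -/
def conjFrame (h : G) : E →L[ℝ] E :=
  fderiv ℝ (fun z => extChartAt I (1 : G) (h⁻¹ * oneParam I G z * h)) (oneCoord I G)

lemma contMDiffAt_conj (h : G) : ContMDiffAt (𝓘(ℝ, E).prod I) 𝓘(ℝ, E) ∞
    (fun x : E × G => extChartAt I (1 : G) (x.2⁻¹ * oneParam I G x.1 * x.2))
    (oneCoord I G, h) := by
  have h1 : ContMDiffAt (𝓘(ℝ, E).prod I) I ∞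
      (fun x : E × G => x.2⁻¹ * oneParam I G x.1 * x.2) (oneCoord I G, h) :=
    (contMDiffAt_snd.inv.mul (contMDiffAt_oneParam_oneCoord.comp (oneCoord I G, h)
      contMDiffAt_fst)).mul contMDiffAt_snd
  refine ContMDiffAt.comp (oneCoord I G, h) (contMDiffAt_extChartAt' ?_) h1
  simp

lemma contMDiff_conjFrame : ContMDiff I 𝓘(ℝ, E →L[ℝ] E) ∞ (conjFrame I : G → E →L[ℝ] E) := by
  intro h
  exact (contMDiffAt_conj h).fderiv_fst.comp h (contMDiffAt_const.prodMk contMDiffAt_id)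

lemma differentiableAt_conj (h : G) : DifferentiableAt ℝ
    (fun z => extChartAt I (1 : G) (h⁻¹ * oneParam I G z * h)) (oneCoord I G) := by
  rw [← mdifferentiableAt_iff_differentiableAt]
  have h1 := (contMDiffAt_conj (I := I) h).mdifferentiableAt (by simp)
  exact MDifferentiableAt.comp (I' := 𝓘(ℝ, E).prod I) (oneCoord I G)
    (f := fun z : E => (z, h)) h1
    (mdifferentiableAt_id.prodMk mdifferentiableAt_const)

lemma conjFrame_one : conjFrame I (1 : G) = ContinuousLinearMap.id ℝ E := by
  have h : (fun z => extChartAt I (1 : G) ((1 : G)⁻¹ * oneParam I G z * 1))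
      =ᶠ[𝓝 (oneCoord I G)] id := by
    filter_upwards [target_mem_nhds_oneCoord I G] with z hz
    simp only [inv_one, one_mul, mul_one]
    exact (extChartAt I (1 : G)).right_inv hz
  rw [conjFrame, h.fderiv_eq, fderiv_id]

/-- The derivative along a right-invariant vector field. -/
lemma fderiv_oneParam_mul {f : G → F} {h : G} (hf : MDifferentiableAt I 𝓘(ℝ, F) f h) :
    fderiv ℝ (fun z => f (oneParam I G z * h)) (oneCoord I G) =
      leftDerivL I f h ∘L conjFrame I h := by
  -- Multiplying h on the left by κ(z) is the same as multiplying it on the right by h⁻¹κ(z)h, where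
  -- κ is the inverse chart; n gives the coordinates of this conjugate.
  set n : E → E := fun z => extChartAt I (1 : G) (h⁻¹ * oneParam I G z * h) with hn
  have hn0 : n (oneCoord I G) = oneCoord I G := by
    simp only [hn, oneParam_oneCoord, mul_one, inv_mul_cancel]; rfl
  have hcont : ContinuousAt (fun z => h⁻¹ * oneParam I G z * h) (oneCoord I G) := by
    have : IsTopologicalGroup G := topologicalGroup_of_lieGroup I ∞
    exact (continuousAt_const.mul contMDiffAt_oneParam_oneCoord.continuousAt).mul continuousAt_const
  have hev : (fun z => f (oneParam I G z * h)) =ᶠ[𝓝 (oneCoord I G)]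
      (fun w => f (h * oneParam I G w)) ∘ n := by
    have hs : (extChartAt I (1 : G)).source ∈ 𝓝 (h⁻¹ * oneParam I G (oneCoord I G) * h) := by
      simpa using extChartAt_source_mem_nhds (I := I) (1 : G)
    filter_upwards [hcont.preimage_mem_nhds hs] with z hz
    have := (extChartAt I (1 : G)).left_inv hz
    simp only [Function.comp_apply, hn, oneParam] at this ⊢
    rw [this]
    congr 1
    group
  rw [hev.fderiv_eq, fderiv_comp]
  · rw [hn0]; rfl
  · rw [hn0]; exact differentiableAt_mul_oneParam hf
  · exact differentiableAt_conj h

/-- The derivative of the adjoint action at the identity is the bracket. -/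
lemma leftDerivL_conjFrame_one (x y : E) :
    leftDerivL I (conjFrame I : G → E →L[ℝ] E) 1 y x = adL I G x y := by
  set o := oneCoord I G with ho
  have hot := oneCoord_mem_target I G
  have hm : ContDiffAt ℝ ∞ (chartMul I G) (o, o) := contDiffAt_chartMul_oneCoord hot
  have hm1 : ∀ᶠ p in 𝓝 (o, o), DifferentiableAt ℝ (chartMul I G) p := by
    filter_upwards [(hm.of_le (m := 1) (by simp)).eventually (by simp)] with p hp
      using hp.differentiableAt (by simp)
  have hmd : DifferentiableAt ℝ (fderiv ℝ (chartMul I G)) (o, o) :=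
    (hm.fderiv_right (m := ∞) (by simp)).differentiableAt (by simp)
  have hsym := ((hm.of_le (m := 2) ENat.LEInfty.out).isSymmSndFDerivAt (by simp)) (x, 0) (0, y)
  -- the two mixed partial derivatives
  have hA : fderiv ℝ (leftFrame I G) o x y = fderiv ℝ (fderiv ℝ (chartMul I G)) (o, o) (x, 0) (0, y) := by
    have he : (leftFrame I G) =ᶠ[𝓝 o] fun z =>
        (fderiv ℝ (chartMul I G) (z, o)) ∘L (ContinuousLinearMap.inr ℝ E E) := by
      have hc : ContinuousAt (fun z : E => (z, o)) o := by fun_prop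
      filter_upwards [hc.eventually hm1] with z hz
      rw [leftFrame]
      exact (hz.hasFDerivAt.comp o (hasFDerivAt_prodMk_right z o)).fderiv
    have h2 : HasFDerivAt (fun z => fderiv ℝ (chartMul I G) (z, o))
        (fderiv ℝ (fderiv ℝ (chartMul I G)) (o, o) ∘L ContinuousLinearMap.inl ℝ E E) o :=
      HasFDerivAt.comp (f := fun z => (z, o)) o hmd.hasFDerivAt (hasFDerivAt_prodMk_left o o)
    have h3 := (h2.clm_comp (hasFDerivAt_const (ContinuousLinearMap.inr ℝ E E) o)).fderiv
    rw [he.fderiv_eq, h3]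
    simp
  -- R is the frame of the right-invariant fields. Its derivative is the mixed second derivative of
  -- the multiplication taken in the other order, equal to that of the left frame by symmetry.
  set R : E → E →L[ℝ] E := fun w => fderiv ℝ (fun z => chartMul I G (z, w)) o with hR
  have hB : HasFDerivAt R ((ContinuousLinearMap.compL ℝ E (E × E) E).flip
      (ContinuousLinearMap.inl ℝ E E) ∘L
      (fderiv ℝ (fderiv ℝ (chartMul I G)) (o, o) ∘L ContinuousLinearMap.inr ℝ E E)) o := by
    have he : R =ᶠ[𝓝 o] fun w =>
        (fderiv ℝ (chartMul I G) (o, w)) ∘L (ContinuousLinearMap.inl ℝ E E) := by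
      have hc : ContinuousAt (fun w : E => (o, w)) o := by fun_prop
      filter_upwards [hc.eventually hm1] with w hw
      exact (HasFDerivAt.comp (f := fun z => (z, w)) o hw.hasFDerivAt
        (hasFDerivAt_prodMk_left o w)).fderiv
    have h2 : HasFDerivAt (fun w => fderiv ℝ (chartMul I G) (o, w))
        (fderiv ℝ (fderiv ℝ (chartMul I G)) (o, o) ∘L ContinuousLinearMap.inr ℝ E E) o :=
      HasFDerivAt.comp (f := fun z => (o, z)) o hmd.hasFDerivAt (hasFDerivAt_prodMk_right o o)
    refine HasFDerivAt.congr_of_eventuallyEq ?_ he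
    exact ((ContinuousLinearMap.compL ℝ E (E × E) E).flip
      (ContinuousLinearMap.inl ℝ E E)).hasFDerivAt.comp o h2
  -- The right frame is the left frame composed with the adjoint action of the inverse.
  -- Differentiating this product at the identity yields the derivative of the adjoint action as a
  -- difference of derivatives of the two frames.
  have hC : R =ᶠ[𝓝 o] fun w => leftFrame I G w ∘L conjFrame I (oneParam I G w) := by
    filter_upwards [target_mem_nhds_oneCoord I G] with w hw
    have hs : oneParam I G w ∈ (extChartAt I (1 : G)).source := (extChartAt I (1 : G)).map_target hw
    have := fderiv_oneParam_mul (I := I) (f := extChartAt I (1 : G)) (h := oneParam I G w)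
      ((contMDiffAt_extChartAt' (n := ∞)
        (by rw [extChartAt_source] at hs; exact hs)).mdifferentiableAt (by simp))
    exact this
  have hd1 : DifferentiableAt ℝ (leftFrame I G) o :=
    (contDiffAt_leftFrame hot).differentiableAt (by simp)
  have hd2 : DifferentiableAt ℝ (fun w => conjFrame I (1 * oneParam I G w)) o :=
    differentiableAt_mul_oneParam (contMDiff_conjFrame.contMDiffAt.mdifferentiableAt (by simp))
  have hd3 : HasFDerivAt (fun w => conjFrame I (oneParam I G w))
      (leftDerivL I (conjFrame I : G → E →L[ℝ] E) 1) o := by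
    have := hd2.hasFDerivAt
    simp only [one_mul] at this
    convert! this using 1
    simp [leftDerivL, ho]
  have h4 := (hC.hasFDerivAt_iff.1 hB).unique (hd1.hasFDerivAt.clm_comp hd3)
  have h5 := congrArg (fun L : E →L[ℝ] E →L[ℝ] E => L y x) h4
  simp [leftFrame_oneCoord, conjFrame_one, ho] at h5
  simp only [adL, sub_apply, ContinuousLinearMap.flip_apply]
  rw [hA, hsym, h5]
  simp [ho]

end LieCalculus

/-- The modulus of right translations. -/
lemma exists_modulus {G : Type*} [TopologicalSpace G] [Group G] [IsTopologicalGroup G]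
    [LocallyCompactSpace G] [SecondCountableTopology G] [MeasurableSpace G] [BorelSpace G]
    (μ : Measure G) [μ.IsHaarMeasure] :
    ∃ c : G → ℝ, (∀ g, 0 < c g) ∧ (∀ g h, c (g * h) = c g * c h) ∧
    (∀ (f : G → ℝ) (g : G), ∫ h, f (h * g) ∂μ = c g * ∫ h, f h ∂μ) ∧
    ∀ f : G → ℝ≥0∞, Measurable f → ∀ g, ∫⁻ h, f (h * g) ∂μ = ENNReal.ofReal (c g) * ∫⁻ h, f h ∂μ := by
  refine ⟨fun g => (Measure.modularCharacterFun g : ℝ), fun g => ?_, fun g h => ?_, fun f g => ?_,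
    fun f hf g => ?_⟩
  · exact_mod_cast Measure.modularCharacterFun_pos g
  · simp [Measure.modularCharacterFun_map_mul]
  · have h1 := integral_map_equiv (MeasurableEquiv.mulRight g) f (μ := μ)
    have h2 := Measure.map_right_mul_eq_modularCharacterFun_smul μ g
    have h3 : ∫ h, f (h * g) ∂μ = ∫ h, f h ∂(μ.map (· * g)) := h1.symm
    rw [h3, h2, integral_smul_nnreal_measure]
    rfl
  · have h2 := Measure.map_right_mul_eq_modularCharacterFun_smul μ g
    rw [← lintegral_map hf (measurable_mul_const g), h2, lintegral_smul_measure]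
    simp [ENNReal.smul_def]

/-! ### Integration by parts for Haar measure; the trace of the adjoint representation. -/

section HaarCalculus

variable {E : Type*} [NormedAddCommGroup E] [NormedSpace ℝ E] [FiniteDimensional ℝ E]
  {M : Type*} [TopologicalSpace M] {I : ModelWithCorners ℝ E M} [I.Boundaryless]
  {G : Type*} [TopologicalSpace G] [ChartedSpace M G] [Group G] [LieGroup I ∞ G]
  [T2Space G] [SecondCountableTopology G] [MeasurableSpace G] [BorelSpace G]

/-- Differentiation under the integral sign, for smooth functions with compact support. -/
lemma hasFDerivAt_integral_of_compact {V : Type*} [NormedAddCommGroup V] [NormedSpace ℝ V]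
    [FiniteDimensional ℝ V] (μ : Measure G) [IsFiniteMeasureOnCompacts μ] {Φ : V × G → ℝ} {v₀ : V} {U : Set V} (hU : U ∈ 𝓝 v₀)
    (hΦ : ∀ v ∈ U, ∀ g, ContMDiffAt (𝓘(ℝ, V).prod I) 𝓘(ℝ, ℝ) ∞ Φ (v, g)) {K : Set G}
    (hK : IsCompact K) (hz : ∀ v ∈ U, ∀ g, g ∉ K → Φ (v, g) = 0) :
    Integrable (fun g => fderiv ℝ (fun v => Φ (v, g)) v₀) μ ∧
    HasFDerivAt (fun v => ∫ g, Φ (v, g) ∂μ) (∫ g, fderiv ℝ (fun v => Φ (v, g)) v₀ ∂μ) v₀ := by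
  obtain ⟨r, hr, hball⟩ := Metric.nhds_basis_closedBall.mem_iff.1 hU
  set Φ' : V × G → V →L[ℝ] ℝ := fun x => fderiv ℝ (fun w => Φ (w, x.2)) x.1 with hΦ'
  have hcont : ∀ v ∈ U, ∀ g, ContinuousAt Φ' (v, g) := fun v hv g =>
    (hΦ v hv g).fderiv_fst.continuousAt
  have hcompact : IsCompact (Metric.closedBall v₀ r ×ˢ K) := (isCompact_closedBall v₀ r).prod hK
  obtain ⟨C, hC⟩ := hcompact.exists_bound_of_continuousOn (f := Φ') (fun x hx =>
    (hcont x.1 (hball hx.1) x.2).continuousWithinAt)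
  have hzero : ∀ v ∈ Metric.ball v₀ r, ∀ g, g ∉ K → Φ' (v, g) = 0 := by
    intro v hv g hg
    have h : (fun w => Φ (w, g)) =ᶠ[𝓝 v] fun _ => 0 := by
      filter_upwards [Metric.isOpen_ball.mem_nhds hv] with w hw
      exact hz w (hball (Metric.ball_subset_closedBall hw)) g hg
    simp only [hΦ']
    rw [h.fderiv_eq, fderiv_fun_const]
    rfl
  have hv₀ : v₀ ∈ U := mem_of_mem_nhds hU
  have hc1 : ∀ v ∈ U, Continuous fun g => Φ (v, g) := fun v hv =>
    continuous_iff_continuousAt.2 fun g => ContinuousAt.comp (f := fun g => (v, g))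
      (hΦ v hv g).continuousAt (by fun_prop)
  have hc2 : Continuous fun g => Φ' (v₀, g) :=
    continuous_iff_continuousAt.2 fun g => ContinuousAt.comp (f := fun g => (v₀, g))
      (hcont v₀ hv₀ g) (by fun_prop)
  have hint : Integrable (fun g => Φ' (v₀, g)) μ :=
    hc2.integrable_of_hasCompactSupport (HasCompactSupport.intro hK fun g hg =>
      hzero v₀ (Metric.mem_ball_self hr) g hg)
  refine ⟨hint, ?_⟩
  refine hasFDerivAt_integral_of_dominated_of_fderiv_le (F := fun v g => Φ (v, g))
    (F' := fun v g => Φ' (v, g)) (bound := K.indicator fun _ => C)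
    (Metric.ball_mem_nhds v₀ hr) ?_ ?_ ?_ ?_ ?_ ?_
  · filter_upwards [hU] with v hv using (hc1 v hv).aestronglyMeasurable
  · exact (hc1 v₀ hv₀).integrable_of_hasCompactSupport
      (HasCompactSupport.intro hK fun g hg => hz v₀ hv₀ g hg)
  · exact hc2.aestronglyMeasurable
  · refine Filter.Eventually.of_forall fun g v hv => ?_
    by_cases hg : g ∈ K
    · rw [indicator_of_mem hg]
      exact hC (v, g) ⟨Metric.ball_subset_closedBall hv, hg⟩
    · rw [indicator_of_notMem hg, hzero v hv g hg, norm_zero]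
  · exact (integrable_indicator_iff hK.measurableSet).2
      (integrableOn_const hK.measure_lt_top.ne)
  · refine Filter.Eventually.of_forall fun g v hv => ?_
    have hvU := hball (Metric.ball_subset_closedBall hv)
    have h1 : MDifferentiableAt (𝓘(ℝ, V).prod I) 𝓘(ℝ, ℝ) Φ (v, g) :=
      (hΦ v hvU g).mdifferentiableAt (by simp)
    have h2 : MDifferentiableAt 𝓘(ℝ, V) 𝓘(ℝ, ℝ) (fun w => Φ (w, g)) v :=
      MDifferentiableAt.comp (I' := 𝓘(ℝ, V).prod I) v (f := fun w : V => (w, g)) h1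
        (mdifferentiableAt_id.prodMk mdifferentiableAt_const)
    exact (mdifferentiableAt_iff_differentiableAt.1 h2).hasFDerivAt

variable (μ : Measure G) [μ.IsHaarMeasure]

lemma exists_closedBall_oneCoord : ∃ r > 0, Metric.closedBall (oneCoord I G) r ⊆
    (extChartAt I (1 : G)).target :=
  Metric.nhds_basis_closedBall.mem_iff.1 (target_mem_nhds_oneCoord I G)

lemma isCompact_oneParam_image {r : ℝ}
    (hr : Metric.closedBall (oneCoord I G) r ⊆ (extChartAt I (1 : G)).target) :
    IsCompact (oneParam I G '' Metric.closedBall (oneCoord I G) r) :=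
  (isCompact_closedBall _ _).image_of_continuousOn fun z hz =>
    (contMDiffAt_oneParam (hr hz)).continuousAt.continuousWithinAt

-- For z near the coordinates of the identity all translates of f are supported in one compact set,
-- the product of the support of f with the inverse of the image of a ball; differentiation under
-- the integral sign is then allowed.
open scoped Pointwise in
lemma hasFDerivAt_integral_mul_oneParam {f : G → ℝ} (hf : ContMDiff I 𝓘(ℝ, ℝ) ∞ f)
    (hs : HasCompactSupport f) :
    Integrable (leftDerivL I f) μ ∧
    HasFDerivAt (fun z => ∫ g, f (g * oneParam I G z) ∂μ) (∫ g, leftDerivL I f g ∂μ)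
      (oneCoord I G) := by
  have : IsTopologicalGroup G := topologicalGroup_of_lieGroup I ∞
  obtain ⟨r, hr, hb⟩ := exists_closedBall_oneCoord (I := I) (G := G)
  refine hasFDerivAt_integral_of_compact (I := I) μ
    (Φ := fun x : E × G => f (x.2 * oneParam I G x.1)) (Metric.closedBall_mem_nhds _ hr)
    (fun v hv g => contMDiffAt_mul_oneParam hf (hb hv) g)
    (K := tsupport f * (oneParam I G '' Metric.closedBall (oneCoord I G) r)⁻¹)
    (hs.isCompact.mul (isCompact_oneParam_image hb).inv) ?_
  intro v hv g hg
  refine image_eq_zero_of_notMem_tsupport fun hcon => hg ?_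
  exact ⟨_, hcon, (oneParam I G v)⁻¹, Set.inv_mem_inv.2 ⟨v, hv, rfl⟩, by simp⟩

open scoped Pointwise in
lemma hasFDerivAt_integral_oneParam_mul {f : G → ℝ} (hf : ContMDiff I 𝓘(ℝ, ℝ) ∞ f)
    (hs : HasCompactSupport f) :
    Integrable (fun g => leftDerivL I f g ∘L conjFrame I g) μ ∧
    HasFDerivAt (fun z => ∫ g, f (oneParam I G z * g) ∂μ)
      (∫ g, leftDerivL I f g ∘L conjFrame I g ∂μ) (oneCoord I G) := by
  have : IsTopologicalGroup G := topologicalGroup_of_lieGroup I ∞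
  obtain ⟨r, hr, hb⟩ := exists_closedBall_oneCoord (I := I) (G := G)
  have h := hasFDerivAt_integral_of_compact (I := I) μ
    (Φ := fun x : E × G => f (oneParam I G x.1 * x.2)) (Metric.closedBall_mem_nhds _ hr)
    (fun v hv g => contMDiffAt_oneParam_mul hf (hb hv) g)
    (K := (oneParam I G '' Metric.closedBall (oneCoord I G) r)⁻¹ * tsupport f)
    ((isCompact_oneParam_image hb).inv.mul hs.isCompact) ?_
  · have e : ∀ g, fderiv ℝ (fun z => f (oneParam I G z * g)) (oneCoord I G) =
        leftDerivL I f g ∘L conjFrame I g := fun g =>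
      fderiv_oneParam_mul (hf.contMDiffAt.mdifferentiableAt (by simp))
    simpa only [e] using h
  · intro v hv g hg
    refine image_eq_zero_of_notMem_tsupport fun hcon => hg ?_
    exact ⟨(oneParam I G v)⁻¹, Set.inv_mem_inv.2 ⟨v, hv, rfl⟩, _, hcon, by simp⟩

/-- The derivatives of a test function along right-invariant vector fields have mean zero. -/
lemma integral_leftDerivL_conjFrame {f : G → ℝ} (hf : ContMDiff I 𝓘(ℝ, ℝ) ∞ f)
    (hs : HasCompactSupport f) (x : E) : ∫ g, leftDerivL I f g (conjFrame I g x) ∂μ = 0 := by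
  have : IsTopologicalGroup G := topologicalGroup_of_lieGroup I ∞
  obtain ⟨h1, h2⟩ := hasFDerivAt_integral_oneParam_mul (I := I) μ hf hs
  have h3 : (fun z => ∫ g, f (oneParam I G z * g) ∂μ) = fun _ => ∫ g, f g ∂μ := by
    funext z
    exact integral_mul_left_eq_self f _
  rw [h3] at h2
  have h4 := h2.unique (hasFDerivAt_const _ _)
  have h5 := congrArg (fun L : E →L[ℝ] ℝ => L x) h4
  simp only [ContinuousLinearMap.integral_apply h1] at h5
  simpa using h5

variable (I) in
lemma exists_contMDiff_integral_ne_zero : ∃ f : G → ℝ, ContMDiff I 𝓘(ℝ, ℝ) ∞ f ∧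
    HasCompactSupport f ∧ ∫ g, f g ∂μ ≠ 0 := by
  have : IsManifold I ∞ G := inferInstance
  obtain ⟨f⟩ : Nonempty (SmoothBumpFunction I (1 : G)) := inferInstance
  refine ⟨f, f.contMDiff, f.hasCompactSupport, ne_of_gt ?_⟩
  exact f.contMDiff.continuous.integral_pos_of_hasCompactSupport_nonneg_nonzero
    f.hasCompactSupport (fun g => f.nonneg) (x := 1) (by simp)

lemma leftDerivL_apply_smul {f : G → ℝ} {ζ : G → ℝ} (hf : ContMDiff I 𝓘(ℝ, ℝ) ∞ f)
    (hζ : ContMDiff I 𝓘(ℝ, ℝ) ∞ ζ) (g : G) (x : E) :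
    leftDerivL I (fun h => f h * ζ h) g x = f g * leftDerivL I ζ g x + leftDerivL I f g x * ζ g := by
  have := leftDerivL_smul (hf.contMDiffAt.mdifferentiableAt (x := g) (by simp))
    (hζ.contMDiffAt.mdifferentiableAt (x := g) (by simp))
  simp only [smul_eq_mul] at this
  rw [this]
  simp

/-- Left-invariant derivatives of test functions integrate to the trace of the adjoint
representation times the integral; this trace is the derivative of the modulus. -/
lemma integral_leftDerivL {c : G → ℝ}
    (hc : ∀ (f : G → ℝ) (g : G), ∫ h, f (h * g) ∂μ = c g * ∫ h, f h ∂μ) :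
    HasFDerivAt (fun z => c (oneParam I G z)) (traceForm (adL I G)) (oneCoord I G) ∧
    ∀ f : G → ℝ, ContMDiff I 𝓘(ℝ, ℝ) ∞ f → HasCompactSupport f → ∀ x : E,
      ∫ g, leftDerivL I f g x ∂μ = traceForm (adL I G) x * ∫ g, f g ∂μ := by
  have : IsTopologicalGroup G := topologicalGroup_of_lieGroup I ∞
  have : LocallyCompactSpace G := Manifold.locallyCompact_of_finiteDimensional I
  obtain ⟨f₀, hf₀, hs₀, hi₀⟩ := exists_contMDiff_integral_ne_zero I μ
  -- The integral of the right translate of `f₀` is c(g) times the nonzero integral of `f₀`, so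
  -- differentiability of that integral passes to c.
  obtain ⟨δ, hδ⟩ : ∃ δ : E →L[ℝ] ℝ,
      HasFDerivAt (fun z => c (oneParam I G z)) δ (oneCoord I G) := by
    have h1 := (hasFDerivAt_integral_mul_oneParam (I := I) μ hf₀ hs₀).2
    simp only [hc] at h1
    have h2 := h1.mul_const (∫ g, f₀ g ∂μ)⁻¹
    simp only [mul_assoc, mul_inv_cancel₀ hi₀, mul_one] at h2
    exact ⟨_, h2⟩
  have hdiv : ∀ f : G → ℝ, ContMDiff I 𝓘(ℝ, ℝ) ∞ f → HasCompactSupport f → ∀ x : E,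
      ∫ g, leftDerivL I f g x ∂μ = δ x * ∫ g, f g ∂μ := by
    intro f hf hs x
    obtain ⟨h0, h1⟩ := hasFDerivAt_integral_mul_oneParam (I := I) μ hf hs
    simp only [hc] at h1
    have h2 := h1.unique (hδ.mul_const (∫ g, f g ∂μ))
    have h3 := congrArg (fun L : E →L[ℝ] ℝ => L x) h2
    simp only [ContinuousLinearMap.integral_apply h0] at h3
    rw [h3]
    simp [mul_comm]
  suffices h : δ = traceForm (adL I G) by
    rw [← h]; exact ⟨hδ, hdiv⟩
  ext x
  set b := Module.finBasis ℝ E with hb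
  -- The coordinates, in the left-invariant frame, of the right-invariant field with value x at the
  -- identity.
  set ζ : Fin (Module.finrank ℝ E) → G → ℝ := fun i g => coordForm b i (conjFrame I g x) with hζ
  have hζs : ∀ i, ContMDiff I 𝓘(ℝ, ℝ) ∞ (ζ i) := fun i =>
    (((coordForm b i) ∘L (ContinuousLinearMap.apply ℝ E x)).contDiff.contMDiff).comp
      contMDiff_conjFrame
  -- Right-invariant derivatives of f have mean zero. Expanding them with ζ and integrating by parts
  -- by `hdiv` gives ∫ f w = 0 for all test functions f, so the continuous function w vanishes. Its
  -- value at the identity is δ(x) - tr(ad x).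
  set w : G → ℝ := fun g => ∑ i, (δ (b i) * ζ i g - leftDerivL I (ζ i) g (b i)) with hw
  have hwc : Continuous w := by
    refine continuous_finsetSum _ fun i _ => ?_
    exact (continuous_const.mul (hζs i).continuous).sub
      ((contMDiff_leftDerivL (hζs i)).continuous.clm_apply continuous_const)
  have hw0 : w = fun _ => 0 := by
    refine (Continuous.ae_eq_iff_eq μ hwc continuous_const).1 ?_
    refine ae_eq_zero_of_integral_contMDiff_smul_eq_zero I hwc.locallyIntegrable ?_
    intro f hf hs
    have hi : ∀ i, Integrable (fun g => f g * (δ (b i) * ζ i g)) μ := fun i =>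
      (hf.continuous.mul (continuous_const.mul (hζs i).continuous)).integrable_of_hasCompactSupport
        hs.mul_right
    have hi2 : ∀ i, Integrable (fun g => f g * leftDerivL I (ζ i) g (b i)) μ := fun i =>
      (hf.continuous.mul ((contMDiff_leftDerivL (hζs i)).continuous.clm_apply
        continuous_const)).integrable_of_hasCompactSupport hs.mul_right
    have hi3 : ∀ i, Integrable (fun g => leftDerivL I (fun h => f h * ζ i h) g (b i)) μ := fun i =>
      (hasFDerivAt_integral_mul_oneParam (I := I) μ (hf.mul (hζs i))
        hs.mul_right).1.apply_continuousLinearMap (b i)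
    have key : ∀ g, f g • w g = ∑ i, (f g * (δ (b i) * ζ i g) -
        leftDerivL I (fun h => f h * ζ i h) g (b i)) + leftDerivL I f g (conjFrame I g x) := by
      intro g
      have hx : conjFrame I g x = ∑ i, ζ i g • b i := by
        conv_lhs => rw [← b.sum_repr (conjFrame I g x)]
        rfl
      rw [hx, map_sum, ← Finset.sum_add_distrib, smul_eq_mul, hw, Finset.mul_sum]
      refine Finset.sum_congr rfl fun i _ => ?_
      rw [leftDerivL_apply_smul hf (hζs i), map_smul, smul_eq_mul]
      ring
    have hi4 : Integrable (fun g => leftDerivL I f g (conjFrame I g x)) μ :=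
      (hasFDerivAt_integral_oneParam_mul (I := I) μ hf hs).1.apply_continuousLinearMap x
    simp only [key]
    have hi5 : ∀ i, Integrable (fun g => f g * (δ (b i) * ζ i g) -
        leftDerivL I (fun h => f h * ζ i h) g (b i)) μ := fun i => (hi i).sub (hi3 i)
    rw [integral_add (integrable_finsetSum _ fun i _ => hi5 i) hi4,
      integral_leftDerivL_conjFrame μ hf hs, add_zero, integral_finsetSum _ fun i _ => hi5 i]
    refine Finset.sum_eq_zero fun i _ => ?_
    have h6 : ∫ g, leftDerivL I (fun h => f h * ζ i h) g (b i) ∂μ =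
        δ (b i) * ∫ g, f g * ζ i g ∂μ := hdiv _ (hf.mul (hζs i)) hs.mul_right (b i)
    rw [integral_sub (hi i) (hi3 i), h6, ← integral_const_mul, sub_eq_zero]
    exact integral_congr_ae (Filter.Eventually.of_forall fun g => by simp; ring)
  have h1 := congrFun hw0 1
  simp only [hw, Finset.sum_sub_distrib] at h1
  have h2 : ∑ i, δ (b i) * ζ i 1 = δ x := by
    conv_rhs => rw [← b.sum_repr x, map_sum]
    simp [hζ, conjFrame_one, coordForm, mul_comm]
  have h3 : ∀ i, leftDerivL I (ζ i) 1 (b i) = b.coord i (adL I G x (b i)) := by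
    intro i
    have := leftDerivL_clm_comp (contMDiff_conjFrame.contMDiffAt.mdifferentiableAt (x := (1 : G))
      (by simp)) ((coordForm b i) ∘L (ContinuousLinearMap.apply ℝ E x)) (I := I)
    have e : ζ i = fun h => ((coordForm b i) ∘L (ContinuousLinearMap.apply ℝ E x))
      (conjFrame I h) := rfl
    rw [e, this]
    simp only [ContinuousLinearMap.comp_apply, ContinuousLinearMap.apply_apply]
    rw [leftDerivL_conjFrame_one]
    rfl
  rw [h2, sub_eq_zero] at h1
  rw [h1, traceForm_apply, LinearMap.trace_eq_matrix_trace ℝ b, Matrix.trace]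
  refine Finset.sum_congr rfl fun i _ => ?_
  rw [h3, Matrix.diag_apply, LinearMap.toMatrix_apply]
  rfl

end HaarCalculus

/-! ### Smoothness of integrals and of the modulus; inversion; cut-off functions. -/

section SmoothIntegrals

variable {E : Type*} [NormedAddCommGroup E] [NormedSpace ℝ E] [FiniteDimensional ℝ E]
  {M : Type*} [TopologicalSpace M] {I : ModelWithCorners ℝ E M} [I.Boundaryless]
  {G : Type*} [TopologicalSpace G] [ChartedSpace M G] [Group G] [LieGroup I ∞ G]
  [T2Space G] [SecondCountableTopology G] [MeasurableSpace G] [BorelSpace G]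

/-- Integrals of smooth compactly supported functions depend smoothly on parameters. -/
lemma contDiffOn_integral_of_compact {V : Type*} [NormedAddCommGroup V] [NormedSpace ℝ V]
    [FiniteDimensional ℝ V] (μ : Measure G) [IsFiniteMeasureOnCompacts μ] {U : Set V}
    (hU : IsOpen U) {K : Set G} (hK : IsCompact K) (n : ℕ) {Φ : V × G → ℝ}
    (hΦ : ∀ v ∈ U, ∀ g, ContMDiffAt (𝓘(ℝ, V).prod I) 𝓘(ℝ, ℝ) ∞ Φ (v, g))
    (hz : ∀ v ∈ U, ∀ g, g ∉ K → Φ (v, g) = 0) :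
    ContDiffOn ℝ n (fun v => ∫ g, Φ (v, g) ∂μ) U := by
  induction n generalizing Φ with
  | zero =>
    refine contDiffOn_zero.2 fun v hv => ?_
    exact (hasFDerivAt_integral_of_compact μ (hU.mem_nhds hv) hΦ hK hz).2.continuousAt.continuousWithinAt
  | succ n ih =>
    have hd : ∀ v ∈ U, _ := fun v hv =>
      hasFDerivAt_integral_of_compact μ (hU.mem_nhds hv) hΦ hK hz
    rw [Nat.cast_succ, contDiffOn_succ_iff_fderiv_of_isOpen hU]
    refine ⟨fun v hv => (hd v hv).2.differentiableAt.differentiableWithinAt, by simp, ?_⟩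
    rw [contDiffOn_clm_apply]
    intro y
    have h := ih (Φ := fun x => fderiv ℝ (fun w => Φ (w, x.2)) x.1 y) ?_ ?_
    · refine h.congr fun v hv => ?_
      rw [(hd v hv).2.fderiv, ContinuousLinearMap.integral_apply (hd v hv).1]
    · intro v hv g
      exact ((ContinuousLinearMap.apply ℝ ℝ y).contDiff.contMDiff.contMDiffAt).comp (v, g)
        (hΦ v hv g).fderiv_fst
    · intro v hv g hg
      have h : (fun w => Φ (w, g)) =ᶠ[𝓝 v] fun _ => 0 := by
        filter_upwards [hU.mem_nhds hv] with w hw using hz w hw g hg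
      simp only
      rw [h.fderiv_eq, fderiv_fun_const]
      rfl

lemma CompactExhaustion.tendsto_setIntegral {G : Type*} [TopologicalSpace G] [T2Space G]
    [MeasurableSpace G] [BorelSpace G] (K : CompactExhaustion G) {μ : Measure G} {F : Type*}
    [NormedAddCommGroup F] [NormedSpace ℝ F] {u : G → F} (hu : Integrable u μ) :
    Filter.Tendsto (fun n => ∫ w in K n, u w ∂μ) Filter.atTop (𝓝 (∫ w, u w ∂μ)) := by
  have h := tendsto_setIntegral_of_monotone (μ := μ) (f := u)
    (fun n => (K.isCompact n).measurableSet) (fun m n hmn => K.subset hmn) hu.integrableOn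
  rwa [K.iUnion_eq, setIntegral_univ] at h

/-- Left translation by g carries the chart at the identity to a chart at g. -/
lemma contMDiffAt_of_mul_oneParam {F : Type*} [NormedAddCommGroup F] [NormedSpace ℝ F] {f : G → F}
    {g : G} (h : ContDiffAt ℝ ∞ (fun z => f (g * oneParam I G z)) (oneCoord I G)) :
    ContMDiffAt I 𝓘(ℝ, F) ∞ f g := by
  have : IsTopologicalGroup G := topologicalGroup_of_lieGroup I ∞
  have h1 : ContMDiffAt I 𝓘(ℝ, E) ∞ (fun a : G => extChartAt I (1 : G) (g⁻¹ * a)) g := by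
    refine ContMDiffAt.comp g (contMDiffAt_extChartAt' ?_) (contMDiffAt_mul_left' g⁻¹ g)
    simp
  have h2 : ContMDiffAt I 𝓘(ℝ, F) ∞
      ((fun z => f (g * oneParam I G z)) ∘ fun a : G => extChartAt I (1 : G) (g⁻¹ * a)) g := by
    refine ContMDiffAt.comp g ?_ h1
    have : extChartAt I (1 : G) (g⁻¹ * g) = oneCoord I G := by rw [inv_mul_cancel]; rfl
    rw [this]
    exact h.contMDiffAt
  refine h2.congr_of_eventuallyEq ?_
  have hs : (extChartAt I (1 : G)).source ∈ 𝓝 (g⁻¹ * g) := by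
    simpa using extChartAt_source_mem_nhds (I := I) (1 : G)
  have hc : ContinuousAt (fun a : G => g⁻¹ * a) g := by fun_prop
  filter_upwards [hc.preimage_mem_nhds hs] with a ha
  simp only [Function.comp_apply, oneParam]
  rw [(extChartAt I (1 : G)).left_inv ha, mul_inv_cancel_left]

variable (μ : Measure G) [μ.IsHaarMeasure]

/-- The modulus is smooth and its logarithmic derivative is the trace of the adjoint
representation. -/
lemma contMDiff_modulus {c : G → ℝ} (hm : ∀ g h, c (g * h) = c g * c h)
    (hc : ∀ (f : G → ℝ) (g : G), ∫ h, f (h * g) ∂μ = c g * ∫ h, f h ∂μ) :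
    ContMDiff I 𝓘(ℝ, ℝ) ∞ c ∧ ∀ g, leftDerivL I c g = c g • traceForm (adL I G) := by
  have : IsTopologicalGroup G := topologicalGroup_of_lieGroup I ∞
  constructor
  · obtain ⟨f, hf, hs, hi⟩ := exists_contMDiff_integral_ne_zero I μ
    obtain ⟨r, hr, hb⟩ := exists_closedBall_oneCoord (I := I) (G := G)
    have hK := (isCompact_oneParam_image hb).prod hs.isCompact
    -- Near the identity c is a parameter integral divided by a constant; smoothness elsewhere
    -- follows from multiplicativity.
    have h1 : ContDiffAt ℝ ∞ (fun z => c (oneParam I G z)) (oneCoord I G) := by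
      rw [contDiffAt_infty]
      intro n
      have h2 := contDiffOn_integral_of_compact (I := I) μ
        (Φ := fun x : E × G => f (x.2 * oneParam I G x.1)) Metric.isOpen_ball
        (hK.image (f := fun h => h.2 * h.1⁻¹) (by fun_prop)) n
        (fun v hv g => contMDiffAt_mul_oneParam hf (hb (Metric.ball_subset_closedBall hv)) g) (by
          intro v hv g hg
          refine image_eq_zero_of_notMem_tsupport fun hcon => hg ?_
          exact ⟨(oneParam I G v, _), ⟨⟨v, Metric.ball_subset_closedBall hv, rfl⟩, hcon⟩, by simp⟩)
      have h3 := (h2.contDiffAt (Metric.ball_mem_nhds _ hr)).mul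
        (contDiffAt_const (c := (∫ g, f g ∂μ)⁻¹))
      simp only [hc] at h3
      refine h3.congr_of_eventuallyEq (Filter.Eventually.of_forall fun z => ?_)
      simp only
      rw [mul_assoc, mul_inv_cancel₀ hi, mul_one]
    intro g
    refine contMDiffAt_of_mul_oneParam ?_
    simp only [hm]
    exact contDiffAt_const.mul h1
  · intro g
    rw [leftDerivL]
    simp only [hm]
    exact ((integral_leftDerivL (I := I) μ hc).1.const_mul (c g)).fderiv

/-- Inversion turns Haar measure into its multiple by the modulus. -/
lemma lintegral_inv_eq {G : Type*} [TopologicalSpace G] [Group G] [IsTopologicalGroup G]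
    [LocallyCompactSpace G] [SecondCountableTopology G] [MeasurableSpace G] [BorelSpace G]
    (μ : Measure G) [μ.IsHaarMeasure] {c : G → ℝ}
    (hcm : Measurable c) (hpos : ∀ g, 0 < c g) (hm : ∀ g h, c (g * h) = c g * c h)
    (hc : ∀ f : G → ℝ≥0∞, Measurable f → ∀ g,
      ∫⁻ h, f (h * g) ∂μ = ENNReal.ofReal (c g) * ∫⁻ h, f h ∂μ) :
    μ.map Inv.inv = μ.withDensity fun g => ENNReal.ofReal (c g) := by
  have hc1 : c 1 = 1 := by
    have h1 := hm 1 1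
    rw [mul_one] at h1
    exact (mul_eq_left₀ (hpos 1).ne').1 h1.symm
  have hcinv : ∀ g, c g⁻¹ = (c g)⁻¹ := fun g =>
    eq_inv_of_mul_eq_one_left (by rw [← hm, inv_mul_cancel, hc1])
  obtain ⟨K, hK, hK1⟩ := exists_compact_mem_nhds (1 : G)
  set k : G → ℝ≥0∞ := (closure K).indicator fun _ => 1 with hk
  have hkm : Measurable k := measurable_const.indicator isClosed_closure.measurableSet
  have hki : ∫⁻ h, k h ∂μ = μ (closure K) := by
    rw [hk, lintegral_indicator isClosed_closure.measurableSet]; simp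
  have hk0 : ∫⁻ h, k h ∂μ ≠ 0 := by
    rw [hki]
    exact (Measure.measure_pos_of_mem_nhds μ (Filter.mem_of_superset hK1 subset_closure)).ne'
  have hkt : ∫⁻ h, k h ∂μ ≠ ⊤ := by
    rw [hki]; exact hK.closure.measure_lt_top.ne
  -- Fubini for k ⊗ f along the measure-preserving map (x, y) ↦ (yx, x⁻¹). The auxiliary k is there
  -- to be integrated out: its integral is neither 0 nor ∞ and can be cancelled.
  have key : ∀ f : G → ℝ≥0∞, Measurable f →
      ∫⁻ x, f x⁻¹ * ENNReal.ofReal (c x) ∂μ = ∫⁻ x, f x ∂μ := by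
    intro f hf
    have hmeas : Measurable fun z : G × G => k z.1 * f z.2 :=
      (hkm.comp measurable_fst).mul (hf.comp measurable_snd)
    have h1 := (measurePreserving_mul_prod_inv (μ := μ) (ν := μ)).lintegral_comp hmeas
    rw [lintegral_prod_mul hkm.aemeasurable hf.aemeasurable] at h1
    have hmeas' : Measurable fun z : G × G => k (z.2 * z.1) * f z.1⁻¹ :=
      (hkm.comp (measurable_snd.mul measurable_fst)).mul (hf.comp measurable_fst.inv)
    rw [lintegral_prod _ hmeas'.aemeasurable] at h1
    have h2 : ∀ x, ∫⁻ y, k (y * x) * f x⁻¹ ∂μ =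
        (f x⁻¹ * ENNReal.ofReal (c x)) * ∫⁻ h, k h ∂μ := by
      intro x
      have hkx : Measurable fun y => k (y * x) := hkm.comp (measurable_mul_const x)
      rw [lintegral_mul_const _ hkx, hc k hkm]
      ring
    simp only [h2] at h1
    have hfc : Measurable fun x => f x⁻¹ * ENNReal.ofReal (c x) :=
      (hf.comp measurable_inv).mul hcm.ennreal_ofReal
    rw [lintegral_mul_const _ hfc, mul_comm] at h1
    exact (ENNReal.mul_right_inj hk0 hkt).1 h1
  refine Measure.ext_of_lintegral _ fun f hf => ?_
  rw [lintegral_map hf measurable_inv, lintegral_withDensity_eq_lintegral_mul _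
    hcm.ennreal_ofReal hf, ← key _ (hcm.ennreal_ofReal.mul hf)]
  refine lintegral_congr fun x => ?_
  simp only [Pi.mul_apply, hcinv]
  rw [mul_comm, ← mul_assoc, ← ENNReal.ofReal_mul (hpos x).le, mul_inv_cancel₀ (hpos x).ne',
    ENNReal.ofReal_one, one_mul]

variable (I G) in
/-- There are smooth compactly supported cut-off functions with uniformly bounded left-invariant
derivatives. -/
lemma exists_cutoff : ∃ (χ : ℕ → G → ℝ) (C : ℝ), (∀ n, ContMDiff I 𝓘(ℝ, ℝ) ∞ (χ n)) ∧
    (∀ n, HasCompactSupport (χ n)) ∧ (∀ n g, ‖χ n g‖ ≤ C) ∧ (∀ n g, ‖leftDerivL I (χ n) g‖ ≤ C) ∧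
    (∀ g, Filter.Tendsto (fun n => χ n g) Filter.atTop (𝓝 1)) ∧
    ∀ g, Filter.Tendsto (fun n => leftDerivL I (χ n) g) Filter.atTop (𝓝 0) := by
  have : IsTopologicalGroup G := topologicalGroup_of_lieGroup I ∞
  have : LocallyCompactSpace G := Manifold.locallyCompact_of_finiteDimensional I
  set μ : Measure G := Measure.haar
  obtain ⟨f, hf, hs, hi⟩ := exists_contMDiff_integral_ne_zero I μ
  set b : G → ℝ := fun g => (∫ g, f g ∂μ)⁻¹ * f g with hb
  have hbs : ContMDiff I 𝓘(ℝ, ℝ) ∞ b := contMDiff_const.mul hf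
  have hbc : HasCompactSupport b := hs.mul_left
  have hbi : ∫ g, b g ∂μ = 1 := by
    rw [hb, integral_const_mul, inv_mul_cancel₀ hi]
  have hbint : Integrable b μ := hbs.continuous.integrable_of_hasCompactSupport hbc
  obtain ⟨r, hr, hball⟩ := exists_closedBall_oneCoord (I := I) (G := G)
  set κ := oneParam I G
  set Q := κ '' Metric.closedBall (oneCoord I G) r with hQ
  have hQc : IsCompact Q := isCompact_oneParam_image hball
  have hsm : ∀ g : G, ∀ v ∈ Metric.ball (oneCoord I G) r, ∀ w : G,
      ContMDiffAt (𝓘(ℝ, E).prod I) 𝓘(ℝ, ℝ) ∞ (fun x : E × G => b ((g * κ x.1)⁻¹ * x.2)) (v, w) := by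
    intro g v hv w
    have h0 : ContMDiffAt (𝓘(ℝ, E).prod I) I ∞ (fun x : E × G => (g * κ x.1)⁻¹ * x.2) (v, w) :=
      (contMDiffAt_const.mul ((contMDiffAt_oneParam (hball (Metric.ball_subset_closedBall hv))).comp
        (v, w) contMDiffAt_fst)).inv.mul contMDiffAt_snd
    exact hbs.contMDiffAt.comp (v, w) h0
  have hcp : ∀ g : G, IsCompact ((fun x : G × G => g * x.1 * x.2) '' (Q ×ˢ tsupport b)) := fun g =>
    (hQc.prod hbc.isCompact).image (by fun_prop)
  have hz : ∀ g : G, ∀ v ∈ Metric.ball (oneCoord I G) r, ∀ w : G,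
      w ∉ ((fun x : G × G => g * x.1 * x.2) '' (Q ×ˢ tsupport b)) → b ((g * κ v)⁻¹ * w) = 0 := by
    intro g v hv w hw
    refine image_eq_zero_of_notMem_tsupport fun hcon => hw ?_
    exact ⟨(κ v, (g * κ v)⁻¹ * w), ⟨⟨v, Metric.ball_subset_closedBall hv, rfl⟩, hcon⟩, mul_inv_cancel_left _ _⟩
  set K : CompactExhaustion G := default
  -- The indicator of the n-th compact set, smoothed by the bump b of integral one. Left-invariant
  -- derivatives fall on b, so they are bounded by the L¹ norm of b' whatever n is.
  set χ : ℕ → G → ℝ := fun n g => ∫ w in K n, b (g⁻¹ * w) ∂μ with hχ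
  set b' : G → E →L[ℝ] ℝ := fun y => fderiv ℝ (fun z => b ((κ z)⁻¹ * y)) (oneCoord I G) with hb'
  have hd : ∀ (ν : Measure G) [IsFiniteMeasureOnCompacts ν], ∀ g,
      Integrable (fun w => b' (g⁻¹ * w)) ν ∧
      HasFDerivAt (fun z => ∫ w, b ((g * κ z)⁻¹ * w) ∂ν) (∫ w, b' (g⁻¹ * w) ∂ν) (oneCoord I G) := by
    intro ν _ g
    have := hasFDerivAt_integral_of_compact (I := I) ν (Metric.ball_mem_nhds (oneCoord I G) hr)
      (hsm g) (hcp g) (hz g)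
    simpa only [hb', mul_inv_rev, mul_assoc] using this
  have hχd : ∀ n g, leftDerivL I (χ n) g = ∫ w in K n, b' (g⁻¹ * w) ∂μ := fun n g =>
    (hd (μ.restrict (K n)) g).2.fderiv
  have hint' : Integrable b' μ := by simpa using (hd μ 1).1
  refine ⟨χ, max (∫ w, ‖b w‖ ∂μ) (∫ w, ‖b' w‖ ∂μ), ?_, ?_, ?_, ?_, ?_, ?_⟩
  · intro n g
    refine contMDiffAt_of_mul_oneParam ?_
    rw [contDiffAt_infty]
    intro m
    exact (contDiffOn_integral_of_compact (I := I) (μ.restrict (K n)) Metric.isOpen_ball (hcp g) m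
      (hsm g) (hz g)).contDiffAt (Metric.ball_mem_nhds _ hr)
  · intro n
    refine HasCompactSupport.intro (K := (fun x : G × G => x.1 * x.2⁻¹) '' (K n ×ˢ tsupport b))
      (((K.isCompact n).prod hbc.isCompact).image (by fun_prop)) fun g hg => ?_
    refine setIntegral_eq_zero_of_forall_eq_zero fun w hw => ?_
    refine image_eq_zero_of_notMem_tsupport fun hcon => hg ?_
    exact ⟨(w, g⁻¹ * w), ⟨hw, hcon⟩, by simp⟩
  · intro n g
    refine le_trans ?_ (le_max_left _ _)
    rw [← integral_mul_left_eq_self (fun w => ‖b w‖) g⁻¹]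
    refine (norm_integral_le_integral_norm _).trans ?_
    exact setIntegral_le_integral (hbint.comp_mul_left g⁻¹).norm
      (Filter.Eventually.of_forall fun _ => norm_nonneg _)
  · intro n g
    refine le_trans ?_ (le_max_right _ _)
    rw [hχd, ← integral_mul_left_eq_self (fun w => ‖b' w‖) g⁻¹]
    refine (norm_integral_le_integral_norm _).trans ?_
    exact setIntegral_le_integral (hint'.comp_mul_left g⁻¹).norm
      (Filter.Eventually.of_forall fun _ => norm_nonneg _)
  · intro g
    have := K.tendsto_setIntegral (hbint.comp_mul_left g⁻¹)
    rwa [integral_mul_left_eq_self b, hbi] at this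
  · intro g
    have h1 := K.tendsto_setIntegral (hint'.comp_mul_left g⁻¹)
    have h2 : ∫ w, b' (g⁻¹ * w) ∂μ = 0 := by
      have h3 := (hd μ g).2
      -- Over the whole group the integral of b(g⁻¹w) is 1 for every g, so its derivative in g is
      -- zero; this is the limit of the derivatives of the cut-offs.
      have h4 : (fun z => ∫ w, b ((g * κ z)⁻¹ * w) ∂μ) = fun _ => 1 := by
        funext z
        rw [integral_mul_left_eq_self b, hbi]
      rw [h4] at h3
      exact h3.unique (hasFDerivAt_const _ _)
    rw [h2] at h1
    simpa only [hχd] using h1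

end SmoothIntegrals

/-! ### The exterior derivative as a form and its symbol on multiples of constant forms. -/

section ExteriorDerivative

variable {E : Type*} [NormedAddCommGroup E] [NormedSpace ℝ E] [FiniteDimensional ℝ E]

instance instContinuousAddAltFormCLM (k l : ℕ) : ContinuousAdd (AltForm E k →L[ℝ] AltForm E l) :=
  ContinuousLinearMap.topologicalAddGroup.toContinuousAdd

/-- The exterior product with a linear form as a continuous bilinear map. -/
def lineWedgeL (k : ℕ) : (E →L[ℝ] ℝ) →L[ℝ] AltForm E k →L[ℝ] AltForm E (k + 1) :=
  (ContinuousLinearMap.compL ℝ (AltForm E k) (E →L[ℝ] AltForm E k) (AltForm E (k + 1))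
    (ContinuousAlternatingMap.alternatizeUncurryFinCLM ℝ E ℝ)) ∘L
    ContinuousLinearMap.smulRightL ℝ E (AltForm E k)

@[simp] lemma lineWedgeL_apply {k : ℕ} (τ : E →L[ℝ] ℝ) (a : AltForm E k) :
    lineWedgeL k τ a = lineWedge τ a := rfl

/-- The Chevalley–Eilenberg differential as a continuous linear map. -/
def algDerL (ad : E →L[ℝ] E →L[ℝ] E) (k : ℕ) : AltForm E k →L[ℝ] AltForm E (k + 1) :=
  LinearMap.toContinuousLinearMap
    { toFun := algDer ad
      map_add' := fun a b => by
        have h : halfDer ad (a + b) = halfDer ad a + halfDer ad b := by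
          ext1 x; simp only [halfDer_apply, map_add, smul_add, add_apply]
        simp only [algDer, h, ContinuousAlternatingMap.alternatizeUncurryFin_add]
      map_smul' := fun r a => by
        have h : halfDer ad (r • a) = r • halfDer ad a := by
          ext1 x
          simp only [halfDer_apply, map_smul, smul_apply]
          exact smul_comm _ _ _
        simp only [algDer, h, ContinuousAlternatingMap.alternatizeUncurryFin_smul]
        rfl }

variable
  {M : Type*} [TopologicalSpace M] {I : ModelWithCorners ℝ E M} [I.Boundaryless]
  {G : Type*} [TopologicalSpace G] [ChartedSpace M G] [Group G] [LieGroup I ∞ G]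

variable (I) in
/-- The exterior derivative as a form. -/
def extDerL {k : ℕ} (φ : G → AltForm E k) (g : G) : AltForm E (k + 1) :=
  ContinuousAlternatingMap.alternatizeUncurryFin (leftDerivL I φ g + halfDer (adL I G) (φ g))

/-- By `bracket_sum_eq` the bracket terms over i < j are the alternation of x ↦ -½ D, with D the
derivation induced by ad x. Thus dφ is the alternation of one linear map, to which the algebra of
the preceding parts applies. -/
lemma coe_extDerL {k : ℕ} {φ : G → AltForm E k} {g : G}
    (hφ : MDifferentiableAt I 𝓘(ℝ, AltForm E k) φ g) :
    (extDerL I φ g : (Fin (k + 1) → E) → ℝ) = extDer I φ g := by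
  funext v
  have hb : ∀ x y : E, algBracket I G x y = -algBracket I G y x := fun x y => by
    rw [← adL_apply, ← adL_apply, adL_skew]
  rw [extDerL, alternatizeUncurryFin_coe, extDer, bracket_sum_eq (φ g) _ hb,
    ← Finset.sum_add_distrib]
  refine Finset.sum_congr rfl fun i _ => ?_
  rw [leftDeriv_eq_leftDerivL hφ, ← mul_add]
  congr 1
  simp only [add_apply, ContinuousAlternatingMap.add_apply, halfDer_apply,
    ContinuousAlternatingMap.smul_apply, inducedDer_apply, smul_eq_mul, adL_apply]

variable (I) in
/-- The exterior derivative of the product of a function with constant forms. -/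
def extDerSymbol (k : ℕ) (f : G → ℝ) (g : G) : AltForm E k →L[ℝ] AltForm E (k + 1) :=
  lineWedgeL k (leftDerivL I f g) + f g • algDerL (adL I G) k

lemma extDerSymbol_apply {k : ℕ} (f : G → ℝ) (g : G) (a : AltForm E k) :
    extDerSymbol I k f g a = lineWedge (leftDerivL I f g) a + f g • algDer (adL I G) a := rfl

lemma extDerL_smul_const {k : ℕ} {f : G → ℝ} {g : G} (hf : MDifferentiableAt I 𝓘(ℝ, ℝ) f g)
    (a : AltForm E k) : extDerL I (fun h => f h • a) g = extDerSymbol I k f g a := by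
  have h1 : leftDerivL I (fun h => f h • a) g = (leftDerivL I f g).smulRight a := by
    have := leftDerivL_clm_comp hf ((ContinuousLinearMap.id ℝ ℝ).smulRight a)
    simp only [ContinuousLinearMap.smulRight_apply, ContinuousLinearMap.id_apply] at this
    rw [this]
    ext1 x; simp
  have h2 : halfDer (adL I G) (f g • a) = f g • halfDer (adL I G) a := by
    ext1 x
    simp only [halfDer_apply, map_smul, smul_apply]
    exact smul_comm _ _ _
  rw [extDerL, h1, h2, ContinuousAlternatingMap.alternatizeUncurryFin_add,
    ContinuousAlternatingMap.alternatizeUncurryFin_smul]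
  rfl

lemma extDer_smul_const {k : ℕ} {f : G → ℝ} {g : G} (hf : MDifferentiableAt I 𝓘(ℝ, ℝ) f g)
    (a : AltForm E k) : extDer I (fun h => f h • a) g = extDerSymbol I k f g a := by
  rw [← extDerL_smul_const hf, coe_extDerL]
  exact MDifferentiableAt.smul hf mdifferentiableAt_const

lemma extDerSymbol_mul {k : ℕ} {f₁ f₂ : G → ℝ} (h₁ : ContMDiff I 𝓘(ℝ, ℝ) ∞ f₁)
    (h₂ : ContMDiff I 𝓘(ℝ, ℝ) ∞ f₂) (g : G) (a : AltForm E k) :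
    extDerSymbol I k (fun h => f₁ h * f₂ h) g a =
      lineWedge (leftDerivL I f₁ g) (f₂ g • a) + f₁ g • extDerSymbol I k f₂ g a := by
  have h : leftDerivL I (fun h => f₁ h * f₂ h) g =
      f₁ g • leftDerivL I f₂ g + f₂ g • leftDerivL I f₁ g := by
    have := leftDerivL_smul (h₁.contMDiffAt.mdifferentiableAt (x := g) (by simp))
      (h₂.contMDiffAt.mdifferentiableAt (x := g) (by simp))
    simp only [smul_eq_mul] at this
    rw [this]
    ext x; simp [mul_comm]
  have h3 : ∀ (τ : E →L[ℝ] ℝ), lineWedge τ a = lineWedgeL k τ a := fun _ => rfl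
  have h4 : lineWedge (leftDerivL I f₁ g) (f₂ g • a) = lineWedgeL k (leftDerivL I f₁ g) (f₂ g • a) :=
    rfl
  rw [extDerSymbol_apply, extDerSymbol_apply, h3, h3, h4, h, map_add, map_smul, map_smul, map_smul]
  simp only [add_apply, smul_apply, smul_add, smul_smul]
  abel

/-- The function of (z, w) obtained by evaluating f at κ(z)κ(w)⁻¹ is constant on the diagonal, so
its two partial derivatives add up to zero. -/
lemma fderiv_oneParam_inv {f : G → ℝ} (hf : ContMDiff I 𝓘(ℝ, ℝ) ∞ f) :
    fderiv ℝ (fun z => f (oneParam I G z)⁻¹) (oneCoord I G) =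
      -fderiv ℝ (fun z => f (oneParam I G z)) (oneCoord I G) := by
  set o := oneCoord I G
  set Ψ : E × E → ℝ := fun x => f (oneParam I G x.1 * (oneParam I G x.2)⁻¹) with hΨ
  have hd : ContMDiffAt (𝓘(ℝ, E).prod 𝓘(ℝ, E)) 𝓘(ℝ, ℝ) ∞ Ψ (o, o) := by
    have h1 : ContMDiffAt (𝓘(ℝ, E).prod 𝓘(ℝ, E)) I ∞
        (fun x : E × E => oneParam I G x.1 * (oneParam I G x.2)⁻¹) (o, o) :=
      (contMDiffAt_oneParam_oneCoord.comp (o, o) contMDiffAt_fst).mul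
        (contMDiffAt_oneParam_oneCoord.comp (o, o) contMDiffAt_snd).inv
    exact hf.contMDiffAt.comp (o, o) h1
  have hd' : HasFDerivAt Ψ (fderiv ℝ Ψ (o, o)) (o, o) :=
    ((contDiffAt_of_contMDiffAt_prod hd).differentiableAt (by simp)).hasFDerivAt
  have e1 := HasFDerivAt.comp (f := fun z => (z, o)) o hd' (hasFDerivAt_prodMk_left o o)
  have e2 := HasFDerivAt.comp (f := fun z => (o, z)) o hd' (hasFDerivAt_prodMk_right o o)
  have e3 := HasFDerivAt.comp (f := fun z => (z, z)) o hd' ((hasFDerivAt_id o).prodMk (hasFDerivAt_id o))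
  have c1 : (Ψ ∘ fun z => (z, o)) = fun z => f (oneParam I G z) := by
    funext z; simp [hΨ, o]
  have c2 : (Ψ ∘ fun z => (o, z)) = fun z => f (oneParam I G z)⁻¹ := by
    funext z; simp [hΨ, o]
  have c3 : (Ψ ∘ fun z => (z, z)) = fun _ => f 1 := by
    funext z; simp [hΨ]
  rw [c1] at e1; rw [c2] at e2; rw [c3] at e3
  rw [e1.fderiv, e2.fderiv, eq_neg_iff_add_eq_zero]
  have e4 := e3.unique (hasFDerivAt_const _ _)
  rw [← e4]
  ext x
  simp only [add_apply, ContinuousLinearMap.comp_apply, ← map_add]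
  simp

end ExteriorDerivative

/-! ### Convolution with a test function commutes with the weak exterior derivative. -/

section Regularization

variable {E : Type*} [NormedAddCommGroup E] [NormedSpace ℝ E] [FiniteDimensional ℝ E]
  {M : Type*} [TopologicalSpace M] {I : ModelWithCorners ℝ E M} [I.Boundaryless]
  {G : Type*} [TopologicalSpace G] [ChartedSpace M G] [Group G] [LieGroup I ∞ G]
  [T2Space G] [SecondCountableTopology G] [MeasurableSpace G] [BorelSpace G]
  (μ : Measure G) [μ.IsHaarMeasure]

lemma integrable_clm_of_compact {X F F' : Type*} [TopologicalSpace X] [T2Space X]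
    [MeasurableSpace X] [OpensMeasurableSpace X] {μ : Measure X}
    [NormedAddCommGroup F] [NormedSpace ℝ F] [NormedAddCommGroup F'] [NormedSpace ℝ F']
    [SecondCountableTopology X]
    {L : X → F →L[ℝ] F'} (hL : Continuous L) (hs : HasCompactSupport L) {u : X → F}
    (hu : LocallyIntegrable u μ) : Integrable (fun x => L x (u x)) μ := by
  obtain ⟨C, hC⟩ := hL.bounded_above_of_compact_support hs
  have h1 : IntegrableOn u (tsupport L) μ := hu.integrableOn_isCompact hs
  have h2 : IntegrableOn (fun x => L x (u x)) (tsupport L) μ :=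
    (ContinuousLinearMap.id ℝ (F →L[ℝ] F')).integrable_of_bilin_of_bdd_left C
      hL.aestronglyMeasurable (Filter.Eventually.of_forall hC) h1
  refine (integrableOn_iff_integrable_of_support_subset fun x hx => ?_).1 h2
  by_contra h
  exact hx (by simp [image_eq_zero_of_notMem_tsupport h])

/-- The convolution of a form with a test function commutes with the exterior derivative. -/
lemma integral_extDerSymbol {r : ℕ} {u : G → AltForm E r} {u' : G → AltForm E (r + 1)}
    (hu : LocallyIntegrable u μ) (hu' : LocallyIntegrable u' μ) (h : IsWeakExtDer I μ u u')
    {m : G → ℝ} (hm : ContMDiff I 𝓘(ℝ, ℝ) ∞ m) (hs : HasCompactSupport m) (g : G) :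
    ∫ w, extDerSymbol I r (fun a => m (a * w)) g (u w⁻¹) ∂μ = ∫ w, m (g * w) • u' w⁻¹ ∂μ := by
  have : IsTopologicalGroup G := topologicalGroup_of_lieGroup I ∞
  have : LocallyCompactSpace G := Manifold.locallyCompact_of_finiteDimensional I
  -- Above the dimension both sides are zero; otherwise there is a complementary degree l in which
  -- to test.
  by_cases hr : Module.finrank ℝ E < r + 1
  · have h1 : ∀ χ : AltForm E (r + 1), χ = 0 := altForm_eq_zero_of_finrank_lt hr
    rw [h1 (∫ w, extDerSymbol I r (fun a => m (a * w)) g (u w⁻¹) ∂μ), h1 (∫ w, m (g * w) • u' w⁻¹ ∂μ)]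
  obtain ⟨l, hl⟩ : ∃ l, Module.finrank ℝ E = r + (l + 1) := ⟨Module.finrank ℝ E - (r + 1), by omega⟩
  set b : Module.Basis (Fin (r + (l + 1))) ℝ E :=
    (Module.finBasis ℝ E).reindex (finCongr hl) with hb
  obtain ⟨c, hcpos, hcm, hci, hcl⟩ := exists_modulus μ
  obtain ⟨hcs, hcd⟩ := contMDiff_modulus (I := I) μ hcm hci
  -- Inverting the variable replaces u(w⁻¹) by u(w), at the price of the modulus c.
  have hinv : ∀ f : G → AltForm E (r + 1), ∫ w, f w⁻¹ ∂μ = ∫ w, c w • f w ∂μ := by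
    intro f
    have h1 : ∫ w, f w ∂(μ.map Inv.inv) = ∫ w, f w⁻¹ ∂μ :=
      integral_map_equiv (MeasurableEquiv.inv G) f
    rw [← h1, lintegral_inv_eq μ hcs.continuous.measurable hcpos hcm hcl,
      integral_withDensity_eq_integral_toReal_smul hcs.continuous.measurable.ennreal_ofReal (by simp)]
    simp only [ENNReal.toReal_ofReal (hcpos _).le]
  set K : G → ℝ := fun w => c w * m (g * w⁻¹) with hK
  set D : G → E →L[ℝ] ℝ := fun w => leftDerivL I (fun a => m (a * w⁻¹)) g with hD
  have hms : ContMDiff I 𝓘(ℝ, ℝ) ∞ fun w => m (g * w⁻¹) :=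
    hm.comp (contMDiff_const.mul contMDiff_id.inv)
  have hKs : ContMDiff I 𝓘(ℝ, ℝ) ∞ K := hcs.mul hms
  have hmc : HasCompactSupport fun w => m (g * w⁻¹) :=
    hs.comp_homeomorph ((Homeomorph.inv G).trans (Homeomorph.mulLeft g))
  have hKc : HasCompactSupport K := hmc.mul_left
  have hDK : ∀ w, leftDerivL I (fun w => m (g * w⁻¹)) w = -D w := by
    intro w
    have hf : ContMDiff I 𝓘(ℝ, ℝ) ∞ fun a => m (g * a * w⁻¹) :=
      hm.comp ((contMDiff_const.mul contMDiff_id).mul contMDiff_const)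
    have := fderiv_oneParam_inv hf
    simp only [hD, leftDerivL]
    rw [← this]
    simp only [mul_inv_rev, mul_assoc]
  -- The derivative of the modulus contributes K times the trace form: exactly the term produced by
  -- the Leibniz rule of `wedge_algDer`.
  have hdK : ∀ w, leftDerivL I K w = K w • traceForm (adL I G) - c w • D w := by
    intro w
    ext x
    rw [hK, leftDerivL_apply_smul hcs hms, hDK, hcd]
    simp
    ring
  have i1 := hinv fun w => extDerSymbol I r (fun a => m (a * w⁻¹)) g (u w)
  have i2 := hinv fun w => m (g * w⁻¹) • u' w
  simp only [inv_inv] at i1 i2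
  rw [i1, i2]
  set L : G → AltForm E r →L[ℝ] AltForm E (r + 1) := fun w =>
    lineWedgeL r (c w • D w) + K w • algDerL (adL I G) r with hL
  have hL1 : ∀ w, c w • extDerSymbol I r (fun a => m (a * w⁻¹)) g (u w) = L w (u w) := by
    intro w
    simp only [hL, hK, hD, extDerSymbol, map_smul, add_apply,
      smul_apply, smul_add, smul_smul]
  have hcD : ∀ w, c w • D w = K w • traceForm (adL I G) - leftDerivL I K w := fun w => by
    rw [hdK]; abel
  have hLc : Continuous L := by
    simp only [hL, hcD]
    refine Continuous.add ((lineWedgeL (E := E) r).continuous.comp ?_) (hKs.continuous.smul continuous_const)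
    exact (hKs.continuous.smul continuous_const).sub (contMDiff_leftDerivL hKs).continuous
  have hdK0 : ∀ w, w ∉ tsupport K → leftDerivL I K w = 0 := by
    intro w hw
    ext x
    rw [← leftDeriv_eq_leftDerivL (hKs.contMDiffAt.mdifferentiableAt (by simp)),
      leftDeriv_eq_zero I x hw]
    rfl
  have hLs : HasCompactSupport L := by
    refine HasCompactSupport.intro hKc fun w hw => ?_
    simp only [hL, hcD, hdK0 w hw, image_eq_zero_of_notMem_tsupport hw]
    simp only [zero_smul, sub_zero, map_zero]
    ext1 a
    simp
  have hint1 : Integrable (fun w => L w (u w)) μ := integrable_clm_of_compact hLc hLs hu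
  have hint2 : Integrable (fun w => c w • m (g * w⁻¹) • u' w) μ := by
    have := hu'.integrable_smul_left_of_hasCompactSupport hKs.continuous hKc
    simpa only [hK, mul_smul] using this
  simp only [hL1]
  rw [← sub_eq_zero, ← integral_sub hint1 hint2]
  set e : Module.Basis (Fin (r + 1 + l)) ℝ E := b.reindex (finCongr (by omega)) with he
  have hei : (e : Fin (r + 1 + l) → E) = fun i => b (Fin.cast (by omega) i) := by
    funext i; simp [he]
  -- By non-degeneracy it suffices to pair with a constant form c₀, and K c₀ is an admissible test
  -- form in the definition of the weak derivative.
  refine eq_zero_of_wedge_eq_zero e _ fun c₀ => ?_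
  set T : AltForm E (r + 1) →L[ℝ] ℝ :=
    LinearMap.toContinuousLinearMap ((wedgeBilin e).flip c₀) with hT
  have hTa : ∀ a : AltForm E (r + 1), wedge a c₀ e = T a := fun a => rfl
  have hint3 : Integrable (fun w => L w (u w) - c w • m (g * w⁻¹) • u' w) μ := hint1.sub hint2
  rw [hTa, ← ContinuousLinearMap.integral_comp_comm T hint3]
  have hw := h l b (fun w => K w • c₀) (hKs.smul contMDiff_const) hKc.smul_right
  have p1 : ∀ w, wedge (u w) (extDer I (fun w => K w • c₀) w) b = (-1) ^ (r + 1) * T (L w (u w)) := by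
    intro w
    have hK1 : MDifferentiableAt I 𝓘(ℝ, ℝ) K w := hKs.contMDiffAt.mdifferentiableAt (by simp)
    rw [extDer_smul_const hK1]
    have h1 : wedge (u w) (extDerSymbol I l K w c₀) b =
        wedge (u w) (lineWedge (leftDerivL I K w) c₀) b + K w * wedge (u w) (algDer (adL I G) c₀) b := by
      rw [← wedge_smul_right, ← wedge_add_right]
      rfl
    have h2 : L w (u w) = K w • lineWedgeL r (traceForm (adL I G)) (u w) -
        lineWedgeL r (leftDerivL I K w) (u w) + K w • algDer (adL I G) (u w) := by
      simp only [hL, hcD, map_sub, map_smul]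
      rfl
    rw [h1, wedge_lineWedge_comm, wedge_algDer (adL I G) adL_skew _ _ _ (by omega), ← hei, h2,
      map_add, map_sub, map_smul, map_smul]
    simp only [smul_eq_mul, ← hTa, lineWedgeL_apply]
    ring
  have p2 : ∀ w, wedge (u' w) (K w • c₀) (fun i => b (Fin.cast (by omega) i)) =
      T (c w • m (g * w⁻¹) • u' w) := by
    intro w
    rw [← hei, map_smul, map_smul, ← hTa]
    exact (wedge_smul_right _ _ _ _).trans (by simp only [hK, smul_eq_mul]; exact mul_assoc _ _ _)
  simp only [p1] at hw
  rw [integral_const_mul] at hw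
  have hw2 := mul_left_cancel₀ (pow_ne_zero _ (by norm_num)) hw
  simp only [map_sub]
  rw [integral_sub (T.integrable_comp hint1) (T.integrable_comp hint2), hw2, sub_eq_zero]
  exact integral_congr_ae (Filter.Eventually.of_forall p2)

end Regularization

/-! ### Translations and convolutions in dual Lebesgue spaces. -/

section Translation

variable {G : Type*} [TopologicalSpace G] [Group G] [IsTopologicalGroup G] [LocallyCompactSpace G]
  [T2Space G] [SecondCountableTopology G] [MeasurableSpace G] [BorelSpace G]
  (μ : Measure G) [μ.IsHaarMeasure]
  {F : Type*} [NormedAddCommGroup F] [NormedSpace ℝ F]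

/-- Translation preserves the L^q norm, so Hölder bounds the integral over h uniformly in g, and the
compactly supported m is integrable in g. -/
lemma integrable_convolution_mul {p q : ℝ≥0∞} [p.HolderConjugate q] {m a v : G → ℝ}
    (hm : Continuous m) (hs : HasCompactSupport m) (ha : MemLp a p μ) (hv : MemLp v q μ) :
    Integrable (fun z : G × G => m z.1 * (a z.2 * v (z.1⁻¹ * z.2))) (μ.prod μ) := by
  have hmeas : AEStronglyMeasurable (fun z : G × G => m z.1 * (a z.2 * v (z.1⁻¹ * z.2)))
      (μ.prod μ) := by
    refine (hm.aestronglyMeasurable.comp_fst).mul ((ha.1.comp_snd).mul ?_)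
    exact hv.1.comp_quasiMeasurePreserving (quasiMeasurePreserving_inv_mul μ μ)
  have hvg : ∀ g, MemLp (fun h => v (g⁻¹ * h)) q μ := fun g =>
    hv.comp_measurePreserving (measurePreserving_mul_left μ g⁻¹)
  have hi : ∀ g, Integrable (fun h => a h * v (g⁻¹ * h)) μ := fun g => ha.integrable_mul (hvg g)
  refine (integrable_prod_iff hmeas).2 ⟨Filter.Eventually.of_forall fun g => (hi g).const_mul (m g), ?_⟩
  refine Integrable.mono' (g := fun g => ‖m g‖ * (eLpNorm a p μ * eLpNorm v q μ).toReal)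
    ((hm.integrable_of_hasCompactSupport hs).norm.mul_const _) hmeas.norm.integral_prod_right' ?_
  refine Filter.Eventually.of_forall fun g => ?_
  simp only [norm_mul, integral_const_mul]
  rw [norm_norm]
  refine mul_le_mul_of_nonneg_left ?_ (norm_nonneg _)
  rw [Real.norm_of_nonneg (integral_nonneg fun _ => by positivity)]
  have h1 : ∫ h, ‖a h‖ * ‖v (g⁻¹ * h)‖ ∂μ = (eLpNorm (fun h => a h * v (g⁻¹ * h)) 1 μ).toReal := by
    rw [eLpNorm_one_eq_lintegral_enorm, ← integral_norm_eq_lintegral_enorm (hi g).1]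
    simp only [norm_mul]
  rw [h1]
  refine ENNReal.toReal_mono (ENNReal.mul_ne_top ha.eLpNorm_ne_top hv.eLpNorm_ne_top) ?_
  have h2 := eLpNorm_smul_le_mul_eLpNorm (p := p) (q := q) (r := 1) (hvg g).1 ha.1
  have h3 : eLpNorm (fun h => v (g⁻¹ * h)) q μ = eLpNorm v q μ :=
    eLpNorm_comp_measurePreserving hv.1 (measurePreserving_mul_left μ g⁻¹)
  rw [h3] at h2
  exact h2

lemma integrable_convolution_clm {p q : ℝ≥0∞} [p.HolderConjugate q] {m : G → ℝ}
    {A : G → F →L[ℝ] ℝ} {u : G → F}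
    (hm : Continuous m) (hs : HasCompactSupport m) (hA : MemLp A p μ) (hu : MemLp u q μ) :
    Integrable (fun z : G × G => m z.1 * A z.2 (u (z.1⁻¹ * z.2))) (μ.prod μ) := by
  refine (integrable_convolution_mul (p := p) (q := q) μ hm hs hA.norm hu.norm).mono ?_ ?_
  · refine (hm.aestronglyMeasurable.comp_fst).mul ?_
    exact (ContinuousLinearMap.id ℝ (F →L[ℝ] ℝ)).aestronglyMeasurable_comp₂ hA.1.comp_snd
      (hu.1.comp_quasiMeasurePreserving (quasiMeasurePreserving_inv_mul μ μ))
  · refine Filter.Eventually.of_forall fun z => ?_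
    simp only [norm_mul, norm_norm]
    exact mul_le_mul_of_nonneg_left ((A z.2).le_opNorm _) (norm_nonneg _)

/-- Continuity of translation, in the weak sense. -/
lemma continuous_integral_translate {p q : ℝ≥0∞} [p.HolderConjugate q] (hq1 : 1 ≤ q) (hp1 : 1 ≤ p)
    (hq : q ≠ ⊤) {A : G → F →L[ℝ] ℝ} {u : G → F} (hA : MemLp A p μ) (hu : MemLp u q μ) :
    Continuous fun g => ∫ h, A h (u (g⁻¹ * h)) ∂μ := by
  have : Fact (1 ≤ q) := ⟨hq1⟩
  have : Fact (1 ≤ p) := ⟨hp1⟩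
  have : Fact (q ≠ ⊤) := ⟨hq⟩
  have h1 : ∀ g, ∫ h, A h (u (g⁻¹ * h)) ∂μ =
      (ContinuousLinearMap.id ℝ (F →L[ℝ] ℝ)).lpPairing μ p q hA.toLp
        (DomMulAct.mk g⁻¹ • hu.toLp) := by
    intro g
    rw [ContinuousLinearMap.lpPairing_eq_integral]
    refine integral_congr_ae ?_
    have h2 := (measurePreserving_mul_left μ g⁻¹).quasiMeasurePreserving.ae_eq_comp hu.coeFn_toLp
    filter_upwards [hA.coeFn_toLp, DomMulAct.smul_Lp_ae_eq (DomMulAct.mk g⁻¹) hu.toLp, h2]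
      with h e1 e2 e3
    rw [e1, e2]
    simp only [Function.comp_apply] at e3
    simp [e3]
  simp only [h1]
  refine ((ContinuousLinearMap.id ℝ (F →L[ℝ] ℝ)).lpPairing μ p q hA.toLp).continuous.comp ?_
  have hc : Continuous fun g : G => DomMulAct.mk g⁻¹ :=
    DomMulAct.continuous_mk.comp continuous_inv
  exact hc.smul continuous_const

end Translation

/-! ### Integrability of compactly supported kernels on a product. -/

section ProductIntegrability

variable {X Y F F' : Type*} [TopologicalSpace X] [TopologicalSpace Y] [T2Space X] [T2Space Y]
  [SecondCountableTopology X] [SecondCountableTopology Y]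
  [MeasurableSpace X] [MeasurableSpace Y] [BorelSpace X] [BorelSpace Y]
  [NormedAddCommGroup F] [NormedSpace ℝ F] [NormedAddCommGroup F'] [NormedSpace ℝ F']

lemma integrable_prod_of_compact {μ : Measure X} {ν : Measure Y} [SFinite μ] [SFinite ν]
    {k : X × Y → F →L[ℝ] F'} (hk : Continuous k) (hs : HasCompactSupport k) {A : X → F' →L[ℝ] ℝ}
    {u : Y → F} (hA : LocallyIntegrable A μ) (hu : LocallyIntegrable u ν) :
    Integrable (fun z => A z.1 (k z (u z.2))) (μ.prod ν) := by
  obtain ⟨C, hC⟩ := hk.bounded_above_of_compact_support hs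
  set K₁ := Prod.fst '' tsupport k
  set K₂ := Prod.snd '' tsupport k
  have hK₁ : IsCompact K₁ := hs.isCompact.image continuous_fst
  have hK₂ : IsCompact K₂ := hs.isCompact.image continuous_snd
  have h1 : Integrable (K₁.indicator fun x => ‖A x‖) μ :=
    (integrable_indicator_iff hK₁.measurableSet).2 (hA.integrableOn_isCompact hK₁).norm
  have h2 : Integrable (K₂.indicator fun y => ‖u y‖) ν :=
    (integrable_indicator_iff hK₂.measurableSet).2 (hu.integrableOn_isCompact hK₂).norm
  refine ((h1.mul_prod h2).const_mul C).mono' ?_ (Filter.Eventually.of_forall fun z => ?_)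
  · exact (ContinuousLinearMap.id ℝ (F' →L[ℝ] ℝ)).aestronglyMeasurable_comp₂
      hA.aestronglyMeasurable.comp_fst ((ContinuousLinearMap.id ℝ (F →L[ℝ] F')).aestronglyMeasurable_comp₂
        hk.aestronglyMeasurable hu.aestronglyMeasurable.comp_snd)
  · by_cases hz : z ∈ tsupport k
    · rw [indicator_of_mem (mem_image_of_mem _ hz), indicator_of_mem (mem_image_of_mem _ hz)]
      refine ((A z.1).le_opNorm _).trans ?_
      calc ‖A z.1‖ * ‖k z (u z.2)‖ ≤ ‖A z.1‖ * (C * ‖u z.2‖) :=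
            mul_le_mul_of_nonneg_left ((k z).le_of_opNorm_le (hC z) _) (norm_nonneg _)
        _ = C * (‖A z.1‖ * ‖u z.2‖) := by ring
    · have hC0 : 0 ≤ C := (norm_nonneg _).trans (hC z)
      rw [image_eq_zero_of_notMem_tsupport hz]
      simp only [zero_apply, map_zero, norm_zero]
      refine mul_nonneg hC0 (mul_nonneg ?_ ?_) <;> exact indicator_nonneg (fun _ _ => norm_nonneg _) _

end ProductIntegrability

/-! ### Stokes' formula for a smoothed and cut-off form. -/

section Green

instance instContinuousENormAltFormDual {E : Type*} [NormedAddCommGroup E] [NormedSpace ℝ E]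
    (k : ℕ) : ContinuousENorm (AltForm E k →L[ℝ] ℝ) :=
  @SeminormedAddGroup.toContinuousENorm (AltForm E k →L[ℝ] ℝ) inferInstance

variable {E : Type*} [NormedAddCommGroup E] [NormedSpace ℝ E] [FiniteDimensional ℝ E]
  {M : Type*} [TopologicalSpace M] (I : ModelWithCorners ℝ E M) [I.Boundaryless]
  {G : Type*} [TopologicalSpace G] [ChartedSpace M G] [Group G] [LieGroup I ∞ G]
  [T2Space G] [SecondCountableTopology G] [MeasurableSpace G] [BorelSpace G]
  (μ : Measure G) [μ.IsHaarMeasure]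
  {F : Type*} [NormedAddCommGroup F] [NormedSpace ℝ F]

/-- Inversion turns Haar measure into its multiple by the modulus, a continuous density, and
preserves compact sets. -/
lemma locallyIntegrable_comp_inv [hI : LieGroup I ∞ G] {u : G → F} (hu : LocallyIntegrable u μ) :
    LocallyIntegrable (fun w => u w⁻¹) μ := by
  have : IsTopologicalGroup G := topologicalGroup_of_lieGroup I ∞
  have : LocallyCompactSpace G := Manifold.locallyCompact_of_finiteDimensional I
  obtain ⟨c, hcpos, hcm, hci, hcl⟩ := exists_modulus μ
  have hcc := (contMDiff_modulus (I := I) μ hcm hci).1.continuous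
  refine locallyIntegrable_iff.2 fun K hK => ?_
  have hKi : IsCompact ((MeasurableEquiv.inv G) ⁻¹' K) := by
    have : (MeasurableEquiv.inv G) ⁻¹' K = K⁻¹ := rfl
    rw [this]; exact hK.inv
  have h1 := integrableOn_map_equiv (MeasurableEquiv.inv G) (f := u) (μ := μ)
    (s := (MeasurableEquiv.inv G) ⁻¹' K)
  have h2 : (MeasurableEquiv.inv G) ⁻¹' ((MeasurableEquiv.inv G) ⁻¹' K) = K := by
    ext x; simp
  rw [h2] at h1
  refine h1.1 ?_
  have h3 : Measure.map (MeasurableEquiv.inv G) μ = _ :=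
    lintegral_inv_eq μ hcc.measurable hcpos hcm hcl
  rw [h3, IntegrableOn, restrict_withDensity hKi.measurableSet,
    integrable_withDensity_iff_integrable_smul' hcc.measurable.ennreal_ofReal (by simp)]
  simp only [ENNReal.toReal_ofReal (hcpos _).le]
  exact (hu.continuous_smul hcc).integrableOn_isCompact hKi

/-- Makes the symbol an admissible kernel for `integrable_prod_of_compact`, which justifies Fubini
in `integral_cutoff_convolution`. -/
lemma continuous_extDerSymbol_prod {k : ℕ} {f : G × G → ℝ}
    (hf : ContMDiff (I.prod I) 𝓘(ℝ, ℝ) ∞ f) (hs : HasCompactSupport f) :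
    Continuous (fun z : G × G => extDerSymbol I k (fun a => f (a, z.2)) z.1) ∧
    HasCompactSupport (fun z : G × G => extDerSymbol I k (fun a => f (a, z.2)) z.1) := by
  have hd : Continuous fun z : G × G => leftDerivL I (fun a => f (a, z.2)) z.1 := by
    rw [continuous_iff_continuousAt]
    intro z
    have h1 : ContMDiffAt (𝓘(ℝ, E).prod (I.prod I)) 𝓘(ℝ, ℝ) ∞
        (fun x : E × (G × G) => f (x.2.1 * oneParam I G x.1, x.2.2)) (oneCoord I G, z) := by
      refine hf.contMDiffAt.comp _ (ContMDiffAt.prodMk ?_ ?_)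
      · exact (contMDiffAt_fst.comp _ contMDiffAt_snd).mul
          (contMDiffAt_oneParam_oneCoord.comp (oneCoord I G, z) contMDiffAt_fst)
      · exact contMDiffAt_snd.comp _ contMDiffAt_snd
    exact ContinuousAt.comp (f := fun z => (oneCoord I G, z)) h1.fderiv_fst.continuousAt
      (by fun_prop)
  constructor
  · have h1 : Continuous fun z : G × G =>
        lineWedgeL k (leftDerivL I (fun a => f (a, z.2)) z.1) := (lineWedgeL k).continuous.comp hd
    exact h1.add (hf.continuous.smul continuous_const)
  · refine HasCompactSupport.intro hs fun z hz => ?_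
    have h0 : f =ᶠ[𝓝 z] fun _ => 0 := notMem_tsupport_iff_eventuallyEq.1 hz
    have h1 : (fun a => f (a, z.2)) =ᶠ[𝓝 z.1] fun _ => 0 := by
      have hc : ContinuousAt (fun a : G => (a, z.2)) z.1 := by fun_prop
      exact hc.eventually h0
    have : IsTopologicalGroup G := topologicalGroup_of_lieGroup I ∞
    have h2 : leftDerivL I (fun a => f (a, z.2)) z.1 = 0 := by
      have hc : ContinuousAt (fun w => z.1 * oneParam I G w) (oneCoord I G) :=
        continuousAt_const.mul contMDiffAt_oneParam_oneCoord.continuousAt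
      have h3 : (fun w => f (z.1 * oneParam I G w, z.2)) =ᶠ[𝓝 (oneCoord I G)] fun _ => 0 := by
        have h4 : ∀ᶠ a in 𝓝 (z.1 * oneParam I G (oneCoord I G)), f (a, z.2) = 0 := by
          rw [oneParam_oneCoord, mul_one]; exact h1
        exact hc.eventually h4
      rw [leftDerivL, h3.fderiv_eq, fderiv_fun_const]; rfl
    ext1 a
    have h5 : f (z.1, z.2) = 0 := h1.self_of_nhds
    rw [extDerSymbol_apply, h2, h5, zero_smul, add_zero]
    exact congrArg (fun T => T a) (map_zero (lineWedgeL (E := E) k))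

variable {r : ℕ} {u : G → AltForm E r} {u' : G → AltForm E (r + 1)}
  {A : G → AltForm E r →L[ℝ] ℝ} {B : G → AltForm E (r + 1) →L[ℝ] ℝ}

lemma integrable_test_smul_inv {F : Type*} [NormedAddCommGroup F] [NormedSpace ℝ F] {u : G → F}
    (hu : LocallyIntegrable u μ) {m : G → ℝ} (hm : ContMDiff I 𝓘(ℝ, ℝ) ∞ m)
    (hs : HasCompactSupport m) (h : G) : Integrable (fun w => m (h * w) • u w⁻¹) μ := by
  have : IsTopologicalGroup G := topologicalGroup_of_lieGroup I ∞
  exact (locallyIntegrable_comp_inv I μ hu).integrable_smul_left_of_hasCompactSupport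
    (hm.continuous.comp (continuous_const.mul continuous_id))
    (hs.comp_homeomorph (Homeomorph.mulLeft h))

/-- Stokes' formula for a form convolved with a test function and cut off by another one. -/
lemma integral_cutoff_convolution (hA : LocallyIntegrable A μ) (hB : LocallyIntegrable B μ)
    (hAB : ∀ f : G → ℝ, ContMDiff I 𝓘(ℝ, ℝ) ∞ f → HasCompactSupport f → ∀ a : AltForm E r,
      ∫ g, f g * A g a ∂μ = ∫ g, B g (extDerSymbol I r f g a) ∂μ)
    (hu : LocallyIntegrable u μ) (hu' : LocallyIntegrable u' μ) (h : IsWeakExtDer I μ u u')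
    {χ m : G → ℝ} (hχ : ContMDiff I 𝓘(ℝ, ℝ) ∞ χ) (hχs : HasCompactSupport χ)
    (hm : ContMDiff I 𝓘(ℝ, ℝ) ∞ m) (hms : HasCompactSupport m) :
    ∫ g, χ g * A g (∫ w, m (g * w) • u w⁻¹ ∂μ) ∂μ =
      ∫ g, B g (lineWedge (leftDerivL I χ g) (∫ w, m (g * w) • u w⁻¹ ∂μ)) +
        χ g * B g (∫ w, m (g * w) • u' w⁻¹ ∂μ) ∂μ := by
  have : IsTopologicalGroup G := topologicalGroup_of_lieGroup I ∞
  have : LocallyCompactSpace G := Manifold.locallyCompact_of_finiteDimensional I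
  -- For fixed w the function f(·, w) is a test function and u(w⁻¹) a constant form, so `hAB`
  -- applies to their product. Integrating over w and exchanging integrals gives the formula for the
  -- convolution.
  set f : G × G → ℝ := fun z => χ z.1 * m (z.1 * z.2) with hf
  have hfs : ContMDiff (I.prod I) 𝓘(ℝ, ℝ) ∞ f :=
    (hχ.comp contMDiff_fst).mul (hm.comp (contMDiff_fst.mul contMDiff_snd))
  have hfc : HasCompactSupport f := by
    refine HasCompactSupport.intro (K := (fun z : G × G => (z.1, z.1⁻¹ * z.2)) ''
      (tsupport χ ×ˢ tsupport m)) ((hχs.isCompact.prod hms.isCompact).image (by fun_prop))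
      fun z hz => ?_
    by_contra hne
    obtain ⟨h1, h2⟩ := mul_ne_zero_iff.1 hne
    exact hz ⟨(z.1, z.1 * z.2), ⟨subset_tsupport _ h1, subset_tsupport _ h2⟩, by simp⟩
  have hui := locallyIntegrable_comp_inv I μ hu
  have hfw : ∀ w, ContMDiff I 𝓘(ℝ, ℝ) ∞ fun a => f (a, w) := fun w =>
    hfs.comp (contMDiff_id.prodMk contMDiff_const)
  have hfwc : ∀ w, HasCompactSupport fun a => f (a, w) := fun w => hχs.mul_right
  have hmw : ∀ w, ContMDiff I 𝓘(ℝ, ℝ) ∞ fun a => m (a * w) := fun w =>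
    hm.comp (contMDiff_id.mul contMDiff_const)
  have e1 : ∀ g, χ g * A g (∫ w, m (g * w) • u w⁻¹ ∂μ) = ∫ w, f (g, w) * A g (u w⁻¹) ∂μ := by
    intro g
    rw [← ContinuousLinearMap.integral_comp_comm _ (integrable_test_smul_inv I μ hu hm hms g),
      ← integral_const_mul]
    refine integral_congr_ae (Filter.Eventually.of_forall fun w => ?_)
    simp only [hf, map_smul, smul_eq_mul]
    ring
  obtain ⟨k1, k2⟩ := continuous_extDerSymbol_prod I (k := r) hfs hfc
  have i1 : Integrable (fun z : G × G => f z * A z.1 (u z.2⁻¹)) (μ.prod μ) := by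
    have := integrable_prod_of_compact (k := fun z => f z • ContinuousLinearMap.id ℝ (AltForm E r))
      (hfs.continuous.smul continuous_const) hfc.smul_right hA hui
    simpa using this
  have i2 := integrable_prod_of_compact k1 k2 hB hui
  have e2 : ∀ g, ∫ w, B g (extDerSymbol I r (fun a => f (a, w)) g (u w⁻¹)) ∂μ =
      B g (lineWedge (leftDerivL I χ g) (∫ w, m (g * w) • u w⁻¹ ∂μ)) +
        χ g * B g (∫ w, m (g * w) • u' w⁻¹ ∂μ) := by
    intro g
    have j1 := integrable_test_smul_inv I μ hu hm hms g
    have j2 := integrable_test_smul_inv I μ hu' hm hms g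
    have j3 : Integrable (fun w => extDerSymbol I r (fun a => f (a, w)) g (u w⁻¹)) μ := by
      have hc : Continuous fun w : G => (g, w) := by fun_prop
      refine integrable_clm_of_compact (k1.comp hc) ?_ hui
      refine HasCompactSupport.intro (k2.isCompact.image continuous_snd) fun w hw => ?_
      exact image_eq_zero_of_notMem_tsupport (f := fun z : G × G =>
        extDerSymbol I r (fun a => f (a, z.2)) z.1) (x := (g, w)) fun hcon => hw ⟨(g, w), hcon, rfl⟩
    have e3 : ∀ w, extDerSymbol I r (fun a => f (a, w)) g (u w⁻¹) =
        lineWedgeL r (leftDerivL I χ g) (m (g * w) • u w⁻¹) +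
          χ g • extDerSymbol I r (fun a => m (a * w)) g (u w⁻¹) := fun w =>
      extDerSymbol_mul hχ (hmw w) g (u w⁻¹)
    have e4 := integral_extDerSymbol μ hu hu' h hm hms g
    -- The integral must be split into two summands. Where χ(g) ≠ 0, dividing by it gives the
    -- integrability of the second; where χ(g) = 0 that summand is absent.
    by_cases hχ0 : χ g = 0
    · rw [ContinuousLinearMap.integral_comp_comm _ j3]
      simp only [e3, hχ0, zero_smul, add_zero, zero_mul]
      rw [ContinuousLinearMap.integral_comp_comm _ j1]
      rfl
    · have j4 : Integrable (fun w => extDerSymbol I r (fun a => m (a * w)) g (u w⁻¹)) μ := by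
        have := (j3.sub ((lineWedgeL r (leftDerivL I χ g)).integrable_comp j1)).smul (χ g)⁻¹
        refine this.congr (Filter.Eventually.of_forall fun w => ?_)
        simp [e3, smul_smul, hχ0]
      rw [ContinuousLinearMap.integral_comp_comm _ j3]
      simp only [e3]
      have j5 : Integrable (fun w => χ g • extDerSymbol I r (fun a => m (a * w)) g (u w⁻¹)) μ :=
        j4.smul (χ g)
      rw [integral_add ((lineWedgeL r (leftDerivL I χ g)).integrable_comp j1) j5, integral_smul, e4, ContinuousLinearMap.integral_comp_comm _ j1, map_add, map_smul]
      rfl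
  simp only [e1, ← e2]
  rw [integral_integral_swap (f := fun g w => f (g, w) * A g (u w⁻¹)) i1,
    integral_integral_swap (f := fun g w => B g (extDerSymbol I r (fun a => f (a, w)) g (u w⁻¹))) i2]
  exact integral_congr_ae (Filter.Eventually.of_forall fun w => hAB _ (hfw w) (hfwc w) _)

end Green

section Bilinear

variable {U V W : Type*} [NormedAddCommGroup U] [NormedSpace ℝ U] [NormedAddCommGroup V]
  [NormedSpace ℝ V] [NormedAddCommGroup W] [NormedSpace ℝ W]

lemma exists_bound_bilin (L : U →L[ℝ] V →L[ℝ] W) : ∃ K, 0 ≤ K ∧ ∀ x y, ‖L x y‖ ≤ K * ‖x‖ * ‖y‖ :=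
  ⟨‖L‖, norm_nonneg L, L.le_opNorm₂⟩

lemma aestronglyMeasurable_clm_apply {X : Type*} [MeasurableSpace X] {μ : Measure X}
    {B : X → V →L[ℝ] W} {v : X → V} (hB : AEStronglyMeasurable B μ) (hv : AEStronglyMeasurable v μ) :
    AEStronglyMeasurable (fun x => B x (v x)) μ :=
  (ContinuousLinearMap.id ℝ (V →L[ℝ] W)).aestronglyMeasurable_comp₂ hB hv

lemma aestronglyMeasurable_bilin_apply {X : Type*} [MeasurableSpace X] {μ : Measure X}
    (L : U →L[ℝ] V →L[ℝ] W) {x : X → U} {v : X → V} (hx : AEStronglyMeasurable x μ)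
    (hv : AEStronglyMeasurable v μ) : AEStronglyMeasurable (fun z => L (x z) (v z)) μ :=
  L.aestronglyMeasurable_comp₂ hx hv

end Bilinear

/-! ### Stokes' formula for dual Lebesgue exponents. -/

section GreenFormula

variable {E : Type*} [NormedAddCommGroup E] [NormedSpace ℝ E] [FiniteDimensional ℝ E]
  {M : Type*} [TopologicalSpace M] (I : ModelWithCorners ℝ E M) [I.Boundaryless]
  {G : Type*} [TopologicalSpace G] [ChartedSpace M G] [Group G] [LieGroup I ∞ G]
  [T2Space G] [SecondCountableTopology G] [MeasurableSpace G] [BorelSpace G]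
  (μ : Measure G) [μ.IsHaarMeasure]
  {p q : ℝ≥0∞} [p.HolderConjugate q]

section Convolution

variable {F : Type*} [NormedAddCommGroup F] [NormedSpace ℝ F] [CompleteSpace F]
  {m : G → ℝ} {A : G → F →L[ℝ] ℝ} {u : G → F}

lemma integral_test_smul_translate [IsTopologicalGroup G] (m : G → ℝ) (u : G → F) (h : G) :
    ∫ g, m g • u (g⁻¹ * h) ∂μ = ∫ w, m (h * w) • u w⁻¹ ∂μ := by
  rw [← integral_mul_left_eq_self (fun g => m g • u (g⁻¹ * h)) h]
  simp

/-- Fubini: averaging the pairing of A with the translates of u against m amounts to pairing A with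
the smoothed form. -/
lemma integral_convolution_pairing (hm : ContMDiff I 𝓘(ℝ, ℝ) ∞ m) (hs : HasCompactSupport m)
    (hq : 1 ≤ q) (hA : MemLp A p μ) (hu : MemLp u q μ) :
    Integrable (fun h => A h (∫ w, m (h * w) • u w⁻¹ ∂μ)) μ ∧
    ∫ g, m g * ∫ h, A h (u (g⁻¹ * h)) ∂μ ∂μ = ∫ h, A h (∫ w, m (h * w) • u w⁻¹ ∂μ) ∂μ := by
  have : IsTopologicalGroup G := topologicalGroup_of_lieGroup I ∞
  have : LocallyCompactSpace G := Manifold.locallyCompact_of_finiteDimensional I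
  have h1 := integrable_convolution_clm μ hm.continuous hs hA hu
  have h2 : ∀ h, ∫ g, m g * A h (u (g⁻¹ * h)) ∂μ = A h (∫ w, m (h * w) • u w⁻¹ ∂μ) := by
    intro h
    rw [← ContinuousLinearMap.integral_comp_comm _
      (integrable_test_smul_inv I μ (hu.locallyIntegrable hq) hm hs h)]
    have := integral_mul_left_eq_self (μ := μ) (fun g => m g * A h (u (g⁻¹ * h))) h
    rw [← this]
    simp
  refine ⟨?_, ?_⟩
  · have := h1.integral_prod_right
    simpa only [h2] using this
  · simp only [← integral_const_mul, ← h2]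
    exact integral_integral_swap (f := fun g h => m g * A h (u (g⁻¹ * h))) h1

/-- Supplies the dominating function for the terms containing a derivative of the cut-off, for which
the value of the functional alone gives no bound. -/
lemma integrable_norm_mul_norm_convolution {F' : Type*} [NormedAddCommGroup F'] {A : G → F'}
    (hm : ContMDiff I 𝓘(ℝ, ℝ) ∞ m)
    (hs : HasCompactSupport m) (hA : MemLp A p μ) (hu : MemLp u q μ) :
    Integrable (fun h => ‖A h‖ * ‖∫ w, m (h * w) • u w⁻¹ ∂μ‖) μ ∧
    AEStronglyMeasurable (fun h => ∫ w, m (h * w) • u w⁻¹ ∂μ) μ := by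
  have : IsTopologicalGroup G := topologicalGroup_of_lieGroup I ∞
  have : LocallyCompactSpace G := Manifold.locallyCompact_of_finiteDimensional I
  have hmeas : AEStronglyMeasurable (fun h => ∫ w, m (h * w) • u w⁻¹ ∂μ) μ := by
    simp only [← integral_test_smul_translate]
    refine AEStronglyMeasurable.integral_prod_right' (f := fun z : G × G => m z.2 • u (z.2⁻¹ * z.1)) ?_
    exact hm.continuous.aestronglyMeasurable.comp_snd.smul
      (hu.1.comp_quasiMeasurePreserving (quasiMeasurePreserving_inv_mul_swap μ μ))
  refine ⟨?_, hmeas⟩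
  have h1 := (integrable_convolution_mul (p := p) (q := q) μ hm.continuous.norm hs.norm hA.norm
    hu.norm).integral_prod_right
  refine h1.mono' (hA.1.norm.mul hmeas.norm) (Filter.Eventually.of_forall fun h => ?_)
  rw [norm_mul, norm_norm, norm_norm, ← integral_test_smul_translate]
  have h2 : ∫ g, ‖m g‖ * (‖A h‖ * ‖u (g⁻¹ * h)‖) ∂μ = ‖A h‖ * ∫ g, ‖m g • u (g⁻¹ * h)‖ ∂μ := by
    rw [← integral_const_mul]
    refine integral_congr_ae (Filter.Eventually.of_forall fun g => ?_)
    simp only [norm_smul]; ring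
  rw [h2]
  exact mul_le_mul_of_nonneg_left (norm_integral_le_integral_norm _) (norm_nonneg _)

end Convolution

variable {r : ℕ} {u : G → AltForm E r} {u' : G → AltForm E (r + 1)}
  {A : G → AltForm E r →L[ℝ] ℝ} {B : G → AltForm E (r + 1) →L[ℝ] ℝ}

/-- Stokes' formula for an `L^p` functional and a form that is in `L^q` together with its
exterior derivative: no compactness of supports is required. -/
theorem integral_eq_of_isWeakExtDer (hp : 1 ≤ p) (hq : 1 ≤ q) (hqt : q ≠ ⊤)
    (hA : MemLp A p μ) (hB : MemLp B p μ)
    (hAB : ∀ f : G → ℝ, ContMDiff I 𝓘(ℝ, ℝ) ∞ f → HasCompactSupport f → ∀ a : AltForm E r,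
      ∫ g, f g * A g a ∂μ = ∫ g, B g (extDerSymbol I r f g a) ∂μ)
    (hu : MemLp u q μ) (hu' : MemLp u' q μ) (h : IsWeakExtDer I μ u u') :
    ∫ g, A g (u g) ∂μ = ∫ g, B g (u' g) ∂μ := by
  have : IsTopologicalGroup G := topologicalGroup_of_lieGroup I ∞
  have : LocallyCompactSpace G := Manifold.locallyCompact_of_finiteDimensional I
  have hAl := hA.locallyIntegrable hp
  have hBl := hB.locallyIntegrable hp
  have hul := hu.locallyIntegrable hq
  have hul' := hu'.locallyIntegrable hq
  -- The formula for the smoothed form: in the cut-off formula the functions χ_n tend to 1 and their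
  -- derivatives to 0, both boundedly, so dominated convergence removes the cut-off.
  have key : ∀ m : G → ℝ, ContMDiff I 𝓘(ℝ, ℝ) ∞ m → HasCompactSupport m →
      ∫ g, A g (∫ w, m (g * w) • u w⁻¹ ∂μ) ∂μ = ∫ g, B g (∫ w, m (g * w) • u' w⁻¹ ∂μ) ∂μ := by
    intro m hm hms
    obtain ⟨χ, C, hχ, hχs, hχb, hχd, hχl, hχdl⟩ := exists_cutoff I G
    have hC : 0 ≤ C := (norm_nonneg _).trans (hχb 0 1)
    obtain ⟨i1, -⟩ := integral_convolution_pairing I μ hm hms hq hA hu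
    obtain ⟨i2, -⟩ := integral_convolution_pairing I μ hm hms hq hB hu'
    obtain ⟨i3, m3⟩ := integrable_norm_mul_norm_convolution (A := B) I μ hm hms hB hu
    set φ : G → AltForm E r := fun g => ∫ w, m (g * w) • u w⁻¹ ∂μ with hφ
    set ψ : G → AltForm E (r + 1) := fun g => ∫ w, m (g * w) • u' w⁻¹ ∂μ with hψ
    obtain ⟨K, hK0, hK⟩ := exists_bound_bilin (lineWedgeL (E := E) r)
    have t1 : Filter.Tendsto (fun n => ∫ g, χ n g * A g (φ g) ∂μ) Filter.atTop
        (𝓝 (∫ g, A g (φ g) ∂μ)) := by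
      refine tendsto_integral_of_dominated_convergence (fun g => C * ‖A g (φ g)‖)
        (fun n => (hχ n).continuous.aestronglyMeasurable.mul i1.1) (i1.norm.const_mul C)
        (fun n => Filter.Eventually.of_forall fun g => ?_)
        (Filter.Eventually.of_forall fun g => ?_)
      · rw [norm_mul]
        exact mul_le_mul_of_nonneg_right (hχb n g) (norm_nonneg _)
      · simpa using (hχl g).mul_const (A g (φ g))
    have t2 : Filter.Tendsto (fun n => ∫ g, B g (lineWedgeL r (leftDerivL I (χ n) g) (φ g)) +
        χ n g * B g (ψ g) ∂μ) Filter.atTop (𝓝 (∫ g, B g (ψ g) ∂μ)) := by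
      refine tendsto_integral_of_dominated_convergence
        (fun g => K * C * (‖B g‖ * ‖φ g‖) + C * ‖B g (ψ g)‖)
        (fun n => AEStronglyMeasurable.add ?_ ((hχ n).continuous.aestronglyMeasurable.mul i2.1))
        ((i3.const_mul _).add (i2.norm.const_mul C))
        (fun n => Filter.Eventually.of_forall fun g => ?_)
        (Filter.Eventually.of_forall fun g => ?_)
      · exact aestronglyMeasurable_clm_apply hB.1 (aestronglyMeasurable_bilin_apply
          (lineWedgeL (E := E) r) (contMDiff_leftDerivL (hχ n)).continuous.aestronglyMeasurable m3)
      · refine (norm_add_le _ _).trans (add_le_add ?_ ?_)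
        · refine ((B g).le_opNorm _).trans ?_
          have h1 := hK (leftDerivL I (χ n) g) (φ g)
          calc ‖B g‖ * ‖lineWedgeL r (leftDerivL I (χ n) g) (φ g)‖
              ≤ ‖B g‖ * (K * C * ‖φ g‖) := by
                refine mul_le_mul_of_nonneg_left (h1.trans ?_) (ContinuousLinearMap.opNorm_nonneg _)
                gcongr
                exact hχd n g
            _ = _ := by ring
        · rw [norm_mul]
          exact mul_le_mul_of_nonneg_right (hχb n g) (norm_nonneg _)
      · have h1 : Filter.Tendsto (fun n => B g (lineWedgeL r (leftDerivL I (χ n) g) (φ g)))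
            Filter.atTop (𝓝 (B g ((lineWedgeL r).flip (φ g) 0))) :=
          ((B g).continuous.tendsto _).comp
            ((((lineWedgeL (E := E) r).flip (φ g)).continuous.tendsto 0).comp (hχdl g))
        have h2 := h1.add ((hχl g).mul_const (B g (ψ g)))
        simpa using h2
    have e : ∀ n, ∫ g, χ n g * A g (φ g) ∂μ =
        ∫ g, B g (lineWedgeL r (leftDerivL I (χ n) g) (φ g)) + χ n g * B g (ψ g) ∂μ := fun n =>
      integral_cutoff_convolution I μ hAl hBl hAB hul hul' h (hχ n) (hχs n) hm hms
    simp only [e] at t1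
    exact tendsto_nhds_unique t1 t2
  -- Φ is continuous and by `key` orthogonal to every test function, hence zero everywhere. Its
  -- value at the identity is the assertion, so no approximation of u by its convolutions is needed.
  set Φ : G → ℝ := fun g => ∫ h, A h (u (g⁻¹ * h)) ∂μ - ∫ h, B h (u' (g⁻¹ * h)) ∂μ with hΦ
  have c1 := continuous_integral_translate μ hq hp hqt hA hu
  have c2 := continuous_integral_translate μ hq hp hqt hB hu'
  have hΦc : Continuous Φ := c1.sub c2
  have h0 : Φ = fun _ => 0 := by
    refine (Continuous.ae_eq_iff_eq μ hΦc continuous_const).1 ?_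
    refine ae_eq_zero_of_integral_contMDiff_smul_eq_zero I hΦc.locallyIntegrable ?_
    intro m hm hms
    obtain ⟨-, j1⟩ := integral_convolution_pairing I μ hm hms hq hA hu
    obtain ⟨-, j2⟩ := integral_convolution_pairing I μ hm hms hq hB hu'
    have k1 : Integrable (fun g => m g * ∫ h, A h (u (g⁻¹ * h)) ∂μ) μ :=
      (hm.continuous.mul c1).integrable_of_hasCompactSupport hms.mul_right
    have k2 : Integrable (fun g => m g * ∫ h, B h (u' (g⁻¹ * h)) ∂μ) μ :=
      (hm.continuous.mul c2).integrable_of_hasCompactSupport hms.mul_right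
    simp only [hΦ, smul_eq_mul, mul_sub]
    rw [integral_sub k1 k2, j1, j2, key m hm hms, sub_self]
  have h1 := congrFun h0 1
  simp only [hΦ, inv_one, one_mul, sub_eq_zero] at h1
  exact h1

end GreenFormula

/-! ### Growth of the orbits of generalized eigenvectors in the past. -/

section Growth

variable {V : Type*} [AddCommGroup V] [Module ℝ V]

/-- The complex-linear extension of a real linear form. -/
def complexify (l : V →ₗ[ℝ] ℝ) : ℂ ⊗[ℝ] V →ₗ[ℂ] ℂ :=
  (TensorProduct.AlgebraTensorModule.rid ℝ ℂ ℂ).toLinearMap ∘ₗ l.baseChange ℂ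

lemma complexify_tmul (l : V →ₗ[ℝ] ℝ) (z : ℂ) (v : V) : complexify l (z ⊗ₜ v) = l v • z := by
  simp [complexify]

lemma tensorRe_tmul (z : ℂ) (v : V) : tensorRe (z ⊗ₜ[ℝ] v) = z.re • v := by
  simp [tensorRe]

lemma re_complexify (l : V →ₗ[ℝ] ℝ) (x : ℂ ⊗[ℝ] V) : (complexify l x).re = l (tensorRe x) := by
  induction x using TensorProduct.induction_on with
  | zero => simp
  | tmul z v => simp [complexify_tmul, tensorRe_tmul, mul_comm]
  | add x y hx hy => simp [hx, hy]

variable {P : ℝ → V →ₗ[ℝ] V} {D : Module.End ℝ V} {l : V →ₗ[ℝ] ℝ}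

lemma hasDerivAt_complexify (h : ∀ v t, HasDerivAt (fun t => l (P t v)) (l (P t (D v))) t)
    (x : ℂ ⊗[ℝ] V) (t : ℝ) : HasDerivAt (fun t => complexify (l ∘ₗ P t) x)
      (complexify (l ∘ₗ P t) (D.baseChange ℂ x)) t := by
  induction x using TensorProduct.induction_on with
  | zero => simpa using hasDerivAt_const t (0 : ℂ)
  | tmul z v =>
    simp only [complexify_tmul, LinearMap.baseChange_tmul, LinearMap.comp_apply]
    exact (h v t).smul_const z
  | add x y hx hy =>
    simp only [map_add]
    exact hx.add hy

/-- Induction on the nilpotency order. The derivative of e^{-zt} l(P_t x) is the same expression for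
(D - z)x, of lower order and so polynomially bounded; the mean value inequality between t and 0
costs one more power of 1 + |t|. -/
lemma exists_growth_of_pow_eq_zero (h : ∀ v t, HasDerivAt (fun t => l (P t v)) (l (P t (D v))) t)
    (z : ℂ) (n : ℕ) (x : ℂ ⊗[ℝ] V)
    (hx : ((D.baseChange ℂ - algebraMap ℂ (Module.End ℂ (ℂ ⊗[ℝ] V)) z) ^ n) x = 0) :
    ∃ C, 0 ≤ C ∧ ∀ t ≤ 0, ‖complexify (l ∘ₗ P t) x‖ ≤ C * (1 + |t|) ^ n * Real.exp (z.re * t) := by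
  induction n generalizing x with
  | zero => exact ⟨0, le_rfl, fun t _ => by simp at hx; simp [hx]⟩
  | succ n ih =>
    set y := (D.baseChange ℂ - algebraMap ℂ (Module.End ℂ (ℂ ⊗[ℝ] V)) z) x with hy
    obtain ⟨C, hC0, hC⟩ := ih y (by rw [hy, ← Module.End.mul_apply, ← pow_succ]; exact hx)
    set g : ℝ → ℂ := fun t => Complex.exp (-z * t) * complexify (l ∘ₗ P t) x with hg
    have hnexp : ∀ t : ℝ, ‖Complex.exp (-z * t)‖ = Real.exp (-(z.re * t)) := fun t => by
      rw [Complex.norm_exp]; simp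
    have hD : ∀ t : ℝ, HasDerivAt g (Complex.exp (-z * t) * complexify (l ∘ₗ P t) y) t := by
      intro t
      have h1 : HasDerivAt (fun t : ℝ => Complex.exp (-z * t)) (Complex.exp (-z * t) * (-z)) t := by
        have h2 : HasDerivAt (fun t : ℝ => -z * (t : ℂ)) (-z * 1) t :=
          (Complex.ofRealCLM.hasDerivAt (x := t)).const_mul (-z)
        simpa using h2.cexp
      have h3 := h1.mul (hasDerivAt_complexify h x t)
      refine h3.congr_deriv ?_
      have h4 : D.baseChange ℂ x = y + z • x := by simp [hy]
      rw [h4, map_add, map_smul, smul_eq_mul]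
      ring
    refine ⟨‖g 0‖ + C, by positivity, fun t ht => ?_⟩
    have h5 : ‖g 0 - g t‖ ≤ C * (1 + |t|) ^ n * ‖(0 : ℝ) - t‖ := by
      refine (convex_Icc t 0).norm_image_sub_le_of_norm_hasDerivWithin_le
        (fun s _ => (hD s).hasDerivWithinAt) (fun s hs => ?_) ⟨le_rfl, ht⟩ ⟨ht, le_rfl⟩
      rw [norm_mul, hnexp]
      have h6 := hC s hs.2
      have h7 : |s| ≤ |t| := by
        rw [abs_of_nonpos hs.2, abs_of_nonpos ht]; linarith [hs.1]
      calc Real.exp (-(z.re * s)) * ‖complexify (l ∘ₗ P s) y‖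
          ≤ Real.exp (-(z.re * s)) * (C * (1 + |s|) ^ n * Real.exp (z.re * s)) := by gcongr
        _ = C * (1 + |s|) ^ n := by
          rw [mul_comm, mul_assoc, ← Real.exp_add]; simp
        _ ≤ C * (1 + |t|) ^ n := by gcongr
    have h8 : ‖g t‖ ≤ (‖g 0‖ + C) * (1 + |t|) ^ (n + 1) := by
      have h9 : ‖g t‖ ≤ ‖g 0‖ + ‖g 0 - g t‖ := by
        have := norm_sub_le (g 0) (g 0 - g t)
        simpa using this
      have h10 : (1 : ℝ) ≤ (1 + |t|) ^ (n + 1) := one_le_pow₀ (by linarith [abs_nonneg t])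
      rw [zero_sub, norm_neg, Real.norm_eq_abs] at h5
      calc ‖g t‖ ≤ ‖g 0‖ + C * (1 + |t|) ^ n * |t| := h9.trans (by linarith)
        _ ≤ ‖g 0‖ * (1 + |t|) ^ (n + 1) + C * (1 + |t|) ^ n * (1 + |t|) := by
          gcongr
          · exact le_mul_of_one_le_right (norm_nonneg _) h10
          · linarith
        _ = _ := by ring
    have h11 : complexify (l ∘ₗ P t) x = Complex.exp (z * t) * g t := by
      rw [hg]
      simp only
      rw [← mul_assoc, ← Complex.exp_add]
      simp
    rw [h11, norm_mul, Complex.norm_exp, mul_comm]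
    have h12 : (z * (t : ℂ)).re = z.re * t := by simp
    rw [h12]
    gcongr

end Growth

/-! ### Growth subspaces, spectral components and uniform growth bounds. -/

section GrowthSubspaces

variable {V : Type*} [NormedAddCommGroup V] [NormedSpace ℝ V] (P : ℝ → V →ₗ[ℝ] V)

/-- The vectors whose orbit is at most polynomial times `exp (s t)` in the past. -/
def polyGrowthSubspace (s : ℝ) : Submodule ℝ V where
  carrier := {v | ∃ (C : ℝ) (N : ℕ), 0 ≤ C ∧
    ∀ t ≤ 0, ‖P t v‖ ≤ C * (1 + |t|) ^ N * Real.exp (s * t)}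
  zero_mem' := ⟨0, 0, le_rfl, fun t _ => by simp⟩
  add_mem' := by
    rintro v w ⟨C, N, hC, h⟩ ⟨C', N', hC', h'⟩
    refine ⟨C + C', max N N', by positivity, fun t ht => ?_⟩
    have h1 : (1 : ℝ) ≤ 1 + |t| := by linarith [abs_nonneg t]
    rw [map_add]
    refine (norm_add_le _ _).trans ((add_le_add (h t ht) (h' t ht)).trans ?_)
    rw [add_mul, add_mul]
    gcongr
    · exact le_max_left _ _
    · exact le_max_right _ _
  smul_mem' := by
    rintro c v ⟨C, N, hC, h⟩
    refine ⟨|c| * C, N, by positivity, fun t ht => ?_⟩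
    rw [map_smul, norm_smul, Real.norm_eq_abs, mul_assoc, mul_assoc]
    gcongr
    rw [← mul_assoc]
    exact h t ht

/-- The vectors whose orbit is at most `exp ((s + c) t)` in the past, for some `c > 0`. -/
def fastGrowthSubspace (s : ℝ) : Submodule ℝ V where
  carrier := {v | ∃ C c : ℝ, 0 ≤ C ∧ 0 < c ∧
    ∀ t ≤ 0, ‖P t v‖ ≤ C * Real.exp ((s + c) * t)}
  zero_mem' := ⟨0, 1, le_rfl, one_pos, fun t _ => by simp⟩
  add_mem' := by
    rintro v w ⟨C, c, hC, hc, h⟩ ⟨C', c', hC', hc', h'⟩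
    refine ⟨C + C', min c c', by positivity, by positivity, fun t ht => ?_⟩
    rw [map_add]
    refine (norm_add_le _ _).trans ((add_le_add (h t ht) (h' t ht)).trans ?_)
    rw [add_mul C C']
    refine add_le_add (mul_le_mul_of_nonneg_left (Real.exp_le_exp.2 ?_) hC)
      (mul_le_mul_of_nonneg_left (Real.exp_le_exp.2 ?_) hC')
    · exact mul_le_mul_of_nonpos_right (by simp) ht
    · exact mul_le_mul_of_nonpos_right (by simp) ht
  smul_mem' := by
    rintro c v ⟨C, d, hC, hd, h⟩
    refine ⟨|c| * C, d, by positivity, hd, fun t ht => ?_⟩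
    rw [map_smul, norm_smul, Real.norm_eq_abs, mul_assoc]
    gcongr
    exact h t ht

/-- The complex subspace of the vectors all of whose multiples have their real part in a given real
subspace. -/
def reSubspace {V : Type*} [AddCommGroup V] [Module ℝ V] (K : Submodule ℝ V) :
    Submodule ℂ (ℂ ⊗[ℝ] V) where
  carrier := {x | ∀ c : ℂ, tensorRe (c • x) ∈ K}
  zero_mem' := fun c => by simp
  add_mem' := fun {x y} hx hy c => by
    rw [smul_add, map_add]; exact K.add_mem (hx c) (hy c)
  smul_mem' := fun a x hx c => by rw [smul_smul]; exact hx _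

variable {P} [FiniteDimensional ℝ V] {D : Module.End ℝ V} {ι : Type*} [Fintype ι]
  {L : V →ₗ[ℝ] (ι → ℝ)}

/-- The scalar estimate is applied to each coordinate of L; an injective linear map on a
finite-dimensional space is bounded below, which turns the coordinate bounds into a norm bound. -/
lemma tensorRe_mem_polyGrowth (hL : Function.Injective L)
    (h : ∀ v i t, HasDerivAt (fun t => L (P t v) i) (L (P t (D v)) i) t) {z : ℂ} {x : ℂ ⊗[ℝ] V}
    (hx : x ∈ Module.End.maxGenEigenspace (D.baseChange ℂ) z) :
    tensorRe x ∈ polyGrowthSubspace P z.re := by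
  obtain ⟨n, hn⟩ := (Module.End.mem_maxGenEigenspace _ _ _).1 hx
  have hn' : ((D.baseChange ℂ - algebraMap ℂ (Module.End ℂ (ℂ ⊗[ℝ] V)) z) ^ n) x = 0 := by
    rw [Algebra.algebraMap_eq_smul_one]; exact hn
  choose C hC0 hC using fun i : ι => exists_growth_of_pow_eq_zero
    (l := LinearMap.proj i ∘ₗ L) (fun v t => h v i t) z n x hn'
  obtain ⟨K, hK0, hK⟩ := L.exists_antilipschitzWith (LinearMap.ker_eq_bot.2 hL)
  refine ⟨K * ∑ i, C i, n, by have := Finset.sum_nonneg fun i (_ : i ∈ Finset.univ) => hC0 i; positivity,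
    fun t ht => ?_⟩
  have h1 : ‖P t (tensorRe x)‖ ≤ K * ‖L (P t (tensorRe x))‖ := by
    have := hK.le_mul_dist (P t (tensorRe x)) 0
    simpa using this
  refine h1.trans ?_
  rw [mul_assoc, mul_assoc]
  refine mul_le_mul_of_nonneg_left ?_ K.2
  refine (pi_norm_le_iff_of_nonneg ?_).2 fun i => ?_
  · have := Finset.sum_nonneg fun i (_ : i ∈ Finset.univ) => hC0 i
    positivity
  · have h2 := hC i t ht
    have h3 : L (P t (tensorRe x)) i = (complexify ((LinearMap.proj i ∘ₗ L) ∘ₗ P t) x).re := by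
      rw [re_complexify]; rfl
    rw [h3, Real.norm_eq_abs]
    refine (Complex.abs_re_le_norm _).trans (h2.trans ?_)
    rw [mul_assoc]
    gcongr
    exact Finset.single_le_sum (fun i _ => hC0 i) (Finset.mem_univ i)

/-- Half of the gap between s and s' absorbs the polynomial, and the other half is left as the
exponential gain c. -/
lemma polyGrowth_le_fastGrowth {s s' : ℝ} (hs : s < s') :
    polyGrowthSubspace P s' ≤ fastGrowthSubspace P s := by
  rintro v ⟨C, N, hC, h⟩
  set c := (s' - s) / 2 with hc
  have hc0 : 0 < c := by rw [hc]; linarith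
  refine ⟨C * (N.factorial / c ^ N * Real.exp c), c, by positivity, hc0, fun t ht => ?_⟩
  refine (h t ht).trans ?_
  have h1 := Real.pow_div_factorial_le_exp (c * (1 + |t|)) (by positivity) N
  have h2 : (1 + |t|) ^ N ≤ N.factorial / c ^ N * Real.exp (c * (1 + |t|)) := by
    rw [div_le_iff₀ (by positivity), mul_pow] at h1
    rw [div_mul_eq_mul_div, le_div_iff₀ (by positivity)]
    linarith
  have h3 : Real.exp (c * (1 + |t|)) * Real.exp (s' * t) =
      Real.exp c * Real.exp ((s + c) * t) := by
    rw [← Real.exp_add, ← Real.exp_add, abs_of_nonpos ht, hc]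
    congr 1
    ring
  calc C * (1 + |t|) ^ N * Real.exp (s' * t)
      ≤ C * (N.factorial / c ^ N * Real.exp (c * (1 + |t|))) * Real.exp (s' * t) := by gcongr
    _ = C * (N.factorial / c ^ N) * (Real.exp (c * (1 + |t|)) * Real.exp (s' * t)) := by ring
    _ = _ := by rw [h3]; ring

/-- It suffices to bound the vectors of a basis. Since W increases with N, the sum of the finitely
many indices serves all of them. -/
lemma exists_uniform_bound (K : Submodule ℝ V) {W : ℕ → ℝ → ℝ} (hW : ∀ t ≤ 0, Monotone (W · t))
    (hK : ∀ v ∈ K, ∃ N, ∀ t ≤ 0, ‖P t v‖ ≤ W N t) :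
    ∃ (C : ℝ) (N : ℕ), 0 ≤ C ∧ ∀ v ∈ K, ∀ t ≤ 0, ‖P t v‖ ≤ C * W N t * ‖v‖ := by
  let b := Module.finBasis ℝ K
  choose N hN using fun i => hK (b i) (b i).2
  let R : K →L[ℝ] (Fin (Module.finrank ℝ K) → ℝ) := LinearMap.toContinuousLinearMap
    (b.equivFun : K →ₗ[ℝ] (Fin (Module.finrank ℝ K) → ℝ))
  refine ⟨Module.finrank ℝ K * ‖R‖, ∑ i, N i, by positivity, fun v hv t ht => ?_⟩
  have h1 : v = ∑ i, R ⟨v, hv⟩ i • (b i : V) := by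
    have := congrArg K.subtype (b.sum_equivFun ⟨v, hv⟩)
    rw [map_sum] at this
    exact this.symm
  have h2 : ∀ i, |R ⟨v, hv⟩ i| ≤ ‖R‖ * ‖v‖ := fun i =>
    (norm_le_pi_norm (R ⟨v, hv⟩) i).trans (R.le_opNorm _)
  conv_lhs => rw [h1]
  rw [map_sum]
  refine (norm_sum_le _ _).trans ?_
  calc ∑ i, ‖P t (R ⟨v, hv⟩ i • (b i : V))‖
      ≤ ∑ i : Fin (Module.finrank ℝ K), (‖R‖ * ‖v‖) * W (∑ i, N i) t := by
        refine Finset.sum_le_sum fun i _ => ?_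
        rw [map_smul, norm_smul]
        exact mul_le_mul (h2 i) ((hN i t ht).trans (hW t ht (Finset.single_le_sum
          (fun _ _ => Nat.zero_le _) (Finset.mem_univ i)))) (norm_nonneg _) (by positivity)
    _ = _ := by simp; ring

lemma exists_uniform_polyGrowth (s : ℝ) : ∃ (C : ℝ) (N : ℕ), 0 ≤ C ∧
    ∀ v ∈ polyGrowthSubspace P s, ∀ t ≤ 0,
      ‖P t v‖ ≤ C * (1 + |t|) ^ N * Real.exp (s * t) * ‖v‖ := by
  -- N is both coefficient and exponent, so that a single increasing family covers all polynomial
  -- bounds.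
  obtain ⟨C, N, hC, h⟩ := exists_uniform_bound (P := P) (polyGrowthSubspace P s)
    (W := fun N t => N * (1 + |t|) ^ N * Real.exp (s * t))
    (fun t _ N N' hN => by
      have h1 : (1 : ℝ) ≤ 1 + |t| := by linarith [abs_nonneg t]
      dsimp only
      gcongr)
    (by
      rintro v ⟨C, N, hC, h⟩
      obtain ⟨n, hn⟩ := exists_nat_ge C
      refine ⟨max n N, fun t ht => (h t ht).trans ?_⟩
      have h1 : (1 : ℝ) ≤ 1 + |t| := by linarith [abs_nonneg t]
      have h2 : C ≤ (max n N : ℕ) := hn.trans (by exact_mod_cast le_max_left n N)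
      gcongr
      exact le_max_right _ _)
  exact ⟨C * N, N, by positivity, fun v hv t ht => (h v hv t ht).trans_eq (by ring)⟩

lemma exists_uniform_fastGrowth (s : ℝ) : ∃ C c : ℝ, 0 ≤ C ∧ 0 < c ∧
    ∀ v ∈ fastGrowthSubspace P s, ∀ t ≤ 0, ‖P t v‖ ≤ C * Real.exp ((s + c) * t) * ‖v‖ := by
  have hmono : ∀ t ≤ 0, ∀ c c' : ℝ, c' ≤ c → Real.exp ((s + c) * t) ≤ Real.exp ((s + c') * t) :=
    fun t ht c c' hc => Real.exp_le_exp.2 (mul_le_mul_of_nonpos_right (by linarith) ht)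
  -- N is the coefficient and 1/(N + 1) the gain. A smaller gain is a weaker bound for t ≤ 0, so the
  -- family increases with N.
  obtain ⟨C, N, hC, h⟩ := exists_uniform_bound (P := P) (fastGrowthSubspace P s)
    (W := fun N t => N * Real.exp ((s + 1 / ((N : ℝ) + 1)) * t))
    (fun t ht N N' hN => by
      have h1 : (1 : ℝ) / ((N' : ℝ) + 1) ≤ 1 / ((N : ℝ) + 1) := by gcongr
      exact mul_le_mul (by exact_mod_cast hN) (hmono t ht _ _ h1) (Real.exp_pos _).le
        (Nat.cast_nonneg _))
    (by
      rintro v ⟨C, c, hC, hc, h⟩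
      obtain ⟨n, hn⟩ := exists_nat_ge C
      obtain ⟨m, hm⟩ := exists_nat_one_div_lt hc
      refine ⟨max n m, fun t ht => (h t ht).trans ?_⟩
      have h2 : C ≤ (max n m : ℕ) := hn.trans (by exact_mod_cast le_max_left n m)
      have h3 : (1 : ℝ) / ((max n m : ℕ) + 1) ≤ 1 / ((m : ℝ) + 1) := by
        have : (m : ℝ) ≤ (max n m : ℕ) := by exact_mod_cast le_max_right n m
        gcongr
      exact mul_le_mul h2 (hmono t ht _ _ (h3.trans hm.le)) (Real.exp_pos _).le
        (Nat.cast_nonneg _))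
  exact ⟨C * N, 1 / ((N : ℝ) + 1), by positivity, by positivity, fun v hv t ht =>
    (h v hv t ht).trans_eq (by ring)⟩

/-- As `reSubspace` is a complex subspace, containment of the sum of characteristic subspaces may be
tested on each of them. -/
lemma spectralProj_mem {S : Set ℂ} {K : Submodule ℝ V}
    (h : ∀ z ∈ S, Module.End.maxGenEigenspace (D.baseChange ℂ) z ≤ reSubspace K) (v : V) :
    spectralProj D S v ∈ K := by
  have h1 : charSubspace D S ≤ reSubspace K := iSup₂_le h
  have h2 := h1 (Submodule.projection_apply_mem (isCompl_charSubspace D S)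
    (TensorProduct.mk ℝ ℂ V 1 v)) 1
  rw [one_smul] at h2
  exact h2

/-- By linearity it suffices to consider generalized eigenvectors, which span; on each of them one
of the three projections is the identity and the other two vanish. -/
lemma projection_charSubspace_add (D : Module.End ℝ V) {S₁ S₂ S₃ : Set ℂ} (h12 : Disjoint S₁ S₂)
    (h13 : Disjoint S₁ S₃) (h23 : Disjoint S₂ S₃) (hu : S₁ ∪ S₂ ∪ S₃ = Set.univ)
    (x : ℂ ⊗[ℝ] V) :
    Submodule.projection _ _ (isCompl_charSubspace D S₁) x +
    Submodule.projection _ _ (isCompl_charSubspace D S₂) x +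
    Submodule.projection _ _ (isCompl_charSubspace D S₃) x = x := by
  have hx : x ∈ ⨆ z, Module.End.maxGenEigenspace (D.baseChange ℂ) z := by
    rw [Module.End.iSup_maxGenEigenspace_eq_top]; trivial
  have hin : ∀ (S : Set ℂ) z y, y ∈ Module.End.maxGenEigenspace (D.baseChange ℂ) z → z ∈ S →
      Submodule.projection _ _ (isCompl_charSubspace D S) y = y := fun S z y hy hz =>
    Submodule.projection_apply_of_mem_left _ (le_iSup₂_of_le (f := fun z (_ : z ∈ S) =>
      Module.End.maxGenEigenspace (D.baseChange ℂ) z) z hz le_rfl hy)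
  have hout : ∀ (S : Set ℂ) z y, y ∈ Module.End.maxGenEigenspace (D.baseChange ℂ) z → z ∉ S →
      Submodule.projection _ _ (isCompl_charSubspace D S) y = 0 := fun S z y hy hz =>
    Submodule.projection_apply_of_mem_right _ (le_iSup₂_of_le (f := fun z (_ : z ∈ Sᶜ) =>
      Module.End.maxGenEigenspace (D.baseChange ℂ) z) z hz le_rfl hy)
  induction hx using Submodule.iSup_induction' with
  | mem z y hy =>
    have hz : z ∈ S₁ ∪ S₂ ∪ S₃ := hu ▸ Set.mem_univ z
    rcases hz with (hz | hz) | hz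
    · rw [hin S₁ z y hy hz, hout S₂ z y hy (h12.notMem_of_mem_left hz),
        hout S₃ z y hy (h13.notMem_of_mem_left hz), add_zero, add_zero]
    · rw [hout S₁ z y hy (h12.notMem_of_mem_right hz), hin S₂ z y hy hz,
        hout S₃ z y hy (h23.notMem_of_mem_left hz), add_zero, zero_add]
    · rw [hout S₁ z y hy (h13.notMem_of_mem_right hz),
        hout S₂ z y hy (h23.notMem_of_mem_right hz), hin S₃ z y hy hz, add_zero, zero_add]
  | zero => simp
  | add y y' _ _ h h' =>
    simp only [map_add]
    nth_rewrite 4 [← h]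
    nth_rewrite 4 [← h']
    abel

lemma spectralProj_add (D : Module.End ℝ V) (s : ℝ) (v : V) :
    spectralProj D {z | z.re < s} v + spectralProj D {z | z.re = s} v +
      spectralProj D {z | s < z.re} v = v := by
  have h := congrArg tensorRe (projection_charSubspace_add D (S₁ := {z | z.re < s})
    (S₂ := {z | z.re = s}) (S₃ := {z | s < z.re})
    (Set.disjoint_left.2 fun z h h' => ne_of_lt h h')
    (Set.disjoint_left.2 fun z h h' => lt_asymm (α := ℝ) h h')
    (Set.disjoint_left.2 fun z h h' => ne_of_gt h' h)
    (by ext z; simpa [or_assoc] using lt_trichotomy z.re s) (TensorProduct.mk ℝ ℂ V 1 v))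
  rw [map_add, map_add] at h
  refine h.trans ?_
  simp [tensorRe_tmul]

/-- Without a component below s, the vector is the sum of a component in the polynomial growth
subspace and one in the fast growth subspace, and each subspace has a uniform bound. -/
theorem exists_growth_bound (hL : Function.Injective L)
    (h : ∀ v i t, HasDerivAt (fun t => L (P t v) i) (L (P t (D v)) i) t) (s : ℝ) :
    ∃ (C c : ℝ) (N : ℕ), 0 ≤ C ∧ 0 < c ∧ ∀ v, spectralProj D {z | z.re < s} v = 0 → ∀ t ≤ 0,
      ‖P t v‖ ≤ C * (1 + |t|) ^ N * Real.exp (s * t) * ‖spectralProj D {z | z.re = s} v‖ +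
        C * Real.exp ((s + c) * t) * ‖spectralProj D {z | s < z.re} v‖ := by
  obtain ⟨C, N, hC, h0⟩ := exists_uniform_polyGrowth (P := P) s
  obtain ⟨C', c, hC', hc, h1⟩ := exists_uniform_fastGrowth (P := P) s
  have m0 : ∀ v, spectralProj D {z | z.re = s} v ∈ polyGrowthSubspace P s :=
    spectralProj_mem fun z hz x hx a => by
      have := tensorRe_mem_polyGrowth hL h (Submodule.smul_mem _ a hx)
      rwa [show z.re = s from hz] at this
  have m1 : ∀ v, spectralProj D {z | s < z.re} v ∈ fastGrowthSubspace P s :=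
    spectralProj_mem fun z hz x hx a => polyGrowth_le_fastGrowth hz
      (tensorRe_mem_polyGrowth hL h (Submodule.smul_mem _ a hx))
  refine ⟨max C C', c, N, le_max_of_le_left hC, hc, fun v hv t ht => ?_⟩
  have hsum := spectralProj_add D s v
  rw [hv, zero_add] at hsum
  conv_lhs => rw [← hsum]
  rw [map_add]
  refine (norm_add_le _ _).trans (add_le_add ((h0 _ (m0 v) t ht).trans ?_)
    ((h1 _ (m1 v) t ht).trans ?_))
  · gcongr; exact le_max_left _ _
  · gcongr; exact le_max_right _ _

end GrowthSubspaces

/-! ### Checking form-valued functions on basis vectors. -/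

section Evaluation

variable {E : Type*} [NormedAddCommGroup E] [NormedSpace ℝ E]

/-- The values of an alternating form on the families of vectors of a basis. -/
def altEval {ι : Type*} (b : ι → E) (k : ℕ) : AltForm E k →ₗ[ℝ] ((Fin k → ι) → ℝ) where
  toFun a := fun f => a (b ∘ f)
  map_add' _ _ := rfl
  map_smul' _ _ := rfl

lemma altEval_injective {ι : Type*} [Finite ι] (b : Module.Basis ι ℝ E) (k : ℕ) :
    Function.Injective (altEval b k) := by
  intro a a' h
  have h1 : a.toAlternatingMap = a'.toAlternatingMap :=
    Module.Basis.ext_alternating b fun v _ => congrFun h v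
  ext v
  exact congrArg (fun m : E [⋀^Fin k]→ₗ[ℝ] ℝ => m v) h1

variable [FiniteDimensional ℝ E]

/-- Reduces differentiability and smoothness of form-valued functions to those of their values on
vectors. -/
lemma exists_clm_leftInverse_altEval (k : ℕ) :
    ∃ R : ((Fin k → Fin (Module.finrank ℝ E)) → ℝ) →L[ℝ] AltForm E k,
      ∀ a, R (altEval (Module.finBasis ℝ E) k a) = a := by
  obtain ⟨R, hR⟩ := (altEval (Module.finBasis ℝ E) k).exists_leftInverse_of_injective
    (LinearMap.ker_eq_bot.2 (altEval_injective _ k))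
  exact ⟨LinearMap.toContinuousLinearMap R, fun a => LinearMap.congr_fun hR a⟩

lemma hasDerivAt_altForm {k : ℕ} {f : ℝ → AltForm E k} {f' : AltForm E k} {t : ℝ}
    (h : ∀ v, HasDerivAt (fun s => f s v) (f' v) t) : HasDerivAt f f' t := by
  obtain ⟨R, hR⟩ := exists_clm_leftInverse_altEval (E := E) k
  have h1 : HasDerivAt (fun s => altEval (Module.finBasis ℝ E) k (f s))
      (altEval (Module.finBasis ℝ E) k f') t := hasDerivAt_pi.2 fun i => h _
  have h2 := R.hasFDerivAt.comp_hasDerivAt t h1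
  rw [hR] at h2
  exact h2.congr_of_eventuallyEq (Filter.Eventually.of_forall fun s => (hR (f s)).symm)

lemma contDiff_altForm {k : ℕ} {f : ℝ → AltForm E k}
    (h : ∀ v, ContDiff ℝ ∞ (fun s => f s v)) : ContDiff ℝ ∞ f := by
  obtain ⟨R, hR⟩ := exists_clm_leftInverse_altEval (E := E) k
  have h1 : ContDiff ℝ ∞ (fun s => altEval (Module.finBasis ℝ E) k (f s)) :=
    contDiff_pi.2 fun i => h _
  have h2 := R.contDiff.comp h1
  have h3 : f = fun s => R (altEval (Module.finBasis ℝ E) k (f s)) :=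
    funext fun s => (hR (f s)).symm
  rw [h3]
  exact h2

end Evaluation

/-! ### The linear flow of α and its action on forms. -/

section PullBack

variable {E : Type*} [NormedAddCommGroup E] [NormedSpace ℝ E] [FiniteDimensional ℝ E]
  (α : E →L[ℝ] E)

/-- The linear flow of an endomorphism. -/
def expFlow (t : ℝ) : E →L[ℝ] E := NormedSpace.exp (t • α)

lemma expFlow_zero : expFlow α 0 = ContinuousLinearMap.id ℝ E := by
  simp [expFlow]
  rfl

lemma hasDerivAt_expFlow (t : ℝ) : HasDerivAt (expFlow α) (α ∘L expFlow α t) t :=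
  hasDerivAt_exp_smul_const' α t

lemma hasDerivAt_expFlow_apply (t : ℝ) (x : E) :
    HasDerivAt (fun t => expFlow α t x) (α (expFlow α t x)) t :=
  (ContinuousLinearMap.apply ℝ E x).hasFDerivAt.comp_hasDerivAt t (hasDerivAt_expFlow α t)

lemma contDiff_expFlow : ContDiff ℝ ∞ (expFlow α) := by
  have h1 : ContDiff ℝ ∞ (NormedSpace.exp : (E →L[ℝ] E) → (E →L[ℝ] E)) :=
    AnalyticOnNhd.contDiff fun x _ => NormedSpace.exp_analytic x
  exact h1.comp (contDiff_id.smul contDiff_const)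

lemma expFlow_comp_neg (t : ℝ) : expFlow α t ∘L expFlow α (-t) = ContinuousLinearMap.id ℝ E := by
  have h : Commute (t • α) (-t • α) := ((Commute.refl α).smul_left t).smul_right (-t)
  let : NormedAlgebra ℚ (E →L[ℝ] E) := NormedAlgebra.restrictScalars ℚ ℝ _
  have := NormedSpace.exp_add_of_commute h
  rw [← add_smul, add_neg_cancel, zero_smul, NormedSpace.exp_zero] at this
  exact this.symm

lemma expFlow_apply_neg (t : ℝ) (x : E) : expFlow α t (expFlow α (-t) x) = x :=
  congrArg (fun f : E →L[ℝ] E => f x) (expFlow_comp_neg α t)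

lemma expFlow_neg_apply (t : ℝ) (x : E) : expFlow α (-t) (expFlow α t x) = x := by
  have := expFlow_apply_neg α (-t) x
  rwa [neg_neg] at this

lemma expFlow_comm (t : ℝ) (x : E) : α (expFlow α t x) = expFlow α t (α x) := by
  have h : Commute α (expFlow α t) := ((Commute.refl α).smul_right t).exp_right
  exact congrArg (fun f : E →L[ℝ] E => f x) h

variable {k : ℕ}

lemma hasDerivAt_apply_expFlow (a : AltForm E k) (w : Fin k → E) (t : ℝ) :
    HasDerivAt (fun t => a (fun i => expFlow α t (w i)))
      (inducedDer α k a (fun i => expFlow α t (w i))) t := by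
  have h1 := (a.hasFDerivAt (fun i => expFlow α t (w i))).comp_hasDerivAt t
    (hasDerivAt_pi.2 fun i => hasDerivAt_expFlow_apply α t (w i))
  refine h1.congr_deriv ?_
  rw [inducedDer_apply]
  simp [ContinuousMultilinearMap.linearDeriv_apply]

/-- The pull-back of a form along the linear flow. -/
def flowPull (t : ℝ) (a : AltForm E k) : AltForm E k := a.compContinuousLinearMap (expFlow α t)

/-- The value at `(h, t)` of the pull-back to the semi-direct product of a form on the first
factor, in left trivializations. -/
def flowLift (t : ℝ) (a : AltForm E k) : AltForm (E × ℝ) k :=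
  a.compContinuousLinearMap (expFlow α t ∘L ContinuousLinearMap.fst ℝ E ℝ)

lemma flowPull_apply (t : ℝ) (a : AltForm E k) (v : Fin k → E) :
    flowPull α t a v = a (fun i => expFlow α t (v i)) := rfl

lemma flowLift_apply (t : ℝ) (a : AltForm E k) (v : Fin k → E × ℝ) :
    flowLift α t a v = a (fun i => expFlow α t (v i).1) := rfl

lemma hasDerivAt_flowLift (a : AltForm E k) (t : ℝ) :
    HasDerivAt (fun t => flowLift α t a) (flowLift α t (inducedDer α k a)) t :=
  hasDerivAt_altForm fun v => hasDerivAt_apply_expFlow α a (fun i => (v i).1) t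

lemma contDiff_flowLift (a : AltForm E k) : ContDiff ℝ ∞ (fun t => flowLift α t a) :=
  contDiff_altForm fun v => by
    have h1 : ContDiff ℝ ∞ (fun t => fun i => expFlow α t (v i).1) :=
      contDiff_pi.2 fun i => (contDiff_expFlow α).clm_apply contDiff_const
    exact (a.toContinuousMultilinearMap.contDiff).comp h1

/-- `flowPull` as a linear map of the form. -/
def flowPullₗ (t : ℝ) : AltForm E k →ₗ[ℝ] AltForm E k where
  toFun := flowPull α t
  map_add' _ _ := rfl
  map_smul' _ _ := rfl

/-- `flowLift` as a linear map of the form. -/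
def flowLiftL (k : ℕ) (t : ℝ) : AltForm E k →L[ℝ] AltForm (E × ℝ) k :=
  LinearMap.toContinuousLinearMap
    { toFun := flowLift α t
      map_add' := fun _ _ => rfl
      map_smul' := fun _ _ => rfl }

@[simp] lemma flowLiftL_apply (t : ℝ) (a : AltForm E k) : flowLiftL α k t a = flowLift α t a := rfl

theorem exists_flowPull_bound (k : ℕ) (s : ℝ) :
    ∃ (C c : ℝ) (N : ℕ), 0 ≤ C ∧ 0 < c ∧ ∀ a : AltForm E k,
      spectralProj (inducedDer α k) {z | z.re < s} a = 0 → ∀ t ≤ 0,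
      ‖flowPull α t a‖ ≤ C * (1 + |t|) ^ N * Real.exp (s * t) *
          ‖spectralProj (inducedDer α k) {z | z.re = s} a‖ +
        C * Real.exp ((s + c) * t) * ‖spectralProj (inducedDer α k) {z | s < z.re} a‖ :=
  exists_growth_bound (P := flowPullₗ α) (altEval_injective (Module.finBasis ℝ E) k)
    (fun a f t => hasDerivAt_apply_expFlow α a _ t) s

lemma wedge_inducedDer_trace' {m l : ℕ} (a : AltForm E m) (b : AltForm E l)
    (hn : m + l = Module.finrank ℝ E) (v : Fin (m + l) → E) :
    wedge (inducedDer α m a) b v + wedge a (inducedDer α l b) v =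
      LinearMap.trace ℝ E (α : E →ₗ[ℝ] E) * wedge a b v := by
  have h := wedge_inducedDer_trace α a b ((Module.finBasis ℝ E).reindex (finCongr hn.symm))
  have e : ((Module.finBasis ℝ E).reindex (finCongr hn.symm) : Fin (m + l) → E) =
      fun i => Module.finBasis ℝ E (Fin.cast hn i) := by
    funext i; simp
  rw [e] at h
  rw [wedge_eq_det_mul _ _ (Module.finBasis ℝ E) hn v, wedge_eq_det_mul a _ (Module.finBasis ℝ E) hn v,
    wedge_eq_det_mul a b (Module.finBasis ℝ E) hn v, ← mul_add, h]
  ring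

/-- In top degree the derivation induced by α is multiplication by its trace, so the left side
solves y' = tr(α) y in t; its product with e^{-tr(α)t} is constant. -/
lemma wedge_flow {m l : ℕ} (a : AltForm E m) (b : AltForm E l)
    (hn : m + l = Module.finrank ℝ E) (v : Fin (m + l) → E) (t : ℝ) :
    wedge a b (fun i => expFlow α t (v i)) =
      Real.exp (LinearMap.trace ℝ E (α : E →ₗ[ℝ] E) * t) * wedge a b v := by
  set lam := LinearMap.trace ℝ E (α : E →ₗ[ℝ] E)
  have hd : ∀ t, HasDerivAt (fun t => wedge a b (fun i => expFlow α t (v i)))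
      (lam * wedge a b (fun i => expFlow α t (v i))) t := by
    intro t
    rw [← wedge_inducedDer_trace' α a b hn]
    unfold wedge
    rw [← mul_add, ← Finset.sum_add_distrib]
    refine HasDerivAt.const_mul _ (HasDerivAt.fun_sum fun σ _ => ?_)
    rw [← mul_add]
    exact ((hasDerivAt_apply_expFlow α a _ t).mul (hasDerivAt_apply_expFlow α b _ t)).const_mul _
  have h2 : ∀ t, HasDerivAt (fun t => Real.exp (-(lam * t)) *
      wedge a b (fun i => expFlow α t (v i))) 0 t := by
    intro t
    have h3 : HasDerivAt (fun t => -(lam * t)) (-lam) t := by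
      simpa using ((hasDerivAt_id t).const_mul lam).fun_neg
    refine (h3.exp.mul (hd t)).congr_deriv (by ring)
  have h4 := is_const_of_deriv_eq_zero (fun t => (h2 t).differentiableAt) (fun t => (h2 t).deriv) t 0
  simp only [mul_zero, neg_zero, Real.exp_zero, one_mul, expFlow_zero,
    ContinuousLinearMap.id_apply] at h4
  rw [← h4, ← mul_assoc, ← Real.exp_add]
  simp

end PullBack

/-! ### The left-invariant frame and the bracket of the semi-direct product. -/

section SemiDirectFrame

variable {E : Type*} [NormedAddCommGroup E] [NormedSpace ℝ E] [FiniteDimensional ℝ E]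
  {H : Type*} [TopologicalSpace H] [ChartedSpace E H] [Group H] [LieGroup 𝓘(ℝ, E) ∞ H]
  {α : E →L[ℝ] E} (F : AutFlow H α)

lemma AutFlow.contMDiff_at (t : ℝ) : ContMDiff 𝓘(ℝ, E) 𝓘(ℝ, E) ∞ (fun h : H => F.at t h) :=
  F.smooth.comp (contMDiff_const.prodMk contMDiff_id :
    ContMDiff 𝓘(ℝ, E) (𝓘(ℝ, ℝ).prod 𝓘(ℝ, E)) ∞ fun h : H => (t, h))

/-- The automorphism at time `t` in the chart at the identity. -/
def AutFlow.chart (t : ℝ) (w : E) : E :=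
  extChartAt 𝓘(ℝ, E) (1 : H) (F.at t (oneParam 𝓘(ℝ, E) H w))

lemma AutFlow.hasFDerivAt_chart (t : ℝ) :
    HasFDerivAt (F.chart t) (expFlow α t) (oneCoord 𝓘(ℝ, E) H) := by
  have hmd : MDifferentiableAt 𝓘(ℝ, E) 𝓘(ℝ, E) (fun h : H => F.at t h) 1 :=
    ((F.contMDiff_at t) 1).mdifferentiableAt (by simp)
  have h1 : DifferentiableWithinAt ℝ (writtenInExtChartAt 𝓘(ℝ, E) 𝓘(ℝ, E) 1 (fun h : H => F.at t h))
    (range 𝓘(ℝ, E)) (extChartAt 𝓘(ℝ, E) (1 : H) 1) := hmd.differentiableWithinAt_writtenInExtChartAt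
  have h2 : ∀ x : E, _ = _ := F.deriv_one t
  have h3 : (mfderiv 𝓘(ℝ, E) 𝓘(ℝ, E) (fun h : H => F.at t h) 1 : E →L[ℝ] E) = expFlow α t :=
    ContinuousLinearMap.ext h2
  rw [hmd.mfderiv] at h3
  rw [𝓘(ℝ, E).range_eq_univ] at h1 h3
  have h4 := h1.hasFDerivWithinAt
  rw [h3, hasFDerivWithinAt_univ] at h4
  have h5 : writtenInExtChartAt 𝓘(ℝ, E) 𝓘(ℝ, E) 1 (fun h : H => F.at t h) = F.chart t := by
    unfold writtenInExtChartAt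
    dsimp only
    rw [map_one]
    rfl
  rw [h5] at h4
  exact h4

lemma AutFlow.chart_oneCoord (t : ℝ) : F.chart t (oneCoord 𝓘(ℝ, E) H) = oneCoord 𝓘(ℝ, E) H := by
  rw [AutFlow.chart, oneParam_oneCoord, map_one]
  rfl

lemma AutFlow.oneParam_chart (t : ℝ) :
    ∀ᶠ w in 𝓝 (oneCoord 𝓘(ℝ, E) H), oneParam 𝓘(ℝ, E) H (F.chart t w) =
      F.at t (oneParam 𝓘(ℝ, E) H w) := by
  have hc : ContinuousAt (fun w => F.at t (oneParam 𝓘(ℝ, E) H w)) (oneCoord 𝓘(ℝ, E) H) := by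
    refine ContinuousAt.comp (f := oneParam 𝓘(ℝ, E) H) (g := fun h => F.at t h)
      (F.contMDiff_at t).continuous.continuousAt ?_
    exact contMDiffAt_oneParam_oneCoord.continuousAt
  have h1 : (extChartAt 𝓘(ℝ, E) (1 : H)).source ∈ 𝓝 (F.at t (oneParam 𝓘(ℝ, E) H
      (oneCoord 𝓘(ℝ, E) H))) := by
    rw [oneParam_oneCoord, map_one]
    exact extChartAt_source_mem_nhds (1 : H)
  filter_upwards [hc h1] with w hw
  exact (extChartAt 𝓘(ℝ, E) (1 : H)).left_inv hw

namespace SemiProd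

/-- The element with given components. -/
def mk (h : H) (t : ℝ) : SemiProd F := ((h, t) : H × ℝ)

variable {F} in
/-- The first component. -/
def fst (g : SemiProd F) : H := Prod.fst (show H × ℝ from g)

variable {F} in
/-- The second component. -/
def snd (g : SemiProd F) : ℝ := Prod.snd (show H × ℝ from g)

@[simp] lemma fst_mk (h : H) (t : ℝ) : (mk F h t).fst = h := rfl

@[simp] lemma snd_mk (h : H) (t : ℝ) : (mk F h t).snd = t := rfl

@[simp] lemma mk_fst_snd (g : SemiProd F) : mk F g.fst g.snd = g := rfl

lemma oneCoord_eq : oneCoord (𝓘(ℝ, E).prod 𝓘(ℝ, ℝ)) (SemiProd F) =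
    (oneCoord 𝓘(ℝ, E) H, (0 : ℝ)) := by
  change extChartAt (𝓘(ℝ, E).prod 𝓘(ℝ, ℝ)) ((1, 0) : H × ℝ) ((1, 0) : H × ℝ) = _
  rw [extChartAt_prod]
  rfl

lemma oneParam_eq (x : E × ℝ) : oneParam (𝓘(ℝ, E).prod 𝓘(ℝ, ℝ)) (SemiProd F) x =
    mk F (oneParam 𝓘(ℝ, E) H x.1) x.2 := by
  change (extChartAt (𝓘(ℝ, E).prod 𝓘(ℝ, ℝ)) ((1, 0) : H × ℝ)).symm x = _
  rw [extChartAt_prod]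
  rfl

lemma target_eq : (extChartAt (𝓘(ℝ, E).prod 𝓘(ℝ, ℝ)) (1 : SemiProd F)).target =
    (extChartAt 𝓘(ℝ, E) (1 : H)).target ×ˢ univ := by
  change (extChartAt (𝓘(ℝ, E).prod 𝓘(ℝ, ℝ)) ((1, 0) : H × ℝ)).target = _
  rw [extChartAt_prod, PartialEquiv.prod_target]
  rw [extChartAt_model_space_eq_id]
  rfl

lemma mul_eq (x y : SemiProd F) : x * y = mk F (x.fst * F.at x.snd y.fst) (x.snd + y.snd) := rfl

lemma chartMul_eq (x y : E × ℝ) : chartMul (𝓘(ℝ, E).prod 𝓘(ℝ, ℝ)) (SemiProd F) (x, y) =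
    (extChartAt 𝓘(ℝ, E) (1 : H) (oneParam 𝓘(ℝ, E) H x.1 *
      F.at x.2 (oneParam 𝓘(ℝ, E) H y.1)), x.2 + y.2) := by
  rw [chartMul]
  dsimp only
  rw [oneParam_eq, oneParam_eq, mul_eq]
  change extChartAt (𝓘(ℝ, E).prod 𝓘(ℝ, ℝ)) ((1, 0) : H × ℝ) _ = _
  rw [extChartAt_prod]
  rfl

/-- Left multiplication by (h, t) sends (h', t') to (h F_t(h'), t + t'). The first component has
derivative the frame of H after e^{tα}, the second is a translation. -/
lemma leftFrame_eq {x : E × ℝ} (hx : x.1 ∈ (extChartAt 𝓘(ℝ, E) (1 : H)).target) :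
    leftFrame (𝓘(ℝ, E).prod 𝓘(ℝ, ℝ)) (SemiProd F) x =
      ((leftFrame 𝓘(ℝ, E) H x.1 ∘L expFlow α x.2) ∘L ContinuousLinearMap.fst ℝ E ℝ).prod
        (ContinuousLinearMap.snd ℝ E ℝ) := by
  rw [leftFrame, oneCoord_eq]
  refine HasFDerivAt.fderiv ?_
  have h1 : HasFDerivAt (fun w => chartMul 𝓘(ℝ, E) H (x.1, F.chart x.2 w))
      (leftFrame 𝓘(ℝ, E) H x.1 ∘L expFlow α x.2) (oneCoord 𝓘(ℝ, E) H) := by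
    have h2 : HasFDerivAt (fun w => chartMul 𝓘(ℝ, E) H (x.1, w)) (leftFrame 𝓘(ℝ, E) H x.1)
        (F.chart x.2 (oneCoord 𝓘(ℝ, E) H)) := by
      rw [F.chart_oneCoord]
      refine DifferentiableAt.hasFDerivAt ?_
      have h3 : DifferentiableAt ℝ (chartMul 𝓘(ℝ, E) H) (x.1, oneCoord 𝓘(ℝ, E) H) :=
        (contDiffAt_chartMul_oneCoord hx).differentiableAt (by simp)
      exact h3.comp (oneCoord 𝓘(ℝ, E) H)
        ((differentiableAt_const x.1).prodMk differentiableAt_id)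
    exact h2.comp _ (F.hasFDerivAt_chart x.2)
  have h4 : HasFDerivAt (fun w => extChartAt 𝓘(ℝ, E) (1 : H) (oneParam 𝓘(ℝ, E) H x.1 *
      F.at x.2 (oneParam 𝓘(ℝ, E) H w))) (leftFrame 𝓘(ℝ, E) H x.1 ∘L expFlow α x.2)
      (oneCoord 𝓘(ℝ, E) H) := by
    refine h1.congr_of_eventuallyEq ?_
    filter_upwards [F.oneParam_chart x.2] with w hw
    rw [chartMul]
    dsimp only
    rw [hw]
  have h5 : HasFDerivAt (fun y : E × ℝ => ((extChartAt 𝓘(ℝ, E) (1 : H) (oneParam 𝓘(ℝ, E) H x.1 *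
      F.at x.2 (oneParam 𝓘(ℝ, E) H y.1)), x.2 + y.2) : E × ℝ))
      (((leftFrame 𝓘(ℝ, E) H x.1 ∘L expFlow α x.2) ∘L ContinuousLinearMap.fst ℝ E ℝ).prod
        (ContinuousLinearMap.snd ℝ E ℝ)) (oneCoord 𝓘(ℝ, E) H, (0 : ℝ)) :=
    (HasFDerivAt.comp (g := fun w => extChartAt 𝓘(ℝ, E) (1 : H) (oneParam 𝓘(ℝ, E) H x.1 *
      F.at x.2 (oneParam 𝓘(ℝ, E) H w))) (oneCoord 𝓘(ℝ, E) H, (0 : ℝ)) h4 hasFDerivAt_fst).prodMk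
      (hasFDerivAt_snd.const_add x.2)
  refine h5.congr_of_eventuallyEq (Filter.Eventually.of_forall fun y => chartMul_eq F x y)

lemma fderiv_leftFrame_apply (x y : E × ℝ) :
    fderiv ℝ (leftFrame (𝓘(ℝ, E).prod 𝓘(ℝ, ℝ)) (SemiProd F))
      (oneCoord (𝓘(ℝ, E).prod 𝓘(ℝ, ℝ)) (SemiProd F)) x y =
    (fderiv ℝ (leftFrame 𝓘(ℝ, E) H) (oneCoord 𝓘(ℝ, E) H) x.1 y.1 + x.2 • α y.1, 0) := by
  have hd : DifferentiableAt ℝ (leftFrame (𝓘(ℝ, E).prod 𝓘(ℝ, ℝ)) (SemiProd F))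
      (oneCoord (𝓘(ℝ, E).prod 𝓘(ℝ, ℝ)) (SemiProd F)) :=
    (contDiffAt_leftFrame (oneCoord_mem_target _ _)).differentiableAt (by simp)
  have hdH : DifferentiableAt ℝ (leftFrame 𝓘(ℝ, E) H) (oneCoord 𝓘(ℝ, E) H) :=
    (contDiffAt_leftFrame (oneCoord_mem_target _ _)).differentiableAt (by simp)
  have h1 := hd.hasFDerivAt.clm_apply (hasFDerivAt_const y _)
  have h2 : HasFDerivAt (fun z : E × ℝ => ((leftFrame 𝓘(ℝ, E) H z.1 (expFlow α z.2 y.1), y.2) : E × ℝ))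
      ((((fderiv ℝ (leftFrame 𝓘(ℝ, E) H) (oneCoord 𝓘(ℝ, E) H)).flip y.1) ∘L
        ContinuousLinearMap.fst ℝ E ℝ + (ContinuousLinearMap.snd ℝ E ℝ).smulRight (α y.1)).prod 0)
      (oneCoord 𝓘(ℝ, E) H, (0 : ℝ)) := by
    refine HasFDerivAt.prodMk ?_ (hasFDerivAt_const y.2 _)
    refine (((HasFDerivAt.comp (g := leftFrame 𝓘(ℝ, E) H) (oneCoord 𝓘(ℝ, E) H, (0 : ℝ))
      hdH.hasFDerivAt hasFDerivAt_fst).clm_apply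
      (HasFDerivAt.comp (g := fun t => expFlow α t y.1) (oneCoord 𝓘(ℝ, E) H, (0 : ℝ))
        (hasDerivAt_expFlow_apply α 0 y.1).hasFDerivAt hasFDerivAt_snd))).congr_fderiv ?_
    ext z <;> simp [expFlow_zero, leftFrame_oneCoord]
  have h3 : (fun z => leftFrame (𝓘(ℝ, E).prod 𝓘(ℝ, ℝ)) (SemiProd F) z y) =ᶠ[
      𝓝 (oneCoord (𝓘(ℝ, E).prod 𝓘(ℝ, ℝ)) (SemiProd F))]
      (fun z : E × ℝ => ((leftFrame 𝓘(ℝ, E) H z.1 (expFlow α z.2 y.1), y.2) : E × ℝ)) := by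
    filter_upwards [target_mem_nhds_oneCoord (𝓘(ℝ, E).prod 𝓘(ℝ, ℝ)) (SemiProd F)] with z hz
    rw [target_eq] at hz
    rw [leftFrame_eq F hz.1]
    rfl
  rw [oneCoord_eq] at h1 h3 ⊢
  have h4 := congrArg (fun f : E × ℝ →L[ℝ] E × ℝ => f x) (h1.unique (h2.congr_of_eventuallyEq h3))
  simpa using h4

lemma adL_apply_eq (x y : E × ℝ) : adL (𝓘(ℝ, E).prod 𝓘(ℝ, ℝ)) (SemiProd F) x y =
    (adL 𝓘(ℝ, E) H x.1 y.1 + x.2 • α y.1 - y.2 • α x.1, 0) := by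
  have h : adL (𝓘(ℝ, E).prod 𝓘(ℝ, ℝ)) (SemiProd F) x y =
    fderiv ℝ (leftFrame (𝓘(ℝ, E).prod 𝓘(ℝ, ℝ)) (SemiProd F))
      (oneCoord (𝓘(ℝ, E).prod 𝓘(ℝ, ℝ)) (SemiProd F)) x y -
    fderiv ℝ (leftFrame (𝓘(ℝ, E).prod 𝓘(ℝ, ℝ)) (SemiProd F))
      (oneCoord (𝓘(ℝ, E).prod 𝓘(ℝ, ℝ)) (SemiProd F)) y x := rfl
  have h' : adL 𝓘(ℝ, E) H x.1 y.1 =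
    fderiv ℝ (leftFrame 𝓘(ℝ, E) H) (oneCoord 𝓘(ℝ, E) H) x.1 y.1 -
    fderiv ℝ (leftFrame 𝓘(ℝ, E) H) (oneCoord 𝓘(ℝ, E) H) y.1 x.1 := rfl
  rw [h, h', fderiv_leftFrame_apply, fderiv_leftFrame_apply]
  ext
  · simp
    abel
  · simp

/-- The adjoint action of ∂_t is α on the algebra of H and zero on the line. -/
lemma traceForm_zero_one : traceForm (adL (𝓘(ℝ, E).prod 𝓘(ℝ, ℝ)) (SemiProd F)) (0, 1) =
    LinearMap.trace ℝ E (α : E →ₗ[ℝ] E) := by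
  rw [traceForm_apply]
  have h : (adL (𝓘(ℝ, E).prod 𝓘(ℝ, ℝ)) (SemiProd F) (0, 1) : E × ℝ →ₗ[ℝ] E × ℝ) =
      LinearMap.prodMap (α : E →ₗ[ℝ] E) 0 := by
    refine LinearMap.ext fun y => ?_
    have := adL_apply_eq F (0, 1) y
    simpa using this
  rw [h, LinearMap.trace_prodMap']
  simp

end SemiProd

variable (hα : IsDerivation H α)

-- Since α is a derivation, e^{-sα}[e^{sα}x, e^{sα}y] has zero derivative in s; its value at s = 0
-- is [x, y].
include hα in
lemma expFlow_adL (t : ℝ) (x y : E) :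
    expFlow α t (adL 𝓘(ℝ, E) H x y) = adL 𝓘(ℝ, E) H (expFlow α t x) (expFlow α t y) := by
  have hder : ∀ x y, α (adL 𝓘(ℝ, E) H x y) = adL 𝓘(ℝ, E) H (α x) y + adL 𝓘(ℝ, E) H x (α y) := by
    intro x y
    simp only [adL_apply]
    exact hα x y
  have h1 : ∀ s, HasDerivAt (fun s => expFlow α (-s) (adL 𝓘(ℝ, E) H (expFlow α s x)
      (expFlow α s y))) 0 s := by
    intro s
    have h2 : HasDerivAt (fun s => adL 𝓘(ℝ, E) H (expFlow α s x) (expFlow α s y))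
        (α (adL 𝓘(ℝ, E) H (expFlow α s x) (expFlow α s y))) s := by
      rw [hder]
      exact ((adL 𝓘(ℝ, E) H).hasFDerivAt.comp_hasDerivAt s
        (hasDerivAt_expFlow_apply α s x)).clm_apply (hasDerivAt_expFlow_apply α s y)
    have h3 : HasDerivAt (fun s => expFlow α (-s)) (-(α ∘L expFlow α (-s))) s := by
      have := (hasDerivAt_expFlow α (-s)).scomp s (hasDerivAt_neg s)
      rw [neg_one_smul] at this
      exact this
    refine (h3.clm_apply h2).congr_deriv ?_
    simp [expFlow_comm]
  have h4 := is_const_of_deriv_eq_zero (fun s => (h1 s).differentiableAt) (fun s => (h1 s).deriv) t 0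
  simp only [neg_zero, expFlow_zero, ContinuousLinearMap.id_apply] at h4
  rw [← h4, expFlow_apply_neg]

end SemiDirectFrame

/-! ### The exterior derivative of pulled-back forms on the semi-direct product. -/

section SemiDirectCalculus

variable {E : Type*} [NormedAddCommGroup E] [NormedSpace ℝ E] [FiniteDimensional ℝ E]
  {H : Type*} [TopologicalSpace H] [ChartedSpace E H] [Group H] [LieGroup 𝓘(ℝ, E) ∞ H]
  {α : E →L[ℝ] E} (F : AutFlow H α)
  {V : Type*} [NormedAddCommGroup V] [NormedSpace ℝ V]

lemma hasFDerivAt_mul_flow {f : H → V} {h : H} (hf : MDifferentiableAt 𝓘(ℝ, E) 𝓘(ℝ, V) f h)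
    (t : ℝ) : HasFDerivAt (fun w => f (h * F.at t (oneParam 𝓘(ℝ, E) H w)))
      (leftDerivL 𝓘(ℝ, E) f h ∘L expFlow α t) (oneCoord 𝓘(ℝ, E) H) := by
  have h1 : HasFDerivAt (fun w => f (h * oneParam 𝓘(ℝ, E) H w)) (leftDerivL 𝓘(ℝ, E) f h)
      (F.chart t (oneCoord 𝓘(ℝ, E) H)) := by
    rw [F.chart_oneCoord]
    exact (differentiableAt_mul_oneParam hf).hasFDerivAt
  refine (h1.comp _ (F.hasFDerivAt_chart t)).congr_of_eventuallyEq ?_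
  filter_upwards [F.oneParam_chart t] with w hw
  simp [hw]

namespace SemiProd

/-- The form `dt`. -/
def dt : E × ℝ →L[ℝ] ℝ := ContinuousLinearMap.snd ℝ E ℝ

lemma leftDerivL_smul_comp_snd {f : H → ℝ} {h : H} {t : ℝ}
    (hf : MDifferentiableAt 𝓘(ℝ, E) 𝓘(ℝ, ℝ) f h) {X : ℝ → V} {X' : V} (hX : HasDerivAt X X' t) :
    leftDerivL (𝓘(ℝ, E).prod 𝓘(ℝ, ℝ)) (fun g : SemiProd F => f g.fst • X g.snd) (mk F h t) =
      ((leftDerivL 𝓘(ℝ, E) f h ∘L expFlow α t) ∘L ContinuousLinearMap.fst ℝ E ℝ).smulRight (X t) +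
        dt.smulRight (f h • X') := by
  rw [leftDerivL, oneCoord_eq]
  refine HasFDerivAt.fderiv ?_
  have h1 : (fun z => f (mk F h t * oneParam (𝓘(ℝ, E).prod 𝓘(ℝ, ℝ)) (SemiProd F) z).fst •
      X (mk F h t * oneParam (𝓘(ℝ, E).prod 𝓘(ℝ, ℝ)) (SemiProd F) z).snd) =
      fun z : E × ℝ => f (h * F.at t (oneParam 𝓘(ℝ, E) H z.1)) • X (t + z.2) := by
    funext z
    rw [oneParam_eq, mul_eq]
    rfl
  rw [h1]
  have h2 : HasFDerivAt (fun z : E × ℝ => f (h * F.at t (oneParam 𝓘(ℝ, E) H z.1)))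
      ((leftDerivL 𝓘(ℝ, E) f h ∘L expFlow α t) ∘L ContinuousLinearMap.fst ℝ E ℝ)
      (oneCoord 𝓘(ℝ, E) H, (0 : ℝ)) :=
    HasFDerivAt.comp (g := fun w => f (h * F.at t (oneParam 𝓘(ℝ, E) H w)))
      (oneCoord 𝓘(ℝ, E) H, (0 : ℝ)) (hasFDerivAt_mul_flow F hf t) hasFDerivAt_fst
  have h3 : HasFDerivAt (fun z : E × ℝ => X (t + z.2))
      ((ContinuousLinearMap.toSpanSingleton ℝ X') ∘L ContinuousLinearMap.snd ℝ E ℝ)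
      (oneCoord 𝓘(ℝ, E) H, (0 : ℝ)) := by
    have h4 : HasDerivAt (fun s => X (t + s)) X' 0 := by
      have := HasDerivAt.comp_const_add t 0 (by rwa [add_zero] : HasDerivAt X X' (t + 0))
      exact this
    exact HasFDerivAt.comp (g := fun s => X (t + s)) (oneCoord 𝓘(ℝ, E) H, (0 : ℝ))
      h4.hasFDerivAt hasFDerivAt_snd
  refine (h2.smul h3).congr_fderiv ?_
  ext z <;> simp [dt]

lemma leftDerivL_comp_snd {X : ℝ → V} {X' : V} {h : H} {t : ℝ} (hX : HasDerivAt X X' t) :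
    leftDerivL (𝓘(ℝ, E).prod 𝓘(ℝ, ℝ)) (fun g : SemiProd F => X g.snd) (mk F h t) =
      dt.smulRight X' := by
  have h1 := leftDerivL_smul_comp_snd F (f := fun _ : H => (1 : ℝ)) (h := h)
    mdifferentiableAt_const hX
  simp only [one_smul] at h1
  rw [h1]
  have h2 : leftDerivL 𝓘(ℝ, E) (fun _ : H => (1 : ℝ)) h = 0 := by simp [leftDerivL]
  rw [h2]
  ext z <;> simp

lemma leftDerivL_apply_fst {Φ : SemiProd F → V} {h : H} {t : ℝ}
    (hΦ : MDifferentiableAt (𝓘(ℝ, E).prod 𝓘(ℝ, ℝ)) 𝓘(ℝ, V) Φ (mk F h t)) 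
    (hΦt : MDifferentiableAt 𝓘(ℝ, E) 𝓘(ℝ, V) (fun h => Φ (mk F h t)) h) (y : E) :
    leftDerivL (𝓘(ℝ, E).prod 𝓘(ℝ, ℝ)) Φ (mk F h t) (y, 0) =
      leftDerivL 𝓘(ℝ, E) (fun h => Φ (mk F h t)) h (expFlow α t y) := by
  have h1 := (differentiableAt_mul_oneParam hΦ).hasFDerivAt
  rw [oneCoord_eq] at h1
  have h2 : HasFDerivAt (fun w : E => (w, (0 : ℝ))) (ContinuousLinearMap.inl ℝ E ℝ)
      (oneCoord 𝓘(ℝ, E) H) := (hasFDerivAt_id _).prodMk (hasFDerivAt_const _ _)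
  have h3 := HasFDerivAt.comp (oneCoord 𝓘(ℝ, E) H) h1 h2
  have h4 := hasFDerivAt_mul_flow F hΦt t
  have h5 : ((fun z => Φ (mk F h t * oneParam (𝓘(ℝ, E).prod 𝓘(ℝ, ℝ)) (SemiProd F) z)) ∘
      fun w : E => (w, (0 : ℝ))) = fun w => Φ (mk F (h * F.at t (oneParam 𝓘(ℝ, E) H w)) t) := by
    funext w
    rw [Function.comp_apply, oneParam_eq, mul_eq]
    simp
  rw [h5] at h3
  have h6 := congrArg (fun f : E →L[ℝ] V => f y) (h3.unique h4)
  rw [leftDerivL, oneCoord_eq]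
  exact h6

end SemiProd

open SemiProd

lemma sum_smul_inducedDer {k : ℕ} (a : AltForm E k) (t : ℝ) (w : Fin k → E × ℝ) (s : ℝ) :
    ∑ i, flowLift α t a (Function.update w i (s • α (w i).1, 0)) =
      s * flowLift α t (inducedDer α k a) w := by
  rw [flowLift_apply, inducedDer_apply, Finset.mul_sum]
  refine Finset.sum_congr rfl fun i _ => ?_
  rw [flowLift_apply]
  have h1 : (fun j => expFlow α t (Function.update w i (s • α (w i).1, (0 : ℝ)) j).1) =
      Function.update (fun j => expFlow α t (w j).1) i (s • α (expFlow α t (w i).1)) := by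
    funext j
    by_cases hj : j = i
    · subst hj; simp [expFlow_comm]
    · simp [hj]
  rw [h1, a.map_update_smul]
  rfl

lemma flowLift_update_adL (hα : IsDerivation H α) {k : ℕ} (a : AltForm E k) (t : ℝ)
    (w : Fin k → E × ℝ) (i : Fin k) (x y : E) :
    flowLift α t a (Function.update w i (adL 𝓘(ℝ, E) H x y, 0)) =
      a (Function.update (fun j => expFlow α t (w j).1) i
        (adL 𝓘(ℝ, E) H (expFlow α t x) (expFlow α t y))) := by
  rw [flowLift_apply]
  congr 1
  funext j
  by_cases hj : j = i
  · subst hj; simp [expFlow_adL hα]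
  · simp [hj]

lemma algDer_apply (ad : E →L[ℝ] E →L[ℝ] E) {k : ℕ} (c : AltForm E k) (v : Fin (k + 1) → E) :
    algDer ad c v = ∑ j : Fin (k + 1), (-1 : ℝ) ^ (j : ℕ) * (-(1 / 2) * ∑ a : Fin k,
        c (Function.update (fun b => v (j.succAbove b)) a (ad (v j) (v (j.succAbove a))))) := by
  rw [algDer, alternatizeUncurryFin_coe]
  refine Finset.sum_congr rfl fun j _ => ?_
  rw [halfDer_apply, ContinuousAlternatingMap.smul_apply, inducedDer_apply, smul_eq_mul]

/-- A bracket in G is a bracket in H plus two terms in which one ∂_t-component acts through α. The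
flow respects the brackets of H. After antisymmetrization the two mixed terms contribute equally
(`alternatize_bilin_swap`), so the factor -½ becomes -1. -/
lemma algDer_flowLift (hα : IsDerivation H α) {k : ℕ} (a : AltForm E k) (t : ℝ) :
    algDer (adL (𝓘(ℝ, E).prod 𝓘(ℝ, ℝ)) (SemiProd F)) (flowLift α t a) =
      flowLift α t (algDer (adL 𝓘(ℝ, E) H) a) -
        lineWedge dt (flowLift α t (inducedDer α k a)) := by
  ext v
  rw [algDer_apply, ContinuousAlternatingMap.sub_apply, flowLift_apply, algDer_apply,
    coe_lineWedge]
  have hsplit : ∀ (j : Fin (k + 1)), ∑ c : Fin k, flowLift α t a (Function.update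
      (fun b => v (j.succAbove b)) c (adL (𝓘(ℝ, E).prod 𝓘(ℝ, ℝ)) (SemiProd F) (v j)
        (v (j.succAbove c)))) =
      ∑ c : Fin k, a (Function.update (fun b => expFlow α t (v (j.succAbove b)).1) c
        (adL 𝓘(ℝ, E) H (expFlow α t (v j).1) (expFlow α t (v (j.succAbove c)).1))) +
      (v j).2 * flowLift α t (inducedDer α k a) (fun b => v (j.succAbove b)) -
      ∑ c : Fin k, flowLift α t a (Function.update (fun b => v (j.succAbove b)) c
        ((v (j.succAbove c)).2 • α (v j).1, 0)) := by
    intro j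
    rw [← sum_smul_inducedDer, ← Finset.sum_add_distrib, ← Finset.sum_sub_distrib]
    refine Finset.sum_congr rfl fun c _ => ?_
    rw [← flowLift_update_adL hα, ← (flowLift α t a).map_update_add,
      ← (flowLift α t a).map_update_sub, adL_apply_eq]
    simp
  simp only [hsplit]
  have hswap := alternatize_bilin_swap (flowLift α t a)
    (fun x y : E × ℝ => ((x.2 • α y.1, 0) : E × ℝ)) v
  have h2 : extMul (dt : E × ℝ → ℝ) (flowLift α t (inducedDer α k a)) v = ∑ j : Fin (k + 1),
      (-1 : ℝ) ^ (j : ℕ) * ((v j).2 * flowLift α t (inducedDer α k a) fun b => v (j.succAbove b)) := by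
    unfold extMul
    refine Finset.sum_congr rfl fun j _ => ?_
    simp [dt]
    try ring
  rw [h2]
  have h3 : ∀ j : Fin (k + 1), ∑ c : Fin k, flowLift α t a (Function.update
      (fun b => v (j.succAbove b)) c ((v j).2 • α (v (j.succAbove c)).1, 0)) =
      (v j).2 * flowLift α t (inducedDer α k a) (fun b => v (j.succAbove b)) :=
    fun j => sum_smul_inducedDer a t _ _
  simp only [h3] at hswap
  rw [← sub_eq_zero] at hswap ⊢
  rw [← Finset.sum_sub_distrib, ← Finset.sum_sub_distrib]
  simp only [sub_neg_eq_add, ← Finset.sum_add_distrib] at hswap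
  refine Eq.trans ?_ ((congrArg (fun x => (1 / 2 : ℝ) * x) hswap).trans (mul_zero _))
  rw [Finset.mul_sum]
  refine Finset.sum_congr rfl fun j _ => ?_
  ring

lemma flowLift_lineWedge {k : ℕ} (τ : E →L[ℝ] ℝ) (a : AltForm E k) (t : ℝ) :
    flowLift α t (lineWedge τ a) =
      lineWedge ((τ ∘L expFlow α t) ∘L ContinuousLinearMap.fst ℝ E ℝ) (flowLift α t a) := by
  ext v
  rw [flowLift_apply, coe_lineWedge, coe_lineWedge]
  rfl

/-- The t-derivative of the pull-back produces dt ∧ π^* of the derivation applied to a, and the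
bracket terms produce the opposite by `algDer_flowLift`. What remains is that d commutes with
pull-back, together with the derivative of ψ. -/
theorem extDerL_flowLift (hα : IsDerivation H α) {k : ℕ} {f : H → ℝ} {h : H} {t : ℝ}
    (hf : MDifferentiableAt 𝓘(ℝ, E) 𝓘(ℝ, ℝ) f h) {ψ : ℝ → ℝ} {ψ' : ℝ} (hψ : HasDerivAt ψ ψ' t)
    (a : AltForm E k) :
    extDerL (𝓘(ℝ, E).prod 𝓘(ℝ, ℝ)) (fun g : SemiProd F => f g.fst • ψ g.snd • flowLift α g.snd a)
        (mk F h t) =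
      (ψ' * f h) • lineWedge dt (flowLift α t a) +
        ψ t • flowLift α t (extDerSymbol 𝓘(ℝ, E) k f h a) := by
  have h1 := leftDerivL_smul_comp_snd F hf (hψ.fun_smul (hasDerivAt_flowLift α a t))
  have h2 : extDerL (𝓘(ℝ, E).prod 𝓘(ℝ, ℝ))
      (fun g : SemiProd F => f g.fst • ψ g.snd • flowLift α g.snd a) (mk F h t) =
      ContinuousAlternatingMap.alternatizeUncurryFin
        (leftDerivL (𝓘(ℝ, E).prod 𝓘(ℝ, ℝ))
          (fun g : SemiProd F => f g.fst • ψ g.snd • flowLift α g.snd a) (mk F h t)) +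
        algDer (adL (𝓘(ℝ, E).prod 𝓘(ℝ, ℝ)) (SemiProd F)) (f h • ψ t • flowLift α t a) :=
    ContinuousAlternatingMap.alternatizeUncurryFin_add _ _
  have h3 : ∀ (c : ℝ) (b : AltForm (E × ℝ) k),
      algDer (adL (𝓘(ℝ, E).prod 𝓘(ℝ, ℝ)) (SemiProd F)) (c • b) =
      c • algDer (adL (𝓘(ℝ, E).prod 𝓘(ℝ, ℝ)) (SemiProd F)) b := fun c b =>
    (algDerL (adL (𝓘(ℝ, E).prod 𝓘(ℝ, ℝ)) (SemiProd F)) k).map_smul c b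
  have h4 : ∀ (c : ℝ) (b : AltForm E (k + 1)), flowLift α t (c • b) = c • flowLift α t b :=
    fun _ _ => rfl
  have h5 : ∀ (b b' : AltForm E (k + 1)), flowLift α t (b + b') = flowLift α t b + flowLift α t b' :=
    fun _ _ => rfl
  have h6 : ∀ (τ : E × ℝ →L[ℝ] ℝ) (c : ℝ) (b : AltForm (E × ℝ) k),
      lineWedge τ (c • b) = c • lineWedge τ b := fun τ c b => (lineWedgeₗ k τ).map_smul c b
  have h7 : ∀ (τ : E × ℝ →L[ℝ] ℝ) (b b' : AltForm (E × ℝ) k),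
      lineWedge τ (b + b') = lineWedge τ b + lineWedge τ b' := fun τ b b' =>
    (lineWedgeₗ k τ).map_add b b'
  rw [h2, h1, ContinuousAlternatingMap.alternatizeUncurryFin_add, h3, h3, algDer_flowLift F hα,
    extDerSymbol_apply, h5, h4, flowLift_lineWedge]
  change lineWedge _ _ + lineWedge _ _ + _ = _
  rw [h6, h6, h7, h6, h6]
  module

end SemiDirectCalculus

/-! ### The modulus of the semi-direct product along the line. -/

section SemiDirectMeasure

variable {E : Type*} [NormedAddCommGroup E] [NormedSpace ℝ E] [FiniteDimensional ℝ E]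
  {H : Type*} [TopologicalSpace H] [T2Space H] [SecondCountableTopology H]
  [ChartedSpace E H] [Group H] [LieGroup 𝓘(ℝ, E) ∞ H]
  [MeasurableSpace H] [BorelSpace H] {α : E →L[ℝ] E} (F : AutFlow H α)

namespace SemiProd

instance : T2Space (SemiProd F) := inferInstanceAs (T2Space (H × ℝ))

instance : SecondCountableTopology (SemiProd F) :=
  inferInstanceAs (SecondCountableTopology (H × ℝ))

/-- The underlying homeomorphism with the product. -/
def homeo : SemiProd F ≃ₜ H × ℝ := Homeomorph.refl (H × ℝ)

lemma continuous_fst : Continuous (fst : SemiProd F → H) :=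
  _root_.continuous_fst.comp (homeo F).continuous

lemma continuous_snd : Continuous (snd : SemiProd F → ℝ) :=
  _root_.continuous_snd.comp (homeo F).continuous

lemma contMDiff_fst : ContMDiff (𝓘(ℝ, E).prod 𝓘(ℝ, ℝ)) 𝓘(ℝ, E) ∞ (fst : SemiProd F → H) :=
  _root_.contMDiff_fst (I := 𝓘(ℝ, E)) (J := 𝓘(ℝ, ℝ)) (M := H) (N := ℝ)

lemma contMDiff_snd : ContMDiff (𝓘(ℝ, E).prod 𝓘(ℝ, ℝ)) 𝓘(ℝ, ℝ) ∞ (snd : SemiProd F → ℝ) :=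
  _root_.contMDiff_snd (I := 𝓘(ℝ, E)) (J := 𝓘(ℝ, ℝ)) (M := H) (N := ℝ)

lemma contMDiff_mk (t : ℝ) :
    ContMDiff 𝓘(ℝ, E) (𝓘(ℝ, E).prod 𝓘(ℝ, ℝ)) ∞ (fun h => mk F h t) :=
  (contMDiff_id.prodMk contMDiff_const : ContMDiff 𝓘(ℝ, E) (𝓘(ℝ, E).prod 𝓘(ℝ, ℝ)) ∞
    fun h : H => (h, t))

variable (ν : Measure (SemiProd F)) [ν.IsHaarMeasure]

/-- The logarithmic derivative of the modulus is the trace form, whose value on ∂_t is tr α; this is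
a linear differential equation with value 1 at s = 0. -/
lemma modulus_mk_one {c : SemiProd F → ℝ} (hm : ∀ g h, c (g * h) = c g * c h) (hpos : ∀ g, 0 < c g)
    (hc : ∀ (f : SemiProd F → ℝ) (g : SemiProd F), ∫ h, f (h * g) ∂ν = c g * ∫ h, f h ∂ν) (s : ℝ) :
    c (mk F 1 s) = Real.exp (LinearMap.trace ℝ E (α : E →ₗ[ℝ] E) * s) := by
  set lam := LinearMap.trace ℝ E (α : E →ₗ[ℝ] E) with hlam
  obtain ⟨hsm, hder⟩ := contMDiff_modulus (I := 𝓘(ℝ, E).prod 𝓘(ℝ, ℝ)) ν hm hc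
  have h1 : ∀ s, HasDerivAt (fun s => c (mk F 1 s)) (lam * c (mk F 1 s)) s := by
    intro s
    have h2 := (differentiableAt_mul_oneParam ((hsm (mk F 1 s)).mdifferentiableAt
      (by simp))).hasFDerivAt
    change HasFDerivAt _ (leftDerivL (𝓘(ℝ, E).prod 𝓘(ℝ, ℝ)) c (mk F 1 s)) _ at h2
    rw [hder, oneCoord_eq] at h2
    have h3 : HasDerivAt (fun u : ℝ => (oneCoord 𝓘(ℝ, E) H, u - s)) ((0 : E), (1 : ℝ)) s :=
      (hasDerivAt_const s _).prodMk ((hasDerivAt_id s).sub_const s)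
    have h2' : HasFDerivAt (fun z => c (mk F 1 s * oneParam (𝓘(ℝ, E).prod 𝓘(ℝ, ℝ)) (SemiProd F) z))
      (c (mk F 1 s) • traceForm (adL (𝓘(ℝ, E).prod 𝓘(ℝ, ℝ)) (SemiProd F)))
      (oneCoord 𝓘(ℝ, E) H, s - s) := by rwa [sub_self]
    have h4 := h2'.comp_hasDerivAt s h3
    have h5 : ((fun z => c (mk F 1 s * oneParam (𝓘(ℝ, E).prod 𝓘(ℝ, ℝ)) (SemiProd F) z)) ∘
        fun u : ℝ => (oneCoord 𝓘(ℝ, E) H, u - s)) = fun u => c (mk F 1 u) := by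
      funext u
      rw [Function.comp_apply, oneParam_eq, mul_eq]
      simp
    rw [h5] at h4
    refine h4.congr_deriv ?_
    rw [smul_apply, traceForm_zero_one, smul_eq_mul, mul_comm]
  have h2 : ∀ s, HasDerivAt (fun s => Real.exp (-(lam * s)) * c (mk F 1 s)) 0 s := by
    intro t
    have h3 : HasDerivAt (fun t => -(lam * t)) (-lam) t := by
      simpa using ((hasDerivAt_id t).const_mul lam).fun_neg
    refine (h3.exp.mul (h1 t)).congr_deriv (by ring)
  have h4 := is_const_of_deriv_eq_zero (fun t => (h2 t).differentiableAt) (fun t => (h2 t).deriv) s 0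
  have h5 : c (mk F 1 0) = 1 := by
    have h6 := hm 1 1
    have h7 := hpos 1
    rw [mul_one] at h6
    have : c 1 = 1 := by
      have : c 1 * (c 1 - 1) = 0 := by linarith
      rcases mul_eq_zero.1 this with h | h <;> linarith
    exact this
  simp only [mul_zero, neg_zero, Real.exp_zero, one_mul, h5] at h4
  rw [← mul_one (Real.exp (lam * s)), ← h4, ← mul_assoc, ← Real.exp_add]
  simp

end SemiProd

end SemiDirectMeasure

/-! ### Lebesgue measure as Haar measure on a multiplicative copy of ℝ. -/

section MultiplicativeReal

instance : MeasurableSpace (Multiplicative ℝ) := inferInstanceAs (MeasurableSpace ℝ)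

instance : BorelSpace (Multiplicative ℝ) := inferInstanceAs (BorelSpace ℝ)

instance : SecondCountableTopology (Multiplicative ℝ) :=
  inferInstanceAs (SecondCountableTopology ℝ)

/-- Lebesgue measure on the multiplicative group of real numbers. -/
def multVolume : Measure (Multiplicative ℝ) := (volume : Measure ℝ)

instance : SFinite multVolume := inferInstanceAs (SFinite (volume : Measure ℝ))

instance : multVolume.IsHaarMeasure where
  lt_top_of_isCompact := fun K hK => IsCompact.measure_lt_top (μ := (volume : Measure ℝ)) hK
  map_mul_left_eq_self := fun g => map_add_left_eq_self (volume : Measure ℝ) g.toAdd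
  open_pos := fun U hU hne => IsOpen.measure_ne_zero (volume : Measure ℝ) hU hne

end MultiplicativeReal

/-! ### Haar measure of the semi-direct product in product coordinates. -/

section SemiDirectMeasure

variable {E : Type*} [NormedAddCommGroup E] [NormedSpace ℝ E] [FiniteDimensional ℝ E]
  {H : Type*} [TopologicalSpace H] [T2Space H] [SecondCountableTopology H]
  [ChartedSpace E H] [Group H] [LieGroup 𝓘(ℝ, E) ∞ H]
  [MeasurableSpace H] [BorelSpace H] {α : E →L[ℝ] E} (F : AutFlow H α)

namespace SemiProd

variable (ν : Measure (SemiProd F)) [ν.IsHaarMeasure]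

/-- The point (h₀h, s + t) is (h₀, 0)(h, t)(1, s). The left factor preserves ν and the right one has
modulus e^{tr(α)s}, which the weight e^{tr(α)t} compensates. -/
lemma lintegral_exp_mul (f : SemiProd F → ℝ≥0∞) (hf : Measurable f) (h₀ : H) (s : ℝ) :
    ∫⁻ g, ENNReal.ofReal (Real.exp (LinearMap.trace ℝ E (α : E →ₗ[ℝ] E) * g.snd)) *
      f (mk F (h₀ * g.fst) (s + g.snd)) ∂ν =
    ∫⁻ g, ENNReal.ofReal (Real.exp (LinearMap.trace ℝ E (α : E →ₗ[ℝ] E) * g.snd)) * f g ∂ν := by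
  have : IsTopologicalGroup (SemiProd F) := topologicalGroup_of_lieGroup (𝓘(ℝ, E).prod 𝓘(ℝ, ℝ)) ∞
  have : LocallyCompactSpace (SemiProd F) :=
    Manifold.locallyCompact_of_finiteDimensional (𝓘(ℝ, E).prod 𝓘(ℝ, ℝ))
  obtain ⟨c, hpos, hm, hc, hcl⟩ := exists_modulus ν
  set lam := LinearMap.trace ℝ E (α : E →ₗ[ℝ] E) with hlam
  have hmeas : Measurable fun g : SemiProd F => ENNReal.ofReal (Real.exp (lam * g.snd)) :=
    (Real.continuous_exp.comp (continuous_const.mul (continuous_snd F))).measurable.ennreal_ofReal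
  have h1 : (fun g : SemiProd F => ENNReal.ofReal (Real.exp (lam * g.snd)) *
      f (mk F (h₀ * g.fst) (s + g.snd))) = fun g => (fun x : SemiProd F =>
        ENNReal.ofReal (Real.exp (-(lam * s))) *
        (ENNReal.ofReal (Real.exp (lam * x.snd)) * f x)) ((mk F h₀ 0 * g) * mk F 1 s) := by
    funext g
    have e : (mk F h₀ 0 * g) * mk F 1 s = mk F (h₀ * g.fst) (s + g.snd) := by
      rw [mul_eq, mul_eq]
      simp [AutFlow.at, add_comm]
    simp only [e, snd_mk]
    rw [← mul_assoc, ← ENNReal.ofReal_mul (Real.exp_pos _).le, ← Real.exp_add]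
    congr 4
    ring
  rw [h1, lintegral_mul_left_eq_self (μ := ν) (fun g => (fun x : SemiProd F =>
        ENNReal.ofReal (Real.exp (-(lam * s))) *
        (ENNReal.ofReal (Real.exp (lam * x.snd)) * f x)) (g * mk F 1 s)),
    hcl (fun x : SemiProd F => ENNReal.ofReal (Real.exp (-(lam * s))) *
        (ENNReal.ofReal (Real.exp (lam * x.snd)) * f x)) ((hmeas.mul hf).const_mul _), modulus_mk_one F ν hm hpos hc, lintegral_const_mul (f := fun x : SemiProd F =>
      ENNReal.ofReal (Real.exp (lam * x.snd)) * f x) _ (hmeas.mul hf), ← mul_assoc, ← ENNReal.ofReal_mul (Real.exp_pos _).le, ← Real.exp_add]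
  simp [hlam]

/-- By `lintegral_exp_mul` the measure e^{tr(α)t} ν is invariant under the direct product H × ℝ, so
uniqueness of Haar measure makes it a multiple of the product measure. -/
lemma exists_map_homeo_eq (μ : Measure H) [μ.IsHaarMeasure] : ∃ c : ℝ≥0∞, c ≠ 0 ∧ c ≠ ⊤ ∧
    ν.map (homeo F) = c • μ.prod (volume.withDensity fun t => ENNReal.ofReal
      (Real.exp (-(LinearMap.trace ℝ E (α : E →ₗ[ℝ] E) * t)))) := by
  have : IsTopologicalGroup H := topologicalGroup_of_lieGroup 𝓘(ℝ, E) ∞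
  have : LocallyCompactSpace H := Manifold.locallyCompact_of_finiteDimensional 𝓘(ℝ, E)
  have : IsTopologicalGroup (SemiProd F) := topologicalGroup_of_lieGroup (𝓘(ℝ, E).prod 𝓘(ℝ, ℝ)) ∞
  have : LocallyCompactSpace (SemiProd F) :=
    Manifold.locallyCompact_of_finiteDimensional (𝓘(ℝ, E).prod 𝓘(ℝ, ℝ))
  set lam := LinearMap.trace ℝ E (α : E →ₗ[ℝ] E) with hlam
  let κ : SemiProd F ≃ₜ H × Multiplicative ℝ := homeo F
  let w : SemiProd F → ℝ≥0∞ := fun g => ENNReal.ofReal (Real.exp (lam * g.snd))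
  have hwc : Continuous fun g : SemiProd F => Real.exp (lam * g.snd) :=
    Real.continuous_exp.comp (continuous_const.mul (continuous_snd F))
  have hw : Measurable w := hwc.measurable.ennreal_ofReal
  let ν₁ : Measure (H × Multiplicative ℝ) := (ν.withDensity w).map κ
  have i1 : IsLocallyFiniteMeasure (ν.withDensity w) :=
    IsLocallyFiniteMeasure.withDensity_ofReal hwc
  have i2 : IsFiniteMeasureOnCompacts ν₁ := Measure.IsFiniteMeasureOnCompacts.map _ κ
  have i3 : (ν.withDensity w).IsOpenPosMeasure :=
    (withDensity_absolutelyContinuous' hw.aemeasurable (Filter.Eventually.of_forall fun g => by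
      simp [w, Real.exp_pos])).isOpenPosMeasure
  have i4 : ν₁.IsOpenPosMeasure := κ.continuous.isOpenPosMeasure_map κ.surjective
  have i5 : ν₁.IsMulLeftInvariant := by
    refine ⟨fun x => Measure.ext_of_lintegral _ fun f hf => ?_⟩
    rw [lintegral_map hf (measurable_const_mul x),
      lintegral_map (f := fun a => f (x * a)) (hf.comp (measurable_const_mul x)) κ.measurable,
      lintegral_map hf κ.measurable,
      lintegral_withDensity_eq_lintegral_mul (g := fun a => f (x * κ a)) _ hw
        ((hf.comp (measurable_const_mul x)).comp κ.measurable),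
      lintegral_withDensity_eq_lintegral_mul (g := fun a => f (κ a)) _ hw (hf.comp κ.measurable)]
    exact lintegral_exp_mul F ν (fun g => f (κ g)) (hf.comp κ.measurable) x.1 x.2.toAdd
  have i6 : ν₁.IsHaarMeasure := {}
  have h1 := Measure.isMulLeftInvariant_eq_smul ν₁ (μ.prod multVolume)
  have h2 := Measure.haarScalarFactor_pos_of_isHaarMeasure ν₁ (μ.prod multVolume)
  refine ⟨Measure.haarScalarFactor ν₁ (μ.prod multVolume), by exact_mod_cast h2.ne',
    ENNReal.coe_ne_top, Measure.ext_of_lintegral _ fun f hf => ?_⟩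
  set c := Measure.haarScalarFactor ν₁ (μ.prod multVolume)
  have hw' : Measurable fun t : ℝ => ENNReal.ofReal (Real.exp (-(lam * t))) := by fun_prop
  have hw2 : Measurable fun x : H × ℝ => ENNReal.ofReal (Real.exp (-(lam * x.2))) :=
    hw'.comp measurable_snd
  let f' : H × Multiplicative ℝ → ℝ≥0∞ :=
    fun x => ENNReal.ofReal (Real.exp (-(lam * x.2.toAdd))) * f (x.1, x.2.toAdd)
  have hf' : Measurable f' := hw2.mul hf
  have h3 : ∫⁻ x, f' x ∂ν₁ =
      c * ∫⁻ x, ENNReal.ofReal (Real.exp (-(lam * x.2))) * f x ∂(μ.prod volume) := by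
    rw [h1]
    exact lintegral_smul_measure _ _
  have h4 : ∫⁻ x, f' x ∂ν₁ = ∫⁻ g, w g * f' (κ g) ∂ν := by
    rw [lintegral_map hf' κ.measurable, lintegral_withDensity_eq_lintegral_mul
      (g := fun g => f' (κ g)) _ hw (hf'.comp κ.measurable)]
    rfl
  rw [lintegral_smul_measure, prod_withDensity_right hw',
    lintegral_withDensity_eq_lintegral_mul _ hw2 hf, lintegral_map hf (homeo F).measurable]
  refine Eq.trans ?_ (h4.symm.trans h3)
  refine lintegral_congr fun g => ?_
  change f (homeo F g) = ENNReal.ofReal (Real.exp (lam * g.snd)) *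
    (ENNReal.ofReal (Real.exp (-(lam * g.snd))) * f (homeo F g))
  rw [← mul_assoc, ← ENNReal.ofReal_mul (Real.exp_pos _).le, ← Real.exp_add]
  simp

/-- The Haar measure of the semi-direct product along the line. -/
def lineMeasure (c lam : ℝ) : Measure ℝ :=
  volume.withDensity fun t => ENNReal.ofReal (c * Real.exp (-(lam * t)))

instance (c lam : ℝ) : IsLocallyFiniteMeasure (lineMeasure c lam) :=
  IsLocallyFiniteMeasure.withDensity_ofReal (by fun_prop)

theorem exists_measurePreserving (μ : Measure H) [μ.IsHaarMeasure] : ∃ c : ℝ, 0 < c ∧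
    MeasurePreserving (homeo F) ν
      (μ.prod (lineMeasure c (LinearMap.trace ℝ E (α : E →ₗ[ℝ] E)))) := by
  obtain ⟨c, hc0, hct, hc⟩ := exists_map_homeo_eq F ν μ
  refine ⟨c.toReal, ENNReal.toReal_pos hc0 hct, (homeo F).measurable, ?_⟩
  have h1 : lineMeasure c.toReal (LinearMap.trace ℝ E (α : E →ₗ[ℝ] E)) =
      c • volume.withDensity fun t => ENNReal.ofReal
        (Real.exp (-(LinearMap.trace ℝ E (α : E →ₗ[ℝ] E) * t))) := by
    rw [← withDensity_smul _ (by fun_prop), lineMeasure]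
    congr 1
    funext t
    rw [ENNReal.ofReal_mul ENNReal.toReal_nonneg, ENNReal.ofReal_toReal hct]
    rfl
  rw [hc, h1, Measure.prod_smul_right]

end SemiProd

end SemiDirectMeasure

/-! ### Integration of L^p functions along fibres of finite measure. -/

section FiberIntegral

variable {X T V : Type*} [MeasurableSpace X] [MeasurableSpace T] {μ : Measure X} {τ : Measure T}
  [SFinite μ] [IsFiniteMeasure τ] [NormedAddCommGroup V] [NormedSpace ℝ V]
  {p q : ℝ≥0∞}

lemma MeasureTheory.MemLp.ae_memLp_fiber {Ξ : X × T → V} (hp : p ≠ 0) (hpt : p ≠ ⊤)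
    (h : MemLp Ξ p (μ.prod τ)) : ∀ᵐ x ∂μ, MemLp (fun t => Ξ (x, t)) p τ := by
  have h1 := (eLpNorm_lt_top_iff_lintegral_rpow_enorm_lt_top hp hpt).1 h.2
  rw [lintegral_prod _ (by exact (h.1.enorm.pow_const _))] at h1
  have hm : AEMeasurable (fun x => ∫⁻ t, ‖Ξ (x, t)‖ₑ ^ p.toReal ∂τ) μ :=
    (h.1.enorm.pow_const _).lintegral_prod_right'
  filter_upwards [ae_lt_top' hm h1.ne, h.1.prodMk_left] with x hx hx'
  exact ⟨hx', (eLpNorm_lt_top_iff_lintegral_rpow_enorm_lt_top hp hpt).2 hx⟩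

/-- On a finite measure the L¹ norm is controlled by the L^p norm. This bounds the p-th power of the
fibre integral by a constant times the fibre integral of the p-th power, for almost every x. -/
lemma MeasureTheory.MemLp.integral_fiber {Ξ : X × T → V} (hp : 1 ≤ p) (hpt : p ≠ ⊤)
    (h : MemLp Ξ p (μ.prod τ)) : MemLp (fun x => ∫ t, Ξ (x, t) ∂τ) p μ := by
  have hp0 : p ≠ 0 := (zero_lt_one.trans_le hp).ne'
  have hpr : 0 < p.toReal := ENNReal.toReal_pos hp0 hpt
  refine ⟨h.1.integral_prod_right', ?_⟩
  rw [eLpNorm_lt_top_iff_lintegral_rpow_enorm_lt_top hp0 hpt]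
  have h1 := (eLpNorm_lt_top_iff_lintegral_rpow_enorm_lt_top hp0 hpt).1 h.2
  rw [lintegral_prod _ (by exact (h.1.enorm.pow_const _))] at h1
  set K : ℝ≥0∞ := τ univ ^ (1 / (1 : ℝ≥0∞).toReal - 1 / p.toReal) with hK
  have hKt : K ≠ ⊤ := by
    refine ENNReal.rpow_ne_top_of_nonneg ?_ (measure_ne_top τ univ)
    have h2 : (1 : ℝ) ≤ p.toReal := by
      rw [← ENNReal.toReal_one]
      exact ENNReal.toReal_mono hpt hp
    simp only [ENNReal.toReal_one, div_one, one_div, sub_nonneg]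
    exact inv_le_one_of_one_le₀ h2
  have hb : ∀ᵐ x ∂μ, ‖∫ t, Ξ (x, t) ∂τ‖ₑ ^ p.toReal ≤
      K ^ p.toReal * ∫⁻ t, ‖Ξ (x, t)‖ₑ ^ p.toReal ∂τ := by
    filter_upwards [h.1.prodMk_left] with x hx
    have h3 : ‖∫ t, Ξ (x, t) ∂τ‖ₑ ≤ eLpNorm (fun t => Ξ (x, t)) p τ * K := by
      refine (enorm_integral_le_lintegral_enorm _).trans ?_
      rw [← eLpNorm_one_eq_lintegral_enorm]
      exact eLpNorm_le_eLpNorm_mul_rpow_measure_univ hp hx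
    refine (ENNReal.rpow_le_rpow h3 hpr.le).trans ?_
    rw [ENNReal.mul_rpow_of_nonneg _ _ hpr.le, eLpNorm_eq_lintegral_rpow_enorm_toReal hp0 hpt,
      ← ENNReal.rpow_mul, one_div, inv_mul_cancel₀ hpr.ne', ENNReal.rpow_one, mul_comm]
  refine (lintegral_mono_ae hb).trans_lt ?_
  rw [lintegral_const_mul' _ _ (ENNReal.rpow_ne_top_of_nonneg hpr.le hKt)]
  exact ENNReal.mul_lt_top (ENNReal.rpow_lt_top_of_nonneg hpr.le hKt) h1

lemma integrable_clm_apply [p.HolderConjugate q] {X : Type*} [MeasurableSpace X] {μ : Measure X}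
    {Ξ : X → V →L[ℝ] ℝ} {v : X → V} (hΞ : MemLp Ξ p μ) (hv : MemLp v q μ) :
    Integrable (fun x => Ξ x (v x)) μ := by
  have h1 : Integrable (fun x => ‖Ξ x‖ * ‖v x‖) μ := MemLp.integrable_mul (hΞ.norm) (hv.norm)
  refine h1.mono' (aestronglyMeasurable_clm_apply hΞ.1 hv.1) ?_
  exact Filter.Eventually.of_forall fun x => (Ξ x).le_opNorm _

lemma integral_fiber_apply [p.HolderConjugate q] (hp : 1 ≤ p) (hpt : p ≠ ⊤)
    {Ξ : X × T → V →L[ℝ] ℝ} {v : X → V} (hΞ : MemLp Ξ p (μ.prod τ)) (hv : MemLp v q μ) :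
    ∫ x, (∫ t, Ξ (x, t) ∂τ) (v x) ∂μ = ∫ z, Ξ z (v z.1) ∂(μ.prod τ) := by
  have hp0 : p ≠ 0 := (zero_lt_one.trans_le hp).ne'
  have h1 : Integrable (fun z : X × T => Ξ z (v z.1)) (μ.prod τ) :=
    integrable_clm_apply hΞ (hv.comp_fst τ)
  rw [integral_prod _ h1]
  refine integral_congr_ae ?_
  filter_upwards [hΞ.ae_memLp_fiber hp0 hpt] with x hx
  exact ContinuousLinearMap.integral_apply (hx.integrable hp) (v x)

/-- The bound on Y is asked only where θ ≠ 0: the flow is bounded on a strip, which carries θ, but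
not on the whole line. -/
lemma memLp_bilin_comp {U W : Type*} [NormedAddCommGroup U] [NormedSpace ℝ U]
    [NormedAddCommGroup W] [NormedSpace ℝ W] (L : U →L[ℝ] W →L[ℝ] ℝ) {Y : X → V →L[ℝ] W}
    {θ : X → U} (hY : AEStronglyMeasurable Y μ) {C : ℝ} (hC : ∀ x, θ x ≠ 0 → ‖Y x‖ ≤ C)
    (hθ : MemLp θ p μ) : MemLp (fun x => L (θ x) ∘L Y x) p μ := by
  have hm : AEStronglyMeasurable (fun x => L (θ x) ∘L Y x) μ :=
    aestronglyMeasurable_bilin_apply (ContinuousLinearMap.compL ℝ V W ℝ)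
      (L.continuous.comp_aestronglyMeasurable hθ.1) hY
  refine hθ.of_le_mul (c := ‖L‖ * C) hm (Filter.Eventually.of_forall fun x => ?_)
  by_cases hx : θ x = 0
  · simp [hx]
  · calc ‖L (θ x) ∘L Y x‖ ≤ ‖L (θ x)‖ * ‖Y x‖ := ContinuousLinearMap.opNorm_comp_le _ _
      _ ≤ (‖L‖ * ‖θ x‖) * C := by
        gcongr
        · exact L.le_opNorm _
        · exact hC x hx
      _ = _ := by ring

end FiberIntegral

/-! ### Smooth plateau functions on the line. -/

section Plateau

lemma exists_abs_deriv_smoothTransition_le : ∃ K, 0 ≤ K ∧ ∀ x, |deriv Real.smoothTransition x| ≤ K := by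
  have hc : Continuous (deriv Real.smoothTransition) :=
    (Real.smoothTransition.contDiff (n := 1)).continuous_deriv le_rfl
  obtain ⟨K, hK⟩ := (isCompact_Icc (a := (0 : ℝ)) (b := 1)).exists_bound_of_continuousOn
    hc.continuousOn
  refine ⟨max K 0, le_max_right _ _, fun x => ?_⟩
  by_cases hx : x ∈ Icc (0 : ℝ) 1
  · exact (hK x hx).trans (le_max_left _ _)
  · have h0 : deriv Real.smoothTransition x = 0 := by
      rcases lt_or_ge x 0 with h | h
      · have : Real.smoothTransition =ᶠ[𝓝 x] fun _ => (0 : ℝ) := by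
          filter_upwards [Iio_mem_nhds h] with y hy
          exact Real.smoothTransition.zero_of_nonpos (le_of_lt hy)
        rw [this.deriv_eq, deriv_const]
      · have h1 : 1 < x := not_le.1 fun h' => hx ⟨h, h'⟩
        have : Real.smoothTransition =ᶠ[𝓝 x] fun _ => (1 : ℝ) := by
          filter_upwards [Ioi_mem_nhds h1] with y hy
          exact Real.smoothTransition.one_of_one_le (le_of_lt hy)
        rw [this.deriv_eq, deriv_const]
    rw [h0, abs_zero]
    exact le_max_right _ _

/-- Smooth cut-off functions with a prescribed slope. -/
lemma exists_plateau : ∃ K, 0 ≤ K ∧ ∀ c R L : ℝ, 0 < L → ∃ κ : ℝ → ℝ, ContDiff ℝ ∞ κ ∧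
    (∀ t, |κ t| ≤ 1) ∧ (∀ t, |t - c| ≤ R → κ t = 1) ∧ (∀ t, R + L ≤ |t - c| → κ t = 0) ∧
    (∀ t, |deriv κ t| ≤ K / L) ∧ (∀ t, |t - c| < R → deriv κ t = 0) ∧
    (∀ t, R + L < |t - c| → deriv κ t = 0) := by
  obtain ⟨K, hK0, hK⟩ := exists_abs_deriv_smoothTransition_le
  -- The cut-off is a product of two transitions, each with slope at most K / L and values in [0,
  -- 1].
  refine ⟨2 * K, by positivity, fun c R L hL => ?_⟩
  let s₁ : ℝ → ℝ := fun t => Real.smoothTransition ((R + L - (t - c)) / L)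
  let s₂ : ℝ → ℝ := fun t => Real.smoothTransition ((R + L + (t - c)) / L)
  have hs : ∀ x, |Real.smoothTransition x| ≤ 1 := fun x =>
    abs_le.2 ⟨by linarith [Real.smoothTransition.nonneg x], Real.smoothTransition.le_one x⟩
  have hd : ∀ x, HasDerivAt Real.smoothTransition (deriv Real.smoothTransition x) x := fun x =>
    ((Real.smoothTransition.contDiff (n := 1)).differentiable (by simp) x).hasDerivAt
  have h₁ : ∀ t, HasDerivAt s₁
      (deriv Real.smoothTransition ((R + L - (t - c)) / L) * (-1 / L)) t := fun t =>
    (hd _).comp t ((((hasDerivAt_id t).sub_const c).const_sub (R + L)).div_const L)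
  have h₂ : ∀ t, HasDerivAt s₂
      (deriv Real.smoothTransition ((R + L + (t - c)) / L) * (1 / L)) t := fun t =>
    (hd _).comp t ((((hasDerivAt_id t).sub_const c).const_add (R + L)).div_const L)
  have hone : ∀ t, |t - c| ≤ R → s₁ t * s₂ t = 1 := by
    intro t ht
    have := abs_le.1 ht
    have e1 : s₁ t = 1 := Real.smoothTransition.one_of_one_le (by
      rw [le_div_iff₀ hL]; linarith)
    have e2 : s₂ t = 1 := Real.smoothTransition.one_of_one_le (by
      rw [le_div_iff₀ hL]; linarith)
    rw [e1, e2, one_mul]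
  have hzero : ∀ t, R + L ≤ |t - c| → s₁ t * s₂ t = 0 := by
    intro t ht
    rcases le_abs.1 ht with h | h
    · have e1 : s₁ t = 0 := Real.smoothTransition.zero_of_nonpos
        (div_nonpos_of_nonpos_of_nonneg (by linarith) hL.le)
      rw [e1, zero_mul]
    · have e2 : s₂ t = 0 := Real.smoothTransition.zero_of_nonpos
        (div_nonpos_of_nonpos_of_nonneg (by linarith) hL.le)
      rw [e2, mul_zero]
  refine ⟨fun t => s₁ t * s₂ t, ?_, ?_, hone, hzero, ?_, ?_, ?_⟩
  · exact (Real.smoothTransition.contDiff.comp (by fun_prop)).mul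
      (Real.smoothTransition.contDiff.comp (by fun_prop))
  · intro t
    rw [abs_mul]
    exact mul_le_one₀ (hs _) (abs_nonneg _) (hs _)
  · intro t
    rw [((h₁ t).fun_mul (h₂ t)).deriv]
    refine (abs_add_le _ _).trans ?_
    rw [abs_mul, abs_mul, abs_mul, abs_mul]
    have e1 : |(-1 : ℝ) / L| = 1 / L := by rw [abs_div, abs_neg, abs_one, abs_of_pos hL]
    have e2 : |(1 : ℝ) / L| = 1 / L := by rw [abs_div, abs_one, abs_of_pos hL]
    rw [e1, e2]
    have e3 : 0 ≤ 1 / L := by positivity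
    calc _ ≤ K * (1 / L) * 1 + 1 * (K * (1 / L)) := by
          gcongr
          exacts [hK _, hs _, hs _, hK _]
      _ = _ := by ring
  · intro t ht
    have : (fun t => s₁ t * s₂ t) =ᶠ[𝓝 t] fun _ => (1 : ℝ) := by
      have hcont : ContinuousAt (fun t => |t - c|) t := by fun_prop
      filter_upwards [hcont.eventually_lt continuousAt_const ht] with y hy using hone y hy.le
    rw [this.deriv_eq, deriv_const]
  · intro t ht
    have : (fun t => s₁ t * s₂ t) =ᶠ[𝓝 t] fun _ => (0 : ℝ) := by
      have hcont : ContinuousAt (fun t => |t - c|) t := by fun_prop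
      filter_upwards [continuousAt_const.eventually_lt hcont ht] with y hy using hzero y hy.le
    rw [this.deriv_eq, deriv_const]

end Plateau

/-! ### Test forms and their exterior derivatives in Lebesgue spaces. -/

section TestForms

variable {E : Type*} [NormedAddCommGroup E] [NormedSpace ℝ E] [FiniteDimensional ℝ E]
  {M : Type*} [TopologicalSpace M] {I : ModelWithCorners ℝ E M} [I.Boundaryless]
  {G : Type*} [TopologicalSpace G] [ChartedSpace M G] [Group G] [LieGroup I ∞ G]
  {k : ℕ} {φ : G → AltForm E k}

lemma continuous_extDerL (hφ : ContMDiff I 𝓘(ℝ, AltForm E k) ∞ φ) : Continuous (extDerL I φ) := by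
  have h : ∀ g, extDerL I φ g = ContinuousAlternatingMap.alternatizeUncurryFinCLM ℝ E ℝ
      (leftDerivL I φ g) + algDerL (adL I G) k (φ g) := fun g =>
    ContinuousAlternatingMap.alternatizeUncurryFin_add _ _
  rw [funext h]
  exact ((ContinuousLinearMap.continuous _).comp (contMDiff_leftDerivL hφ).continuous).add
    ((ContinuousLinearMap.continuous _).comp hφ.continuous)

lemma extDerL_eq_zero (hφ : ContMDiff I 𝓘(ℝ, AltForm E k) ∞ φ) {g : G} (hg : g ∉ tsupport φ) :
    extDerL I φ g = 0 := by
  ext v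
  rw [coe_extDerL ((hφ g).mdifferentiableAt (by simp))]
  have h0 : φ g = 0 := image_eq_zero_of_notMem_tsupport hg
  simp [extDer, leftDeriv_eq_zero I _ hg, h0]

lemma hasCompactSupport_extDerL (hφ : ContMDiff I 𝓘(ℝ, AltForm E k) ∞ φ)
    (hs : HasCompactSupport φ) : HasCompactSupport (extDerL I φ) :=
  HasCompactSupport.intro' hs (isClosed_tsupport φ) fun _ hg => extDerL_eq_zero hφ hg

variable [T2Space G] [SecondCountableTopology G] [MeasurableSpace G] [BorelSpace G]
  (μ : Measure G) [IsFiniteMeasureOnCompacts μ] (q : ℝ≥0∞)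

lemma memLp_extDerL (hφ : ContMDiff I 𝓘(ℝ, AltForm E k) ∞ φ) (hs : HasCompactSupport φ) :
    MemLp (extDerL I φ) q μ :=
  (continuous_extDerL hφ).memLp_of_hasCompactSupport (hasCompactSupport_extDerL hφ hs)

lemma memLp_extDerSymbol {f : G → ℝ} (hf : ContMDiff I 𝓘(ℝ, ℝ) ∞ f) (hs : HasCompactSupport f)
    (a : AltForm E k) : MemLp (fun g => extDerSymbol I k f g a) q μ := by
  have h1 : (fun g => extDerSymbol I k f g a) = extDerL I (fun g => f g • a) := by
    funext g
    rw [extDerL_smul_const ((hf g).mdifferentiableAt (by simp))]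
  rw [h1]
  exact memLp_extDerL μ q (hf.smul contMDiff_const) hs.smul_right

end TestForms

/-! ### Hölder's inequality for the wedge pairing. -/

section WedgePairing

variable {E : Type*} [NormedAddCommGroup E] [NormedSpace ℝ E] [FiniteDimensional ℝ E]

/-- The coefficient of the wedge product, as a continuous bilinear map. -/
def wedgeL {m l : ℕ} (v : Fin (m + l) → E) : AltForm E m →L[ℝ] AltForm E l →L[ℝ] ℝ :=
  (wedgeBilin v).toContinuousBilinearMap

lemma exists_wedge_bound {m l : ℕ} (v : Fin (m + l) → E) :
    ∃ K, 0 ≤ K ∧ ∀ (a : AltForm E m) (b : AltForm E l), |wedge a b v| ≤ K * ‖a‖ * ‖b‖ :=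
  exists_bound_bilin (wedgeL v)

variable {X : Type*} [MeasurableSpace X] {μ : Measure X} {p q : ℝ≥0∞} [p.HolderConjugate q]

lemma aestronglyMeasurable_wedge {m l : ℕ} (v : Fin (m + l) → E) {θ : X → AltForm E m}
    {φ : X → AltForm E l} (hθ : AEStronglyMeasurable θ μ) (hφ : AEStronglyMeasurable φ μ) :
    AEStronglyMeasurable (fun x => wedge (θ x) (φ x) v) μ :=
  aestronglyMeasurable_bilin_apply (wedgeL v) hθ hφ

lemma integrable_wedge_memLp {m l : ℕ} (v : Fin (m + l) → E) {θ : X → AltForm E m}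
    {φ : X → AltForm E l} (hθ : MemLp θ p μ) (hφ : MemLp φ q μ) :
    Integrable (fun x => wedge (θ x) (φ x) v) μ := by
  obtain ⟨K, hK0, hK⟩ := exists_wedge_bound (E := E) v
  have h1 : Integrable (fun x => ‖θ x‖ * ‖φ x‖) μ := MemLp.integrable_mul hθ.norm hφ.norm
  refine (h1.const_mul K).mono' (aestronglyMeasurable_wedge v hθ.1 hφ.1) ?_
  exact Filter.Eventually.of_forall fun x => (hK _ _).trans_eq (mul_assoc _ _ _)

lemma abs_integral_wedge_le {m l : ℕ} {v : Fin (m + l) → E} {K : ℝ} (hK0 : 0 ≤ K)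
    (hK : ∀ (a : AltForm E m) (b : AltForm E l), |wedge a b v| ≤ K * ‖a‖ * ‖b‖)
    {θ : X → AltForm E m} {φ : X → AltForm E l} (hθ : MemLp θ p μ) (hφ : MemLp φ q μ) :
    |∫ x, wedge (θ x) (φ x) v ∂μ| ≤ K * (eLpNorm θ p μ).toReal * (eLpNorm φ q μ).toReal := by
  have h1 : Integrable (fun x => ‖θ x‖ * ‖φ x‖) μ := MemLp.integrable_mul hθ.norm hφ.norm
  have h2 : |∫ x, wedge (θ x) (φ x) v ∂μ| ≤ ∫ x, K * (‖θ x‖ * ‖φ x‖) ∂μ :=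
    norm_integral_le_of_norm_le (f := fun x => wedge (θ x) (φ x) v) (h1.const_mul K)
      (Filter.Eventually.of_forall fun x => (hK _ _).trans_eq (mul_assoc _ _ _))
  refine h2.trans ?_
  rw [integral_const_mul, mul_assoc]
  refine mul_le_mul_of_nonneg_left ?_ hK0
  have h3 : eLpNorm (fun x => ‖θ x‖ * ‖φ x‖) 1 μ ≤ eLpNorm θ p μ * eLpNorm φ q μ := by
    have := eLpNorm_smul_le_mul_eLpNorm (p := p) (q := q) (r := 1) hφ.norm.1 hθ.norm.1
    rw [eLpNorm_norm, eLpNorm_norm] at this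
    exact this
  rw [← ENNReal.toReal_mul]
  refine le_trans (le_of_eq ?_) (ENNReal.toReal_mono (ENNReal.mul_ne_top hθ.2.ne hφ.2.ne) h3)
  rw [eLpNorm_one_eq_lintegral_enorm, ← integral_norm_eq_lintegral_enorm h1.1]
  refine integral_congr_ae (Filter.Eventually.of_forall fun x => ?_)
  simp

end WedgePairing

/-! ### Continuity and local boundedness of the pull-back in time. -/

section ContinuousFlowLift

lemma exists_clm_bound {V W : Type*} [NormedAddCommGroup V] [NormedSpace ℝ V]
    [NormedAddCommGroup W] [NormedSpace ℝ W] {Y : ℝ → V →L[ℝ] W} (hY : Continuous Y) (a b : ℝ) :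
    ∃ C, ∀ t ∈ Icc a b, ‖Y t‖ ≤ C :=
  isCompact_Icc.exists_bound_of_continuousOn hY.continuousOn

variable {E : Type*} [NormedAddCommGroup E] [NormedSpace ℝ E] [FiniteDimensional ℝ E]
  (α : E →L[ℝ] E) (k : ℕ)

lemma continuous_flowLiftL : Continuous (flowLiftL α k) :=
  continuous_clm_apply.2 fun a => (contDiff_flowLift α a).continuous

lemma exists_flowLiftL_bound (a b : ℝ) : ∃ C, ∀ t ∈ Icc a b, ‖flowLiftL α k t‖ ≤ C :=
  exists_clm_bound (continuous_flowLiftL α k) a b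

lemma aestronglyMeasurable_flowLiftL {X : Type*} [MeasurableSpace X] (μ : Measure X)
    {t : X → ℝ} (ht : Measurable t) : AEStronglyMeasurable (fun x => flowLiftL α k (t x)) μ :=
  ((continuous_flowLiftL α k).stronglyMeasurable.comp_measurable ht).aestronglyMeasurable

end ContinuousFlowLift

/-! ### Stokes' formula on a strip of the semi-direct product. -/

section StripGreen

variable {E : Type*} [NormedAddCommGroup E] [NormedSpace ℝ E] [FiniteDimensional ℝ E]
  {H : Type*} [TopologicalSpace H] [T2Space H] [SecondCountableTopology H]
  [ChartedSpace E H] [Group H] [LieGroup 𝓘(ℝ, E) ∞ H]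
  [MeasurableSpace H] [BorelSpace H] {μ : Measure H} [μ.IsHaarMeasure] [SFinite μ]
  {α : E →L[ℝ] E} {F : AutFlow H α}
  {ν : Measure (SemiProd F)} [ν.IsHaarMeasure] {ρ : Measure ℝ}

open SemiProd

lemma MeasureTheory.MemLp.comp_mk {V : Type*} [NormedAddCommGroup V] {f : SemiProd F → V}
    {p : ℝ≥0∞} [SFinite ρ] (hν : MeasurePreserving (homeo F) ν (μ.prod ρ)) (hf : MemLp f p ν) :
    MemLp (fun x : H × ℝ => f (mk F x.1 x.2)) p (μ.prod ρ) :=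
  hf.comp_measurePreserving (hν.symm (homeo F).toMeasurableEquiv)

lemma prod_restrict_right {X T : Type*} [MeasurableSpace X] [MeasurableSpace T] (μ : Measure X)
    (ρ : Measure T) [SFinite μ] [SFinite ρ] (S : Set T) :
    μ.prod (ρ.restrict S) = (μ.prod ρ).restrict (univ ×ˢ S) := by
  rw [← Measure.prod_restrict, Measure.restrict_univ]

lemma integral_eq_strip [SFinite ρ] (hν : MeasurePreserving (homeo F) ν (μ.prod ρ)) {S : Set ℝ}
    {f : SemiProd F → ℝ} (hf : ∀ g : SemiProd F, g.snd ∉ S → f g = 0) :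
    ∫ g, f g ∂ν = ∫ x, f (mk F x.1 x.2) ∂(μ.prod (ρ.restrict S)) := by
  have h1 := hν.integral_comp (homeo F).measurableEmbedding (fun x => f (mk F x.1 x.2))
  rw [prod_restrict_right, setIntegral_eq_integral_of_forall_compl_eq_zero, ← h1]
  · rfl
  · intro x hx
    exact hf _ fun h => hx ⟨mem_univ _, h⟩

/-- The forms on the first factor, paired with a form on a strip of the semi-direct product. -/
def stripPairing {m r : ℕ} (b : Fin (m + r) → E × ℝ) (s : ℝ) (θ : SemiProd F → AltForm (E × ℝ) m)
    (x : H × ℝ) : AltForm E r →L[ℝ] ℝ :=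
  (s • wedgeBilin b).toContinuousBilinearMap (θ (mk F x.1 x.2)) ∘L flowLiftL α r x.2

variable {p q : ℝ≥0∞}

lemma memLp_stripPairing [SFinite ρ] (hν : MeasurePreserving (homeo F) ν (μ.prod ρ)) {A B : ℝ}
    {m : ℕ} (r : ℕ) (b : Fin (m + r) → E × ℝ) (s : ℝ) {θ : SemiProd F → AltForm (E × ℝ) m}
    (hs : ∀ g : SemiProd F, g.snd ∉ Icc A B → θ g = 0) (hθ : MemLp θ p ν) :
    MemLp (stripPairing b s θ) p (μ.prod (ρ.restrict (Icc A B))) := by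
  obtain ⟨C, hC⟩ := exists_flowLiftL_bound α r A B
  have h1 : MemLp (fun x : H × ℝ => θ (mk F x.1 x.2)) p (μ.prod (ρ.restrict (Icc A B))) := by
    rw [prod_restrict_right]
    exact MemLp.restrict _ (hθ.comp_mk hν)
  refine memLp_bilin_comp (Y := fun x : H × ℝ => flowLiftL α r x.2) (C := C)
    (s • wedgeBilin b).toContinuousBilinearMap
    (aestronglyMeasurable_flowLiftL α r _ measurable_snd) (fun x hx => hC _ ?_) h1
  by_contra hcon
  exact hx (hs _ hcon)

lemma integral_stripPairing [SFinite ρ] [p.HolderConjugate q] {A B : ℝ}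
    [IsFiniteMeasure (ρ.restrict (Icc A B))] (hp : 1 ≤ p) (hpt : p ≠ ⊤)
    (hν : MeasurePreserving (homeo F) ν (μ.prod ρ))
    {m r : ℕ} (b : Fin (m + r) → E × ℝ) (s : ℝ) {θ : SemiProd F → AltForm (E × ℝ) m}
    (hs : ∀ g : SemiProd F, g.snd ∉ Icc A B → θ g = 0) (hθ : MemLp θ p ν)
    {v : H → AltForm E r} (hv : MemLp v q μ) :
    ∫ h, (∫ t, stripPairing b s θ (h, t) ∂(ρ.restrict (Icc A B))) (v h) ∂μ =
      s * ∫ g, wedge (θ g) (flowLift α g.snd (v g.fst)) b ∂ν := by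
  have h1 := integral_fiber_apply hp hpt (memLp_stripPairing hν r b s hs hθ) hv
  refine h1.trans ?_
  rw [integral_eq_strip hν (S := Icc A B) fun g hg => ?_, ← integral_const_mul]
  · rfl
  · rw [hs g hg]; exact wedge_zero_left _ _

/-- Integration over t ∈ [A, B] turns θ and η into L^p functionals on forms of H, to which
`integral_eq_of_isWeakExtDer` applies. Its hypothesis on test functions f and constant forms a is
the weak relation on G tested on f(h) ψ(t) π^*a, with ψ = 1 on the strip. -/
theorem integral_wedge_flowLift [IsLocallyFiniteMeasure ρ] [p.HolderConjugate q] (hp : 1 ≤ p)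
    (hpt : p ≠ ⊤) (hq : 1 ≤ q) (hqt : q ≠ ⊤) (hα : IsDerivation H α)
    (hν : MeasurePreserving (homeo F) ν (μ.prod ρ)) {m r : ℕ}
    {θ : SemiProd F → AltForm (E × ℝ) m} {η : SemiProd F → AltForm (E × ℝ) (m + 1)}
    (hθ : MemLp θ p ν) (hη : MemLp η p ν)
    (hd : IsWeakExtDer (𝓘(ℝ, E).prod 𝓘(ℝ, ℝ)) ν θ η) {A B : ℝ}
    (hθs : ∀ g : SemiProd F, g.snd ∉ Icc A B → θ g = 0)
    (hηs : ∀ g : SemiProd F, g.snd ∉ Icc A B → η g = 0)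
    {u : H → AltForm E r} {u' : H → AltForm E (r + 1)} (hu : MemLp u q μ) (hu' : MemLp u' q μ)
    (h : IsWeakExtDer 𝓘(ℝ, E) μ u u') (b : Module.Basis (Fin (m + (r + 1))) ℝ (E × ℝ)) :
    ∫ g, wedge (θ g) (flowLift α g.snd (u' g.fst)) b ∂ν =
      (-1) ^ (m + 1) * ∫ g, wedge (η g) (flowLift α g.snd (u g.fst))
        (fun i => b (Fin.cast (by omega) i)) ∂ν := by
  have hfin : IsFiniteMeasure (ρ.restrict (Icc A B)) :=
    ⟨by rw [Measure.restrict_apply_univ]; exact isCompact_Icc.measure_lt_top⟩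
  set b' : Fin (m + 1 + r) → E × ℝ := fun i => b (Fin.cast (by omega) i)
  have hA := MemLp.integral_fiber (V := AltForm E r →L[ℝ] ℝ) hp hpt
    (memLp_stripPairing hν r b' ((-1) ^ (m + 1)) hηs hη)
  have hB := MemLp.integral_fiber (V := AltForm E (r + 1) →L[ℝ] ℝ) hp hpt
    (memLp_stripPairing hν (r + 1) b 1 hθs hθ)
  have key := integral_eq_of_isWeakExtDer 𝓘(ℝ, E) μ hp hq hqt hA hB ?_ hu hu' h
  · rw [integral_stripPairing hp hpt hν b' _ hηs hη hu,
      integral_stripPairing hp hpt hν b 1 hθs hθ hu', one_mul] at key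
    exact key.symm
  intro f hf hfs a
  have e1 : ∀ h, f h * (∫ t, stripPairing b' ((-1) ^ (m + 1)) η (h, t) ∂(ρ.restrict (Icc A B))) a =
      (∫ t, stripPairing b' ((-1) ^ (m + 1)) η (h, t) ∂(ρ.restrict (Icc A B))) (f h • a) := by
    intro h
    rw [map_smul, smul_eq_mul]
  simp only [e1]
  have hfa : MemLp (fun h => f h • a) q μ :=
    (hf.continuous.smul continuous_const).memLp_of_hasCompactSupport hfs.smul_right
  rw [integral_stripPairing hp hpt hν b' _ hηs hη hfa,
    integral_stripPairing hp hpt hν b 1 hθs hθ (memLp_extDerSymbol μ q hf hfs a), one_mul]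
  obtain ⟨K, -, hK⟩ := exists_plateau
  -- The plateau exceeds [A, B] by a positive margin, so ψ' vanishes on the closed strip and the
  -- dt-term of the exterior derivative drops out.
  obtain ⟨ψ, hψ, -, hψ1, hψ0, -, hψd, -⟩ := hK ((A + B) / 2) (|B - A| / 2 + 1) 1 one_pos
  have hIcc : ∀ t ∈ Icc A B, |t - (A + B) / 2| < |B - A| / 2 + 1 := by
    intro t ht
    have := le_abs_self (B - A)
    rw [abs_lt]
    constructor <;> linarith [ht.1, ht.2]
  let Φ : SemiProd F → AltForm (E × ℝ) r := fun g => f g.fst • ψ g.snd • flowLift α g.snd a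
  have hΦ : ContMDiff (𝓘(ℝ, E).prod 𝓘(ℝ, ℝ)) 𝓘(ℝ, AltForm (E × ℝ) r) ∞ Φ := by
    have h1 : ContMDiff 𝓘(ℝ, ℝ) 𝓘(ℝ, AltForm (E × ℝ) r) ∞ fun t => ψ t • flowLift α t a :=
      (hψ.smul (contDiff_flowLift α a)).contMDiff
    exact (hf.comp (contMDiff_fst F)).smul (h1.comp (contMDiff_snd F))
  have hΦs : HasCompactSupport Φ := by
    have hcomp : IsCompact ((homeo F).symm '' (tsupport f ×ˢ
        Metric.closedBall ((A + B) / 2) (|B - A| / 2 + 2))) :=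
      (hfs.prod (isCompact_closedBall _ _)).image (homeo F).symm.continuous
    refine HasCompactSupport.intro hcomp fun g hg => ?_
    by_cases h1 : g.fst ∈ tsupport f
    · have h2 : ψ g.snd = 0 := by
        refine hψ0 _ ?_
        by_contra h3
        refine hg ⟨(g.fst, g.snd), ⟨h1, ?_⟩, rfl⟩
        rw [Metric.mem_closedBall, Real.dist_eq]
        linarith
      simp [Φ, h2]
    · simp [Φ, image_eq_zero_of_notMem_tsupport h1]
  have h2 := hd r b Φ hΦ hΦs
  have e2 : ∀ g, wedge (θ g) (extDer (𝓘(ℝ, E).prod 𝓘(ℝ, ℝ)) Φ g) b =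
      wedge (θ g) (flowLift α g.snd (extDerSymbol 𝓘(ℝ, E) r f g.fst a)) b := by
    intro g
    by_cases hg : g.snd ∈ Icc A B
    · rw [← coe_extDerL ((hΦ g).mdifferentiableAt (by simp))]
      have h3 := extDerL_flowLift F hα (k := r) (h := g.fst) (t := g.snd)
        ((hf g.fst).mdifferentiableAt (by simp))
        ((hψ.differentiable (by simp) g.snd).hasDerivAt) a
      rw [mk_fst_snd, hψd _ (hIcc _ hg), hψ1 _ (hIcc _ hg).le, zero_mul, zero_smul, zero_add,
        one_smul] at h3
      rw [h3]
    · rw [hθs g hg]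
      exact (wedge_zero_left _ _).trans (wedge_zero_left _ _).symm
  have e3 : ∀ g, wedge (η g) (Φ g) b' = wedge (η g) (flowLift α g.snd (f g.fst • a)) b' := by
    intro g
    by_cases hg : g.snd ∈ Icc A B
    · have : Φ g = flowLift α g.snd (f g.fst • a) := by
        simp only [Φ, hψ1 _ (hIcc _ hg).le, one_smul]
        rfl
      rw [this]
    · rw [hηs g hg]
      exact (wedge_zero_left _ _).trans (wedge_zero_left _ _).symm
  simp only [e2] at h2
  rw [h2]
  congr 1
  exact integral_congr_ae (Filter.Eventually.of_forall fun g => (e3 g).symm)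

end StripGreen

/-! ### Top-degree wedge products with dt. -/

section ProductBasis

variable {E : Type*} [NormedAddCommGroup E] [NormedSpace ℝ E] [FiniteDimensional ℝ E]
  (α : E →L[ℝ] E)

/-- The basis `(∂_t, b)` of the Lie algebra of a semi-direct product. -/
def consBasis {n : ℕ} (b : Module.Basis (Fin n) ℝ E) : Module.Basis (Fin (n + 1)) ℝ (E × ℝ) :=
  (b.prod (Module.Basis.singleton Unit ℝ)).reindex
    ((Equiv.optionEquivSumPUnit.{0} (Fin n)).symm.trans (finSuccEquiv n).symm)

lemma coe_consBasis {n : ℕ} (b : Module.Basis (Fin n) ℝ E) :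
    (consBasis b : Fin (n + 1) → E × ℝ) =
      Fin.cons ((0 : E), (1 : ℝ)) (fun i => (b i, (0 : ℝ))) := by
  funext j
  refine Fin.cases ?_ (fun i => ?_) j
  · simp [consBasis]
  · simp [consBasis]

/-- The restriction at time `t` of a form on the semi-direct product to the first factor. -/
def flowRes (k : ℕ) (t : ℝ) : AltForm (E × ℝ) k →L[ℝ] AltForm E k :=
  ContinuousAlternatingMap.compContinuousLinearMapCLM
    (ContinuousLinearMap.inl ℝ E ℝ ∘L expFlow α (-t))

lemma flowRes_apply {k : ℕ} (t : ℝ) (w : AltForm (E × ℝ) k) (v : Fin k → E) :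
    flowRes α k t w v = w (fun i => (expFlow α (-t) (v i), 0)) := rfl

lemma flowRes_flowLift {k : ℕ} (t : ℝ) (a : AltForm E k) :
    flowRes α k t (flowLift α t a) = a := by
  ext v
  rw [flowRes_apply, flowLift_apply]
  simp [expFlow_apply_neg]

open SemiProd

/-- dt vanishes on every vector of the basis but the first, which leaves a wedge product on H
evaluated on the vectors e^{tα} b_i; `wedge_flow` gives the exponential. -/
lemma wedge_dt_flowLift {m l : ℕ} (b : Module.Basis (Fin (m + l)) ℝ E) (a : AltForm E m)
    (w : AltForm (E × ℝ) l) (t : ℝ) (h : m + 1 + l = m + l + 1) :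
    wedge (lineWedge dt (flowLift α t a)) w (fun i => consBasis b (Fin.cast h i)) =
      Real.exp (LinearMap.trace ℝ E (α : E →ₗ[ℝ] E) * t) * wedge a (flowRes α l t w) b := by
  have hn : m + l = Module.finrank ℝ E := by
    rw [Module.finrank_eq_card_basis b, Fintype.card_fin]
  rw [← wedge_flow α a _ hn, coe_lineWedge, coe_consBasis, wedge_extMul_cons]
  · unfold wedge
    congr 1
    refine Finset.sum_congr rfl fun σ _ => ?_
    rw [flowLift_apply, flowRes_apply]
    simp only [expFlow_neg_apply]
  · simp [dt]
  · intro i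
    simp [dt]

lemma exists_wedge_dt_flowLift {m l : ℕ} (b : Module.Basis (Fin (m + l)) ℝ E)
    (v : Fin (m + 1 + l) → E × ℝ) : ∃ D : ℝ, ∀ (a : AltForm E m) (w : AltForm (E × ℝ) l) (t : ℝ),
    wedge (lineWedge dt (flowLift α t a)) w v =
      D * (Real.exp (LinearMap.trace ℝ E (α : E →ₗ[ℝ] E) * t) * wedge a (flowRes α l t w) b) := by
  have h : m + 1 + l = m + l + 1 := by omega
  refine ⟨(consBasis b).det (fun i => v (Fin.cast h.symm i)), fun a w t => ?_⟩
  rw [wedge_eq_det_mul _ w (consBasis b) h v, wedge_dt_flowLift]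

end ProductBasis

/-! ### The closed forms f dt ∧ π^*e and their pairings. -/

section ClosedLift

variable {E : Type*} [NormedAddCommGroup E] [NormedSpace ℝ E] [FiniteDimensional ℝ E]
  {H : Type*} [TopologicalSpace H] [T2Space H] [SecondCountableTopology H]
  [ChartedSpace E H] [Group H] [LieGroup 𝓘(ℝ, E) ∞ H]
  [MeasurableSpace H] [BorelSpace H] {μ : Measure H} [μ.IsHaarMeasure] [SFinite μ]
  {α : E →L[ℝ] E} {F : AutFlow H α}
  {ν : Measure (SemiProd F)} [ν.IsHaarMeasure] {ρ : Measure ℝ}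

open SemiProd

/-- Restriction to the slice at time t is the pull-back by h ↦ (h, t), which commutes with d. The
factor e^{-tα} undoes the twist of the left trivialization, and it respects brackets. -/
lemma flowRes_extDerL (hα : IsDerivation H α) {l : ℕ} {Φ : SemiProd F → AltForm (E × ℝ) l}
    (hΦ : ContMDiff (𝓘(ℝ, E).prod 𝓘(ℝ, ℝ)) 𝓘(ℝ, AltForm (E × ℝ) l) ∞ Φ) (h : H) (t : ℝ) :
    flowRes α (l + 1) t (extDerL (𝓘(ℝ, E).prod 𝓘(ℝ, ℝ)) Φ (mk F h t)) =
      extDerL 𝓘(ℝ, E) (fun h => flowRes α l t (Φ (mk F h t))) h := by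
  have hΦt : MDifferentiableAt 𝓘(ℝ, E) 𝓘(ℝ, AltForm (E × ℝ) l) (fun h => Φ (mk F h t)) h :=
    ((hΦ.comp (contMDiff_mk F t)) h).mdifferentiableAt (by simp)
  ext v
  rw [flowRes_apply, extDerL, extDerL, ContinuousAlternatingMap.alternatizeUncurryFin_add,
    ContinuousAlternatingMap.alternatizeUncurryFin_add]
  refine congrArg₂ (fun x y : ℝ => x + y) ?_ ?_
  · change ContinuousAlternatingMap.alternatizeUncurryFin _ _ =
      ContinuousAlternatingMap.alternatizeUncurryFin _ _
    rw [alternatizeUncurryFin_coe, alternatizeUncurryFin_coe]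
    refine Finset.sum_congr rfl fun j _ => ?_
    rw [leftDerivL_apply_fst F ((hΦ _).mdifferentiableAt (by simp)) hΦt, expFlow_apply_neg,
      leftDerivL_clm_comp hΦt]
    rfl
  · change algDer _ _ _ = algDer _ _ _
    rw [algDer_apply, algDer_apply]
    refine Finset.sum_congr rfl fun j _ => ?_
    congr 2
    refine Finset.sum_congr rfl fun c _ => ?_
    rw [flowRes_apply]
    congr 1
    funext i
    by_cases hi : i = c
    · subst hi
      simp [adL_apply_eq, expFlow_adL hα]
    · simp [hi]

/-- The form `f dt ∧ π^* e` on the semi-direct product. -/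
def dtLift {m : ℕ} (F : AutFlow H α) (f : ℝ → ℝ) (e : H → AltForm E m) (g : SemiProd F) :
    AltForm (E × ℝ) (m + 1) :=
  f g.snd • lineWedge dt (flowLift α g.snd (e g.fst))

variable {p q : ℝ≥0∞}

lemma integral_homeo [SFinite ρ] (hν : MeasurePreserving (homeo F) ν (μ.prod ρ))
    (f : SemiProd F → ℝ) : ∫ g, f g ∂ν = ∫ x, f (mk F x.1 x.2) ∂(μ.prod ρ) :=
  hν.integral_comp (homeo F).measurableEmbedding (fun x => f (mk F x.1 x.2))

lemma integrable_homeo [SFinite ρ] (hν : MeasurePreserving (homeo F) ν (μ.prod ρ))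
    {f : SemiProd F → ℝ} (hf : Integrable f ν) :
    Integrable (fun x : H × ℝ => f (mk F x.1 x.2)) (μ.prod ρ) :=
  (hν.integrable_comp_emb (homeo F).measurableEmbedding
    (g := fun x : H × ℝ => f (mk F x.1 x.2))).1 hf

/-- By Fubini the pairing with dΦ is an integral over t of pairings of e with the differentials of
the slices of Φ, each of which vanishes because e is closed. The factor dt kills all t-derivatives,
so no smoothness of f is involved. -/
theorem isWeakExtDer_dtLift [SFinite ρ] [p.HolderConjugate q] (hα : IsDerivation H α)
    (hν : MeasurePreserving (homeo F) ν (μ.prod ρ)) {m : ℕ} {f : ℝ → ℝ} {e : H → AltForm E m}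
    (he : IsWeakExtDer 𝓘(ℝ, E) μ e fun _ => 0) (hω : MemLp (dtLift F f e) p ν) :
    IsWeakExtDer (𝓘(ℝ, E).prod 𝓘(ℝ, ℝ)) ν (dtLift F f e) fun _ => 0 := by
  intro l b₁ Φ hΦ hΦs
  have h0 : ∀ g : SemiProd F, wedge (0 : AltForm (E × ℝ) (m + 1 + 1)) (Φ g)
      (fun i => b₁ (Fin.cast (by omega) i)) = 0 := fun g => wedge_zero_left _ _
  simp only [h0, integral_zero, mul_zero]
  have hn : m + (l + 1) = Module.finrank ℝ E := by
    have h1 := Module.finrank_eq_card_basis b₁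
    rw [Fintype.card_fin, Module.finrank_prod, Module.finrank_self] at h1
    omega
  let b : Module.Basis (Fin (m + (l + 1))) ℝ E :=
    (Module.finBasis ℝ E).reindex (finCongr hn.symm)
  obtain ⟨D, hD⟩ := exists_wedge_dt_flowLift α b b₁
  have e1 : ∀ g, wedge (dtLift F f e g) (extDer (𝓘(ℝ, E).prod 𝓘(ℝ, ℝ)) Φ g) b₁ =
      wedge (dtLift F f e g) (extDerL (𝓘(ℝ, E).prod 𝓘(ℝ, ℝ)) Φ g) b₁ := fun g => by
    rw [coe_extDerL ((hΦ g).mdifferentiableAt (by simp))]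
  have hint : Integrable (fun g => wedge (dtLift F f e g)
      (extDerL (𝓘(ℝ, E).prod 𝓘(ℝ, ℝ)) Φ g) b₁) ν :=
    integrable_wedge_memLp (q := q) _ hω (memLp_extDerL ν q hΦ hΦs)
  simp only [e1]
  rw [integral_homeo hν, integral_prod_symm _ (integrable_homeo hν hint)]
  refine integral_eq_zero_of_ae (Filter.Eventually.of_forall fun t => ?_)
  have e2 : ∀ h, wedge (dtLift F f e (mk F h t))
      (extDerL (𝓘(ℝ, E).prod 𝓘(ℝ, ℝ)) Φ (mk F h t)) b₁ =
      (f t * (D * Real.exp (LinearMap.trace ℝ E (α : E →ₗ[ℝ] E) * t))) *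
        wedge (e h) (extDer 𝓘(ℝ, E) (fun h => flowRes α l t (Φ (mk F h t))) h) b := by
    intro h
    have h1 : wedge (dtLift F f e (mk F h t))
      (extDerL (𝓘(ℝ, E).prod 𝓘(ℝ, ℝ)) Φ (mk F h t)) b₁ =
      f t * wedge (lineWedge dt (flowLift α t (e h)))
        (extDerL (𝓘(ℝ, E).prod 𝓘(ℝ, ℝ)) Φ (mk F h t)) b₁ := wedge_smul_left _ _ _ _
    have hmd : MDifferentiableAt 𝓘(ℝ, E) 𝓘(ℝ, AltForm E l)
        (fun h => flowRes α l t (Φ (mk F h t))) h :=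
      (((flowRes α l t).contMDiff.comp (hΦ.comp (contMDiff_mk F t))) h).mdifferentiableAt
        (n := ∞) (by simp)
    rw [h1, hD, flowRes_extDerL hα hΦ, coe_extDerL hmd]
    ring
  simp only [e2]
  rw [integral_const_mul, he l b (fun h => flowRes α l t (Φ (mk F h t)))
    ((flowRes α l t).contMDiff.comp (hΦ.comp (contMDiff_mk F t))) ?_]
  · have h2 : ∀ h : H, wedge (0 : AltForm E (m + 1)) (flowRes α l t (Φ (mk F h t)))
      (fun i => b (Fin.cast (by omega) i)) = 0 := fun h => wedge_zero_left _ _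
    simp only [h2]
    simp
  · have hc : IsCompact (fst '' tsupport Φ) := hΦs.image (continuous_fst F)
    refine HasCompactSupport.intro hc fun h hh => ?_
    have : Φ (mk F h t) = 0 := by
      by_contra hne
      exact hh ⟨mk F h t, subset_tsupport _ hne, rfl⟩
    rw [this, map_zero]

/-- The factor e^{tr(α)t} of `wedge_dt_flowLift` cancels the density of Haar measure, and the
integral splits into a product. -/
lemma integral_dtLift_flowLift {c : ℝ} (hc : 0 < c)
    (hν : MeasurePreserving (homeo F) ν (μ.prod (lineMeasure c
      (LinearMap.trace ℝ E (α : E →ₗ[ℝ] E))))) {m r : ℕ} {f : ℝ → ℝ} {e : H → AltForm E m}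
    {u : H → AltForm E r} (b : Module.Basis (Fin (m + r)) ℝ E) (h : m + 1 + r = m + r + 1) :
    ∫ g, wedge (dtLift F f e g) (flowLift α g.snd (u g.fst))
      (fun i => consBasis b (Fin.cast h i)) ∂ν =
      (c * ∫ t, f t) * ∫ h, wedge (e h) (u h) b ∂μ := by
  set lam := LinearMap.trace ℝ E (α : E →ₗ[ℝ] E)
  have e1 : ∀ g : SemiProd F, wedge (dtLift F f e g) (flowLift α g.snd (u g.fst))
      (fun i => consBasis b (Fin.cast h i)) =
      wedge (e g.fst) (u g.fst) b * (f g.snd * Real.exp (lam * g.snd)) := by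
    intro g
    have h1 : wedge (dtLift F f e g) (flowLift α g.snd (u g.fst))
      (fun i => consBasis b (Fin.cast h i)) =
      f g.snd * wedge (lineWedge dt (flowLift α g.snd (e g.fst)))
        (flowLift α g.snd (u g.fst)) (fun i => consBasis b (Fin.cast h i)) :=
      wedge_smul_left _ _ _ _
    rw [h1, wedge_dt_flowLift, flowRes_flowLift]
    ring
  simp only [e1]
  rw [integral_homeo hν]
  simp only [fst_mk, snd_mk]
  rw [integral_prod_mul (fun h => wedge (e h) (u h) b) (fun t => f t * Real.exp (lam * t)),
    lineMeasure, mul_comm]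
  congr 1
  rw [integral_withDensity_eq_integral_toReal_smul (by fun_prop)
    (Filter.Eventually.of_forall fun _ => ENNReal.ofReal_lt_top), ← integral_const_mul]
  refine integral_congr_ae (Filter.Eventually.of_forall fun t => ?_)
  simp only [smul_eq_mul]
  rw [ENNReal.toReal_ofReal (by positivity)]
  calc _ = c * f t * (Real.exp (-(lam * t)) * Real.exp (lam * t)) := by ring
    _ = c * f t := by rw [← Real.exp_add]; simp

end ClosedLift

/-! ### Norms of pulled-back forms on strips. -/

section StripNorm

variable {E : Type*} [NormedAddCommGroup E] [NormedSpace ℝ E] [FiniteDimensional ℝ E]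
  {H : Type*} [TopologicalSpace H] [T2Space H] [SecondCountableTopology H]
  [ChartedSpace E H] [Group H] [LieGroup 𝓘(ℝ, E) ∞ H]
  [MeasurableSpace H] [BorelSpace H] {μ : Measure H} [μ.IsHaarMeasure] [SFinite μ]
  {α : E →L[ℝ] E} {F : AutFlow H α}
  {ν : Measure (SemiProd F)} [ν.IsHaarMeasure]

open SemiProd

lemma eLpNorm_homeo {V : Type*} [NormedAddCommGroup V] {ρ : Measure ℝ} [SFinite ρ] (p : ℝ≥0∞)
    (hν : MeasurePreserving (homeo F) ν (μ.prod ρ)) {X : SemiProd F → V}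
    (hX : AEStronglyMeasurable X ν) :
    eLpNorm X p ν = eLpNorm (fun x : H × ℝ => X (mk F x.1 x.2)) p (μ.prod ρ) := by
  have h1 : AEStronglyMeasurable (fun x : H × ℝ => X (mk F x.1 x.2)) (μ.prod ρ) :=
    hX.comp_measurePreserving (hν.symm (homeo F).toMeasurableEquiv)
  exact (eLpNorm_comp_measurePreserving h1 hν)

lemma lintegral_lineMeasure_indicator {c lam : ℝ} (hc : 0 < c) (A B : ℝ) :
    ∫⁻ t, (Icc A B).indicator (fun t => ENNReal.ofReal (Real.exp (lam * t))) t
      ∂(lineMeasure c lam) = ENNReal.ofReal (c * (B - A)) := by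
  have hm : Measurable fun t => ENNReal.ofReal (Real.exp (lam * t)) := by fun_prop
  rw [lineMeasure, lintegral_withDensity_eq_lintegral_mul _ (by fun_prop)
    (hm.indicator measurableSet_Icc)]
  have h1 : ((fun t : ℝ => ENNReal.ofReal (c * Real.exp (-(lam * t)))) *
      (Icc A B).indicator fun t => ENNReal.ofReal (Real.exp (lam * t))) =
      (Icc A B).indicator fun _ => ENNReal.ofReal c := by
    funext t
    by_cases ht : t ∈ Icc A B
    · simp only [Pi.mul_apply, indicator_of_mem ht]
      rw [← ENNReal.ofReal_mul (by positivity), mul_assoc, ← Real.exp_add]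
      simp
    · simp [indicator_of_notMem ht]
  rw [h1, lintegral_indicator_const measurableSet_Icc, Real.volume_Icc,
    ← ENNReal.ofReal_mul hc.le]

/-- The s-th power of e^{(lam/s)t} is e^{lam t}, which the density cancels; integrating over t
leaves the length of the strip. -/
lemma eLpNorm_le_of_strip {V : Type*} [NormedAddCommGroup V] {c lam s : ℝ} (hc : 0 < c)
    (hs : 0 < s) (hν : MeasurePreserving (homeo F) ν (μ.prod (lineMeasure c lam)))
    {X : SemiProd F → V} (hX : AEStronglyMeasurable X ν) {A B : ℝ}
    (hXs : ∀ g : SemiProd F, g.snd ∉ Icc A B → X g = 0) {y : H → ℝ}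
    (hb : ∀ᵐ h ∂μ, ∀ t ∈ Icc A B, ‖X (mk F h t)‖ ≤ Real.exp (lam / s * t) * y h) :
    eLpNorm X (ENNReal.ofReal s) ν ≤
      ENNReal.ofReal (c * (B - A)) ^ (1 / s) * eLpNorm y (ENNReal.ofReal s) μ := by
  have hP0 : ENNReal.ofReal s ≠ 0 := by simpa using hs
  have hX' : AEStronglyMeasurable (fun x : H × ℝ => X (mk F x.1 x.2))
      (μ.prod (lineMeasure c lam)) :=
    hX.comp_measurePreserving (hν.symm (homeo F).toMeasurableEquiv)
  rw [eLpNorm_homeo _ hν hX, eLpNorm_eq_lintegral_rpow_enorm_toReal hP0 ENNReal.ofReal_ne_top,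
    eLpNorm_eq_lintegral_rpow_enorm_toReal hP0 ENNReal.ofReal_ne_top,
    ENNReal.toReal_ofReal hs.le, ← ENNReal.mul_rpow_of_nonneg _ _ (by positivity)]
  refine ENNReal.rpow_le_rpow ?_ (by positivity)
  rw [lintegral_prod _ (by exact hX'.enorm.pow_const _)]
  have hin : ∀ᵐ h ∂μ, ∫⁻ t, ‖X (mk F h t)‖ₑ ^ s ∂(lineMeasure c lam) ≤
      ENNReal.ofReal (c * (B - A)) * ‖y h‖ₑ ^ s := by
    filter_upwards [hb] with h hh
    rw [← lintegral_lineMeasure_indicator (lam := lam) hc A B, ← lintegral_mul_const']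
    · refine lintegral_mono fun t => ?_
      by_cases ht : t ∈ Icc A B
      · rw [indicator_of_mem ht]
        have h1 : ‖X (mk F h t)‖ₑ ≤ ENNReal.ofReal (Real.exp (lam / s * t)) * ‖y h‖ₑ := by
          rw [← ofReal_norm, ← ofReal_norm, ← ENNReal.ofReal_mul (by positivity)]
          refine ENNReal.ofReal_le_ofReal ((hh t ht).trans ?_)
          gcongr
          exact le_abs_self _
        refine (ENNReal.rpow_le_rpow h1 hs.le).trans_eq ?_
        rw [ENNReal.mul_rpow_of_nonneg _ _ hs.le, ENNReal.ofReal_rpow_of_pos (Real.exp_pos _),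
          ← Real.exp_mul]
        have h2 : lam / s * t * s = lam * t := by field_simp
        rw [h2]
      · have h2 : X (mk F h t) = 0 := hXs _ ht
        simp [h2, hs]
    · exact ENNReal.rpow_ne_top_of_nonneg hs.le enorm_ne_top
  refine (lintegral_mono_ae hin).trans_eq ?_
  rw [lintegral_const_mul' _ _ ENNReal.ofReal_ne_top]

/-- The pull-back to the semi-direct product of a form on the first factor, cut off to a strip. -/
def stripLift {k : ℕ} (F : AutFlow H α) (A B : ℝ) (u : H → AltForm E k) (g : SemiProd F) :
    AltForm (E × ℝ) k :=
  (Icc A B).indicator (fun t => flowLift α t (u g.fst)) g.snd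

lemma stripLift_of_mem {k : ℕ} {A B : ℝ} (u : H → AltForm E k) {g : SemiProd F}
    (hg : g.snd ∈ Icc A B) : stripLift F A B u g = flowLift α g.snd (u g.fst) :=
  indicator_of_mem hg _

lemma stripLift_of_notMem {k : ℕ} {A B : ℝ} (u : H → AltForm E k) {g : SemiProd F}
    (hg : g.snd ∉ Icc A B) : stripLift F A B u g = 0 :=
  indicator_of_notMem hg _

lemma aestronglyMeasurable_stripLift {ρ : Measure ℝ} [SFinite ρ]
    (hν : MeasurePreserving (homeo F) ν (μ.prod ρ)) {k : ℕ} (A B : ℝ) {u : H → AltForm E k}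
    (hu : AEStronglyMeasurable u μ) : AEStronglyMeasurable (stripLift F A B u) ν := by
  have h1 : AEStronglyMeasurable (fun x : H × ℝ => flowLiftL α k x.2 (u x.1)) (μ.prod ρ) :=
    aestronglyMeasurable_clm_apply (aestronglyMeasurable_flowLiftL α k _ measurable_snd)
      hu.comp_fst
  have h2 : AEStronglyMeasurable ((Prod.snd ⁻¹' Icc A B).indicator
      fun x : H × ℝ => flowLiftL α k x.2 (u x.1)) (μ.prod ρ) :=
    h1.indicator (measurable_snd measurableSet_Icc)
  exact h2.comp_measurePreserving hν

lemma rpow_le_one_add {x s : ℝ} (hx : 0 ≤ x) (hs : 1 ≤ s) : x ^ (1 / s) ≤ 1 + x := by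
  have h0 : 0 ≤ 1 / s := by positivity
  have h1 : 1 / s ≤ 1 := by rw [div_le_one (by linarith)]; exact hs
  rcases le_total x 1 with h | h
  · exact (Real.rpow_le_one hx h h0).trans (by linarith)
  · calc x ^ (1 / s) ≤ x ^ (1 : ℝ) := Real.rpow_le_rpow_of_exponent_le h h1
      _ ≤ 1 + x := by rw [Real.rpow_one]; linarith

/-- The critical weight is the rate that the Haar density neutralizes in L^s. Relative to it the
0-part grows polynomially for t ≤ 0, while the +-part keeps a factor e^{δt}, at most e^{δB} on the
strip. -/
theorem exists_stripLift_bound {c s : ℝ} (hc : 0 < c) (hs : 1 ≤ s)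
    (hν : MeasurePreserving (homeo F) ν
      (μ.prod (lineMeasure c (LinearMap.trace ℝ E (α : E →ₗ[ℝ] E))))) (k : ℕ) :
    ∃ (C δ : ℝ) (N : ℕ), 0 ≤ C ∧ 0 < δ ∧ ∀ u : H → AltForm E k, AEStronglyMeasurable u μ →
      (∀ᵐ h ∂μ, projMinus α s k (u h) = 0) → ∀ A B, A ≤ B → B ≤ 0 →
      eLpNorm (stripLift F A B u) (ENNReal.ofReal s) ν ≤
        ENNReal.ofReal (C * (1 + |A|) ^ N) *
          eLpNorm (fun h => projZero α s k (u h)) (ENNReal.ofReal s) μ +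
        ENNReal.ofReal (C * (1 + |A|) ^ N * Real.exp (δ * B)) *
          eLpNorm (fun h => projPlus α s k (u h)) (ENNReal.ofReal s) μ := by
  obtain ⟨C, δ, N, hC, hδ, hb⟩ := exists_flowPull_bound α k (criticalWeight α s)
  set K := ‖flowLiftL α k 0‖ with hK
  have hK0 : 0 ≤ K := ContinuousLinearMap.opNorm_nonneg _
  have hlift : ∀ t (a : AltForm E k), ‖flowLift α t a‖ ≤ K * ‖flowPull α t a‖ := by
    intro t a
    have h1 : flowLift α t a = flowLiftL α k 0 (flowPull α t a) := by
      ext v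
      rw [flowLiftL_apply, flowLift_apply, flowLift_apply, flowPull_apply]
      simp [expFlow_zero]
    rw [h1]
    exact ContinuousLinearMap.le_opNorm _ _
  -- The length of the strip enters to the power 1/s; it is bounded by (1 + c)(1 + |A|), whence the
  -- additional power.
  refine ⟨(1 + c) * (K * C), δ, N + 1, by positivity, hδ, fun u hu hum A B hAB hB => ?_⟩
  set D := 1 + |A| with hD
  have hD1 : 1 ≤ D := by rw [hD]; linarith [abs_nonneg A]
  set y₀ : H → ℝ := fun h => K * C * D ^ N * ‖projZero α s k (u h)‖
  set y₁ : H → ℝ := fun h => K * C * D ^ N * Real.exp (δ * B) * ‖projPlus α s k (u h)‖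
  have hpt : ∀ᵐ h ∂μ, ∀ t ∈ Icc A B, ‖stripLift F A B u (mk F h t)‖ ≤
      Real.exp (LinearMap.trace ℝ E (α : E →ₗ[ℝ] E) / s * t) * (y₀ h + y₁ h) := by
    filter_upwards [hum] with h hh t ht
    have ht0 : t ≤ 0 := ht.2.trans hB
    have htA : |t| ≤ |A| := by
      rw [abs_of_nonpos ht0, abs_of_nonpos (hAB.trans hB)]
      linarith [ht.1]
    have h2 : stripLift F A B u (mk F h t) = flowLift α t (u h) := stripLift_of_mem u ht
    rw [h2]
    refine (hlift t _).trans ((mul_le_mul_of_nonneg_left (hb (u h) hh t ht0) hK0).trans ?_)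
    have h3 : Real.exp ((criticalWeight α s + δ) * t) ≤
        Real.exp (criticalWeight α s * t) * Real.exp (δ * B) := by
      rw [← Real.exp_add]
      refine Real.exp_le_exp.2 ?_
      have := mul_le_mul_of_nonneg_left ht.2 hδ.le
      linarith
    have h4 : (1 : ℝ) ≤ D ^ N := one_le_pow₀ hD1
    change K * (C * (1 + |t|) ^ N * Real.exp (criticalWeight α s * t) * ‖projZero α s k (u h)‖ +
      C * Real.exp ((criticalWeight α s + δ) * t) * ‖projPlus α s k (u h)‖) ≤
      Real.exp (criticalWeight α s * t) * (K * C * D ^ N * ‖projZero α s k (u h)‖ +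
        K * C * D ^ N * Real.exp (δ * B) * ‖projPlus α s k (u h)‖)
    calc _ ≤ K * (C * D ^ N * Real.exp (criticalWeight α s * t) * ‖projZero α s k (u h)‖ +
          C * D ^ N * (Real.exp (criticalWeight α s * t) * Real.exp (δ * B)) *
            ‖projPlus α s k (u h)‖) := by
          gcongr
          · rw [hD]; gcongr
          · exact le_mul_of_one_le_right hC h4
      _ = _ := by ring
  have h5 := eLpNorm_le_of_strip hc (by linarith) hν
    (aestronglyMeasurable_stripLift hν A B hu) (fun g hg => stripLift_of_notMem u hg) hpt
  refine h5.trans ?_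
  have hm0 : AEStronglyMeasurable (fun h => projZero α s k (u h)) μ :=
    (LinearMap.toContinuousLinearMap (projZero α s k)).continuous.comp_aestronglyMeasurable hu
  have hm1 : AEStronglyMeasurable (fun h => projPlus α s k (u h)) μ :=
    (LinearMap.toContinuousLinearMap (projPlus α s k)).continuous.comp_aestronglyMeasurable hu
  have h6 : eLpNorm (fun h => y₀ h + y₁ h) (ENNReal.ofReal s) μ ≤
      ENNReal.ofReal (K * C * D ^ N) * eLpNorm (fun h => projZero α s k (u h)) (ENNReal.ofReal s) μ +
      ENNReal.ofReal (K * C * D ^ N * Real.exp (δ * B)) *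
        eLpNorm (fun h => projPlus α s k (u h)) (ENNReal.ofReal s) μ := by
    refine (eLpNorm_add_le (hm0.norm.const_mul _) (hm1.norm.const_mul _)
      (by simpa using hs)).trans (add_le_add ?_ ?_)
    · refine (eLpNorm_const_smul_le (c := K * C * D ^ N)).trans_eq ?_
      rw [eLpNorm_norm, Real.enorm_of_nonneg (by positivity)]
    · refine (eLpNorm_const_smul_le (c := K * C * D ^ N * Real.exp (δ * B))).trans_eq ?_
      rw [eLpNorm_norm, Real.enorm_of_nonneg (by positivity)]
  have h7 : ENNReal.ofReal (c * (B - A)) ^ (1 / s) ≤ ENNReal.ofReal ((1 + c) * D) := by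
    have h8 : 0 ≤ c * (B - A) := mul_nonneg hc.le (by linarith)
    rw [ENNReal.ofReal_rpow_of_nonneg h8 (by positivity)]
    refine ENNReal.ofReal_le_ofReal ((rpow_le_one_add h8 hs).trans ?_)
    have h9 : B - A ≤ |A| := by rw [abs_of_nonpos (hAB.trans hB)]; linarith
    have := mul_le_mul_of_nonneg_left h9 hc.le
    rw [hD]
    nlinarith [abs_nonneg A]
  refine (mul_le_mul' h7 h6).trans_eq ?_
  rw [mul_add, ← mul_assoc, ← mul_assoc, ← ENNReal.ofReal_mul (by positivity),
    ← ENNReal.ofReal_mul (by positivity)]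
  congr 3
  · ring
  · ring

lemma exists_clm_le {V W : Type*} [NormedAddCommGroup V] [NormedSpace ℝ V]
    [NormedAddCommGroup W] [NormedSpace ℝ W] (L : V →L[ℝ] W) : ∃ K, 0 ≤ K ∧ ∀ a, ‖L a‖ ≤ K * ‖a‖ :=
  ⟨‖L‖, norm_nonneg _, L.le_opNorm⟩

lemma exists_lineWedge_bound {V : Type*} [NormedAddCommGroup V] [NormedSpace ℝ V] (k : ℕ)
    (l : V →L[ℝ] ℝ) : ∃ K, 0 ≤ K ∧ ∀ a : AltForm V k, ‖lineWedge l a‖ ≤ K * ‖a‖ :=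
  exists_clm_le (lineWedgeL k l)

end StripNorm

lemma continuous_bilin_hasCompactSupport {U V W X : Type*} [NormedAddCommGroup U]
    [NormedSpace ℝ U] [NormedAddCommGroup V] [NormedSpace ℝ V] [NormedAddCommGroup W]
    [NormedSpace ℝ W] [TopologicalSpace X] (L : U →L[ℝ] V →L[ℝ] W) {x : X → U} {y : X → V}
    (hx : Continuous x) (hy : Continuous y) (hs : HasCompactSupport y) :
    Continuous (fun z => L (x z) (y z)) ∧ HasCompactSupport (fun z => L (x z) (y z)) :=
  ⟨(L.continuous.comp hx).clm_apply hy, hs.mono' fun z hz => subset_tsupport _ fun h0 =>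
    hz (by simp [h0])⟩

/-! ### Product rule and closedness of the weak exterior derivative. -/

section ProductRule

variable {E : Type*} [NormedAddCommGroup E] [NormedSpace ℝ E] [FiniteDimensional ℝ E]
  {M : Type*} [TopologicalSpace M] {I : ModelWithCorners ℝ E M} [I.Boundaryless]
  {G : Type*} [TopologicalSpace G] [ChartedSpace M G] [Group G] [LieGroup I ∞ G]

lemma extDerL_smul {k : ℕ} {f : G → ℝ} {φ : G → AltForm E k} {g : G}
    (hf : MDifferentiableAt I 𝓘(ℝ, ℝ) f g) (hφ : MDifferentiableAt I 𝓘(ℝ, AltForm E k) φ g) :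
    extDerL I (fun h => f h • φ h) g =
      lineWedge (leftDerivL I f g) (φ g) + f g • extDerL I φ g := by
  have h2 : halfDer (adL I G) (f g • φ g) = f g • halfDer (adL I G) (φ g) := by
    ext1 x
    simp only [halfDer_apply, map_smul, smul_apply]
    exact smul_comm _ _ _
  rw [extDerL, leftDerivL_smul hf hφ, h2, add_right_comm, ← smul_add,
    ContinuousAlternatingMap.alternatizeUncurryFin_add,
    ContinuousAlternatingMap.alternatizeUncurryFin_smul]
  exact add_comm _ _

lemma wedge_smul_eq_sub {m l : ℕ} (c : ℝ) (a : AltForm E m) (x y : AltForm E l)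
    (v : Fin (m + l) → E) : wedge (c • a) y v = wedge a (x + c • y) v - wedge a x v := by
  have h1 : wedge a (x + c • y) v = wedge a x v + wedge a (c • y) v := wedge_add_right _ _ _ _
  have h2 : wedge a (c • y) v = c * wedge a y v := wedge_smul_right _ _ _ _
  have h3 : wedge (c • a) y v = c * wedge a y v := wedge_smul_left _ _ _ _
  rw [h1, h2, h3]
  ring

lemma wedge_lineWedge_add_smul {m l : ℕ} (τ : E →L[ℝ] ℝ) (c : ℝ) (a : AltForm E m)
    (a' : AltForm E (m + 1)) (x : AltForm E l) (v : Fin (m + (l + 1)) → E) :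
    wedge (lineWedge τ a + c • a') x (fun i : Fin (m + 1 + l) => v (Fin.cast (by omega) i)) =
      (-1) ^ m * wedge a (lineWedge τ x) v +
        wedge a' (c • x) (fun i : Fin (m + 1 + l) => v (Fin.cast (by omega) i)) := by
  set v' : Fin (m + 1 + l) → E := fun i => v (Fin.cast (by omega) i)
  have h1 : wedge (lineWedge τ a + c • a') x v' =
      wedge (lineWedge τ a) x v' + wedge (c • a') x v' := wedge_add_left _ _ _ _
  have h2 : wedge (c • a') x v' = c * wedge a' x v' := wedge_smul_left _ _ _ _
  have h3 : wedge a' (c • x) v' = c * wedge a' x v' := wedge_smul_right _ _ _ _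
  have h4 : wedge a (lineWedge τ x) v = (-1) ^ m * wedge (lineWedge τ a) x v' :=
    wedge_lineWedge_comm _ _ _ _
  rw [h1, h2, h3, h4, ← mul_assoc, ← mul_pow]
  norm_num

variable [T2Space G] [SecondCountableTopology G] [MeasurableSpace G] [BorelSpace G]
  {μ : Measure G} [IsFiniteMeasureOnCompacts μ] {p : ℝ≥0∞}

lemma memLp_lineWedge (q : ℝ≥0∞) {f : G → ℝ} (hf : ContMDiff I 𝓘(ℝ, ℝ) ∞ f) {l : ℕ}
    {φ : G → AltForm E l} (hφ : ContMDiff I 𝓘(ℝ, AltForm E l) ∞ φ) (hs : HasCompactSupport φ) :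
    MemLp (fun g => lineWedge (leftDerivL I f g) (φ g)) q μ := by
  obtain ⟨h1, h2⟩ := continuous_bilin_hasCompactSupport (lineWedgeL (E := E) l)
    (contMDiff_leftDerivL hf).continuous hφ.continuous hs
  exact h1.memLp_of_hasCompactSupport h2

/-- If φ is a test form so is fφ, and d(fφ) = df ∧ φ + f dφ; moving df across θ gives the extra
term. -/
theorem IsWeakExtDer.smul_smooth (q : ℝ≥0∞) [p.HolderConjugate q] {m : ℕ} {θ : G → AltForm E m} {η : G → AltForm E (m + 1)}
    (hd : IsWeakExtDer I μ θ η) (hθ : MemLp θ p μ) (hη : MemLp η p μ) {f : G → ℝ}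
    (hf : ContMDiff I 𝓘(ℝ, ℝ) ∞ f) :
    IsWeakExtDer I μ (fun g => f g • θ g)
      (fun g => lineWedge (leftDerivL I f g) (θ g) + f g • η g) := by
  intro l b φ hφ hs
  set b' : Fin (m + 1 + l) → E := fun i => b (Fin.cast (by omega) i)
  have hfφ : ContMDiff I 𝓘(ℝ, AltForm E l) ∞ fun g => f g • φ g := hf.smul hφ
  have hfs : HasCompactSupport fun g => f g • φ g :=
    hs.mono' fun g hg => subset_tsupport _ fun h0 => hg (by simp only [h0, smul_zero])
  set ψ : G → AltForm E (l + 1) := fun g => lineWedge (leftDerivL I f g) (φ g)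
  have hψ : MemLp ψ q μ := memLp_lineWedge q hf hφ hs
  have e1 : ∀ g, wedge (f g • θ g) (extDer I φ g) b =
      wedge (θ g) (extDerL I (fun g => f g • φ g) g) b - wedge (θ g) (ψ g) b := fun g => by
    rw [extDerL_smul ((hf g).mdifferentiableAt (by simp)) ((hφ g).mdifferentiableAt (by simp)),
      ← coe_extDerL ((hφ g).mdifferentiableAt (by simp))]
    exact wedge_smul_eq_sub _ _ _ _ _
  have e2 : ∀ g, wedge (lineWedge (leftDerivL I f g) (θ g) + f g • η g) (φ g) b' =
      (-1) ^ m * wedge (θ g) (ψ g) b + wedge (η g) (f g • φ g) b' := fun g =>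
    wedge_lineWedge_add_smul _ _ _ _ _ _
  have i1 : Integrable (fun g => wedge (θ g) (ψ g) b) μ := integrable_wedge_memLp (q := q) _ hθ hψ
  have i2 : Integrable (fun g => wedge (θ g) (extDerL I (fun g => f g • φ g) g) b) μ :=
    integrable_wedge_memLp (q := q) _ hθ (memLp_extDerL μ q hfφ hfs)
  have i3 : Integrable (fun g => wedge (η g) (f g • φ g) b') μ :=
    integrable_wedge_memLp (q := q) _ hη (hfφ.continuous.memLp_of_hasCompactSupport hfs)
  have e3 : ∀ g, wedge (θ g) (extDerL I (fun g => f g • φ g) g) b =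
      wedge (θ g) (extDer I (fun g => f g • φ g) g) b := fun g => by
    rw [coe_extDerL ((hfφ g).mdifferentiableAt (by simp))]
  have h0 := hd l b _ hfφ hfs
  change ∫ g, wedge (f g • θ g) (extDer I φ g) b ∂μ = (-1) ^ (m + 1) * ∫ g,
    wedge (lineWedge (leftDerivL I f g) (θ g) + f g • η g) (φ g) b' ∂μ
  simp only [e1, e2]
  rw [integral_sub i2 i1, integral_add (i1.const_mul _) i3, integral_const_mul]
  simp only [e3]
  rw [h0]
  have hm : (-1 : ℝ) ^ (m + 1) * (-1) ^ m = -1 := by rw [pow_succ, mul_right_comm, ← mul_pow]; simp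
  linear_combination (-∫ g, wedge (θ g) (ψ g) b ∂μ) * hm

/-- Weak exterior derivatives in `L^p` are determined by the form, up to null sets, and the graph
of the weak exterior derivative is closed. -/
lemma isClosed_isWeakExtDer (q : ℝ≥0∞) [p.HolderConjugate q] [Fact (1 ≤ p)] (m : ℕ) : IsClosed
    {x : Lp (AltForm E m) p μ × Lp (AltForm E (m + 1)) p μ | IsWeakExtDer I μ x.1 x.2} := by
  have hc : ∀ {n l : ℕ} (v : Fin (n + l) → E) {φ : G → AltForm E l}, MemLp φ q μ →
      Continuous fun θ : Lp (AltForm E n) p μ => ∫ g, wedge (θ g) (φ g) v ∂μ := by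
    intro n l v φ hφ
    obtain ⟨K, hK0, hK⟩ := exists_wedge_bound (E := E) v
    refine (LipschitzWith.of_dist_le_mul (K := ⟨K * (eLpNorm φ q μ).toReal, by positivity⟩)
      fun θ θ' => ?_).continuous
    rw [Real.dist_eq, dist_eq_norm, ← integral_sub (integrable_wedge_memLp _ (Lp.memLp θ) hφ)
      (integrable_wedge_memLp _ (Lp.memLp θ') hφ)]
    have h1 : ∫ g, (wedge (θ g) (φ g) v - wedge (θ' g) (φ g) v) ∂μ =
        ∫ g, wedge ((θ - θ' : Lp (AltForm E n) p μ) g) (φ g) v ∂μ := by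
      refine integral_congr_ae ((Lp.coeFn_sub θ θ').mono fun g hg => ?_)
      simp only [hg]
      exact (congrArg (fun L : AltForm E l →L[ℝ] ℝ => L (φ g))
        (map_sub (wedgeL v) (θ g) (θ' g))).symm
    rw [h1]
    refine (abs_integral_wedge_le hK0 hK (Lp.memLp (θ - θ')) hφ).trans_eq ?_
    rw [← Lp.norm_def]
    change _ = K * (eLpNorm φ q μ).toReal * _
    ring
  -- The graph is an intersection of one equation for each test form, and both sides of each
  -- equation are continuous by Hölder's inequality.
  have hset : {x : Lp (AltForm E m) p μ × Lp (AltForm E (m + 1)) p μ | IsWeakExtDer I μ x.1 x.2} =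
      ⋂ (l : ℕ) (b : Module.Basis (Fin (m + (l + 1))) ℝ E) (φ : G → AltForm E l)
        (_ : ContMDiff I 𝓘(ℝ, AltForm E l) ∞ φ) (_ : HasCompactSupport φ),
      {x : Lp (AltForm E m) p μ × Lp (AltForm E (m + 1)) p μ |
        ∫ g, wedge (x.1 g) (extDerL I φ g) b ∂μ =
        (-1) ^ (m + 1) * ∫ g, wedge (x.2 g) (φ g) (fun i => b (Fin.cast (by omega) i)) ∂μ} := by
    ext x
    simp only [mem_ofPred_eq, mem_iInter, IsWeakExtDer]
    refine forall_congr' fun l => forall_congr' fun b => forall_congr' fun φ =>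
      forall_congr' fun hφ => forall_congr' fun hs => ?_
    have e : ∀ g, wedge (x.1 g) (extDerL I φ g) b = wedge (x.1 g) (extDer I φ g) b := fun g => by
      rw [coe_extDerL ((hφ g).mdifferentiableAt (by simp))]
    simp only [e]
  rw [hset]
  refine isClosed_iInter fun l => isClosed_iInter fun b => isClosed_iInter fun φ =>
    isClosed_iInter fun hφ => isClosed_iInter fun hs => isClosed_eq ?_ ?_
  · exact (hc _ (memLp_extDerL μ q hφ hs)).comp continuous_fst
  · exact continuous_const.mul
      ((hc _ (hφ.continuous.memLp_of_hasCompactSupport hs)).comp continuous_snd)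

end ProductRule

/-! ### Bounded primitives from vanishing cohomology. -/

section BoundedPrimitive

variable {E : Type*} [NormedAddCommGroup E] [NormedSpace ℝ E] [FiniteDimensional ℝ E]
  {M : Type*} [TopologicalSpace M] {I : ModelWithCorners ℝ E M} [I.Boundaryless]
  {G : Type*} [TopologicalSpace G] [ChartedSpace M G] [Group G] [LieGroup I ∞ G]
  [T2Space G] [SecondCountableTopology G] [MeasurableSpace G] [BorelSpace G]
  {μ : Measure G} [μ.IsHaarMeasure] {p : ℝ≥0∞}

lemma isClosed_closedForms (q : ℝ≥0∞) [p.HolderConjugate q] [Fact (1 ≤ p)] (m : ℕ) (hp : 1 ≤ p) :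
    IsClosed (closedForms I μ m hp : Set (Lp (AltForm E m) p μ)) := by
  have h1 : (closedForms I μ m hp : Set (Lp (AltForm E m) p μ)) = (fun θ => (θ, 0)) ⁻¹'
      {x : Lp (AltForm E m) p μ × Lp (AltForm E (m + 1)) p μ | IsWeakExtDer I μ x.1 x.2} := by
    ext θ
    have h0 := Lp.coeFn_zero (AltForm E (m + 1)) p μ
    exact ⟨fun h => IsWeakExtDer.congr I μ h Filter.EventuallyEq.rfl h0.symm,
      fun h => IsWeakExtDer.congr I μ h Filter.EventuallyEq.rfl h0⟩
  rw [h1]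
  exact (isClosed_isWeakExtDer q m).preimage (by fun_prop)

/-- The graph of the weak exterior derivative from `L^p` closed forms to their primitives. -/
def weakGraph [Fact (1 ≤ p)] (I : ModelWithCorners ℝ E M) [LieGroup I ∞ G] (μ : Measure G)
    [μ.IsHaarMeasure] (m : ℕ) :
    Submodule ℝ (Lp (AltForm E m) p μ × Lp (AltForm E (m + 1)) p μ) where
  carrier := {x | IsWeakExtDer I μ x.1 x.2 ∧ IsClosedForm I μ x.2}
  zero_mem' := ⟨(IsWeakExtDer.zero I μ).congr I μ (Lp.coeFn_zero (AltForm E m) p μ).symm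
    (Lp.coeFn_zero (AltForm E (m + 1)) p μ).symm,
    (closedForms I μ (m + 1) (p := p) Fact.out).zero_mem⟩
  add_mem' := by
    rintro ⟨β, θ⟩ ⟨β', θ'⟩ ⟨h, hc⟩ ⟨h', hc'⟩
    exact ⟨(IsWeakExtDer.add I μ Fact.out h h' (Lp.memLp β) (Lp.memLp β') (Lp.memLp θ)
      (Lp.memLp θ')).congr I μ (Lp.coeFn_add β β').symm (Lp.coeFn_add θ θ').symm,
      hc.add I μ Fact.out hc'⟩
  smul_mem' := by
    rintro c ⟨β, θ⟩ ⟨h, hc⟩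
    exact ⟨(IsWeakExtDer.smul I μ c h).congr I μ (Lp.coeFn_smul c β).symm
      (Lp.coeFn_smul c θ).symm, hc.smul I μ c⟩

/-- If the `L^p` cohomology vanishes, closed forms have primitives with a norm bound. -/
theorem exists_bounded_primitive (q : ℝ≥0∞) [p.HolderConjugate q] (hp : 1 ≤ p) (m : ℕ)
    (h : ¬ Nontrivial (LpCohomology I μ (m + 1) hp)) :
    ∃ C : ℝ, 0 ≤ C ∧ ∀ θ : G → AltForm E (m + 1), MemLp θ p μ → IsWeakExtDer I μ θ (fun _ => 0) →
      ∃ β : G → AltForm E m, MemLp β p μ ∧ IsWeakExtDer I μ β θ ∧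
        eLpNorm β p μ ≤ ENNReal.ofReal C * eLpNorm θ p μ := by
  have : Fact (1 ≤ p) := ⟨hp⟩
  have hex : ∀ θ ∈ closedForms I μ (m + 1) hp, θ ∈ exactForms I μ (m + 1) hp := by
    intro θ hθ
    rw [not_nontrivial_iff_subsingleton, Submodule.Quotient.subsingleton_iff] at h
    have h1 : (⟨θ, hθ⟩ : closedForms I μ (m + 1) hp) ∈
        (exactForms I μ (m + 1) hp).submoduleOf (closedForms I μ (m + 1) hp) := by
      rw [h]; trivial
    exact h1
  have hZ : CompleteSpace (closedForms I μ (m + 1) hp) :=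
    (isClosed_closedForms q (m + 1) hp).completeSpace_coe
  have hW : CompleteSpace (weakGraph (p := p) I μ m) := by
    refine IsClosed.completeSpace_coe (hs := ?_)
    exact (isClosed_isWeakExtDer q m).inter
      ((isClosed_closedForms q (m + 1) hp).preimage continuous_snd)
  -- A bounded map between Banach spaces that sends a pair (β, dβ) to dβ. It is surjective because
  -- the cohomology vanishes, and the open mapping theorem gives preimages with a norm bound.
  let T : weakGraph (p := p) I μ m →L[ℝ] closedForms I μ (m + 1) hp :=
    ((ContinuousLinearMap.snd ℝ _ _) ∘L (weakGraph (p := p) I μ m).subtypeL).codRestrict _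
      fun x => x.2.2
  have hT : Function.Surjective T := by
    rintro ⟨θ, hθ⟩
    obtain ⟨β, hβ⟩ := hex θ hθ
    exact ⟨⟨(β, θ), hβ, hθ⟩, rfl⟩
  obtain ⟨C, hC, hCb⟩ := T.exists_preimage_norm_le hT
  refine ⟨C, hC.le, fun θ hθ hθc => ?_⟩
  have hmem : hθ.toLp θ ∈ closedForms I μ (m + 1) hp :=
    IsWeakExtDer.congr I μ hθc hθ.coeFn_toLp.symm Filter.EventuallyEq.rfl
  obtain ⟨⟨⟨β, θ'⟩, hβ, hθ'⟩, hT', hb⟩ := hCb ⟨hθ.toLp θ, hmem⟩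
  have hθ'' : θ' = hθ.toLp θ := congrArg Subtype.val hT'
  subst hθ''
  refine ⟨β, Lp.memLp β, hβ.congr I μ Filter.EventuallyEq.rfl hθ.coeFn_toLp, ?_⟩
  have h2 : ‖β‖ ≤ C * ‖hθ.toLp θ‖ := (le_max_left _ _).trans hb
  rw [Lp.norm_toLp, Lp.norm_def] at h2
  rw [← ENNReal.ofReal_toReal hθ.2.ne, ← ENNReal.ofReal_mul hC.le,
    ← ENNReal.ofReal_toReal (Lp.memLp β).2.ne]
  exact ENNReal.ofReal_le_ofReal h2

end BoundedPrimitive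

/-! ### Exterior multiplication by a closed left-invariant linear form. -/

section LineForm

variable {E : Type*} [NormedAddCommGroup E] [NormedSpace ℝ E] [FiniteDimensional ℝ E]

lemma lineWedge_smul_left {k : ℕ} (τ : E →L[ℝ] ℝ) (c : ℝ) (a : AltForm E k) :
    lineWedge (c • τ) a = c • lineWedge τ a :=
  congrArg (fun L : AltForm E k →ₗ[ℝ] AltForm E (k + 1) => L a) ((lineWedgeₗ k).map_smul c τ)

/-- The double product alternates a bilinear map that is symmetric in its two arguments. -/
lemma lineWedge_self {k : ℕ} (τ : E →L[ℝ] ℝ) (a : AltForm E k) :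
    lineWedge τ (lineWedge τ a) = 0 := by
  have h := ContinuousAlternatingMap.alternatizeUncurryFin_alternatizeUncurryFinCLM_comp_of_symmetric
    (f := τ.smulRight (τ.smulRight a)) (fun x y => by
      simp only [ContinuousLinearMap.smulRight_apply, smul_apply]
      exact smul_comm _ _ _)
  rw [← h, lineWedge]
  congr 1
  ext1 x
  exact ((ContinuousAlternatingMap.alternatizeUncurryFinCLM ℝ E ℝ).map_smul (τ x)
    (τ.smulRight a)).symm

lemma lineWedge_lineWedge_comm {k : ℕ} (τ σ : E →L[ℝ] ℝ) (a : AltForm E k) :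
    lineWedge τ (lineWedge σ a) = -lineWedge σ (lineWedge τ a) := by
  have h := lineWedge_self (τ + σ) a
  have h1 : ∀ {l : ℕ} (b : AltForm E l), lineWedge (τ + σ) b = lineWedge τ b + lineWedge σ b :=
    fun {l} b => LinearMap.congr_fun ((lineWedgeₗ l).map_add τ σ) b
  have h2 : ∀ (ρ : E →L[ℝ] ℝ) (b b' : AltForm E (k + 1)),
      lineWedge ρ (b + b') = lineWedge ρ b + lineWedge ρ b' :=
    fun ρ b b' => (lineWedgeₗ _ ρ).map_add b b'
  rw [h1, h1, h2, h2, lineWedge_self, lineWedge_self, zero_add, add_zero] at h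
  exact eq_neg_of_add_eq_zero_left h

variable {M : Type*} [TopologicalSpace M] {I : ModelWithCorners ℝ E M} [I.Boundaryless]
  {G : Type*} [TopologicalSpace G] [ChartedSpace M G] [Group G] [LieGroup I ∞ G]

/-- A linear form that vanishes on brackets is closed as a left-invariant form, so only the term in
which d acts on φ survives, and τ anticommutes with the coordinate forms. -/
lemma extDerL_lineWedge {τ : E →L[ℝ] ℝ} (hτ : ∀ x, τ ∘L adL I G x = 0) {k : ℕ}
    {φ : G → AltForm E k} {g : G} (hφ : MDifferentiableAt I 𝓘(ℝ, AltForm E k) φ g) :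
    extDerL I (fun h => lineWedge τ (φ h)) g = -lineWedge τ (extDerL I φ g) := by
  set Ψ := leftDerivL I φ g + halfDer (adL I G) (φ g) with hΨ
  have h1 : leftDerivL I (fun h => lineWedge τ (φ h)) g + halfDer (adL I G) (lineWedge τ (φ g)) =
      lineWedgeL k τ ∘L Ψ := by
    have h2 : leftDerivL I (fun h => lineWedge τ (φ h)) g = lineWedgeL k τ ∘L leftDerivL I φ g :=
      leftDerivL_clm_comp hφ (lineWedgeL k τ)
    rw [h2, hΨ, ContinuousLinearMap.comp_add]
    congr 1
    ext1 x
    have h0 : lineWedge (0 : E →L[ℝ] ℝ) (φ g) = 0 :=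
      LinearMap.congr_fun (lineWedgeₗ k).map_zero (φ g)
    rw [halfDer_apply, inducedDer_lineWedge, hτ, h0, zero_add]
    exact ((lineWedgeₗ k τ).map_smul _ _).symm
  have e := Module.finBasis ℝ E
  have h3 : extDerL I (fun h => lineWedge τ (φ h)) g =
      ContinuousAlternatingMap.alternatizeUncurryFin (lineWedgeL k τ ∘L Ψ) := by rw [← h1]; rfl
  have h4 : extDerL I φ g = ContinuousAlternatingMap.alternatizeUncurryFin Ψ := rfl
  rw [h3, h4, alternatizeUncurryFin_eq_sum e, alternatizeUncurryFin_eq_sum e]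
  have h5 : lineWedge τ (∑ i, lineWedge (coordForm e i) (Ψ (e i))) =
      ∑ i, lineWedge τ (lineWedge (coordForm e i) (Ψ (e i))) := map_sum (lineWedgeₗ _ τ) _ _
  rw [h5, ← Finset.sum_neg_distrib]
  exact Finset.sum_congr rfl fun i _ => lineWedge_lineWedge_comm _ _ _

variable [MeasurableSpace G] {μ : Measure G}

/-- If φ is a test form so is τ ∧ φ; τ is then moved across θ and across η. -/
theorem IsWeakExtDer.lineWedge {τ : E →L[ℝ] ℝ} (hτ : ∀ x, τ ∘L adL I G x = 0) {m : ℕ}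
    {θ : G → AltForm E m} {η : G → AltForm E (m + 1)} (hd : IsWeakExtDer I μ θ η) :
    IsWeakExtDer I μ (fun g => lineWedge τ (θ g)) (fun g => -lineWedge τ (η g)) := by
  intro l b φ hφ hs
  have hτφ : ContMDiff I 𝓘(ℝ, AltForm E (l + 1)) ∞ fun g => _root_.lineWedge τ (φ g) :=
    (lineWedgeL l τ).contMDiff.comp hφ
  have hτs : HasCompactSupport fun g => _root_.lineWedge τ (φ g) :=
    hs.comp_left (g := lineWedgeL l τ) (map_zero _)
  have hN : m + 1 + (l + 1) = m + (l + 1 + 1) := by omega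
  have h0 := hd (l + 1) (b.reindex (finCongr hN)) _ hτφ hτs
  have e1 : ∀ g, wedge (θ g) (extDer I (fun g => _root_.lineWedge τ (φ g)) g)
      (b.reindex (finCongr hN)) = -(-1) ^ m * wedge (_root_.lineWedge τ (θ g)) (extDer I φ g) b := by
    intro g
    have h2 : wedge (θ g) (-_root_.lineWedge τ (extDerL I φ g)) (b.reindex (finCongr hN)) =
        -wedge (θ g) (_root_.lineWedge τ (extDerL I φ g)) (b.reindex (finCongr hN)) := by
      have := wedge_smul_right (-1) (θ g) (_root_.lineWedge τ (extDerL I φ g))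
        (b.reindex (finCongr hN))
      simpa using this
    rw [← coe_extDerL ((hτφ g).mdifferentiableAt (by simp)),
      ← coe_extDerL ((hφ g).mdifferentiableAt (by simp)),
      extDerL_lineWedge hτ ((hφ g).mdifferentiableAt (by simp)), h2, wedge_lineWedge_comm, neg_mul]
    simp
  have e2 : ∀ g, wedge (η g) (_root_.lineWedge τ (φ g)) (fun i =>
      b.reindex (finCongr hN) (Fin.cast (by omega) i)) = (-1) ^ m *
        wedge (-_root_.lineWedge τ (η g)) (φ g) (fun i => b (Fin.cast (by omega) i)) := by
    intro g
    have h2 : wedge (-_root_.lineWedge τ (η g)) (φ g) (fun i => b (Fin.cast (by omega) i)) =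
        -wedge (_root_.lineWedge τ (η g)) (φ g) (fun i => b (Fin.cast (by omega) i)) := by
      have := wedge_smul_left (-1) (_root_.lineWedge τ (η g)) (φ g)
        (fun i => b (Fin.cast (by omega) i))
      simpa using this
    rw [h2, wedge_lineWedge_comm, pow_succ]
    simp
  simp only [e1, e2, integral_const_mul] at h0
  have h1 : (-1 : ℝ) ^ m * (-1) ^ m = 1 := by rw [← mul_pow]; simp
  set X := ∫ g, wedge (_root_.lineWedge τ (θ g)) (extDer I φ g) b ∂μ
  set Y := ∫ g, wedge (-_root_.lineWedge τ (η g)) (φ g) (fun i => b (Fin.cast (by omega) i)) ∂μ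
  rw [pow_succ] at h0
  rw [pow_succ, pow_succ]
  linear_combination (-(-1) ^ m) * h0 + (Y * (-1) ^ m - X) * h1

end LineForm

/-! ### Cutting off a primitive halves the norm. -/

section Cut

variable {E : Type*} [NormedAddCommGroup E] [NormedSpace ℝ E] [FiniteDimensional ℝ E]
  {H : Type*} [TopologicalSpace H] [T2Space H] [SecondCountableTopology H]
  [ChartedSpace E H] [Group H] [LieGroup 𝓘(ℝ, E) ∞ H]
  [MeasurableSpace H] [BorelSpace H] {α : E →L[ℝ] E} {F : AutFlow H α}
  {ν : Measure (SemiProd F)} [ν.IsHaarMeasure]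

open SemiProd

lemma dt_comp_adL (x : E × ℝ) :
    (dt : E × ℝ →L[ℝ] ℝ) ∘L adL (𝓘(ℝ, E).prod 𝓘(ℝ, ℝ)) (SemiProd F) x = 0 := by
  refine ContinuousLinearMap.ext fun y => ?_
  rw [ContinuousLinearMap.comp_apply, adL_apply_eq]
  rfl

lemma leftDerivL_comp_snd_eq {κ : ℝ → ℝ} (hκ : ContDiff ℝ ∞ κ) (g : SemiProd F) :
    leftDerivL (𝓘(ℝ, E).prod 𝓘(ℝ, ℝ)) (fun g : SemiProd F => κ g.snd) g =
      deriv κ g.snd • (dt : E × ℝ →L[ℝ] ℝ) := by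
  have h := leftDerivL_comp_snd F (h := g.fst) (t := g.snd)
    (hκ.differentiable (by simp) g.snd).hasDerivAt
  rw [mk_fst_snd] at h
  rw [h]
  refine ContinuousLinearMap.ext fun x => ?_
  simp [mul_comm]

lemma contMDiff_comp_snd {κ : ℝ → ℝ} (hκ : ContDiff ℝ ∞ κ) :
    ContMDiff (𝓘(ℝ, E).prod 𝓘(ℝ, ℝ)) 𝓘(ℝ, ℝ) ∞ (fun g : SemiProd F => κ g.snd) :=
  hκ.contMDiff.comp (SemiProd.contMDiff_snd F)

lemma memLp_lineWedge_const {V X : Type*} [NormedAddCommGroup V] [NormedSpace ℝ V]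
    [MeasurableSpace X] {μ : Measure X} {p : ℝ≥0∞} (τ : V →L[ℝ] ℝ) {k : ℕ} {θ : X → AltForm V k}
    (hθ : MemLp θ p μ) : MemLp (fun x => lineWedge τ (θ x)) p μ :=
  (lineWedgeL k τ).comp_memLp' hθ

lemma memLp_smul_comp_snd {V : Type*} [NormedAddCommGroup V] [NormedSpace ℝ V] {f : ℝ → ℝ} {B : ℝ}
    {θ : SemiProd F → V} {p : ℝ≥0∞} (hf : Continuous f) (hfB : ∀ t, |f t| ≤ B)
    (hθ : MemLp θ p ν) : MemLp (fun g => f g.snd • θ g) p ν := by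
  refine hθ.of_le_mul (c := B)
    ((hf.comp (SemiProd.continuous_snd F)).aestronglyMeasurable.smul hθ.1)
    (Filter.Eventually.of_forall fun g => ?_)
  rw [norm_smul, Real.norm_eq_abs]
  exact mul_le_mul_of_nonneg_right (hfB _) (norm_nonneg _)

/-- Subtracting the exterior derivative of a cut-off primitive halves the norm of a closed form
which is supported in a strip, and enlarges the strip by a fixed amount. -/
theorem exists_cut {p : ℝ≥0∞} (q : ℝ≥0∞) [p.HolderConjugate q] {m : ℕ} {C : ℝ} (hC : 0 ≤ C)
    (hprim : ∀ θ : SemiProd F → AltForm (E × ℝ) (m + 1), MemLp θ p ν →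
      IsWeakExtDer (𝓘(ℝ, E).prod 𝓘(ℝ, ℝ)) ν θ (fun _ => 0) →
      ∃ β : SemiProd F → AltForm (E × ℝ) m, MemLp β p ν ∧
        IsWeakExtDer (𝓘(ℝ, E).prod 𝓘(ℝ, ℝ)) ν β θ ∧
        eLpNorm β p ν ≤ ENNReal.ofReal C * eLpNorm θ p ν) :
    ∃ D : ℝ, 0 < D ∧ ∀ (a R : ℝ) (χ : SemiProd F → AltForm (E × ℝ) (m + 1)), MemLp χ p ν →
      IsWeakExtDer (𝓘(ℝ, E).prod 𝓘(ℝ, ℝ)) ν χ (fun _ => 0) →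
      (∀ g : SemiProd F, R < |g.snd - a| → χ g = 0) →
      ∃ (β : SemiProd F → AltForm (E × ℝ) m) (χ₁ : SemiProd F → AltForm (E × ℝ) (m + 1)),
        MemLp β p ν ∧ MemLp χ₁ p ν ∧
        IsWeakExtDer (𝓘(ℝ, E).prod 𝓘(ℝ, ℝ)) ν χ₁ (fun _ => 0) ∧
        IsWeakExtDer (𝓘(ℝ, E).prod 𝓘(ℝ, ℝ)) ν β (fun g => χ g - χ₁ g) ∧
        (∀ g : SemiProd F, R + D < |g.snd - a| → β g = 0) ∧
        (∀ g : SemiProd F, R + D < |g.snd - a| → χ₁ g = 0) ∧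
        eLpNorm β p ν ≤ ENNReal.ofReal C * eLpNorm χ p ν ∧
        eLpNorm χ₁ p ν ≤ ENNReal.ofReal (1 / 2) * eLpNorm χ p ν := by
  obtain ⟨K, hK0, hK⟩ := exists_plateau
  obtain ⟨K', hK'0, hK'⟩ := exists_lineWedge_bound m (dt : E × ℝ →L[ℝ] ℝ)
  -- The slope K / L of the cut-off, the norm bound K' of dt ∧ · and the norm bound C of the
  -- primitive multiply to at most ½; the summand 1 keeps L positive.
  set L := 2 * K * K' * C + 1 with hL
  have hL0 : 0 < L := by positivity
  -- The plateau has radius R + 1 and the slope takes another L. The margin 1 keeps the support of χ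
  -- away from the slope.
  refine ⟨L + 1, by linarith, fun a R χ hχ hχc hχs => ?_⟩
  obtain ⟨β, hβ, hβd, hβn⟩ := hprim χ hχ hχc
  obtain ⟨κ, hκ, hκ1, hκe, hκz, hκd, hκi, hκo⟩ := hK a (R + 1) L hL0
  have hκ' : ContDiff ℝ ∞ (deriv κ) := (contDiff_infty_iff_deriv.1 hκ).2
  have hdtβ : MemLp (fun g => lineWedge (dt : E × ℝ →L[ℝ] ℝ) (β g)) p ν :=
    memLp_lineWedge_const (V := E × ℝ) (k := m) (p := p) (μ := ν) (θ := β) dt hβ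
  have hβ' : MemLp (fun g => κ g.snd • β g) p ν :=
    memLp_smul_comp_snd hκ.continuous hκ1 hβ
  have hχ₁ : MemLp (fun g => deriv κ g.snd • lineWedge (dt : E × ℝ →L[ℝ] ℝ) (β g)) p ν :=
    memLp_smul_comp_snd hκ'.continuous hκd hdtβ
  -- At each point κ' or χ vanishes, so the differential of κ' dt ∧ β, which is -κ' dt ∧ χ, is zero:
  -- the remainder is closed again.
  have hin : ∀ g : SemiProd F, deriv κ g.snd = 0 ∨ χ g = 0 := by
    intro g
    by_cases hg : |g.snd - a| < R + 1
    · exact Or.inl (hκi _ hg)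
    · exact Or.inr (hχs g (by linarith))
  have hneg : ∀ {l : ℕ} (x : AltForm (E × ℝ) l), (-1 : ℝ) • x = -x := fun x => neg_one_smul ℝ x
  refine ⟨fun g => κ g.snd • β g,
    fun g => (-1 : ℝ) • deriv κ g.snd • lineWedge (dt : E × ℝ →L[ℝ] ℝ) (β g),
    hβ', hχ₁.const_smul (-1 : ℝ), ?_, ?_, ?_, ?_, ?_, ?_⟩
  · have h1 : IsWeakExtDer (𝓘(ℝ, E).prod 𝓘(ℝ, ℝ)) ν
        (fun g => lineWedge (dt : E × ℝ →L[ℝ] ℝ) (β g))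
        (fun g => -lineWedge (dt : E × ℝ →L[ℝ] ℝ) (χ g)) := hβd.lineWedge dt_comp_adL
    have h2 := h1.smul_smooth q hdtβ (memLp_lineWedge_const (V := E × ℝ) (k := m + 1) (p := p) (μ := ν) (θ := χ) dt hχ).neg (contMDiff_comp_snd hκ')
    have h3 := IsWeakExtDer.smul (𝓘(ℝ, E).prod 𝓘(ℝ, ℝ)) ν (-1) h2
    refine h3.congr _ ν Filter.EventuallyEq.rfl (Filter.Eventually.of_forall fun g => ?_)
    have h5 : lineWedge (deriv (deriv κ) g.snd • (dt : E × ℝ →L[ℝ] ℝ)) (lineWedge dt (β g)) = 0 := by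
      rw [lineWedge_smul_left, lineWedge_self, smul_zero]
    have h6 : deriv κ g.snd • -lineWedge (dt : E × ℝ →L[ℝ] ℝ) (χ g) = 0 := by
      rcases hin g with h | h
      · rw [h, zero_smul]
      · have h0 : lineWedge (dt : E × ℝ →L[ℝ] ℝ) (0 : AltForm (E × ℝ) (m + 1)) = 0 :=
          (lineWedgeₗ (E := E × ℝ) (m + 1) dt).map_zero
        rw [h, h0, neg_zero, smul_zero]
    change (-1 : ℝ) • (lineWedge (leftDerivL (𝓘(ℝ, E).prod 𝓘(ℝ, ℝ))
      (fun g : SemiProd F => deriv κ g.snd) g) (lineWedge dt (β g)) +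
      deriv κ g.snd • -lineWedge (dt : E × ℝ →L[ℝ] ℝ) (χ g)) = 0
    rw [leftDerivL_comp_snd_eq hκ', h5, h6, add_zero, smul_zero]
  · have h2 := hβd.smul_smooth q hβ hχ (contMDiff_comp_snd hκ)
    refine h2.congr _ ν Filter.EventuallyEq.rfl (Filter.Eventually.of_forall fun g => ?_)
    have h3 : κ g.snd • χ g = χ g := by
      by_cases hg : |g.snd - a| ≤ R + 1
      · rw [hκe _ hg, one_smul]
      · rw [hχs g (by linarith), smul_zero]
    change lineWedge (leftDerivL (𝓘(ℝ, E).prod 𝓘(ℝ, ℝ)) (fun g : SemiProd F => κ g.snd) g) (β g) +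
      κ g.snd • χ g = χ g - (-1 : ℝ) • deriv κ g.snd • lineWedge (dt : E × ℝ →L[ℝ] ℝ) (β g)
    rw [leftDerivL_comp_snd_eq hκ, lineWedge_smul_left, h3, hneg, sub_neg_eq_add]
    exact add_comm _ _
  · intro g hg
    change κ g.snd • β g = 0
    rw [hκz _ (by linarith), zero_smul]
  · intro g hg
    change (-1 : ℝ) • deriv κ g.snd • lineWedge (dt : E × ℝ →L[ℝ] ℝ) (β g) = 0
    rw [hκo _ (by linarith), zero_smul, smul_zero]
  · refine (eLpNorm_mono fun g => ?_).trans hβn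
    change ‖κ g.snd • β g‖ ≤ ‖β g‖
    rw [norm_smul, Real.norm_eq_abs]
    exact mul_le_of_le_one_left (norm_nonneg _) (hκ1 _)
  · have h1 : eLpNorm (fun g => (-1 : ℝ) • deriv κ g.snd • lineWedge (dt : E × ℝ →L[ℝ] ℝ) (β g))
        p ν ≤ ENNReal.ofReal (K / L * K') * eLpNorm β p ν := by
      refine eLpNorm_le_mul_eLpNorm_of_ae_le_mul (Filter.Eventually.of_forall fun g => ?_) p
      rw [hneg, norm_neg, norm_smul, Real.norm_eq_abs, mul_assoc]
      exact mul_le_mul (hκd _) (hK' _) (norm_nonneg _) (by positivity)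
    refine h1.trans ((mul_le_mul_right hβn _).trans ?_)
    rw [← mul_assoc, ← ENNReal.ofReal_mul (by positivity)]
    refine mul_le_mul_left (ENNReal.ofReal_le_ofReal ?_) _
    rw [div_mul_eq_mul_div, div_mul_eq_mul_div, div_le_iff₀ hL0, hL]
    linarith

end Cut

/-! ### Iterated cuts and the estimate of the pairing. -/

section Iteration

variable {E : Type*} [NormedAddCommGroup E] [NormedSpace ℝ E] [FiniteDimensional ℝ E]
  {H : Type*} [TopologicalSpace H] [T2Space H] [SecondCountableTopology H]
  [ChartedSpace E H] [Group H] [LieGroup 𝓘(ℝ, E) ∞ H]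
  [MeasurableSpace H] [BorelSpace H] {μ : Measure H} [μ.IsHaarMeasure] [SFinite μ]
  {α : E →L[ℝ] E} {F : AutFlow H α}
  {ν : Measure (SemiProd F)} [ν.IsHaarMeasure] {p q : ℝ≥0∞} [p.HolderConjugate q]

open SemiProd

/-- Only the strip that carries θ matters, so Hölder's inequality can be used with the truncated
pull-back even if the full pull-back is not in L^q. -/
lemma wedge_flowLift_eq_stripLift {m r : ℕ} {A B : ℝ} {θ : SemiProd F → AltForm (E × ℝ) m}
    (hs : ∀ g : SemiProd F, g.snd ∉ Icc A B → θ g = 0) (u : H → AltForm E r)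
    (v : Fin (m + r) → E × ℝ) (g : SemiProd F) :
    wedge (θ g) (flowLift α g.snd (u g.fst)) v = wedge (θ g) (stripLift F A B u g) v := by
  by_cases hg : g.snd ∈ Icc A B
  · rw [stripLift_of_mem u hg]
  · rw [hs g hg]
    exact (wedge_zero_left _ _).trans (wedge_zero_left _ _).symm

lemma abs_integral_wedge_flowLift_le {m r : ℕ} {A B K : ℝ} {v : Fin (m + r) → E × ℝ} (hK0 : 0 ≤ K)
    (hK : ∀ (a : AltForm (E × ℝ) m) (b : AltForm (E × ℝ) r), |wedge a b v| ≤ K * ‖a‖ * ‖b‖)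
    {θ : SemiProd F → AltForm (E × ℝ) m} (hθ : MemLp θ p ν)
    (hs : ∀ g : SemiProd F, g.snd ∉ Icc A B → θ g = 0) {u : H → AltForm E r}
    (hu : MemLp (stripLift F A B u) q ν) :
    |∫ g, wedge (θ g) (flowLift α g.snd (u g.fst)) v ∂ν| ≤
      K * (eLpNorm θ p ν).toReal * (eLpNorm (stripLift F A B u) q ν).toReal := by
  simp only [wedge_flowLift_eq_stripLift hs]
  exact abs_integral_wedge_le hK0 hK hθ hu

lemma integral_wedge_flowLift_sub {m r : ℕ} {A B : ℝ} (v : Fin (m + r) → E × ℝ)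
    {θ θ' : SemiProd F → AltForm (E × ℝ) m} (hθ : MemLp θ p ν) (hθ' : MemLp θ' p ν)
    (hs : ∀ g : SemiProd F, g.snd ∉ Icc A B → θ g = 0)
    (hs' : ∀ g : SemiProd F, g.snd ∉ Icc A B → θ' g = 0) {u : H → AltForm E r}
    (hu : MemLp (stripLift F A B u) q ν) :
    ∫ g, wedge (θ g - θ' g) (flowLift α g.snd (u g.fst)) v ∂ν =
      ∫ g, wedge (θ g) (flowLift α g.snd (u g.fst)) v ∂ν -
        ∫ g, wedge (θ' g) (flowLift α g.snd (u g.fst)) v ∂ν := by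
  have e : ∀ g : SemiProd F, wedge (θ g - θ' g) (flowLift α g.snd (u g.fst)) v =
      wedge (θ g) (flowLift α g.snd (u g.fst)) v -
        wedge (θ' g) (flowLift α g.snd (u g.fst)) v := fun g =>
    congrArg (fun L : AltForm (E × ℝ) r →L[ℝ] ℝ => L (flowLift α g.snd (u g.fst)))
      (map_sub (wedgeL v) (θ g) (θ' g))
  simp only [e, wedge_flowLift_eq_stripLift hs, wedge_flowLift_eq_stripLift hs']
  exact integral_sub (integrable_wedge_memLp v hθ hu) (integrable_wedge_memLp v hθ' hu)

/-- Induction on the number n of cuts. A cut writes χ = χ₁ + dβ. By Stokes the second term becomes a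
pairing of β with π^*u', at most K C ‖χ‖ ‖π^*u'‖, and χ₁ has at most half the norm of χ. The
geometric series of the halved norms gives the constant 2C. The condition R + nD ≤ T keeps all the
supports inside the strip on which the norms are taken. -/
theorem abs_integral_closed_le {ρ : Measure ℝ} [IsLocallyFiniteMeasure ρ] (hp : 1 ≤ p) (hpt : p ≠ ⊤)
    (hq : 1 ≤ q) (hqt : q ≠ ⊤) (hα : IsDerivation H α)
    (hν : MeasurePreserving (homeo F) ν (μ.prod ρ)) {m r : ℕ} {C D : ℝ} (hC : 0 ≤ C)
    (hcut : ∀ (a R : ℝ) (χ : SemiProd F → AltForm (E × ℝ) (m + 1)), MemLp χ p ν →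
      IsWeakExtDer (𝓘(ℝ, E).prod 𝓘(ℝ, ℝ)) ν χ (fun _ => 0) →
      (∀ g : SemiProd F, R < |g.snd - a| → χ g = 0) →
      ∃ (β : SemiProd F → AltForm (E × ℝ) m) (χ₁ : SemiProd F → AltForm (E × ℝ) (m + 1)),
        MemLp β p ν ∧ MemLp χ₁ p ν ∧
        IsWeakExtDer (𝓘(ℝ, E).prod 𝓘(ℝ, ℝ)) ν χ₁ (fun _ => 0) ∧
        IsWeakExtDer (𝓘(ℝ, E).prod 𝓘(ℝ, ℝ)) ν β (fun g => χ g - χ₁ g) ∧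
        (∀ g : SemiProd F, R + D < |g.snd - a| → β g = 0) ∧
        (∀ g : SemiProd F, R + D < |g.snd - a| → χ₁ g = 0) ∧
        eLpNorm β p ν ≤ ENNReal.ofReal C * eLpNorm χ p ν ∧
        eLpNorm χ₁ p ν ≤ ENNReal.ofReal (1 / 2) * eLpNorm χ p ν)
    (hD : 0 ≤ D) (b : Module.Basis (Fin (m + (r + 1))) ℝ (E × ℝ)) {K : ℝ} (hK0 : 0 ≤ K)
    (hK : ∀ (x : AltForm (E × ℝ) m) (y : AltForm (E × ℝ) (r + 1)), |wedge x y b| ≤ K * ‖x‖ * ‖y‖)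
    (hK' : ∀ (x : AltForm (E × ℝ) (m + 1)) (y : AltForm (E × ℝ) r),
      |wedge x y (fun i => b (Fin.cast (by omega) i))| ≤ K * ‖x‖ * ‖y‖)
    {u : H → AltForm E r} {u' : H → AltForm E (r + 1)} (hu : MemLp u q μ) (hu' : MemLp u' q μ)
    (h : IsWeakExtDer 𝓘(ℝ, E) μ u u') {a A B T : ℝ} (hA : A = a - T) (hB : B = a + T)
    (hU : MemLp (stripLift F A B u) q ν) (hU' : MemLp (stripLift F A B u') q ν) (n : ℕ) :
    ∀ (R : ℝ) (χ : SemiProd F → AltForm (E × ℝ) (m + 1)), R + n * D ≤ T → MemLp χ p ν →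
      IsWeakExtDer (𝓘(ℝ, E).prod 𝓘(ℝ, ℝ)) ν χ (fun _ => 0) →
      (∀ g : SemiProd F, R < |g.snd - a| → χ g = 0) →
      |∫ g, wedge (χ g) (flowLift α g.snd (u g.fst)) (fun i => b (Fin.cast (by omega) i)) ∂ν| ≤
        K * (eLpNorm χ p ν).toReal * ((1 / 2) ^ n * (eLpNorm (stripLift F A B u) q ν).toReal +
          2 * C * (eLpNorm (stripLift F A B u') q ν).toReal) := by
  have hsupp : ∀ {l : ℕ} {θ : SemiProd F → AltForm (E × ℝ) l} {R : ℝ}, R ≤ T →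
      (∀ g : SemiProd F, R < |g.snd - a| → θ g = 0) →
      ∀ g : SemiProd F, g.snd ∉ Icc A B → θ g = 0 := by
    intro l θ R hR hθ g hg
    refine hθ g (hR.trans_lt ?_)
    by_contra hcon
    rw [not_lt, abs_le] at hcon
    exact hg ⟨by rw [hA]; linarith, by rw [hB]; linarith⟩
  set U := (eLpNorm (stripLift F A B u) q ν).toReal with hUdef
  set U' := (eLpNorm (stripLift F A B u') q ν).toReal with hU'def
  have hU0 : 0 ≤ U := ENNReal.toReal_nonneg
  have hU'0 : 0 ≤ U' := ENNReal.toReal_nonneg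
  induction n with
  | zero =>
    intro R χ hR hχ hχc hχs
    have hR' : R ≤ T := by simpa using hR
    refine (abs_integral_wedge_flowLift_le hK0 hK' hχ (hsupp hR' hχs) hU).trans ?_
    have h0 : 0 ≤ (eLpNorm χ p ν).toReal := ENNReal.toReal_nonneg
    refine mul_le_mul_of_nonneg_left ?_ (by positivity)
    rw [pow_zero, one_mul]
    have : 0 ≤ 2 * C * U' := by positivity
    linarith
  | succ n ih =>
    intro R χ hR hχ hχc hχs
    obtain ⟨β, χ₁, hβ, hχ₁, hχ₁c, hd, hβs, hχ₁s, hβn, hχ₁n⟩ := hcut a R χ hχ hχc hχs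
    have hRn : R + D + n * D ≤ T := by push_cast at hR; linarith
    have hRD : R + D ≤ T := by
      have : 0 ≤ n * D := by positivity
      linarith
    have hRT : R ≤ T := by linarith
    have s0 := hsupp hRT hχs
    have s1 := hsupp hRD hχ₁s
    have s2 := hsupp hRD hβs
    have hg := integral_wedge_flowLift (p := p) (q := q) hp hpt hq hqt hα hν hβ (hχ.sub hχ₁) hd s2
      (fun g hg => by
        change χ g - χ₁ g = 0
        rw [s0 g hg, s1 g hg, sub_zero]) hu hu' h b
    have hsub := integral_wedge_flowLift_sub (fun i => b (Fin.cast (by omega) i)) hχ hχ₁ s0 s1 hU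
    have h1 := ih (R + D) χ₁ hRn hχ₁ hχ₁c hχ₁s
    have h2 := abs_integral_wedge_flowLift_le hK0 hK hβ s2 hU'
    have hfin := hχ.2.ne
    have n1 : (eLpNorm χ₁ p ν).toReal ≤ 1 / 2 * (eLpNorm χ p ν).toReal := by
      have := ENNReal.toReal_mono (ENNReal.mul_ne_top ENNReal.ofReal_ne_top hfin) hχ₁n
      rwa [ENNReal.toReal_mul, ENNReal.toReal_ofReal (by norm_num)] at this
    have n2 : (eLpNorm β p ν).toReal ≤ C * (eLpNorm χ p ν).toReal := by
      have := ENNReal.toReal_mono (ENNReal.mul_ne_top ENNReal.ofReal_ne_top hfin) hβn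
      rwa [ENNReal.toReal_mul, ENNReal.toReal_ofReal hC] at this
    set X := ∫ g, wedge (χ g) (flowLift α g.snd (u g.fst)) (fun i => b (Fin.cast (by omega) i)) ∂ν
    set X₁ := ∫ g, wedge (χ₁ g) (flowLift α g.snd (u g.fst))
      (fun i => b (Fin.cast (by omega) i)) ∂ν
    set Y := ∫ g, wedge (β g) (flowLift α g.snd (u' g.fst)) b ∂ν
    have hY : |X - X₁| = |Y| := by
      have hg' : Y = (-1) ^ (m + 1) * (X - X₁) := hg.trans (congrArg _ hsub)
      rw [hg', abs_mul, abs_pow, abs_neg, abs_one, one_pow, one_mul]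
    have h3 : |X| ≤ |X₁| + |Y| := by
      rw [← hY]
      calc |X| = |X₁ + (X - X₁)| := by ring_nf
        _ ≤ _ := abs_add_le _ _
    set N := (eLpNorm χ p ν).toReal
    have g1 : K * (eLpNorm χ₁ p ν).toReal * ((1 / 2) ^ n * U + 2 * C * U') ≤
        K * (1 / 2 * N) * ((1 / 2) ^ n * U + 2 * C * U') := by gcongr
    have g2 : K * (eLpNorm β p ν).toReal * U' ≤ K * (C * N) * U' := by gcongr
    -- The constant reproduces itself: half of 2C from the remainder, plus C from the primitive.
    calc |X| ≤ K * (1 / 2 * N) * ((1 / 2) ^ n * U + 2 * C * U') + K * (C * N) * U' := by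
          linarith
      _ = K * N * ((1 / 2) ^ (n + 1) * U + 2 * C * U') := by rw [pow_succ]; ring

end Iteration

/-! ### Calculus of polynomial growth and exponential decay. -/

section Growth

variable {u v : ℕ → ℝ≥0∞}

lemma PolyGrowth.exists_nonneg (hu : PolyGrowth u) :
    ∃ (C : ℝ) (N : ℕ), 0 ≤ C ∧ ∀ j : ℕ, u j ≤ ENNReal.ofReal (C * ((j : ℝ) + 1) ^ N) := by
  obtain ⟨C, N, h⟩ := hu
  refine ⟨|C|, N, abs_nonneg C, fun j => (h j).trans (ENNReal.ofReal_le_ofReal ?_)⟩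
  gcongr
  exact le_abs_self C

lemma ExpDecay.exists_nonneg (hu : ExpDecay u) :
    ∃ C c : ℝ, 0 ≤ C ∧ 0 < c ∧ ∀ j : ℕ, u j ≤ ENNReal.ofReal (C * Real.exp (-c * j)) := by
  obtain ⟨C, c, hc, h⟩ := hu
  refine ⟨|C|, c, abs_nonneg C, hc, fun j => (h j).trans (ENNReal.ofReal_le_ofReal ?_)⟩
  gcongr
  exact le_abs_self C

lemma PolyGrowth.of_le (hv : PolyGrowth v) (h : ∀ j, u j ≤ v j) : PolyGrowth u := by
  obtain ⟨C, N, hC⟩ := hv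
  exact ⟨C, N, fun j => (h j).trans (hC j)⟩

lemma ExpDecay.of_le (hv : ExpDecay v) (h : ∀ j, u j ≤ v j) : ExpDecay u := by
  obtain ⟨C, c, hc, hC⟩ := hv
  exact ⟨C, c, hc, fun j => (h j).trans (hC j)⟩

lemma polyGrowth_const {a : ℝ≥0∞} (ha : a ≠ ⊤) : PolyGrowth fun _ => a :=
  ⟨a.toReal, 0, fun j => by simp [ENNReal.ofReal_toReal ha]⟩

lemma PolyGrowth.mul (hu : PolyGrowth u) (hv : PolyGrowth v) : PolyGrowth fun j => u j * v j := by
  obtain ⟨C, N, hC, h⟩ := hu.exists_nonneg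
  obtain ⟨C', N', hC', h'⟩ := hv.exists_nonneg
  refine ⟨C * C', N + N', fun j => (mul_le_mul' (h j) (h' j)).trans_eq ?_⟩
  rw [← ENNReal.ofReal_mul (by positivity)]
  congr 1
  ring

lemma PolyGrowth.add (hu : PolyGrowth u) (hv : PolyGrowth v) : PolyGrowth fun j => u j + v j := by
  obtain ⟨C, N, hC, h⟩ := hu.exists_nonneg
  obtain ⟨C', N', hC', h'⟩ := hv.exists_nonneg
  refine ⟨C + C', N + N', fun j => (add_le_add (h j) (h' j)).trans ?_⟩
  rw [← ENNReal.ofReal_add (by positivity) (by positivity), add_mul]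
  have h1 : (1 : ℝ) ≤ (j : ℝ) + 1 := by linarith [Nat.cast_nonneg (α := ℝ) j]
  refine ENNReal.ofReal_le_ofReal (add_le_add ?_ ?_)
  · exact mul_le_mul_of_nonneg_left (pow_le_pow_right₀ h1 (by omega)) hC
  · exact mul_le_mul_of_nonneg_left (pow_le_pow_right₀ h1 (by omega)) hC'

lemma ExpDecay.add (hu : ExpDecay u) (hv : ExpDecay v) : ExpDecay fun j => u j + v j := by
  obtain ⟨C, c, hC, hc, h⟩ := hu.exists_nonneg
  obtain ⟨C', c', hC', hc', h'⟩ := hv.exists_nonneg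
  refine ⟨C + C', min c c', lt_min hc hc', fun j => (add_le_add (h j) (h' j)).trans ?_⟩
  rw [← ENNReal.ofReal_add (by positivity) (by positivity), add_mul]
  refine ENNReal.ofReal_le_ofReal ?_
  gcongr
  · exact min_le_left _ _
  · exact min_le_right _ _

/-- Half of the decay rate absorbs the polynomial. -/
lemma pow_mul_exp_le (N : ℕ) {c : ℝ} (hc : 0 < c) {x : ℝ} (hx : 0 ≤ x) :
    (x + 1) ^ N * Real.exp (-c * x) ≤
      (N.factorial * (2 / c) ^ N * Real.exp (c / 2)) * Real.exp (-(c / 2) * x) := by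
  have h1 := Real.pow_div_factorial_le_exp (c / 2 * (x + 1)) (by positivity) N
  rw [div_le_iff₀ (by positivity), mul_pow] at h1
  have h2 : (x + 1) ^ N = (2 / c) ^ N * ((c / 2) ^ N * (x + 1) ^ N) := by
    have h3 : 2 / c * (c / 2) = 1 := by field_simp
    rw [← mul_assoc, ← mul_pow, h3, one_pow, one_mul]
  rw [h2]
  calc (2 / c) ^ N * ((c / 2) ^ N * (x + 1) ^ N) * Real.exp (-c * x)
      ≤ (2 / c) ^ N * (Real.exp (c / 2 * (x + 1)) * N.factorial) * Real.exp (-c * x) := by gcongr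
    _ = (N.factorial * (2 / c) ^ N) * (Real.exp (c / 2 * (x + 1)) * Real.exp (-c * x)) := by ring
    _ = (N.factorial * (2 / c) ^ N) * (Real.exp (c / 2) * Real.exp (-(c / 2) * x)) := by
        rw [← Real.exp_add, ← Real.exp_add]
        congr 2
        ring
    _ = _ := by ring

lemma PolyGrowth.mul_expDecay (hu : PolyGrowth u) (hv : ExpDecay v) :
    ExpDecay fun j => u j * v j := by
  obtain ⟨C, N, hC, h⟩ := hu.exists_nonneg
  obtain ⟨C', c, hC', hc, h'⟩ := hv.exists_nonneg
  refine ⟨C * C' * (N.factorial * (2 / c) ^ N * Real.exp (c / 2)), c / 2, by positivity,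
    fun j => (mul_le_mul' (h j) (h' j)).trans ?_⟩
  rw [← ENNReal.ofReal_mul (by positivity)]
  refine ENNReal.ofReal_le_ofReal ?_
  calc C * ((j : ℝ) + 1) ^ N * (C' * Real.exp (-c * j))
      = C * C' * (((j : ℝ) + 1) ^ N * Real.exp (-c * j)) := by ring
    _ ≤ C * C' * ((N.factorial * (2 / c) ^ N * Real.exp (c / 2)) * Real.exp (-(c / 2) * j)) :=
        mul_le_mul_of_nonneg_left (pow_mul_exp_le N hc (Nat.cast_nonneg j)) (by positivity)
    _ = _ := by ring

lemma ExpDecay.tendsto_toReal (hu : ExpDecay u) :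
    Filter.Tendsto (fun j => (u j).toReal) Filter.atTop (𝓝 0) := by
  obtain ⟨C, c, hC, hc, h⟩ := hu.exists_nonneg
  have h1 : Filter.Tendsto (fun j : ℕ => C * Real.exp (-c * j)) Filter.atTop (𝓝 0) := by
    have h2 : Filter.Tendsto (fun j : ℕ => -c * (j : ℝ)) Filter.atTop Filter.atBot :=
      tendsto_natCast_atTop_atTop.const_mul_atTop_of_neg (by linarith)
    simpa using (Real.tendsto_exp_atBot.comp h2).const_mul C
  refine squeeze_zero (fun _ => ENNReal.toReal_nonneg) (fun j => ?_) h1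
  exact ENNReal.toReal_le_of_le_ofReal (by positivity) (h j)

lemma expDecay_half_pow : ExpDecay fun j => ENNReal.ofReal ((1 / 2) ^ j) := by
  refine ⟨1, Real.log 2, Real.log_pos (by norm_num), fun j => ?_⟩
  rw [one_mul, mul_comm, Real.exp_nat_mul, Real.exp_neg, Real.exp_log (by norm_num)]
  norm_num

lemma polyGrowth_pow {C M : ℝ} (hC : 0 ≤ C) (N : ℕ) {A : ℕ → ℝ}
    (hA : ∀ j, 1 + |A j| ≤ M * ((j : ℝ) + 1)) :
    PolyGrowth fun j => ENNReal.ofReal (C * (1 + |A j|) ^ N) := by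
  refine ⟨C * M ^ N, N, fun j => ENNReal.ofReal_le_ofReal ?_⟩
  rw [mul_assoc, ← mul_pow]
  exact mul_le_mul_of_nonneg_left (pow_le_pow_left₀ (by positivity) (hA j) N) hC

end Growth

/-! ### Growth of the strip norms along a sequence of strips. -/

section StripGrowth

variable {E : Type*} [NormedAddCommGroup E] [NormedSpace ℝ E] [FiniteDimensional ℝ E]
  {H : Type*} [TopologicalSpace H] [T2Space H] [SecondCountableTopology H]
  [ChartedSpace E H] [Group H] [LieGroup 𝓘(ℝ, E) ∞ H]
  [MeasurableSpace H] [BorelSpace H] {μ : Measure H} [μ.IsHaarMeasure] [SFinite μ]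
  {α : E →L[ℝ] E} {F : AutFlow H α}
  {ν : Measure (SemiProd F)} [ν.IsHaarMeasure]

open SemiProd

lemma polyGrowth_stripLift {c s : ℝ} (hc : 0 < c) (hs : 1 ≤ s)
    (hν : MeasurePreserving (homeo F) ν
      (μ.prod (lineMeasure c (LinearMap.trace ℝ E (α : E →ₗ[ℝ] E))))) {k : ℕ}
    {u : ℕ → H → AltForm E k} (hu : ∀ j, AEStronglyMeasurable (u j) μ)
    (hm : ∀ j, ∀ᵐ h ∂μ, projMinus α s k (u j h) = 0)
    (h0 : PolyGrowth fun j => eLpNorm (fun h => projZero α s k (u j h)) (ENNReal.ofReal s) μ)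
    (h1 : PolyGrowth fun j => eLpNorm (fun h => projPlus α s k (u j h)) (ENNReal.ofReal s) μ)
    {A B : ℕ → ℝ} (hAB : ∀ j, A j ≤ B j) (hB : ∀ j, B j ≤ 0) {M : ℝ}
    (hA : ∀ j, 1 + |A j| ≤ M * ((j : ℝ) + 1)) :
    PolyGrowth fun j => eLpNorm (stripLift F (A j) (B j) (u j)) (ENNReal.ofReal s) ν := by
  obtain ⟨C, δ, N, hC, hδ, hb⟩ := exists_stripLift_bound (F := F) hc hs hν k
  refine (((polyGrowth_pow hC N hA).mul h0).add ((polyGrowth_pow hC N hA).mul h1)).of_le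
    fun j => (hb (u j) (hu j) (hm j) _ _ (hAB j) (hB j)).trans ?_
  refine add_le_add le_rfl (mul_le_mul_left (ENNReal.ofReal_le_ofReal ?_) _)
  refine mul_le_of_le_one_right (by positivity) (Real.exp_le_one_iff.2 ?_)
  exact mul_nonpos_of_nonneg_of_nonpos hδ.le (hB j)

/-- The strips lie below -j and their lower ends are at most linear in j. The 0-part is small by
hypothesis, the +-part gains e^{-δj}, and all other factors are polynomial. -/
lemma expDecay_stripLift {c s : ℝ} (hc : 0 < c) (hs : 1 ≤ s)
    (hν : MeasurePreserving (homeo F) ν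
      (μ.prod (lineMeasure c (LinearMap.trace ℝ E (α : E →ₗ[ℝ] E))))) {k : ℕ}
    {u : ℕ → H → AltForm E k} (hu : ∀ j, AEStronglyMeasurable (u j) μ)
    (hm : ∀ j, ∀ᵐ h ∂μ, projMinus α s k (u j h) = 0)
    (h0 : ExpDecay fun j => eLpNorm (fun h => projZero α s k (u j h)) (ENNReal.ofReal s) μ)
    (h1 : PolyGrowth fun j => eLpNorm (fun h => projPlus α s k (u j h)) (ENNReal.ofReal s) μ)
    {A B : ℕ → ℝ} (hAB : ∀ j, A j ≤ B j) (hB : ∀ j, B j = -j) {M : ℝ}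
    (hA : ∀ j, 1 + |A j| ≤ M * ((j : ℝ) + 1)) :
    ExpDecay fun j => eLpNorm (stripLift F (A j) (B j) (u j)) (ENNReal.ofReal s) ν := by
  obtain ⟨C, δ, N, hC, hδ, hb⟩ := exists_stripLift_bound (F := F) hc hs hν k
  have he : ExpDecay fun j : ℕ => ENNReal.ofReal (Real.exp (δ * B j)) :=
    ⟨1, δ, hδ, fun j => by simp only [hB, one_mul, neg_mul, mul_neg, le_refl]⟩
  have hP := polyGrowth_pow hC N hA
  refine ((hP.mul_expDecay h0).add (h1.mul_expDecay (hP.mul_expDecay he))).of_le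
    fun j => (hb (u j) (hu j) (hm j) _ _ (hAB j) (by rw [hB]; simp)).trans_eq ?_
  rw [ENNReal.ofReal_mul (p := C * (1 + |A j|) ^ N) (by positivity), mul_comm (eLpNorm (fun h => projPlus α s k (u j h)) _ _)]

lemma dtLift_indicator {m : ℕ} (A B : ℝ) (e : H → AltForm E m) :
    dtLift F ((Icc A B).indicator fun _ => 1) e =
      fun g => lineWedge (dt : E × ℝ →L[ℝ] ℝ) (stripLift F A B e g) := by
  funext g
  by_cases hg : g.snd ∈ Icc A B
  · rw [dtLift, indicator_of_mem hg, stripLift_of_mem _ hg, one_smul]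
  · rw [dtLift, indicator_of_notMem hg, stripLift_of_notMem _ hg, zero_smul]
    exact ((lineWedgeₗ (E := E × ℝ) m dt).map_zero).symm

end StripGrowth

/-! ### Choice of the strips and conclusion. -/

open SemiProd in
/-- The pairing of a closed form with forms of slow growth and of exponentially small exterior
derivative tends to zero if the cohomology of the semi-direct product vanishes. -/
theorem tendsto_integral_wedge
    {E : Type*} [NormedAddCommGroup E] [NormedSpace ℝ E] [FiniteDimensional ℝ E]
    {H : Type*} [TopologicalSpace H] [T2Space H] [SecondCountableTopology H]
    [ChartedSpace E H] [Group H] [LieGroup 𝓘(ℝ, E) ∞ H]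
    [MeasurableSpace H] [BorelSpace H] (μ : Measure H) [μ.IsHaarMeasure]
    {α : E →L[ℝ] E} (hα : IsDerivation H α) (F : AutFlow H α)
    (ν : Measure (SemiProd F)) [ν.IsHaarMeasure]
    {p p' : ℝ} (hp : p.HolderConjugate p') {q r : ℕ} (b : Module.Basis (Fin (q + r)) ℝ E)
    {e : H → AltForm E q} (he : MemLp e (ENNReal.ofReal p) μ)
    (he_closed : IsWeakExtDer 𝓘(ℝ, E) μ e (fun _ => 0))
    {e' : ℕ → H → AltForm E r} {de' : ℕ → H → AltForm E (r + 1)}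
    (he' : ∀ j, MemLp (e' j) (ENNReal.ofReal p') μ)
    (hde' : ∀ j, MemLp (de' j) (ENNReal.ofReal p') μ)
    (h_der : ∀ j, IsWeakExtDer 𝓘(ℝ, E) μ (e' j) (de' j))
    (he_minus : ∀ᵐ h ∂μ, projMinus α p q (e h) = 0)
    (he'_minus : ∀ j, ∀ᵐ h ∂μ, projMinus α p' r (e' j h) = 0)
    (hde'_minus : ∀ j, ∀ᵐ h ∂μ, projMinus α p' (r + 1) (de' j h) = 0)
    (he'_zero : PolyGrowth fun j =>
      eLpNorm (fun h => projZero α p' r (e' j h)) (ENNReal.ofReal p') μ)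
    (he'_plus : PolyGrowth fun j =>
      eLpNorm (fun h => projPlus α p' r (e' j h)) (ENNReal.ofReal p') μ)
    (hde'_plus : PolyGrowth fun j =>
      eLpNorm (fun h => projPlus α p' (r + 1) (de' j h)) (ENNReal.ofReal p') μ)
    (hde'_zero : ExpDecay fun j =>
      eLpNorm (fun h => projZero α p' (r + 1) (de' j h)) (ENNReal.ofReal p') μ)
    (hG : ¬ Nontrivial (LpCohomology (𝓘(ℝ, E).prod 𝓘(ℝ, ℝ)) ν (q + 1)
      (ENNReal.one_le_ofReal.2 hp.lt.le))) :
    Filter.Tendsto (fun j => ∫ h, wedge (e h) (e' j h) b ∂μ) Filter.atTop (𝓝 0) := by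
  have : IsTopologicalGroup H := topologicalGroup_of_lieGroup 𝓘(ℝ, E) ∞
  have : LocallyCompactSpace H := Manifold.locallyCompact_of_finiteDimensional 𝓘(ℝ, E)
  have hp1 : 1 ≤ ENNReal.ofReal p := ENNReal.one_le_ofReal.2 hp.lt.le
  have hp'1 : 1 ≤ ENNReal.ofReal p' := ENNReal.one_le_ofReal.2 hp.symm.lt.le
  have hpq : (ENNReal.ofReal p).HolderConjugate (ENNReal.ofReal p') := hp.ennrealOfReal
  obtain ⟨c, hc, hν⟩ := exists_measurePreserving F ν μ
  obtain ⟨C, hC, hprim⟩ := exists_bounded_primitive (ENNReal.ofReal p') hp1 q hG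
  obtain ⟨D, hD, hcut⟩ := exists_cut (ENNReal.ofReal p') hC hprim
  have hN : q + r + 1 = q + (r + 1) := rfl
  have hN' : q + 1 + r = q + r + 1 := by omega
  set b₁ : Module.Basis (Fin (q + (r + 1))) ℝ (E × ℝ) := consBasis b with hb₁
  obtain ⟨K₁, hK₁0, hK₁⟩ := exists_wedge_bound (m := q) (l := r + 1) b₁
  obtain ⟨K₂, hK₂0, hK₂⟩ := exists_wedge_bound (m := q + 1) (l := r) fun i => b₁ (Fin.cast hN' i)
  set K := K₁ + K₂
  have hK0 : 0 ≤ K := by positivity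
  have hKb₁ : ∀ (x : AltForm (E × ℝ) q) (y : AltForm (E × ℝ) (r + 1)),
      |wedge x y b₁| ≤ K * ‖x‖ * ‖y‖ := fun x y => (hK₁ x y).trans (by gcongr; linarith)
  have hKb₂ : ∀ (x : AltForm (E × ℝ) (q + 1)) (y : AltForm (E × ℝ) r),
      |wedge x y fun i => b₁ (Fin.cast hN' i)| ≤ K * ‖x‖ * ‖y‖ :=
    fun x y => (hK₂ x y).trans (by gcongr; linarith)
  -- The initial form has half-width 1 around `a j`, and j cuts need D each. The centre is chosen so
  -- that the upper end of the final strip is exactly -j.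
  set T : ℕ → ℝ := fun j => 1 + j * D with hT
  set a : ℕ → ℝ := fun j => -(j + T j) with ha
  set A : ℕ → ℝ := fun j => a j - T j with hA
  set B : ℕ → ℝ := fun j => a j + T j with hB
  have hB' : ∀ j, B j = -j := fun j => by simp only [hB, ha]; ring
  have hj0 : ∀ j : ℕ, (0 : ℝ) ≤ j := fun j => Nat.cast_nonneg j
  have hjD : ∀ j : ℕ, (0 : ℝ) ≤ j * D := fun j => mul_nonneg (hj0 j) hD.le
  have hAB : ∀ j, A j ≤ B j := fun j => by simp only [hA, hB, hT]; linarith [hjD j]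
  have hA1 : ∀ j, 1 + |A j| ≤ (3 + 2 * D) * ((j : ℝ) + 1) := fun j => by
    have h1 : A j ≤ 0 := by simp only [hA, ha, hT]; linarith [hjD j, hj0 j]
    rw [abs_of_nonpos h1]
    simp only [hA, ha, hT]
    linarith [hjD j, hj0 j]
  have ha1 : ∀ j, 1 + |a j - 1| ≤ (3 + D) * ((j : ℝ) + 1) := fun j => by
    have h1 : a j - 1 ≤ 0 := by simp only [ha, hT]; linarith [hjD j, hj0 j]
    rw [abs_of_nonpos h1]
    simp only [ha, hT]
    linarith [hjD j, hj0 j]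
  -- An indicator is enough for the closedness of the lifted form. Its integral is 2, which does not
  -- depend on j.
  set f : ℕ → ℝ → ℝ := fun j => (Icc (a j - 1) (a j + 1)).indicator fun _ => 1 with hf
  set χ : ℕ → SemiProd F → AltForm (E × ℝ) (q + 1) := fun j => dtLift F (f j) e with hχ
  have hproj : ∀ {k : ℕ} (L : AltForm E k →ₗ[ℝ] AltForm E k) {u : H → AltForm E k},
      MemLp u (ENNReal.ofReal p) μ → MemLp (fun h => L (u h)) (ENNReal.ofReal p) μ :=
    fun L _ hu => (LinearMap.toContinuousLinearMap L).comp_memLp' hu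
  have hS : PolyGrowth fun j =>
      eLpNorm (stripLift F (a j - 1) (a j + 1) e) (ENNReal.ofReal p) ν :=
    polyGrowth_stripLift hc hp.lt.le hν (u := fun _ => e) (fun _ => he.1) (fun _ => he_minus)
      (polyGrowth_const (hproj _ he).2.ne) (polyGrowth_const (hproj _ he).2.ne)
      (A := fun j => a j - 1) (B := fun j => a j + 1) (fun j => by linarith)
      (fun j => by simp only [ha, hT]; linarith [hjD j, hj0 j]) ha1
  have hU : PolyGrowth fun j => eLpNorm (stripLift F (A j) (B j) (e' j)) (ENNReal.ofReal p') ν :=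
    polyGrowth_stripLift hc hp.symm.lt.le hν (fun j => (he' j).1) he'_minus he'_zero he'_plus hAB
      (fun j => by rw [hB']; linarith [hj0 j]) hA1
  have hU' : ExpDecay fun j => eLpNorm (stripLift F (A j) (B j) (de' j)) (ENNReal.ofReal p') ν :=
    expDecay_stripLift hc hp.symm.lt.le hν (fun j => (hde' j).1) hde'_minus hde'_zero hde'_plus
      hAB hB' hA1
  have hPfin : ∀ {w : ℕ → ℝ≥0∞}, PolyGrowth w → ∀ j, w j < ⊤ := fun ⟨_, _, h⟩ j =>
    (h j).trans_lt ENNReal.ofReal_lt_top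
  have hEfin : ∀ {w : ℕ → ℝ≥0∞}, ExpDecay w → ∀ j, w j < ⊤ := fun ⟨_, _, _, h⟩ j =>
    (h j).trans_lt ENNReal.ofReal_lt_top
  have hχeq : ∀ j, χ j = fun g => lineWedge (dt : E × ℝ →L[ℝ] ℝ)
      (stripLift F (a j - 1) (a j + 1) e g) := fun j => dtLift_indicator _ _ _
  have hSm : ∀ j, MemLp (stripLift F (a j - 1) (a j + 1) e) (ENNReal.ofReal p) ν := fun j =>
    ⟨aestronglyMeasurable_stripLift hν _ _ he.1, hPfin hS j⟩
  have hχm : ∀ j, MemLp (χ j) (ENNReal.ofReal p) ν := fun j => by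
    rw [hχeq]
    exact memLp_lineWedge_const (V := E × ℝ) (k := q) (p := ENNReal.ofReal p) (μ := ν)
      (θ := stripLift F (a j - 1) (a j + 1) e) dt (hSm j)
  have hχN : PolyGrowth fun j => eLpNorm (χ j) (ENNReal.ofReal p) ν := by
    obtain ⟨K', hK'0, hK'⟩ := exists_lineWedge_bound q (dt : E × ℝ →L[ℝ] ℝ)
    refine ((polyGrowth_const (ENNReal.ofReal_ne_top (r := K'))).mul hS).of_le fun j => ?_
    rw [hχeq]
    exact eLpNorm_le_mul_eLpNorm_of_ae_le_mul (Filter.Eventually.of_forall fun g => hK' _) _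
  have hχc : ∀ j, IsWeakExtDer (𝓘(ℝ, E).prod 𝓘(ℝ, ℝ)) ν (χ j) fun _ => 0 := fun j =>
    isWeakExtDer_dtLift (q := ENNReal.ofReal p') hα hν he_closed (hχm j)
  have hχs : ∀ j (g : SemiProd F), 1 < |g.snd - a j| → χ j g = 0 := fun j g hg => by
    have h1 : g.snd ∉ Icc (a j - 1) (a j + 1) := fun h =>
      hg.not_ge (abs_le.2 ⟨by linarith [h.1], by linarith [h.2]⟩)
    have h2 : χ j g = f j g.snd • lineWedge (dt : E × ℝ →L[ℝ] ℝ) (flowLift α g.snd (e g.fst)) := rfl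
    have h3 : f j g.snd = 0 := indicator_of_notMem h1 _
    rw [h2, h3, zero_smul]
  -- The pairing on the semi-direct product is 2c times the pairing on H, and the estimate is
  -- applied with j cuts to the initial half-width 1, for which 1 + jD = T j exactly.
  have hmain : ∀ j, 2 * c * |∫ h, wedge (e h) (e' j h) b ∂μ| ≤
      (ENNReal.ofReal K * eLpNorm (χ j) (ENNReal.ofReal p) ν * (ENNReal.ofReal ((1 / 2) ^ j) *
        eLpNorm (stripLift F (A j) (B j) (e' j)) (ENNReal.ofReal p') ν + ENNReal.ofReal (2 * C) *
        eLpNorm (stripLift F (A j) (B j) (de' j)) (ENNReal.ofReal p') ν)).toReal := by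
    intro j
    have h1 := abs_integral_closed_le (p := ENNReal.ofReal p) (q := ENNReal.ofReal p') hp1
      ENNReal.ofReal_ne_top hp'1 ENNReal.ofReal_ne_top hα hν hC hcut hD.le b₁ hK0 hKb₁ hKb₂
      (he' j) (hde' j) (h_der j) (a := a j) (A := A j) (B := B j) (T := T j) rfl rfl
      ⟨aestronglyMeasurable_stripLift hν _ _ (he' j).1, hPfin hU j⟩
      ⟨aestronglyMeasurable_stripLift hν _ _ (hde' j).1, hEfin hU' j⟩ j 1 (χ j) le_rfl
      (hχm j) (hχc j) (hχs j)
    have h2 := integral_dtLift_flowLift (f := f j) (e := e) (u := e' j) hc hν b hN'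
    have h3 : ∫ t, f j t = 2 := by
      rw [hf, integral_indicator measurableSet_Icc]
      simp
      norm_num
    rw [h3] at h2
    rw [ENNReal.toReal_mul, ENNReal.toReal_mul, ENNReal.toReal_ofReal hK0, ENNReal.toReal_add
      (ENNReal.mul_ne_top ENNReal.ofReal_ne_top (hPfin hU j).ne)
      (ENNReal.mul_ne_top ENNReal.ofReal_ne_top (hEfin hU' j).ne), ENNReal.toReal_mul,
      ENNReal.toReal_mul, ENNReal.toReal_ofReal (by positivity), ENNReal.toReal_ofReal (by positivity)]
    refine le_trans (le_of_eq ?_) h1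
    refine Eq.trans ?_ (congrArg abs h2.symm)
    rw [abs_mul, abs_of_pos (by positivity : 0 < c * 2), mul_comm c]
  have hW : ExpDecay fun j => ENNReal.ofReal K * eLpNorm (χ j) (ENNReal.ofReal p) ν *
      (ENNReal.ofReal ((1 / 2) ^ j) *
        eLpNorm (stripLift F (A j) (B j) (e' j)) (ENNReal.ofReal p') ν + ENNReal.ofReal (2 * C) *
        eLpNorm (stripLift F (A j) (B j) (de' j)) (ENNReal.ofReal p') ν) := by
    refine ((polyGrowth_const ENNReal.ofReal_ne_top).mul hχN).mul_expDecay (ExpDecay.add ?_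
      ((polyGrowth_const ENNReal.ofReal_ne_top).mul_expDecay hU'))
    simpa only [mul_comm] using hU.mul_expDecay expDecay_half_pow
  have hlim := hW.tendsto_toReal.const_mul (2 * c)⁻¹
  rw [mul_zero] at hlim
  refine squeeze_zero_norm (fun j => ?_) hlim
  rw [Real.norm_eq_abs, le_inv_mul_iff₀ (by positivity)]
  exact hmain j

/-- The basis b fixes dim H = q + r, so that dim G = q + r + 1 and r = dim G - k. Evaluating the
integrand on another basis would multiply all the pairings by one nonzero constant. Membership of
`e' j` in Ω is expressed by its weak exterior derivative `de' j`. The proof is by contraposition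
from `tendsto_integral_wedge`. -/
theorem mainTheorem9
    {E : Type*} [NormedAddCommGroup E] [NormedSpace ℝ E] [FiniteDimensional ℝ E]
    {H : Type*} [TopologicalSpace H] [T2Space H] [SecondCountableTopology H]
    [ChartedSpace E H] [Group H] [LieGroup 𝓘(ℝ, E) ∞ H]
    [MeasurableSpace H] [BorelSpace H] (μ : Measure H) [μ.IsHaarMeasure]
    (α : E →L[ℝ] E) (hα : IsDerivation H α) (F : AutFlow H α)
    (ν : Measure (SemiProd F)) [ν.IsHaarMeasure]
    (p p' : ℝ) (hp : p.HolderConjugate p')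
    (k q r : ℕ) (hk : k = q + 1) (b : Module.Basis (Fin (q + r)) ℝ E)
    (hcrit : IsCritical α p q)
    (e : H → AltForm E q) (he : MemLp e (ENNReal.ofReal p) μ)
    (he_closed : IsWeakExtDer 𝓘(ℝ, E) μ e (fun _ => 0))
    (e' : ℕ → H → AltForm E r) (de' : ℕ → H → AltForm E (r + 1))
    (he' : ∀ j, MemLp (e' j) (ENNReal.ofReal p') μ)
    (hde' : ∀ j, MemLp (de' j) (ENNReal.ofReal p') μ)
    (h_der : ∀ j, IsWeakExtDer 𝓘(ℝ, E) μ (e' j) (de' j))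
    (he_minus : ∀ᵐ h ∂μ, projMinus α p q (e h) = 0)
    (he'_minus : ∀ j, ∀ᵐ h ∂μ, projMinus α p' r (e' j h) = 0)
    (hde'_minus : ∀ j, ∀ᵐ h ∂μ, projMinus α p' (r + 1) (de' j h) = 0)
    (h_pairing : ¬ Filter.Tendsto (fun j => ∫ h, wedge (e h) (e' j h) b ∂μ) Filter.atTop (𝓝 0))
    (he'_zero : PolyGrowth fun j =>
      eLpNorm (fun h => projZero α p' r (e' j h)) (ENNReal.ofReal p') μ)
    (he'_plus : PolyGrowth fun j =>
      eLpNorm (fun h => projPlus α p' r (e' j h)) (ENNReal.ofReal p') μ)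
    (hde'_plus : PolyGrowth fun j =>
      eLpNorm (fun h => projPlus α p' (r + 1) (de' j h)) (ENNReal.ofReal p') μ)
    (hde'_zero : ExpDecay fun j =>
      eLpNorm (fun h => projZero α p' (r + 1) (de' j h)) (ENNReal.ofReal p') μ) :
    Nontrivial (LpCohomology (𝓘(ℝ, E).prod 𝓘(ℝ, ℝ)) ν k
      (ENNReal.one_le_ofReal.2 hp.lt.le)) := by
  subst hk
  by_contra hG
  exact h_pairing (tendsto_integral_wedge μ hα F ν hp b he he_closed he' hde' h_der he_minus
    he'_minus hde'_minus he'_zero he'_plus hde'_plus hde'_zero hG)
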